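/- Let $d\ge 0$, $\kappa>0$, $T>0$, $\mathbb T^d=(\mathbb R/\mathbb Z)^d$ with normalized Lebesgue measure, and let $\mathbf b:\mathbb R\times\mathbb T^d\to\mathbb R^d$, $c:\mathbb R\times\mathbb T^d\to\mathbb R$ be $C^\infty$ and $T$-periodic in time (for instance $\mathbf b=2\lambda\mathbf e+\mathbf v$, $c=\kappa\lambda^2+\lambda\,\mathbf v\cdot\mathbf e+\tau^{-1}f'(0)$ for a smooth velocity field $\mathbf v$, periodic in space and time). Put $\mathcal A(t)=\kappa\Delta+\mathbf b(t,\cdot)\cdot\nabla+c(t,\cdot)$ with domain $H^2(\mathbb T^d)\subset L^2(\mathbb T^d)$. For an integer $M\ge 1$ put $\Delta t=T/M$, $t_i=i\Delta t$ and, for $\phi\in L^2(\mathbb T^d)$ and $\mathbf x\in\mathbb T^d$, $$\mathcal K^{\Delta t,i}\phi(\mathbf x)=\mathbb E\big[e^{\Delta t\,c(t_i,\mathbf Y)}\phi(\mathbf Y)\big],\qquad \mathbf Y=\mathbf x+\Delta t\,\mathbf b(t_i,\mathbf x)+\sqrt{2\kappa\Delta t}\,\boldsymbol\omega \pmod{\mathbb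 Z^d},$$ where $\boldsymbol\omega$ is a standard Gaussian vector in $\mathbb R^d$, and $\mathcal K^{\Delta t}=\mathcal K^{\Delta t,M-1}\cdots\mathcal K^{\Delta t,1}\mathcal K^{\Delta t,0}$. A solution operator is a family of bounded linear operators $\mathcal U(t,s)$, $t\ge s\ge 0$, on $L^2(\mathbb T^d)$ with $\mathcal U(s,s)=\mathrm{Id}$, $\mathcal U(t,r)\,\mathcal U(r,s)=\mathcal U(t,s)$ for $t\ge r\ge s\ge 0$, and, for all $w_0\in L^2(\mathbb T^d)$ and $s\ge0$: $\mathcal U(t,s)w_0\to w_0$ in $L^2$ as $t\downarrow s$, and for $t>s$, $\mathcal U(t,s)w_0\in H^2(\mathbb T^d)$ and $\frac{d}{dt}\mathcal U(t,s)w_0=\mathcal A(t)\,\mathcal U(t,s)w_0$ in $L^2(\mathbb T^d)$. **Theorem.** A solution operator exists. Moreover, there are a probability measure $\eta$ on $\mathbb T^d$, absolutely continuous with respect to Lebesgue measure and with $L^2(\mathbb T^d)\subset L^1(\eta)$, and constants $0<\epsilon<\gamma$ such that, with $\eta(\phi)=\int\phi\,d\eta$, the following hold. 1. For all $M\ge1$,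 all $\phi\in L^2(\mathbb T^d)$ with $\phi\ge 0$ a.e., and all $\mathbf x\in\mathbb T^d$, $$\epsilon\,\eta(\phi)\le\mathcal K^{\Delta t}\phi(\mathbf x)\le\gamma\,\eta(\phi).$$ In particular $\eta,\epsilon,\gamma$ do not depend on $\Delta t$. 2. For every solution operator $\mathcal U$, $\mathcal K^{\Delta t}\to\mathcal U(T,0)$ in the operator norm of $L^2(\mathbb T^d)$ as $\Delta t=T/M\to0$ (so $\mathcal U(T,0)$ is unique). For every $\phi\in L^2(\mathbb T^d)$ with $\phi\ge0$ a.e., $\mathcal U(T,0)\phi$ has a continuous representative, which satisfies, with the same $\eta,\epsilon,\gamma$, $$\epsilon\,\eta(\phi)\le\mathcal U(T,0)\phi(\mathbf x)\le\gamma\,\eta(\phi)\qquad\text{for all }\mathbf x\in\mathbb T^d.$$ -/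

import Mathlib

open MeasureTheory Filter Topology ProbabilityTheory
open scoped ContDiff

noncomputable section

namespace FKTorus

/-- The torus `𝕋ᵈ = (ℝ/ℤ)ᵈ`. -/
abbrev Torus (d : ℕ) : Type := UnitAddTorus (Fin d)

/-- The space `ℝᵈ` with its Euclidean norm. -/
abbrev Space (d : ℕ) : Type := EuclideanSpace ℝ (Fin d)

/-- Normalised Lebesgue (Haar) measure on the torus. -/
abbrev torusMeasure (d : ℕ) : Measure (Torus d) :=
  Measure.pi fun _ => AddCircle.haarAddCircle

/-- The real Hilbert space `L²(𝕋ᵈ)`. -/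
abbrev L2Torus (d : ℕ) : Type := Lp ℝ 2 (torusMeasure d)

/-- The quotient map `ℝᵈ → 𝕋ᵈ`. -/
def toTorus {d : ℕ} (x : Space d) : Torus d := fun i => ((x i : ℝ) : UnitAddCircle)

/-- A function of time and of a point of the torus is smooth (jointly in both) if its periodic lift
to `ℝ × ℝᵈ` is `C^∞`. -/
def SmoothCoefficient {d : ℕ} {F : Type*} [NormedAddCommGroup F] [NormedSpace ℝ F]
    (f : ℝ → Torus d → F) : Prop :=
  ContDiff ℝ ∞ fun p : ℝ × Space d => f p.1 (toTorus p.2)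

/-- `C^∞` test functions on the torus. -/
def SmoothTest {d : ℕ} (ψ : Torus d → ℝ) : Prop :=
  ContDiff ℝ ∞ fun x : Space d => ψ (toTorus x)

/-- The classical partial derivative `∂ψ/∂xᵢ` of a function on the torus. -/
def partialDeriv {d : ℕ} (i : Fin d) (ψ : Torus d → ℝ) (x : Torus d) : ℝ :=
  deriv (fun s : ℝ => ψ (x + Pi.single i (s : UnitAddCircle))) 0

/-- `g ∈ L²` is the weak partial derivative `∂u/∂xᵢ` of `u ∈ L²`. -/
def HasWeakPartial {d : ℕ} (i : Fin d) (u g : L2Torus d) : Prop :=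
  ∀ ψ : Torus d → ℝ, SmoothTest ψ →
    ∫ x, u x * partialDeriv i ψ x ∂torusMeasure d = - ∫ x, g x * ψ x ∂torusMeasure d

/-- `u` belongs to `H²(𝕋ᵈ)`, the domain of `𝒜(t) = κ Δ + b(t,·)·∇ + c(t,·)`, and `𝒜(t) u = f`.
Here `g i = ∂ᵢ u` and `h i j = ∂ⱼ ∂ᵢ u`. -/
def GeneratorEq {d : ℕ} (κ : ℝ) (b : ℝ → Torus d → Space d) (c : ℝ → Torus d → ℝ) (t : ℝ)
    (u f : L2Torus d) : Prop :=
  ∃ (g : Fin d → L2Torus d) (h : Fin d → Fin d → L2Torus d),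
    (∀ i, HasWeakPartial i u (g i)) ∧ (∀ i j, HasWeakPartial j (g i) (h i j)) ∧
    ∀ᵐ x ∂torusMeasure d,
      f x = κ * ∑ i, h i i x + ∑ i, b t x i * g i x + c t x * u x

/-- `U(t,s)`, `0 ≤ s ≤ t`, is the solution operator on `L²(𝕋ᵈ)` of
`w_t = κ Δ w + b(t,x)·∇w + c(t,x) w`. -/
structure IsSolutionOperator {d : ℕ} (κ : ℝ) (b : ℝ → Torus d → Space d)
    (c : ℝ → Torus d → ℝ) (U : ℝ → ℝ → L2Torus d →L[ℝ] L2Torus d) : Prop where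
  self_eq : ∀ s, 0 ≤ s → U s s = ContinuousLinearMap.id ℝ (L2Torus d)
  comp_eq : ∀ s r t, 0 ≤ s → s ≤ r → r ≤ t → (U t r).comp (U r s) = U t s
  initial : ∀ s, 0 ≤ s → ∀ w : L2Torus d, Tendsto (fun t => U t s w) (𝓝[>] s) (𝓝 w)
  evolution : ∀ s t, 0 ≤ s → s < t → ∀ w : L2Torus d,
    ∃ f : L2Torus d, GeneratorEq κ b c t (U t s w) f ∧ HasDerivAt (fun r => U r s w) f t

/-- One step of the Euler-Maruyama scheme on the torus, started at `x` at time `t`, with step `Δt`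
and with value `ζ` of the standard Gaussian increment. -/
def eulerStep {d : ℕ} (κ : ℝ) (b : ℝ → Torus d → Space d) (Δt t : ℝ) (x : Torus d)
    (ζ : Space d) : Torus d :=
  x + toTorus (Δt • b t x + √(2 * κ * Δt) • ζ)

/-- The transition operator `P φ(x) = 𝔼[φ(X_{i+1}) | X_i = x]` of the Euler-Maruyama scheme. -/
def transitionOp {d : ℕ} (κ : ℝ) (b : ℝ → Torus d → Space d) (Δt t : ℝ) (φ : Torus d → ℝ)
    (x : Torus d) : ℝ :=
  ∫ ζ, φ (eulerStep κ b Δt t x ζ) ∂stdGaussian (Space d)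

/-- The weighted one-step operator `P e^{Δt 𝒞(t)}`, with `𝒞(t)` the multiplication by `c(t,·)`. -/
def stepOp {d : ℕ} (κ : ℝ) (b : ℝ → Torus d → Space d) (c : ℝ → Torus d → ℝ) (Δt t : ℝ)
    (φ : Torus d → ℝ) : Torus d → ℝ :=
  transitionOp κ b Δt t fun y => Real.exp (Δt * c t y) * φ y

/-- The product `𝒦_{n-1} ⋯ 𝒦_1 𝒦_0` of the one-step operators `𝒦_i` at the times `i Δt`. -/
def stepProd {d : ℕ} (κ : ℝ) (b : ℝ → Torus d → Space d) (c : ℝ → Torus d → ℝ) (Δt : ℝ) :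
    ℕ → (Torus d → ℝ) → Torus d → ℝ
  | 0, φ => φ
  | n + 1, φ => stepOp κ b c Δt (n * Δt) (stepProd κ b c Δt n φ)

/-- The discretized one-period operator `𝒦^{Δt} = 𝒦_{M-1} ⋯ 𝒦_0` with `Δt = T / M`. -/
def periodOp {d : ℕ} (κ : ℝ) (b : ℝ → Torus d → Space d) (c : ℝ → Torus d → ℝ) (T : ℝ) (M : ℕ) :
    (Torus d → ℝ) → Torus d → ℝ :=
  stepProd κ b c (T / M) M

end FKTorus

end

/-! Existence and uniqueness. The heat semigroup is convolution with Gaussians, and its gradient has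
norm `O(t^{-1/2})`. In Duhamel's formula the source `F = b·∇V + cV` of the solution `V` satisfies a
Volterra equation of its own, whose kernel and forcing have an inverse square root singularity. A
Neumann series in an exponentially weighted norm solves it (`SingKernel.exists_solution`), and
uniqueness for this equation gives the evolution law. Second derivatives come from the same argument
for the pair `(V, ∇V)`, restarted at an intermediate time (`jetSystem_jet`). With `H²` regularity
the solution is differentiable in time (`hasDerivAt_sol`), and an energy estimate gives uniqueness.

Uniform bounds, with `η` Lebesgue measure. The potential only contributes factors `exp (± T sup
|c|)`, so products of Gaussian steps with drift remain. For the upper bound, a shift of size `O(Δ)`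
changes a Gaussian of variance of order `nΔ` by `O(Δ/√(nΔ))` times a Gaussian of four times the
variance. Telescoping against the heat semigroup and a discrete Gronwall inequality with a square
root singularity give a bound by a heat flow at time of order `T` (`exists_prodE_le`), which on the
torus is comparable to the mean. For the lower bound, the parallelogram law shows that a centred
Gaussian is, up to a factor, the geometric mean of its shifts by `h` and `-h`. By Cauchy–Schwarz the
heat flow is then at most a constant times the geometric mean of the products with drifts `b` and
`-b` (`hE_le_sqrt_prodE`). The upper bound for `-b` thus yields the lower bound for `b`.

Convergence is stability plus consistency. Stability in operator norm is the same telescoping and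
Gronwall argument on `L²` (`exists_stability`). Consistency with error `o(Δ)` per step uses bounds
of `V` and its derivatives up to second order and is therefore uniform only away from time zero
(`exists_consistency`). On an initial layer of length of order `δ` both the scheme and the solution
are within `O(√δ)` of the heat semigroup, and this suffices.

The bounds pass to the limit almost everywhere. They make the solution operator positive and bounded
from `L²` to `L^∞`. Solving Duhamel's equation also in the space of continuous functions shows that
continuous data have continuous solutions, and density gives a continuous representative for all
data (`exists_continuous_representative`). -/

noncomputable section

namespace FKTorus

open Set
open scoped Interval

/-! ### Convolutions with inverse square root singularities. -/

section Volterra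

variable {E E' : Type*} [NormedAddCommGroup E] [NormedSpace ℝ E]
  [NormedAddCommGroup E'] [NormedSpace ℝ E']

/-- The weight `(θ(1-θ))^{-1/2}` on `(0,1)`. -/
def betaWeight (θ : ℝ) : ℝ := 1 / √(1 - θ) * (1 / √θ)

lemma betaWeight_nonneg (θ : ℝ) : 0 ≤ betaWeight θ := by unfold betaWeight; positivity

lemma intervalIntegrable_one_div_sqrt (a b : ℝ) :
    IntervalIntegrable (fun θ : ℝ => 1 / √θ) volume a b := by
  by_cases h : 0 ≤ a ∧ 0 ≤ b
  · have h1 : IntervalIntegrable (fun x : ℝ => x ^ (-(1/2) : ℝ)) volume a b :=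
      intervalIntegral.intervalIntegrable_rpow' (by norm_num)
    refine h1.congr ?_
    intro x hx
    have hx0 : 0 ≤ x := by
      rcases le_total a b with hab | hab
      · rw [uIoc_of_le hab] at hx; exact h.1.trans hx.1.le
      · rw [uIoc_of_ge hab] at hx; exact h.2.trans hx.1.le
    simp only
    rw [Real.rpow_neg hx0, ← Real.sqrt_eq_rpow, one_div]
  · have key : ∀ c : ℝ, IntervalIntegrable (fun θ : ℝ => 1 / √θ) volume 0 c := by
      intro c
      rcases le_total 0 c with hc | hc
      · have h1 : IntervalIntegrable (fun x : ℝ => x ^ (-(1/2) : ℝ)) volume 0 c :=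
          intervalIntegral.intervalIntegrable_rpow' (by norm_num)
        refine h1.congr ?_
        intro x hx
        rw [uIoc_of_le hc] at hx
        simp only
        rw [Real.rpow_neg hx.1.le, ← Real.sqrt_eq_rpow, one_div]
      -- For nonpositive arguments `√θ = 0`, and division by zero makes the integrand vanish.
      · have h0 : IntervalIntegrable (fun _ : ℝ => (0 : ℝ)) volume 0 c :=
          intervalIntegrable_const
        refine h0.congr ?_
        intro x hx
        rw [uIoc_of_ge hc] at hx
        simp [Real.sqrt_eq_zero_of_nonpos hx.2]
    exact (key a).symm.trans (key b)

/-- On the unit interval one of `θ`, `1 - θ` is at least `1/2`, so one factor is at most `2` and the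
product of the two singularities is at most twice their sum. -/
lemma intervalIntegrable_betaWeight : IntervalIntegrable betaWeight volume 0 1 := by
  have h1 := intervalIntegrable_one_div_sqrt 0 1
  have h2 : IntervalIntegrable (fun θ : ℝ => 1 / √(1 - θ)) volume 0 1 := by
    have := (intervalIntegrable_one_div_sqrt 0 1).comp_sub_left 1
    simpa using this.symm
  refine ((h1.add h2).const_mul 2).mono_fun ?_ ?_
  · unfold betaWeight
    exact (by fun_prop : Measurable fun θ : ℝ => 1 / √(1 - θ) * (1 / √θ)).aestronglyMeasurable
  · refine (ae_restrict_mem measurableSet_uIoc).mono ?_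
    intro θ hθ
    rw [uIoc_of_le zero_le_one] at hθ
    simp only
    rw [Real.norm_of_nonneg (betaWeight_nonneg θ), Real.norm_of_nonneg (by positivity)]
    unfold betaWeight
    have half : (1 : ℝ) / √(1/2) ≤ 2 := by
      rw [div_le_iff₀ (by positivity)]
      have : (1/2 : ℝ) ≤ √(1/2) := by
        apply Real.le_sqrt_of_sq_le; norm_num
      linarith
    rcases le_total θ (1/2) with h | h
    · have : 1 / √(1 - θ) ≤ 2 :=
        (one_div_le_one_div_of_le (by positivity) (Real.sqrt_le_sqrt (by linarith))).trans half
      have h3 : 0 ≤ 1 / √θ := by positivity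
      have h4 : 0 ≤ 1 / √(1 - θ) := by positivity
      nlinarith
    · have : 1 / √θ ≤ 2 :=
        (one_div_le_one_div_of_le (by positivity) (Real.sqrt_le_sqrt (by linarith))).trans half
      have h3 : 0 ≤ 1 / √θ := by positivity
      have h4 : 0 ≤ 1 / √(1 - θ) := by positivity
      nlinarith

/-- `F` is continuous on `(s,∞)` with at most an inverse square root singularity at `s`. -/
structure SingFun (s : ℝ) (F : ℝ → E) : Prop where
  cont : ContinuousOn F (Ioi s)
  bound : ∀ L : ℝ, ∃ Q : ℝ, 0 ≤ Q ∧ ∀ t, s < t → t ≤ s + L → ‖F t‖ ≤ Q * (1 / √(t - s))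

/-- `k t τ` is continuous for `τ > 0` with at most an inverse square root singularity at
`τ = 0`. -/
structure SingKernel (k : ℝ → ℝ → E →L[ℝ] E') : Prop where
  cont : ContinuousOn (fun p : ℝ × ℝ => k p.1 p.2) (univ ×ˢ Ioi 0)
  bound : ∀ L : ℝ, ∃ C : ℝ, 0 ≤ C ∧ ∀ t τ, 0 < τ → τ ≤ L → ‖k t τ‖ ≤ C * (1 / √τ)

/-- The singular convolution `∫ₛᵗ k(t, t - r) F(r) dr`. -/
def singConv (k : ℝ → ℝ → E →L[ℝ] E') (F : ℝ → E) (s t : ℝ) : E' :=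
  ∫ r in s..t, k t (t - r) (F r)

lemma integral_subst_unit (f : ℝ → E) (s t : ℝ) :
    ∫ r in s..t, f r = (t - s) • ∫ θ in (0:ℝ)..1, f (s + (t - s) * θ) := by
  rw [intervalIntegral.smul_integral_comp_add_mul]
  simp

/-- The two inverse square roots contribute a factor `1/(t - s)`, which the Jacobian of the
substitution `r = s + (t - s)θ` will cancel. Bounds are assumed at a single `θ` only, so that
exponentially weighted bounds can be inserted as well. -/
lemma norm_singInt_le_of_point {κ : ℝ → E →L[ℝ] E'} {F : ℝ → E} {s t C Q θ : ℝ} (hst : s < t)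
    (hθ : θ ∈ Ioo (0:ℝ) 1) (hC : 0 ≤ C)
    (hk : ‖κ ((t - s) * (1 - θ))‖ ≤ C * (1 / √((t - s) * (1 - θ))))
    (hF : ‖F (s + (t - s) * θ)‖ ≤ Q * (1 / √((t - s) * θ))) :
    ‖κ (t - (s + (t - s) * θ)) (F (s + (t - s) * θ))‖ ≤ (C * Q / (t - s)) * betaWeight θ := by
  have h0 : 0 < t - s := sub_pos.2 hst
  have e1 : t - (s + (t - s) * θ) = (t - s) * (1 - θ) := by ring
  rw [e1]
  calc _ ≤ ‖κ ((t - s) * (1 - θ))‖ * ‖F (s + (t - s) * θ)‖ := ContinuousLinearMap.le_opNorm _ _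
    _ ≤ (C * (1 / √((t - s) * (1 - θ)))) * (Q * (1 / √((t - s) * θ))) := by
        apply mul_le_mul hk hF (norm_nonneg _) (by positivity)
    _ = (C * Q / (t - s)) * betaWeight θ := by
        rw [Real.sqrt_mul h0.le, Real.sqrt_mul h0.le, betaWeight]
        have h3 : √(t - s) ≠ 0 := (Real.sqrt_pos.2 h0).ne'
        have h4 : √θ ≠ 0 := (Real.sqrt_pos.2 hθ.1).ne'
        have h5 : √(1 - θ) ≠ 0 := (Real.sqrt_pos.2 (by linarith [hθ.2])).ne'
        have h6 : C * Q / (t - s) = C * Q / √(t - s) ^ 2 := by rw [Real.sq_sqrt h0.le]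
        rw [h6]
        field_simp

lemma norm_singInt_le {κ : ℝ → E →L[ℝ] E'} {F : ℝ → E} {s t C Q θ : ℝ} (hst : s < t)
    (hθ : θ ∈ Ioo (0:ℝ) 1) (hC : 0 ≤ C)
    (hk : ∀ τ, 0 < τ → τ ≤ t - s → ‖κ τ‖ ≤ C * (1 / √τ))
    (hF : ∀ r, s < r → r ≤ t → ‖F r‖ ≤ Q * (1 / √(r - s))) :
    ‖κ (t - (s + (t - s) * θ)) (F (s + (t - s) * θ))‖ ≤ (C * Q / (t - s)) * betaWeight θ := by
  have h0 : 0 < t - s := sub_pos.2 hst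
  have h1 : 0 < (t - s) * θ := mul_pos h0 hθ.1
  have h2 : 0 < (t - s) * (1 - θ) := mul_pos h0 (by linarith [hθ.2])
  have hF' := hF (s + (t - s) * θ) (by linarith) (by nlinarith)
  rw [show s + (t - s) * θ - s = (t - s) * θ by ring] at hF'
  exact norm_singInt_le_of_point hst hθ hC (hk _ h2 (by nlinarith)) hF'

lemma ae_uIoc_mem_Ioo : ∀ᵐ θ : ℝ, θ ∈ Ι (0:ℝ) 1 → θ ∈ Ioo (0:ℝ) 1 := by
  have : ∀ᵐ θ : ℝ, θ ≠ 1 := by simp [ae_iff, measure_singleton]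
  filter_upwards [this] with θ h1 h2
  rw [uIoc_of_le zero_le_one] at h2
  exact ⟨h2.1, lt_of_le_of_ne h2.2 h1⟩

lemma aestronglyMeasurable_of_Ioo {f : ℝ → E} (hf : ContinuousOn f (Ioo 0 1)) :
    AEStronglyMeasurable f (volume.restrict (Ι (0:ℝ) 1)) := by
  rw [uIoc_of_le zero_le_one, ← restrict_Ioo_eq_restrict_Ioc]
  exact hf.aestronglyMeasurable measurableSet_Ioo

/-- Continuous dependence of singular convolutions on parameters. -/
lemma continuousOn_singInt {P : Type*} [TopologicalSpace P] [FirstCountableTopology P]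
    {U : Set P} {k : P → ℝ → E →L[ℝ] E'} {T : P → ℝ} {s : ℝ} {F : ℝ → E}
    (hT : ContinuousOn T U) (hTs : ∀ p ∈ U, s < T p)
    (hk : ContinuousOn (fun q : P × ℝ => k q.1 q.2) (U ×ˢ Ioi 0))
    (hkb : ∀ L : ℝ, ∃ C : ℝ, 0 ≤ C ∧ ∀ p ∈ U, ∀ τ, 0 < τ → τ ≤ L → ‖k p τ‖ ≤ C * (1 / √τ))
    (hF : SingFun s F) :
    ContinuousOn (fun p => ∫ r in s..T p, k p (T p - r) (F r)) U := by
  -- The substitution moves the dependence on the parameter into an integrand over a fixed interval,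
  -- where dominated convergence applies.
  have : (fun p => ∫ r in s..T p, k p (T p - r) (F r)) = fun p => (T p - s) •
      ∫ θ in (0:ℝ)..1, k p (T p - (s + (T p - s) * θ)) (F (s + (T p - s) * θ)) := by
    ext p
    rw [integral_subst_unit (fun r => k p (T p - r) (F r))]
  rw [this]
  refine (hT.sub continuousOn_const).smul ?_
  intro p₀ hp₀
  have hjoint : ∀ θ ∈ Ioo (0:ℝ) 1, ContinuousOn
      (fun p => k p (T p - (s + (T p - s) * θ)) (F (s + (T p - s) * θ))) U := by
    intro θ hθ
    refine ContinuousOn.clm_apply ?_ ?_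
    · refine hk.comp (f := fun p => (p, T p - (s + (T p - s) * θ))) ?_ ?_
      · exact continuousOn_id.prodMk
          (hT.sub (continuousOn_const.add ((hT.sub continuousOn_const).mul continuousOn_const)))
      · intro p hp
        refine ⟨hp, ?_⟩
        have := hTs p hp
        have h2 := hθ.2
        show 0 < T p - (s + (T p - s) * θ)
        nlinarith
    · refine hF.cont.comp (continuousOn_const.add ((hT.sub continuousOn_const).mul continuousOn_const)) ?_
      intro p hp
      have := mul_pos (sub_pos.2 (hTs p hp)) hθ.1
      show s < s + (T p - s) * θ
      linarith
  have hmeas : ∀ p ∈ U, AEStronglyMeasurable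
      (fun θ => k p (T p - (s + (T p - s) * θ)) (F (s + (T p - s) * θ)))
      (volume.restrict (Ι (0:ℝ) 1)) := by
    intro p hp
    apply aestronglyMeasurable_of_Ioo
    refine ContinuousOn.clm_apply ?_ ?_
    · refine hk.comp (f := fun θ => (p, T p - (s + (T p - s) * θ))) (by fun_prop) ?_
      intro θ hθ
      refine ⟨hp, ?_⟩
      have := hTs p hp
      have h2 := hθ.2
      show 0 < T p - (s + (T p - s) * θ)
      nlinarith
    · refine hF.cont.comp (by fun_prop) ?_
      intro θ hθ
      have := mul_pos (sub_pos.2 (hTs p hp)) hθ.1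
      show s < s + (T p - s) * θ
      linarith
  have h0 : 0 < T p₀ - s := sub_pos.2 (hTs p₀ hp₀)
  obtain ⟨C, hC, hCb⟩ := hkb (2 * (T p₀ - s))
  obtain ⟨Q, hQ, hQb⟩ := hF.bound (2 * (T p₀ - s))
  -- Near `p₀` the length `T p - s` stays within a factor two of its value there, so one multiple of
  -- `betaWeight` dominates all integrands.
  have hev : ∀ᶠ p in 𝓝[U] p₀, T p - s ∈ Ioo ((T p₀ - s) / 2) (2 * (T p₀ - s)) :=
    ((hT p₀ hp₀).sub continuousWithinAt_const).eventually 
      (Ioo_mem_nhds (by simp only [Pi.sub_apply]; linarith) (by simp only [Pi.sub_apply]; linarith))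
  refine intervalIntegral.continuousWithinAt_of_dominated_interval
    (bound := fun θ => (C * Q / ((T p₀ - s) / 2)) * betaWeight θ) ?_ ?_ ?_ ?_
  · filter_upwards [self_mem_nhdsWithin] with p hp using hmeas p hp
  · filter_upwards [self_mem_nhdsWithin, hev] with p hp hp2
    filter_upwards [ae_uIoc_mem_Ioo] with θ hθ hθ'
    refine (norm_singInt_le (κ := k p) (hTs p hp) (hθ hθ') hC
      (fun τ h1 h2 => hCb p hp τ h1 (by linarith [hp2.2]))
      (fun r h1 h2 => hQb r h1 (by linarith [hp2.2]))).trans ?_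
    apply mul_le_mul_of_nonneg_right _ (betaWeight_nonneg θ)
    apply div_le_div_of_nonneg_left (by positivity) (by linarith) hp2.1.le
  · exact intervalIntegrable_betaWeight.const_mul _
  · filter_upwards [ae_uIoc_mem_Ioo] with θ hθ hθ'
    exact hjoint θ (hθ hθ') p₀ hp₀

/-- Integrability of the singular integrand. -/
lemma SingKernel.intervalIntegrable {k : ℝ → ℝ → E →L[ℝ] E'} (hk : SingKernel k) {F : ℝ → E}
    {s : ℝ} (hF : SingFun s F) {t : ℝ} (hst : s < t) :
    IntervalIntegrable (fun r => k t (t - r) (F r)) volume s t := by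
  have h0 : 0 < t - s := sub_pos.2 hst
  obtain ⟨C, hC, hCb⟩ := hk.bound (t - s)
  obtain ⟨Q, hQ, hQb⟩ := hF.bound (t - s)
  have hint : IntervalIntegrable (fun θ => k t (t - (s + (t - s) * θ)) (F (s + (t - s) * θ)))
      volume 0 1 := by
    refine (intervalIntegrable_betaWeight.const_mul (C * Q / (t - s))).mono_fun' ?_ ?_
    · apply aestronglyMeasurable_of_Ioo
      refine ContinuousOn.clm_apply ?_ ?_
      · refine hk.cont.comp (f := fun θ => (t, t - (s + (t - s) * θ))) (by fun_prop) ?_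
        intro θ hθ
        refine ⟨mem_univ _, ?_⟩
        have h2 := hθ.2
        show 0 < t - (s + (t - s) * θ)
        nlinarith
      · refine hF.cont.comp (by fun_prop) ?_
        intro θ hθ
        have := mul_pos h0 hθ.1
        show s < s + (t - s) * θ
        linarith
    · have := (ae_restrict_iff' (measurableSet_uIoc)).2 ae_uIoc_mem_Ioo
      filter_upwards [this] with θ hθ
      exact norm_singInt_le (κ := k t) hst hθ hC (fun τ h1 h2 => hCb t τ h1 h2)
        (fun r h1 h2 => hQb r h1 (by linarith))
  -- Integrability on the unit interval is carried back to `[s, t]` by undoing the affine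
  -- substitution.
  have h2 := (hint.comp_sub_right s).comp_mul_left (c := (t - s)⁻¹)
  have e : ∀ x : ℝ, s + (t - s) * ((t - s)⁻¹ * x - s) = x + (s - (t - s) * s) := by
    intro x; field_simp; ring
  have h3 := (h2.comp_add_right (-(s - (t - s) * s)))
  convert h3 using 1
  · ext r
    simp only [e]
    ring_nf
  · field_simp; ring
  · field_simp; ring

/-- The bound is independent of `t - s` because the convolution of two inverse square roots is a
Beta integral, constant in time. Convolution improves the singularity to boundedness. -/
lemma norm_singConv_le {k : ℝ → ℝ → E →L[ℝ] E'} {F : ℝ → E} {s t C Q : ℝ} (hst : s < t)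
    (hC : 0 ≤ C)
    (hk : ∀ τ, 0 < τ → τ ≤ t - s → ‖k t τ‖ ≤ C * (1 / √τ))
    (hF : ∀ r, s < r → r ≤ t → ‖F r‖ ≤ Q * (1 / √(r - s))) :
    ‖singConv k F s t‖ ≤ C * Q * ∫ θ in (0:ℝ)..1, betaWeight θ := by
  have h0 : 0 < t - s := sub_pos.2 hst
  rw [singConv, integral_subst_unit (fun r => k t (t - r) (F r)), norm_smul,
    Real.norm_of_nonneg h0.le]
  have : ‖∫ θ in (0:ℝ)..1, k t (t - (s + (t - s) * θ)) (F (s + (t - s) * θ))‖ ≤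
      ∫ θ in (0:ℝ)..1, (C * Q / (t - s)) * betaWeight θ := by
    refine intervalIntegral.norm_integral_le_of_norm_le zero_le_one ?_
      (intervalIntegrable_betaWeight.const_mul _)
    filter_upwards [ae_uIoc_mem_Ioo] with θ hθ hθ'
    rw [uIoc_of_le zero_le_one] at hθ
    exact norm_singInt_le (κ := k t) hst (hθ hθ') hC hk hF
  calc _ ≤ (t - s) * ∫ θ in (0:ℝ)..1, (C * Q / (t - s)) * betaWeight θ :=
        mul_le_mul_of_nonneg_left this h0.le
    _ = _ := by rw [intervalIntegral.integral_const_mul]; field_simp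

/-- The convolution is even bounded on bounded time intervals; `1 ≤ √L / √(t - s)` weakens this to
the bound that makes the class stable under iteration. -/
lemma SingKernel.singFun_singConv {k : ℝ → ℝ → E →L[ℝ] E'} (hk : SingKernel k) {F : ℝ → E}
    {s : ℝ} (hF : SingFun s F) : SingFun s (singConv k F s) where
  cont := by
    refine continuousOn_singInt (U := Ioi s) (k := k) (T := fun t => t) continuousOn_id
      (fun p hp => hp) (hk.cont.mono (by intro x hx; exact ⟨mem_univ _, hx.2⟩)) ?_ hF
    intro L
    obtain ⟨C, hC, h⟩ := hk.bound L
    exact ⟨C, hC, fun p _ => h p⟩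
  bound := by
    intro L
    obtain ⟨C, hC, hCb⟩ := hk.bound L
    obtain ⟨Q, hQ, hQb⟩ := hF.bound L
    have hB : 0 ≤ ∫ θ in (0:ℝ)..1, betaWeight θ :=
      intervalIntegral.integral_nonneg zero_le_one (fun θ _ => betaWeight_nonneg θ)
    refine ⟨C * Q * (∫ θ in (0:ℝ)..1, betaWeight θ) * √L, by positivity, fun t h1 h2 => ?_⟩
    have h0 : 0 < t - s := sub_pos.2 h1
    refine (norm_singConv_le h1 hC (fun τ a b => hCb t τ a (by linarith))
      (fun r a b => hQb r a (by linarith))).trans ?_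
    have : 1 ≤ √L * (1 / √(t - s)) := by
      rw [mul_one_div, one_le_div (Real.sqrt_pos.2 h0)]
      exact Real.sqrt_le_sqrt (by linarith)
    calc C * Q * (∫ θ in (0:ℝ)..1, betaWeight θ) =
        C * Q * (∫ θ in (0:ℝ)..1, betaWeight θ) * 1 := by ring
      _ ≤ C * Q * (∫ θ in (0:ℝ)..1, betaWeight θ) * (√L * (1 / √(t - s))) := by gcongr
      _ = _ := by ring

end Volterra

end FKTorus

end

/-! ### Solvability and uniqueness for singular Volterra equations. -/

noncomputable section

namespace FKTorus

open Set
open scoped Interval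

section VolterraEquation

variable {E E' : Type*} [NormedAddCommGroup E] [NormedSpace ℝ E]
  [NormedAddCommGroup E'] [NormedSpace ℝ E']

lemma tendsto_integral_betaWeight_exp :
    Tendsto (fun Λ : ℝ => ∫ θ in (0:ℝ)..1, betaWeight θ * Real.exp (-(Λ * (1 - θ)))) atTop (𝓝 0) := by
  have h := intervalIntegral.tendsto_integral_filter_of_dominated_convergence (μ := volume)
    (a := 0) (b := 1) (l := (atTop : Filter ℝ)) (f := fun _ => (0:ℝ))
    (F := fun Λ θ => betaWeight θ * Real.exp (-(Λ * (1 - θ)))) betaWeight ?_ ?_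
    intervalIntegrable_betaWeight ?_
  · simpa using h
  · refine Eventually.of_forall fun Λ => ?_
    unfold betaWeight
    exact Measurable.aestronglyMeasurable (by fun_prop)
  · filter_upwards [eventually_ge_atTop 0] with Λ hΛ
    filter_upwards [ae_uIoc_mem_Ioo] with θ hθ hθ'
    have := hθ hθ'
    rw [Real.norm_of_nonneg (mul_nonneg (betaWeight_nonneg _) (Real.exp_pos _).le)]
    refine mul_le_of_le_one_right (betaWeight_nonneg _) (Real.exp_le_one_iff.2 ?_)
    have : 0 ≤ Λ * (1 - θ) := mul_nonneg hΛ (by linarith [this.2])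
    linarith
  · filter_upwards [ae_uIoc_mem_Ioo] with θ hθ hθ'
    have := hθ hθ'
    rw [← mul_zero (betaWeight θ)]
    refine Tendsto.const_mul _ (Real.tendsto_exp_neg_atTop_nhds_zero.comp ?_)
    exact tendsto_id.atTop_mul_const (by linarith [this.2])

lemma intervalIntegrable_betaWeight_exp (Λ : ℝ) :
    IntervalIntegrable (fun θ => betaWeight θ * Real.exp (-(Λ * (1 - θ)))) volume 0 1 :=
  intervalIntegrable_betaWeight.mul_continuousOn (by fun_prop)

/-- This supplies the exponent of a weighted norm in which convolution with a singular kernel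
contracts by `1/2`. For `T ≤ δ` the factor `√T` is small; for `T ≥ δ` the product `lam * T` exceeds
a threshold beyond which the damped Beta integral is small. -/
lemma exists_contraction_weight {C L : ℝ} (hC : 0 ≤ C) :
    ∃ lam : ℝ, 0 ≤ lam ∧ ∀ T, 0 < T → T ≤ L →
      C * √T * (∫ θ in (0:ℝ)..1, betaWeight θ * Real.exp (-(lam * T * (1 - θ)))) ≤ 1 / 2 := by
  set B := ∫ θ in (0:ℝ)..1, betaWeight θ with hB
  have hB0 : 0 ≤ B := intervalIntegral.integral_nonneg zero_le_one (fun θ _ => betaWeight_nonneg θ)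
  have hanti : ∀ Λ Λ', Λ ≤ Λ' → (∫ θ in (0:ℝ)..1, betaWeight θ * Real.exp (-(Λ' * (1 - θ)))) ≤
      ∫ θ in (0:ℝ)..1, betaWeight θ * Real.exp (-(Λ * (1 - θ))) := by
    intro Λ Λ' h
    refine intervalIntegral.integral_mono_on zero_le_one (intervalIntegrable_betaWeight_exp _)
      (intervalIntegrable_betaWeight_exp _) ?_
    intro θ hθ
    have := hθ.2
    exact mul_le_mul_of_nonneg_left (Real.exp_le_exp.2 (by nlinarith)) (betaWeight_nonneg θ)
  have hle : ∀ Λ, 0 ≤ Λ → (∫ θ in (0:ℝ)..1, betaWeight θ * Real.exp (-(Λ * (1 - θ)))) ≤ B := by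
    intro Λ h
    simpa using hanti 0 Λ h
  have hnn : ∀ Λ, 0 ≤ ∫ θ in (0:ℝ)..1, betaWeight θ * Real.exp (-(Λ * (1 - θ))) := fun Λ =>
    intervalIntegral.integral_nonneg zero_le_one
      (fun θ _ => mul_nonneg (betaWeight_nonneg θ) (Real.exp_pos _).le)
  -- The choice makes `C * √δ * B = C * B / (2 * (C * B + 1)) ≤ 1/2`.
  set δ := (1 / (2 * (C * B + 1))) ^ 2 with hδ
  have hCB : 0 ≤ C * B := mul_nonneg hC hB0
  have hδ0 : 0 < δ := by positivity
  have hsδ : √δ = 1 / (2 * (C * B + 1)) := Real.sqrt_sq (by positivity)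
  have hlim : Tendsto (fun Λ : ℝ => C * √L *
      ∫ θ in (0:ℝ)..1, betaWeight θ * Real.exp (-(Λ * (1 - θ)))) atTop (𝓝 (C * √L * 0)) :=
    tendsto_integral_betaWeight_exp.const_mul _
  rw [mul_zero] at hlim
  obtain ⟨Λ, hΛ0, hΛ⟩ := ((hlim.eventually (gt_mem_nhds (by norm_num : (0:ℝ) < 1/2))).and
    (eventually_ge_atTop 0)).exists.imp (fun Λ h => And.symm h)
  refine ⟨Λ / δ, by positivity, fun T hT hTL => ?_⟩
  have hlamT : 0 ≤ Λ / δ * T := by positivity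
  rcases le_total T δ with h | h
  · calc C * √T * (∫ θ in (0:ℝ)..1, betaWeight θ * Real.exp (-(Λ / δ * T * (1 - θ))))
        ≤ C * √δ * B := by
          apply mul_le_mul (mul_le_mul_of_nonneg_left (Real.sqrt_le_sqrt h) hC) (hle _ hlamT)
            (hnn _) (by positivity)
      _ = (C * B) / (2 * (C * B + 1)) := by rw [hsδ]; field_simp
      _ ≤ 1 / 2 := by rw [div_le_iff₀ (by positivity)]; linarith
  · calc C * √T * (∫ θ in (0:ℝ)..1, betaWeight θ * Real.exp (-(Λ / δ * T * (1 - θ))))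
        ≤ C * √L * ∫ θ in (0:ℝ)..1, betaWeight θ * Real.exp (-(Λ * (1 - θ))) := by
          apply mul_le_mul (mul_le_mul_of_nonneg_left (Real.sqrt_le_sqrt hTL) hC) (hanti _ _ ?_)
            (hnn _) (by positivity)
          rw [div_mul_eq_mul_div, le_div_iff₀ hδ0]
          exact mul_le_mul_of_nonneg_left h hΛ0
      _ ≤ 1 / 2 := hΛ.le

/-- The contraction estimate for singular convolutions in an exponentially weighted norm. -/
lemma norm_singConv_le_half {C L lam Q : ℝ} (hC : 0 ≤ C) (hQ : 0 ≤ Q)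
    (hlam : ∀ T, 0 < T → T ≤ L →
      C * √T * (∫ θ in (0:ℝ)..1, betaWeight θ * Real.exp (-(lam * T * (1 - θ)))) ≤ 1 / 2)
    {k : ℝ → ℝ → E →L[ℝ] E'} (hk : ∀ t τ, 0 < τ → τ ≤ L → ‖k t τ‖ ≤ C * (1 / √τ))
    {s : ℝ} {F : ℝ → E}
    (hF : ∀ r, s < r → r ≤ s + L → ‖F r‖ ≤ Q * (Real.exp (lam * (r - s)) * (1 / √(r - s))))
    {t : ℝ} (hst : s < t) (htL : t ≤ s + L) :
    ‖singConv k F s t‖ ≤ Q / 2 * (Real.exp (lam * (t - s)) * (1 / √(t - s))) := by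
  have h0 : 0 < t - s := sub_pos.2 hst
  rw [singConv, integral_subst_unit (fun r => k t (t - r) (F r)), norm_smul,
    Real.norm_of_nonneg h0.le]
  have : ‖∫ θ in (0:ℝ)..1, k t (t - (s + (t - s) * θ)) (F (s + (t - s) * θ))‖ ≤
      ∫ θ in (0:ℝ)..1, (C * Q * Real.exp (lam * (t - s)) / (t - s)) *
        (betaWeight θ * Real.exp (-(lam * (t - s) * (1 - θ)))) := by
    refine intervalIntegral.norm_integral_le_of_norm_le zero_le_one ?_
      ((intervalIntegrable_betaWeight_exp _).const_mul _)
    filter_upwards [ae_uIoc_mem_Ioo] with θ hθ hθ'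
    rw [uIoc_of_le zero_le_one] at hθ
    have hm := hθ hθ'
    have h1 : 0 < (t - s) * θ := mul_pos h0 hm.1
    have h2 : 0 < (t - s) * (1 - θ) := mul_pos h0 (by linarith [hm.2])
    have hF' := hF (s + (t - s) * θ) (by linarith) (by nlinarith)
    rw [show s + (t - s) * θ - s = (t - s) * θ by ring, ← mul_assoc] at hF'
    refine (norm_singInt_le_of_point (κ := k t) hst hm hC (hk _ _ h2 (by nlinarith)) hF').trans
      (le_of_eq ?_)
    rw [show lam * ((t - s) * θ) = lam * (t - s) + -(lam * (t - s) * (1 - θ)) by ring, Real.exp_add]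
    ring
  calc _ ≤ (t - s) * _ := mul_le_mul_of_nonneg_left this h0.le
    _ = Q * (Real.exp (lam * (t - s)) * (1 / √(t - s))) * (C * √(t - s) *
          (∫ θ in (0:ℝ)..1, betaWeight θ * Real.exp (-(lam * (t - s) * (1 - θ))))) := by
        rw [intervalIntegral.integral_const_mul]
        have : √(t - s) ≠ 0 := (Real.sqrt_pos.2 h0).ne'
        field_simp
    _ ≤ Q * (Real.exp (lam * (t - s)) * (1 / √(t - s))) * (1 / 2) :=
        mul_le_mul_of_nonneg_left (hlam _ h0 (by linarith)) (by positivity)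
    _ = _ := by ring

lemma SingFun.add {s : ℝ} {F G : ℝ → E} (hF : SingFun s F) (hG : SingFun s G) :
    SingFun s (fun t => F t + G t) where
  cont := hF.cont.add hG.cont
  bound := by
    intro L
    obtain ⟨Q, hQ, h1⟩ := hF.bound L
    obtain ⟨R, hR, h2⟩ := hG.bound L
    refine ⟨Q + R, add_nonneg hQ hR, fun t a b => ?_⟩
    calc _ ≤ ‖F t‖ + ‖G t‖ := norm_add_le _ _
      _ ≤ _ := by rw [add_mul]; exact add_le_add (h1 t a b) (h2 t a b)

lemma SingFun.neg {s : ℝ} {F : ℝ → E} (hF : SingFun s F) : SingFun s (fun t => - F t) where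
  cont := hF.cont.neg
  bound := by simpa using hF.bound

lemma SingFun.sub {s : ℝ} {F G : ℝ → E} (hF : SingFun s F) (hG : SingFun s G) :
    SingFun s (fun t => F t - G t) := by
  simpa [sub_eq_add_neg] using hF.add hG.neg

lemma SingKernel.singConv_sub {k : ℝ → ℝ → E →L[ℝ] E'} (hk : SingKernel k) {s : ℝ} {F G : ℝ → E}
    (hF : SingFun s F) (hG : SingFun s G) {t : ℝ} (hst : s < t) :
    singConv k (fun r => F r - G r) s t = singConv k F s t - singConv k G s t := by
  simp only [singConv, map_sub]
  exact intervalIntegral.integral_sub (hk.intervalIntegrable hF hst) (hk.intervalIntegrable hG hst)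

lemma SingKernel.singConv_add {k : ℝ → ℝ → E →L[ℝ] E'} (hk : SingKernel k) {s : ℝ} {F G : ℝ → E}
    (hF : SingFun s F) (hG : SingFun s G) {t : ℝ} (hst : s < t) :
    singConv k (fun r => F r + G r) s t = singConv k F s t + singConv k G s t := by
  simp only [singConv, map_add]
  exact intervalIntegral.integral_add (hk.intervalIntegrable hF hst) (hk.intervalIntegrable hG hst)

lemma weight_lower {s t Q lam : ℝ} (hlam : 0 ≤ lam) (hQ : 0 ≤ Q) (hst : s < t) :
    Q * (1 / √(t - s)) ≤ Q * (Real.exp (lam * (t - s)) * (1 / √(t - s))) := by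
  refine mul_le_mul_of_nonneg_left ?_ hQ
  refine le_mul_of_one_le_left (by positivity) (Real.one_le_exp ?_)
  exact mul_nonneg hlam (sub_pos.2 hst).le

/-- The homogeneous Volterra equation has only the zero solution. -/
lemma SingKernel.eq_zero {k : ℝ → ℝ → E →L[ℝ] E} (hk : SingKernel k) {s : ℝ} {F : ℝ → E}
    (hF : SingFun s F) (h : ∀ t, s < t → F t = singConv k F s t) : ∀ t, s < t → F t = 0 := by
  intro t hst
  obtain ⟨C, hC, hCb⟩ := hk.bound (t - s)
  obtain ⟨Q, hQ, hQb⟩ := hF.bound (t - s)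
  obtain ⟨lam, hlam0, hlam⟩ := exists_contraction_weight (C := C) (L := t - s) hC
  -- Each substitution of the bound into the equation halves its constant.
  have key : ∀ n : ℕ, ∀ r, s < r → r ≤ s + (t - s) →
      ‖F r‖ ≤ Q * (1/2) ^ n * (Real.exp (lam * (r - s)) * (1 / √(r - s))) := by
    intro n
    induction n with
    | zero => intro r h1 h2; simpa using (hQb r h1 h2).trans (weight_lower hlam0 hQ h1)
    | succ n ih =>
      intro r h1 h2
      rw [h r h1]
      refine (norm_singConv_le_half hC (by positivity) hlam hCb ih h1 h2).trans (le_of_eq ?_)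
      ring
  have hlim : Tendsto (fun n : ℕ => Q * (1/2) ^ n * (Real.exp (lam * (t - s)) * (1 / √(t - s))))
      atTop (𝓝 0) := by
    have := (((tendsto_pow_atTop_nhds_zero_of_lt_one (r := (1/2 : ℝ)) (by norm_num) (by norm_num)).const_mul
      Q).mul_const (Real.exp (lam * (t - s)) * (1 / √(t - s))))
    simpa using this
  have := ge_of_tendsto' hlim (fun n => key n t hst (by linarith))
  exact norm_le_zero_iff.1 this

/-- The terms of the Neumann series of a Volterra equation. -/
def volterraIter (k : ℝ → ℝ → E →L[ℝ] E) (f : ℝ → E) (s : ℝ) : ℕ → ℝ → E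
  | 0 => f
  | n + 1 => singConv k (volterraIter k f s n) s

/-- By Hahn–Banach a point outside `P` is separated from it by a functional. Being bounded above on
a subspace, the functional vanishes there, hence also on the integral, a contradiction. -/
lemma intervalIntegral_mem_of_closed [CompleteSpace E] {P : Submodule ℝ E} (hP : IsClosed (P : Set E))
    {f : ℝ → E} {a b : ℝ} (hab : a ≤ b) (hf : IntervalIntegrable f volume a b)
    (h : ∀ r ∈ Ioo a b, f r ∈ P) : ∫ r in a..b, f r ∈ P := by
  by_contra hne
  obtain ⟨g, u, hg1, hg2⟩ := geometric_hahn_banach_closed_point P.convex hP hne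
  have hg0 : ∀ x ∈ P, g x = 0 := by
    intro x hx
    by_contra h0
    have := hg1 (((u + 1) / g x) • x) (P.smul_mem _ hx)
    rw [map_smul, smul_eq_mul, div_mul_cancel₀ _ h0] at this
    linarith
  have hu : 0 < u := by simpa using hg1 0 P.zero_mem
  have hz : g (∫ r in a..b, f r) = 0 := by
    rw [← g.intervalIntegral_comp_comm hf, intervalIntegral.integral_of_le hab,
      integral_Ioc_eq_integral_Ioo]
    refine setIntegral_eq_zero_of_forall_eq_zero ?_
    intro r hr
    exact hg0 _ (h r hr)
  linarith

/-- Solvability of Volterra equations with an inverse square root singularity. The solution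
stays in every closed subspace that is invariant under the kernel. -/
theorem SingKernel.exists_solution [CompleteSpace E] {k : ℝ → ℝ → E →L[ℝ] E} (hk : SingKernel k)
    {s : ℝ} {f : ℝ → E} (hf : SingFun s f) :
    ∃ F : ℝ → E, SingFun s F ∧ (∀ t, s < t → F t = f t + singConv k F s t) ∧
      ∀ P : Submodule ℝ E, IsClosed (P : Set E) → (∀ t, s < t → f t ∈ P) →
        (∀ t τ, 0 < τ → ∀ x ∈ P, k t τ x ∈ P) → ∀ t, s < t → F t ∈ P := by
  set φ := volterraIter k f s with hφ
  have hsing : ∀ n, SingFun s (φ n) := by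
    intro n
    induction n with
    | zero => exact hf
    | succ n ih => exact hk.singFun_singConv ih
  -- In the weighted norm the Neumann terms decay like `2⁻ⁿ`. The weight is recorded together with
  -- the bound because the tails have to be convolved in the same norm.
  have hbd : ∀ L : ℝ, ∃ C Q lam : ℝ, 0 ≤ C ∧ 0 ≤ Q ∧ 0 ≤ lam ∧
      (∀ t τ, 0 < τ → τ ≤ L → ‖k t τ‖ ≤ C * (1 / √τ)) ∧
      (∀ T, 0 < T → T ≤ L →
        C * √T * (∫ θ in (0:ℝ)..1, betaWeight θ * Real.exp (-(lam * T * (1 - θ)))) ≤ 1 / 2) ∧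
      ∀ n : ℕ, ∀ t, s < t → t ≤ s + L →
        ‖φ n t‖ ≤ Q * (1/2) ^ n * (Real.exp (lam * (t - s)) * (1 / √(t - s))) := by
    intro L
    obtain ⟨C, hC, hCb⟩ := hk.bound L
    obtain ⟨Q, hQ, hQb⟩ := hf.bound L
    obtain ⟨lam, hlam0, hlam⟩ := exists_contraction_weight (C := C) (L := L) hC
    refine ⟨C, Q, lam, hC, hQ, hlam0, hCb, hlam, fun n => ?_⟩
    induction n with
    | zero =>
      intro r h1 h2
      rw [pow_zero, mul_one]
      exact (hQb r h1 h2).trans (weight_lower hlam0 hQ h1)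
    | succ n ih =>
      intro r h1 h2
      refine (norm_singConv_le_half hC (by positivity) hlam hCb ih h1 h2).trans (le_of_eq ?_)
      ring
  have hgeo : Summable (fun n : ℕ => (1/2 : ℝ) ^ n) := summable_geometric_two
  have hsummable : ∀ t, s < t → Summable (fun n => ‖φ n t‖) := by
    intro t hst
    obtain ⟨C, Q, lam, -, -, -, -, -, h⟩ := hbd (t - s)
    refine Summable.of_nonneg_of_le (fun _ => norm_nonneg _) (fun n => h n t hst (by linarith)) ?_
    exact (hgeo.mul_left Q).mul_right _
  set F : ℝ → E := fun t => ∑' n, φ n t with hF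
  -- tail bound
  have htail : ∀ L : ℝ, ∃ C Q lam : ℝ, 0 ≤ C ∧ 0 ≤ Q ∧ 0 ≤ lam ∧
      (∀ t τ, 0 < τ → τ ≤ L → ‖k t τ‖ ≤ C * (1 / √τ)) ∧
      (∀ T, 0 < T → T ≤ L →
        C * √T * (∫ θ in (0:ℝ)..1, betaWeight θ * Real.exp (-(lam * T * (1 - θ)))) ≤ 1 / 2) ∧
      ∀ n : ℕ, ∀ t, s < t → t ≤ s + L →
        ‖F t - ∑ i ∈ Finset.range n, φ i t‖ ≤
          (2 * Q * (1/2) ^ n) * (Real.exp (lam * (t - s)) * (1 / √(t - s))) := by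
    intro L
    obtain ⟨C, Q, lam, hC, hQ, hlam0, hCb, hlam, h⟩ := hbd L
    refine ⟨C, Q, lam, hC, hQ, hlam0, hCb, hlam, fun n t h1 h2 => ?_⟩
    have hs := (hsummable t h1).of_norm
    have e : F t - ∑ i ∈ Finset.range n, φ i t = ∑' i, φ (i + n) t := by
      rw [sub_eq_iff_eq_add', hF]
      exact (hs.sum_add_tsum_nat_add n).symm
    rw [e]
    have hg : HasSum (fun i : ℕ => Q * (1/2) ^ (i + n) * (Real.exp (lam * (t - s)) * (1 / √(t - s))))
        ((2 * Q * (1/2) ^ n) * (Real.exp (lam * (t - s)) * (1 / √(t - s)))) := by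
      have := ((hasSum_geometric_two.mul_left (Q * (1/2)^n)).mul_right
        (Real.exp (lam * (t - s)) * (1 / √(t - s))))
      rw [show 2 * Q * (1/2 : ℝ) ^ n * (Real.exp (lam * (t - s)) * (1 / √(t - s))) =
        Q * (1/2)^n * 2 * (Real.exp (lam * (t - s)) * (1 / √(t - s))) by ring]
      have e3 : ∀ i : ℕ, Q * (1/2 : ℝ) ^ (i + n) * (Real.exp (lam * (t - s)) * (1 / √(t - s))) =
          Q * (1/2)^n * (1/2) ^ i * (Real.exp (lam * (t - s)) * (1 / √(t - s))) := fun i => by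
        rw [pow_add]; ring
      simp only [e3]
      exact this
    exact tsum_of_norm_bounded hg (fun i => h (i + n) t h1 h2)
  have hFcont : ContinuousOn F (Ioi s) := by
    intro t₀ ht₀
    have ht₀' : s < t₀ := ht₀
    obtain ⟨C, Q, lam, hC, hQ, hlam0, -, -, h⟩ := hbd (t₀ - s + 1)
    set δ := (t₀ - s) / 2 with hδ
    have hδ0 : 0 < δ := by rw [hδ]; linarith
    have hc : ContinuousOn F (Ioo (s + δ) (s + (t₀ - s + 1))) := by
      refine continuousOn_tsum (u := fun n => Q * (1/2)^n * (Real.exp (lam * (t₀ - s + 1)) * (1 / √δ)))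
        (fun n => (hsing n).cont.mono ?_) ((hgeo.mul_left Q).mul_right _) ?_
      · intro x hx; exact lt_trans (by linarith) hx.1
      · intro n t ht
        have ht1 : s < t := lt_trans (by linarith) ht.1
        refine (h n t ht1 ht.2.le).trans ?_
        have hx1 := ht.1
        have hx2 := ht.2
        gcongr <;> linarith
    refine (hc.continuousAt (Ioo_mem_nhds ?_ ?_)).continuousWithinAt <;> linarith
  have hFsing : SingFun s F := by
    refine ⟨hFcont, fun L => ?_⟩
    obtain ⟨C, Q, lam, hC, hQ, hlam0, -, -, h⟩ := htail L
    refine ⟨2 * Q * Real.exp (lam * L), by positivity, fun t h1 h2 => ?_⟩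
    have := h 0 t h1 h2
    simp only [Finset.range_zero, Finset.sum_empty, sub_zero, pow_zero, mul_one] at this
    refine this.trans ?_
    rw [← mul_assoc]
    gcongr
    linarith
  have hpart : ∀ n, SingFun s (fun t => ∑ i ∈ Finset.range n, φ i t) := by
    intro n
    induction n with
    | zero =>
      refine ⟨by simpa using continuousOn_const, fun L => ⟨0, le_rfl, fun t _ _ => by simp⟩⟩
    | succ n ih => simpa only [Finset.sum_range_succ] using ih.add (hsing n)
  have hpartconv : ∀ n, ∀ t, s < t →
      singConv k (fun r => ∑ i ∈ Finset.range n, φ i r) s t + f t =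
        ∑ i ∈ Finset.range (n + 1), φ i t := by
    intro n t hst
    induction n with
    | zero => simp [singConv, hφ, volterraIter]
    | succ n ih =>
      simp only [Finset.sum_range_succ _ n]
      rw [hk.singConv_add (hpart n) (hsing n) hst, Finset.sum_range_succ _ (n+1), ← ih]
      simp only [hφ, volterraIter]
      abel
  refine ⟨F, hFsing, ?_, ?_⟩
  · intro t hst
    obtain ⟨C, Q, lam, hC, hQ, hlam0, hCb, hlam, h⟩ := htail (t - s)
    set W := Real.exp (lam * (t - s)) * (1 / √(t - s))
    -- The residual is one tail of the series minus the convolution of the preceding tail, and both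
    -- are `O(2⁻ⁿ)`.
    have hest : ∀ n : ℕ, ‖F t - (f t + singConv k F s t)‖ ≤ (2 * Q * W) * (1/2) ^ n := by
      intro n
      have e : F t - (f t + singConv k F s t) =
          (F t - ∑ i ∈ Finset.range (n + 1), φ i t) -
          singConv k (fun r => F r - ∑ i ∈ Finset.range n, φ i r) s t := by
        rw [hk.singConv_sub hFsing (hpart n) hst, ← hpartconv n t hst]
        abel
      rw [e]
      have b1 := h (n + 1) t hst (by linarith)
      have b2 := norm_singConv_le_half (Q := 2 * Q * (1/2)^n) hC (by positivity) hlam hCb (h n) hst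
        (by linarith : t ≤ s + (t - s))
      refine (norm_sub_le _ _).trans ((add_le_add b1 b2).trans (le_of_eq ?_))
      rw [pow_succ]; ring
    have hlim : Tendsto (fun n : ℕ => (2 * Q * W) * (1/2 : ℝ) ^ n) atTop (𝓝 0) := by
      have := ((tendsto_pow_atTop_nhds_zero_of_lt_one (r := (1/2 : ℝ)) (by norm_num)
        (by norm_num)).const_mul (2 * Q * W))
      simpa using this
    have := ge_of_tendsto' hlim hest
    exact sub_eq_zero.1 (norm_le_zero_iff.1 this)
  · intro P hP hfP hkP t hst
    have hmem : ∀ n t, s < t → φ n t ∈ P := by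
      intro n
      induction n with
      | zero => exact hfP
      | succ n ih =>
        intro t hst
        refine intervalIntegral_mem_of_closed hP hst.le (hk.intervalIntegrable (hsing n) hst) ?_
        intro r hr
        exact hkP _ _ (sub_pos.2 hr.2) _ (ih r hr.1)
    refine hP.mem_of_tendsto (hsummable t hst).of_norm.hasSum.tendsto_sum_nat
      (Eventually.of_forall fun n => ?_)
    exact P.sum_mem (fun i _ => hmem i t hst)

end VolterraEquation

end FKTorus

end

/-! ### Duhamel's formula for first order perturbations of a smoothing semigroup. -/

noncomputable section

namespace FKTorus

open Set
open scoped Interval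

section OperatorKernels

variable {W Y Y' : Type*} [NormedAddCommGroup W] [NormedSpace ℝ W]
  [NormedAddCommGroup Y] [NormedSpace ℝ Y] [NormedAddCommGroup Y'] [NormedSpace ℝ Y']

/-- Composition on the left with a family of operators, as a kernel on operators. -/
def opKernel (W : Type*) [NormedAddCommGroup W] [NormedSpace ℝ W] (N : ℝ → ℝ → Y →L[ℝ] Y') :
    ℝ → ℝ → (W →L[ℝ] Y) →L[ℝ] (W →L[ℝ] Y') :=
  fun t τ => ContinuousLinearMap.compL ℝ W Y Y' (N t τ)

lemma opKernel_apply (N : ℝ → ℝ → Y →L[ℝ] Y') (t τ : ℝ) (T : W →L[ℝ] Y) :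
    opKernel W N t τ T = N t τ ∘L T := rfl

lemma SingKernel.opKernel {N : ℝ → ℝ → Y →L[ℝ] Y'} (hN : SingKernel N) :
    SingKernel (opKernel W N) where
  cont := (ContinuousLinearMap.compL ℝ W Y Y').continuous.comp_continuousOn hN.cont
  bound := by
    intro L
    obtain ⟨C, hC, h⟩ := hN.bound L
    refine ⟨C, hC, fun t τ h1 h2 => le_trans ?_ (h t τ h1 h2)⟩
    refine ContinuousLinearMap.opNorm_le_bound _ (norm_nonneg _) fun T => ?_
    exact ContinuousLinearMap.opNorm_comp_le _ _

/-- A kernel that only depends on the time lag. -/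
lemma singKernel_const {K : ℝ → Y →L[ℝ] Y'} (hK : ContinuousOn K (Ioi 0))
    (hb : ∀ L : ℝ, ∃ C, 0 ≤ C ∧ ∀ τ, 0 < τ → τ ≤ L → ‖K τ‖ ≤ C * (1 / √τ)) :
    SingKernel (fun _ => K) where
  cont := hK.comp continuousOn_snd (fun _ hx => hx.2)
  bound := fun L => by
    obtain ⟨C, hC, h⟩ := hb L
    exact ⟨C, hC, fun _ => h⟩

lemma SingFun.map {s : ℝ} {F : ℝ → Y} (hF : SingFun s F) (A : Y →L[ℝ] Y') :
    SingFun s (fun t => A (F t)) where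
  cont := A.continuous.comp_continuousOn hF.cont
  bound := fun L => by
    obtain ⟨Q, hQ, h⟩ := hF.bound L
    refine ⟨‖A‖ * Q, by positivity, fun t h1 h2 => (A.le_opNorm _).trans ?_⟩
    rw [mul_assoc]
    exact mul_le_mul_of_nonneg_left (h t h1 h2) (norm_nonneg _)

lemma SingFun.restrict {s m : ℝ} {F : ℝ → Y} (hF : SingFun s F) (hsm : s ≤ m) : SingFun m F where
  cont := hF.cont.mono (Ioi_subset_Ioi hsm)
  bound := fun L => by
    obtain ⟨Q, hQ, h⟩ := hF.bound (L + (m - s))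
    refine ⟨Q, hQ, fun t h1 h2 => (h t (by linarith) (by linarith)).trans ?_⟩
    have : 0 < t - m := sub_pos.2 h1
    gcongr

end OperatorKernels

/-- The operators entering Duhamel's formula for `w_t = Δw + β·∇w + χw` : a semigroup `S`, its
gradient `D`, and the coefficients `β`, `χ`. -/
structure FirstOrderSystem (ι Y : Type*) [Fintype ι] [NormedAddCommGroup Y] [NormedSpace ℝ Y] where
  S : ℝ → Y →L[ℝ] Y
  D : ι → ℝ → Y →L[ℝ] Y
  β : ι → ℝ → Y →L[ℝ] Y
  χ : ℝ → Y →L[ℝ] Y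
  S_zero : S 0 = ContinuousLinearMap.id ℝ Y
  S_add : ∀ s t, 0 ≤ s → 0 ≤ t → S (s + t) = S s ∘L S t
  S_cont : ContinuousOn S (Ioi 0)
  S_bound : ∃ C, 0 ≤ C ∧ ∀ t, 0 ≤ t → ‖S t‖ ≤ C
  D_add : ∀ i s t, 0 < s → 0 ≤ t → D i (s + t) = D i s ∘L S t
  S_comp_D : ∀ i s t, 0 ≤ s → 0 < t → S s ∘L D i t = D i (t + s)
  D_cont : ∀ i, ContinuousOn (D i) (Ioi 0)
  D_bound : ∃ C, 0 ≤ C ∧ ∀ i t, 0 < t → ‖D i t‖ ≤ C * (1 / √t)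
  β_cont : ∀ i, Continuous (β i)
  χ_cont : Continuous χ
  β_bound : ∃ C, 0 ≤ C ∧ ∀ i t, ‖β i t‖ ≤ C
  χ_bound : ∃ C, 0 ≤ C ∧ ∀ t, ‖χ t‖ ≤ C

namespace FirstOrderSystem

variable {ι Y : Type*} [Fintype ι] [NormedAddCommGroup Y] [NormedSpace ℝ Y]
  (A : FirstOrderSystem ι Y)

/-- The Volterra kernel of Duhamel's formula. -/
def N (t τ : ℝ) : Y →L[ℝ] Y := ∑ i, A.β i t ∘L A.D i τ + A.χ t ∘L A.S τ

lemma singKernel_S : SingKernel (fun _ : ℝ => A.S) := by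
  refine singKernel_const A.S_cont fun L => ?_
  obtain ⟨C, hC, h⟩ := A.S_bound
  refine ⟨C * √L, by positivity, fun t h1 h2 => (h t h1.le).trans ?_⟩
  have : 1 ≤ √L * (1 / √t) := by
    rw [mul_one_div, one_le_div (Real.sqrt_pos.2 h1)]
    exact Real.sqrt_le_sqrt (by linarith)
  rw [mul_assoc]
  exact le_mul_of_one_le_right hC this

lemma singKernel_D (i : ι) : SingKernel (fun _ : ℝ => A.D i) := by
  refine singKernel_const (A.D_cont i) fun L => ?_
  obtain ⟨C, hC, h⟩ := A.D_bound
  exact ⟨C, hC, fun τ h1 _ => h i τ h1⟩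

lemma singKernel_N : SingKernel A.N where
  cont := by
    unfold N
    refine ContinuousOn.add (continuousOn_finsetSum _ fun i _ => ?_) ?_
    · exact ((A.β_cont i).comp continuous_fst).continuousOn.clm_comp
        ((A.singKernel_D i).cont)
    · exact ((A.χ_cont).comp continuous_fst).continuousOn.clm_comp A.singKernel_S.cont
  bound := fun L => by
    obtain ⟨B, hB, hBb⟩ := A.β_bound
    obtain ⟨X, hX, hXb⟩ := A.χ_bound
    obtain ⟨C, hC, hCb⟩ := A.D_bound
    obtain ⟨C', hC', hCb'⟩ := A.singKernel_S.bound L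
    refine ⟨∑ _i : ι, B * C + X * C', by positivity, fun t τ h1 h2 => ?_⟩
    rw [add_mul, Finset.sum_mul]
    refine (norm_add_le _ _).trans (add_le_add ((norm_sum_le _ _).trans
      (Finset.sum_le_sum fun i _ => ?_)) ?_)
    · refine (ContinuousLinearMap.opNorm_comp_le _ _).trans ?_
      rw [mul_assoc]
      exact mul_le_mul (hBb i t) (hCb i τ h1) (norm_nonneg _) hB
    · refine (ContinuousLinearMap.opNorm_comp_le _ _).trans ?_
      rw [mul_assoc]
      exact mul_le_mul (hXb t) (hCb' t τ h1 h2) (norm_nonneg _) hX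

lemma singFun_lag {Y' : Type*} [NormedAddCommGroup Y'] [NormedSpace ℝ Y'] {k : ℝ → ℝ → Y →L[ℝ] Y'}
    (hk : SingKernel k) (s : ℝ) : SingFun s (fun t => k t (t - s)) where
  cont := hk.cont.comp (f := fun t => (t, t - s)) (by fun_prop)
    (fun t ht => ⟨mem_univ _, sub_pos.2 (show s < t from ht)⟩)
  bound := fun L => by
    obtain ⟨C, hC, h⟩ := hk.bound L
    exact ⟨C, hC, fun t h1 h2 => h t _ (sub_pos.2 h1) (by linarith)⟩

variable [CompleteSpace Y]

/-- Inserting Duhamel's formula for `V` and `∇V` into `β·∇V + χV` gives a closed Volterra equation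
for this source alone. The clause on closed subspaces is retained for the invariance statement. -/
lemma exists_source (s : ℝ) : ∃ F : ℝ → Y →L[ℝ] Y, SingFun s F ∧
    (∀ t, s < t → F t = A.N t (t - s) + singConv (opKernel Y A.N) F s t) ∧
      ∀ P : Submodule ℝ (Y →L[ℝ] Y), IsClosed (P : Set (Y →L[ℝ] Y)) →
        (∀ t, s < t → A.N t (t - s) ∈ P) →
        (∀ t τ, 0 < τ → ∀ x ∈ P, opKernel Y A.N t τ x ∈ P) → ∀ t, s < t → F t ∈ P :=
  (A.singKernel_N.opKernel (W := Y)).exists_solution (singFun_lag A.singKernel_N s)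

/-- The source term `β·∇V + χV` of the solution `V` started at time `s`. -/
def source (s : ℝ) : ℝ → Y →L[ℝ] Y := (A.exists_source s).choose

lemma singFun_source (s : ℝ) : SingFun s (A.source s) := (A.exists_source s).choose_spec.1

lemma source_eq {s t : ℝ} (h : s < t) :
    A.source s t = A.N t (t - s) + singConv (opKernel Y A.N) (A.source s) s t :=
  (A.exists_source s).choose_spec.2.1 t h

/-- The solution operator. -/
def sol (t s : ℝ) : Y →L[ℝ] Y :=
  A.S (t - s) + singConv (opKernel Y fun _ => A.S) (A.source s) s t

/-- The gradient of the solution operator. -/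
def grad (i : ι) (t s : ℝ) : Y →L[ℝ] Y :=
  A.D i (t - s) + singConv (opKernel Y fun _ => A.D i) (A.source s) s t

/-- The coefficients are evaluated at the outer time `t`, so they come out of the integral over `r`.
-/
lemma singConv_N {W : Type*} [NormedAddCommGroup W] [NormedSpace ℝ W] {F : ℝ → W →L[ℝ] Y} {s t : ℝ}
    (hF : SingFun s F) (h : s < t) :
    singConv (opKernel W A.N) F s t =
      ∑ i, A.β i t ∘L singConv (opKernel W fun _ => A.D i) F s t +
        A.χ t ∘L singConv (opKernel W fun _ => A.S) F s t := by
  have e1 : ∀ B : Y →L[ℝ] Y, ∀ K : ℝ → Y →L[ℝ] Y, SingKernel (fun _ : ℝ => K) →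
      B ∘L singConv (opKernel W fun _ => K) F s t = ∫ r in s..t, B ∘L (K (t - r) ∘L F r) := by
    intro B K hK
    exact (ContinuousLinearMap.intervalIntegral_comp_comm (ContinuousLinearMap.compL ℝ W Y Y B)
      ((hK.opKernel (W := W)).intervalIntegrable hF h)).symm
  have e2 : ∀ B : Y →L[ℝ] Y, ∀ K : ℝ → Y →L[ℝ] Y, SingKernel (fun _ : ℝ => K) →
      IntervalIntegrable (fun r => B ∘L (K (t - r) ∘L F r)) volume s t := by
    intro B K hK
    have h1 := (hK.opKernel (W := W)).intervalIntegrable hF h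
    exact ⟨(ContinuousLinearMap.compL ℝ W Y Y B).integrable_comp h1.1,
      (ContinuousLinearMap.compL ℝ W Y Y B).integrable_comp h1.2⟩
  rw [e1 _ _ A.singKernel_S]
  simp_rw [fun i => e1 (A.β i t) _ (A.singKernel_D i)]
  rw [← intervalIntegral.integral_finsetSum (fun i _ => e2 _ _ (A.singKernel_D i)),
    ← intervalIntegral.integral_add _ (e2 _ _ A.singKernel_S)]
  · refine intervalIntegral.integral_congr fun r _ => ?_
    simp only [opKernel_apply, N]
    ext w
    simp
  · have := IntervalIntegrable.sum (Finset.univ : Finset ι)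
      (f := fun i r => A.β i t ∘L (A.D i (t - r) ∘L F r)) (fun i _ => e2 (A.β i t) _ (A.singKernel_D i))
    have e : (fun r => ∑ i, A.β i t ∘L (A.D i (t - r) ∘L F r)) =
        ∑ i, fun r => A.β i t ∘L (A.D i (t - r) ∘L F r) := by
      ext1 r; simp only [Finset.sum_apply]
    rw [e]
    exact this

/-- This closes the loop: the solution of the Volterra equation is the source built from the very
`sol` and `grad` that it defines. -/
lemma source_eq_grad {s t : ℝ} (h : s < t) :
    A.source s t = ∑ i, A.β i t ∘L A.grad i t s + A.χ t ∘L A.sol t s := by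
  rw [source_eq A h, A.singConv_N (A.singFun_source s) h]
  simp only [N, sol, grad, ContinuousLinearMap.comp_add, Finset.sum_add_distrib]
  abel

lemma singFun_grad (i : ι) (s : ℝ) : SingFun s (fun t => A.grad i t s) :=
  (singFun_lag (A.singKernel_D i) s).add
    ((A.singKernel_D i).opKernel.singFun_singConv (A.singFun_source s))

lemma singFun_sol (s : ℝ) : SingFun s (fun t => A.sol t s) :=
  (singFun_lag A.singKernel_S s).add
    (A.singKernel_S.opKernel.singFun_singConv (A.singFun_source s))

lemma intervalIntegrable_inv_sqrt_sub (s t : ℝ) :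
    IntervalIntegrable (fun r : ℝ => 1 / √(r - s)) volume s t := by
  simpa using (intervalIntegrable_one_div_sqrt 0 (t - s)).comp_sub_right s

lemma integral_inv_sqrt_sub {s t : ℝ} (h : s ≤ t) : ∫ r in s..t, 1 / √(r - s) = 2 * √(t - s) := by
  have h0 : 0 ≤ t - s := sub_nonneg.2 h
  rw [intervalIntegral.integral_comp_sub_right (fun x => 1 / √x), sub_self]
  have : ∫ x in (0:ℝ)..(t - s), 1 / √x = ∫ x in (0:ℝ)..(t - s), x ^ (-(1/2) : ℝ) := by
    refine intervalIntegral.integral_congr fun x hx => ?_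
    rw [uIcc_of_le h0] at hx
    rw [Real.rpow_neg hx.1, ← Real.sqrt_eq_rpow, one_div]
  rw [this, integral_rpow (Or.inl (by norm_num)), Real.sqrt_eq_rpow]
  norm_num
  ring

/-- For short times the solution operator is close to the semigroup. -/
lemma norm_sol_sub_le (s L : ℝ) : ∃ C, 0 ≤ C ∧ ∀ t, s < t → t ≤ s + L →
    ‖A.sol t s - A.S (t - s)‖ ≤ C * √(t - s) := by
  obtain ⟨C, hC, hCb⟩ := A.S_bound
  obtain ⟨Q, hQ, hQb⟩ := (A.singFun_source s).bound L
  refine ⟨C * Q * 2, by positivity, fun t h1 h2 => ?_⟩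
  rw [sol, add_sub_cancel_left, singConv]
  have : ‖∫ r in s..t, opKernel Y (fun _ => A.S) t (t - r) (A.source s r)‖ ≤
      ∫ r in s..t, (C * Q) * (1 / √(r - s)) := by
    refine intervalIntegral.norm_integral_le_of_norm_le h1.le ?_
      ((intervalIntegrable_inv_sqrt_sub s t).const_mul _)
    refine Eventually.of_forall fun r hr => ?_
    rw [opKernel_apply]
    refine (ContinuousLinearMap.opNorm_comp_le _ _).trans ?_
    rw [mul_assoc]
    exact mul_le_mul (hCb _ (by linarith [hr.2])) (hQb r hr.1 (by linarith [hr.2])) (norm_nonneg _) hC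
  refine this.trans (le_of_eq ?_)
  rw [intervalIntegral.integral_const_mul, integral_inv_sqrt_sub h1.le]
  ring

/-- Restarting Duhamel's formula at an intermediate time. -/
lemma restart {Y' : Type*} [NormedAddCommGroup Y'] [NormedSpace ℝ Y'] [CompleteSpace Y']
    {K : ℝ → ℝ → Y →L[ℝ] Y'} (hK : SingKernel K)
    (hKS : ∀ t a b, 0 < a → 0 ≤ b → K t (a + b) = K t a ∘L A.S b) {s m t : ℝ} (hsm : s < m)
    (hmt : m < t) :
    K t (t - s) + singConv (opKernel Y K) (A.source s) s t =
      K t (t - m) ∘L A.sol m s + singConv (opKernel Y K) (A.source s) m t := by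
  have hi := (hK.opKernel (W := Y)).intervalIntegrable (A.singFun_source s) (hsm.trans hmt)
  have hi1 := hi.mono_set (c := s) (d := m) (by
    rw [uIcc_of_le hsm.le, uIcc_of_le (hsm.trans hmt).le]; exact Icc_subset_Icc_right hmt.le)
  have hi2 := hi.mono_set (c := m) (d := t) (by
    rw [uIcc_of_le hmt.le, uIcc_of_le (hsm.trans hmt).le]; exact Icc_subset_Icc_left hsm.le)
  -- On `[s, m]` the lag splits as `(t - m) + (m - r)`, so `K t (t - m)` factors out and leaves the
  -- Duhamel integral at time `m`.
  have e : ∫ r in s..m, opKernel Y K t (t - r) (A.source s r) =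
      K t (t - m) ∘L singConv (opKernel Y fun _ => A.S) (A.source s) s m := by
    have := ContinuousLinearMap.intervalIntegral_comp_comm
      (ContinuousLinearMap.compL ℝ Y Y Y' (K t (t - m)))
      ((A.singKernel_S.opKernel (W := Y)).intervalIntegrable (A.singFun_source s) hsm)
    refine Eq.trans ?_ this
    refine intervalIntegral.integral_congr fun r hr => ?_
    rw [uIcc_of_le hsm.le] at hr
    simp only [opKernel_apply, ContinuousLinearMap.compL_apply]
    rw [← ContinuousLinearMap.comp_assoc, ← hKS t _ _ (sub_pos.2 hmt) (by linarith [hr.2])]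
    congr 2
    ring
  have h1 := hKS t (t - m) (m - s) (sub_pos.2 hmt) (by linarith)
  rw [show t - m + (m - s) = t - s by ring] at h1
  rw [singConv, ← intervalIntegral.integral_add_adjacent_intervals hi1 hi2, e, h1, sol,
    ContinuousLinearMap.comp_add, singConv, singConv]
  abel

lemma N_add (t a b : ℝ) (ha : 0 < a) (hb : 0 ≤ b) : A.N t (a + b) = A.N t a ∘L A.S b := by
  simp only [N, A.S_add a b ha.le hb, fun i => A.D_add i a b ha hb]
  ext w
  simp

lemma singConv_precomp {W : Type*} [NormedAddCommGroup W] [NormedSpace ℝ W]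
    {Y' : Type*} [NormedAddCommGroup Y'] [NormedSpace ℝ Y'] [CompleteSpace Y']
    {K : ℝ → ℝ → Y →L[ℝ] Y'} (hK : SingKernel K) {F : ℝ → Y →L[ℝ] Y} {m t : ℝ}
    (hF : SingFun m F) (hmt : m < t) (B : W →L[ℝ] Y) :
    singConv (opKernel W K) (fun r => F r ∘L B) m t = singConv (opKernel Y K) F m t ∘L B :=
  ContinuousLinearMap.intervalIntegral_comp_comm
    ((ContinuousLinearMap.compL ℝ W Y Y').flip B)
    ((hK.opKernel (W := Y)).intervalIntegrable hF hmt)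

/-- After time `m` both sides solve the Volterra equation with forcing `A.N t (t - m) ∘L A.sol m s`;
their difference solves the homogeneous equation and vanishes. -/
lemma source_restart {s m t : ℝ} (hsm : s < m) (hmt : m < t) :
    A.source s t = A.source m t ∘L A.sol m s := by
  have hF := (A.singFun_source s).restrict hsm.le
  have hG : SingFun m (fun t => A.source m t ∘L A.sol m s) :=
    (A.singFun_source m).map ((ContinuousLinearMap.compL ℝ Y Y Y).flip (A.sol m s))
  have := (A.singKernel_N.opKernel (W := Y)).eq_zero (hF.sub hG) ?_ t hmt
  · exact sub_eq_zero.1 this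
  · intro t hmt
    rw [A.singKernel_N.opKernel.singConv_sub hF hG hmt,
      singConv_precomp A.singKernel_N (A.singFun_source m) hmt,
      A.source_eq (hsm.trans hmt), A.restart A.singKernel_N A.N_add hsm hmt, A.source_eq hmt,
      ContinuousLinearMap.add_comp]
    abel

lemma sol_eq_add_integral {s m t : ℝ} (hsm : s < m) (hmt : m < t) :
    A.sol t s = A.S (t - m) ∘L A.sol m s + singConv (opKernel Y fun _ => A.S) (A.source s) m t :=
  A.restart A.singKernel_S (fun _ a b ha hb => A.S_add a b ha.le hb) hsm hmt

lemma sol_restart {s m t : ℝ} (hsm : s < m) (hmt : m < t) :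
    A.sol t s = A.sol t m ∘L A.sol m s := by
  rw [A.sol_eq_add_integral hsm hmt]
  change _ = (A.S (t - m) + singConv (opKernel Y fun _ => A.S) (A.source m) m t) ∘L A.sol m s
  rw [ContinuousLinearMap.add_comp, ← singConv_precomp A.singKernel_S (A.singFun_source m) hmt]
  congr 1
  refine intervalIntegral.integral_congr_ae ?_
  refine Eventually.of_forall fun r hr => ?_
  rw [uIoc_of_le hmt.le] at hr
  simp only [A.source_restart hsm hr.1]

/-- Invariance of closed subspaces. -/
lemma invariant {M : Submodule ℝ Y} (hM : IsClosed (M : Set Y))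
    (hS : ∀ t, 0 < t → ∀ w ∈ M, A.S t w ∈ M) (hD : ∀ i t, 0 < t → ∀ w ∈ M, A.D i t w ∈ M)
    (hβ : ∀ i t, ∀ w ∈ M, A.β i t w ∈ M) (hχ : ∀ t, ∀ w ∈ M, A.χ t w ∈ M) {s t : ℝ} (hst : s < t) :
    (∀ w ∈ M, A.sol t s w ∈ M) ∧ (∀ i, ∀ w ∈ M, A.grad i t s w ∈ M) ∧
      ∀ w ∈ M, A.source s t w ∈ M := by
  -- The operators preserving `M` form a closed subspace of the operator space, to which the last
  -- clause of `exists_source` applies.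
  set P : Submodule ℝ (Y →L[ℝ] Y) :=
    { carrier := {T | ∀ w ∈ M, T w ∈ M}
      add_mem' := fun ha hb w hw => M.add_mem (ha w hw) (hb w hw)
      zero_mem' := fun w _ => M.zero_mem
      smul_mem' := fun c T hT w hw => M.smul_mem c (hT w hw) } with hP
  have hPc : IsClosed (P : Set (Y →L[ℝ] Y)) := by
    have : (P : Set (Y →L[ℝ] Y)) = ⋂ w ∈ M, {T | T w ∈ M} := by
      ext T; simp [hP]
    rw [this]
    exact isClosed_biInter fun w _ => hM.preimage (ContinuousLinearMap.apply ℝ Y w).continuous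
  have hN : ∀ t τ, 0 < τ → ∀ w ∈ M, A.N t τ w ∈ M := by
    intro t τ hτ w hw
    simp only [N, add_apply, _root_.sum_apply, ContinuousLinearMap.coe_comp, Function.comp]
    exact M.add_mem (M.sum_mem fun i _ => hβ i t _ (hD i τ hτ w hw)) (hχ t _ (hS τ hτ w hw))
  have hsrc : ∀ t, s < t → A.source s t ∈ P := by
    refine (A.exists_source s).choose_spec.2.2 P hPc ?_ ?_
    · intro t ht w hw
      exact hN t _ (sub_pos.2 ht) w hw
    · intro t τ hτ T hT w hw
      exact hN t τ hτ _ (hT w hw)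
  have hconv : ∀ K : ℝ → Y →L[ℝ] Y, SingKernel (fun _ : ℝ => K) →
      (∀ τ, 0 < τ → ∀ w ∈ M, K τ w ∈ M) →
      singConv (opKernel Y fun _ => K) (A.source s) s t ∈ P := by
    intro K hK hKM
    refine intervalIntegral_mem_of_closed hPc hst.le
      ((hK.opKernel (W := Y)).intervalIntegrable (A.singFun_source s) hst) ?_
    intro r hr w hw
    exact hKM _ (sub_pos.2 hr.2) _ (hsrc r hr.1 w hw)
  refine ⟨?_, fun i => ?_, hsrc t hst⟩
  · exact P.add_mem (x := A.S (t - s)) (fun w hw => hS _ (sub_pos.2 hst) w hw)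
      (hconv _ A.singKernel_S hS)
  · exact P.add_mem (x := A.D i (t - s)) (fun w hw => hD i _ (sub_pos.2 hst) w hw)
      (hconv _ (A.singKernel_D i) (hD i))

/-- Operators that intertwine two systems intertwine their solution operators. -/
lemma intertwine {Y' : Type*} [NormedAddCommGroup Y'] [NormedSpace ℝ Y'] [CompleteSpace Y']
    (A' : FirstOrderSystem ι Y') (B : Y →L[ℝ] Y')
    (hS : ∀ t, 0 < t → B ∘L A.S t = A'.S t ∘L B)
    (hD : ∀ i t, 0 < t → B ∘L A.D i t = A'.D i t ∘L B)
    (hβ : ∀ i t, B ∘L A.β i t = A'.β i t ∘L B) (hχ : ∀ t, B ∘L A.χ t = A'.χ t ∘L B)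
    {s t : ℝ} (hst : s < t) :
    B ∘L A.sol t s = A'.sol t s ∘L B ∧ ∀ i, B ∘L A.grad i t s = A'.grad i t s ∘L B := by
  have hN : ∀ t τ, 0 < τ → B ∘L A.N t τ = A'.N t τ ∘L B := by
    intro t τ hτ
    simp only [N, ContinuousLinearMap.comp_add, ContinuousLinearMap.add_comp,
      ContinuousLinearMap.comp_finsetSum, ContinuousLinearMap.finsetSum_comp]
    congr 1
    · refine Finset.sum_congr rfl fun i _ => ?_
      rw [← ContinuousLinearMap.comp_assoc, hβ, ContinuousLinearMap.comp_assoc, hD i τ hτ,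
        ContinuousLinearMap.comp_assoc]
    · rw [← ContinuousLinearMap.comp_assoc, hχ, ContinuousLinearMap.comp_assoc, hS τ hτ,
        ContinuousLinearMap.comp_assoc]
  have hconv : ∀ (K : ℝ → ℝ → Y →L[ℝ] Y) (K' : ℝ → ℝ → Y' →L[ℝ] Y'), SingKernel K →
      (∀ t τ, 0 < τ → B ∘L K t τ = K' t τ ∘L B) → ∀ t, s < t →
      B ∘L singConv (opKernel Y K) (A.source s) s t =
        singConv (opKernel Y K') (fun r => B ∘L A.source s r) s t := by
    intro K K' hK h t hst
    have := ContinuousLinearMap.intervalIntegral_comp_comm (ContinuousLinearMap.compL ℝ Y Y Y' B)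
      ((hK.opKernel (W := Y)).intervalIntegrable (A.singFun_source s) hst)
    refine this.symm.trans (intervalIntegral.integral_congr_ae ?_)
    -- The intertwining relation is available for positive lag only, so the endpoint is discarded.
    have hne : ∀ᵐ r : ℝ, r ≠ t := by simp [ae_iff, measure_singleton]
    filter_upwards [hne] with r hrt hr
    rw [uIoc_of_le hst.le] at hr
    simp only [opKernel_apply, ContinuousLinearMap.compL_apply]
    rw [← ContinuousLinearMap.comp_assoc, h t _ (sub_pos.2 (lt_of_le_of_ne hr.2 hrt)),
      ContinuousLinearMap.comp_assoc]
  have hF : SingFun s (fun t => B ∘L A.source s t) :=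
    (A.singFun_source s).map (ContinuousLinearMap.compL ℝ Y Y Y' B)
  have hG : SingFun s (fun t => A'.source s t ∘L B) :=
    (A'.singFun_source s).map ((ContinuousLinearMap.compL ℝ Y Y' Y').flip B)
  -- Both sides solve the Volterra equation of `A'` with the same forcing, so uniqueness identifies
  -- them.
  have hsrc : ∀ t, s < t → B ∘L A.source s t = A'.source s t ∘L B := by
    intro t hst
    have := (A'.singKernel_N.opKernel (W := Y)).eq_zero (hF.sub hG) ?_ t hst
    · exact sub_eq_zero.1 this
    · intro t hst
      rw [A'.singKernel_N.opKernel.singConv_sub hF hG hst,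
        singConv_precomp A'.singKernel_N (A'.singFun_source s) hst,
        ← hconv A.N A'.N A.singKernel_N hN t hst, A.source_eq hst, A'.source_eq hst,
        ContinuousLinearMap.add_comp, ContinuousLinearMap.comp_add, hN t _ (sub_pos.2 hst)]
      abel
  have hfin : ∀ (K : ℝ → Y →L[ℝ] Y) (K' : ℝ → Y' →L[ℝ] Y'), SingKernel (fun _ : ℝ => K) →
      SingKernel (fun _ : ℝ => K') → (∀ τ, 0 < τ → B ∘L K τ = K' τ ∘L B) →
      B ∘L (K (t - s) + singConv (opKernel Y fun _ => K) (A.source s) s t) =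
        (K' (t - s) + singConv (opKernel Y' fun _ => K') (A'.source s) s t) ∘L B := by
    intro K K' hK hK' h
    rw [ContinuousLinearMap.comp_add, ContinuousLinearMap.add_comp, h _ (sub_pos.2 hst),
      hconv _ (fun _ => K') hK (fun _ => h) t hst,
      ← singConv_precomp hK' (A'.singFun_source s) hst]
    congr 1
    refine intervalIntegral.integral_congr_ae (Eventually.of_forall fun r hr => ?_)
    rw [uIoc_of_le hst.le] at hr
    simp only [hsrc r hr.1]
  exact ⟨hfin _ _ A.singKernel_S A'.singKernel_S hS,
    fun i => hfin _ _ (A.singKernel_D i) (A'.singKernel_D i) (hD i)⟩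

/-- Joint continuity of `S(ρ) ∇V(t,s)`. -/
lemma continuousOn_S_comp_grad (i : ι) (s : ℝ) :
    ContinuousOn (fun p : ℝ × ℝ => A.S p.1 ∘L A.grad i p.2 s) (Ici 0 ×ˢ Ioi s) := by
  obtain ⟨C, hC, hCb⟩ := A.D_bound
  -- In the form `A.D i (τ + ρ)` the composite is norm continuous up to `ρ = 0`, which `A.S` alone
  -- need not be.
  have h1 : ContinuousOn (fun p : ℝ × ℝ => A.D i (p.2 - s + p.1)) (Ici 0 ×ˢ Ioi s) := by
    refine (A.D_cont i).comp (by fun_prop) fun p hp => ?_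
    have h1 : 0 ≤ p.1 := hp.1
    have h2 : s < p.2 := hp.2
    show 0 < p.2 - s + p.1
    linarith
  have h2 : ContinuousOn (fun p : ℝ × ℝ => ∫ r in s..p.2,
      ContinuousLinearMap.compL ℝ Y Y Y (A.D i (p.2 - r + p.1)) (A.source s r)) (Ici 0 ×ˢ Ioi s) := by
    refine continuousOn_singInt (k := fun (p : ℝ × ℝ) τ =>
      ContinuousLinearMap.compL ℝ Y Y Y (A.D i (τ + p.1))) continuousOn_snd (fun p hp => hp.2) ?_ ?_
      (A.singFun_source s)
    · refine (ContinuousLinearMap.compL ℝ Y Y Y).continuous.comp_continuousOn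
        ((A.D_cont i).comp (by fun_prop) fun q hq => ?_)
      have h1 : 0 ≤ q.1.1 := hq.1.1
      have h2 : 0 < q.2 := hq.2
      show 0 < q.2 + q.1.1
      linarith
    · intro L
      refine ⟨C, hC, fun p hp τ h1 _ => ?_⟩
      have h3 : 0 ≤ p.1 := hp.1
      refine (ContinuousLinearMap.opNorm_le_bound _ (norm_nonneg _) fun T =>
        ContinuousLinearMap.opNorm_comp_le _ _).trans ((hCb i (τ + p.1) (by linarith)).trans ?_)
      gcongr
      linarith
  refine (h1.add h2).congr fun p hp => ?_
  have h3 : 0 ≤ p.1 := hp.1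
  have h4 : s < p.2 := hp.2
  have := ContinuousLinearMap.intervalIntegral_comp_comm (ContinuousLinearMap.compL ℝ Y Y Y (A.S p.1))
      (((A.singKernel_D i).opKernel (W := Y)).intervalIntegrable (A.singFun_source s) h4)
  simp only [grad, ContinuousLinearMap.comp_add]
  rw [A.S_comp_D i _ _ h3 (sub_pos.2 h4)]
  congr 1
  refine this.symm.trans (intervalIntegral.integral_congr_ae ?_)
  have hne : ∀ᵐ r : ℝ, r ≠ p.2 := by simp [ae_iff, measure_singleton]
  filter_upwards [hne] with r hrt hr
  rw [uIoc_of_le h4.le] at hr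
  simp only [opKernel_apply, ContinuousLinearMap.compL_apply]
  rw [← ContinuousLinearMap.comp_assoc, A.S_comp_D i _ _ h3 (sub_pos.2 (lt_of_le_of_ne hr.2 hrt))]

end FirstOrderSystem

end FKTorus

end

/-! ### Gaussian kernels: pointwise bounds, shifts, dependence on the variance. -/

noncomputable section

namespace FKTorus

open Set
open scoped RealInnerProductSpace

section GaussKernel

variable {d : ℕ}

/-- The Gaussian density on `ℝᵈ` with covariance `v • 1`. -/
def gk (v : ℝ) (z : Space d) : ℝ := (√(2 * Real.pi * v))⁻¹ ^ d * Real.exp (-(‖z‖ ^ 2 / (2 * v)))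

/-- The kernel `-∂ᵢ gk`. -/
def dk (i : Fin d) (v : ℝ) (z : Space d) : ℝ := z i / v * gk v z

/-- The Gaussian measure on `ℝᵈ` with covariance `v • 1`. -/
def gauss (d : ℕ) (v : ℝ) : Measure (Space d) := (stdGaussian (Space d)).map (fun ζ => √v • ζ)

instance (v : ℝ) : IsProbabilityMeasure (gauss d v) :=
  Measure.isProbabilityMeasure_map (by fun_prop)

lemma gk_nonneg (v : ℝ) (z : Space d) : 0 ≤ gk v z := by unfold gk; positivity

lemma gk_pos {v : ℝ} (hv : 0 < v) (z : Space d) : 0 < gk v z := by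
  unfold gk
  have : 0 < √(2 * Real.pi * v) := Real.sqrt_pos.2 (by positivity)
  positivity

lemma gk_neg (v : ℝ) (z : Space d) : gk v (-z) = gk v z := by simp [gk]

lemma continuous_gk (v : ℝ) : Continuous (gk v : Space d → ℝ) := by unfold gk; fun_prop

lemma continuous_dk (i : Fin d) (v : ℝ) : Continuous (dk i v : Space d → ℝ) := by
  unfold dk
  exact ((by fun_prop : Continuous fun z : Space d => z i / v)).mul (continuous_gk v)

lemma dk_neg (i : Fin d) (v : ℝ) (z : Space d) : dk i v (-z) = - dk i v z := by
  simp [dk, gk_neg, neg_div]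

lemma charFun_gauss {v : ℝ} (hv : 0 ≤ v) (t : Space d) :
    charFun (gauss d v) t = Complex.exp (-(v * ‖t‖ ^ 2) / 2) := by
  rw [gauss, charFun_map_smul, charFun_stdGaussian, norm_smul, Real.norm_of_nonneg (Real.sqrt_nonneg v)]
  congr 1
  push_cast
  rw [mul_pow, ← Complex.ofReal_pow, Real.sq_sqrt hv]

lemma gauss_zero : gauss d 0 = Measure.dirac 0 := by
  refine Measure.ext_of_charFun ?_
  ext t
  rw [charFun_gauss le_rfl, charFun_dirac]
  simp

lemma gauss_conv {s t : ℝ} (hs : 0 ≤ s) (ht : 0 ≤ t) :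
    Measure.conv (gauss d s) (gauss d t) = gauss d (s + t) := by
  refine Measure.ext_of_charFun ?_
  ext x
  rw [charFun_conv, charFun_gauss hs, charFun_gauss ht, charFun_gauss (add_nonneg hs ht),
    ← Complex.exp_add]
  congr 1
  push_cast
  ring

lemma integral_exp_gk {v : ℝ} (hv : 0 < v) :
    ∫ z : Space d, Real.exp (-(‖z‖ ^ 2 / (2 * v))) = √(2 * Real.pi * v) ^ d := by
  have := GaussianFourier.integral_rexp_neg_mul_sq_norm (V := Space d) (b := 1 / (2 * v)) (by positivity)
  have e : ∀ z : Space d, -(1 / (2 * v)) * ‖z‖ ^ 2 = -(‖z‖ ^ 2 / (2 * v)) := fun z => by ring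
  simp only [e] at this
  rw [this, finrank_euclideanSpace_fin, Real.sqrt_eq_rpow, ← Real.rpow_natCast,
    ← Real.rpow_mul (by positivity)]
  congr 1
  · field_simp
  · ring

lemma integrable_gk {v : ℝ} (hv : 0 < v) : Integrable (gk v : Space d → ℝ) := by
  unfold gk
  refine Integrable.const_mul (Integrable.of_integral_ne_zero ?_) _
  rw [integral_exp_gk hv]
  have : 0 < √(2 * Real.pi * v) := Real.sqrt_pos.2 (by positivity)
  positivity

lemma integral_gk {v : ℝ} (hv : 0 < v) : ∫ z : Space d, gk v z = 1 := by
  unfold gk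
  rw [integral_const_mul, integral_exp_gk hv, ← mul_pow, inv_mul_cancel₀, one_pow]
  exact (Real.sqrt_pos.2 (by positivity)).ne'

lemma lintegral_gk {v : ℝ} (hv : 0 < v) : ∫⁻ z : Space d, ENNReal.ofReal (gk v z) = 1 := by
  rw [← ofReal_integral_eq_lintegral_ofReal (integrable_gk hv) (Eventually.of_forall (gk_nonneg v)),
    integral_gk hv, ENNReal.ofReal_one]

/-- Finite measures are determined by their characteristic functions, and the Gaussian Fourier
integral computes that of the density. -/
lemma gauss_eq_withDensity {v : ℝ} (hv : 0 < v) :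
    gauss d v = volume.withDensity (fun z => ENNReal.ofReal (gk v z)) := by
  have hm : Measurable fun z : Space d => ENNReal.ofReal (gk v z) :=
    (continuous_gk v).measurable.ennreal_ofReal
  have : IsFiniteMeasure (volume.withDensity (fun z : Space d => ENNReal.ofReal (gk v z))) :=
    isFiniteMeasure_withDensity (by rw [lintegral_gk hv]; simp)
  refine Measure.ext_of_charFun ?_
  ext t
  rw [charFun_gauss hv.le, charFun_apply, integral_withDensity_eq_integral_toReal_smul hm
    (Eventually.of_forall fun z => ENNReal.ofReal_lt_top)]
  have h0 := GaussianFourier.integral_cexp_neg_mul_sq_norm (V := Space d) (b := ((1 / (2 * v) : ℝ) : ℂ))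
    (by rw [Complex.ofReal_re]; positivity)
  have h1 := GaussianFourier.integral_cexp_neg_mul_sq_norm_add (V := Space d)
    (b := ((1 / (2 * v) : ℝ) : ℂ)) (by rw [Complex.ofReal_re]; positivity) Complex.I t
  rw [← h0] at h1
  have e0 : ∀ z : Space d, Complex.exp (-((1 / (2 * v) : ℝ) : ℂ) * ‖z‖ ^ 2) =
      ((Real.exp (-(‖z‖ ^ 2 / (2 * v))) : ℝ) : ℂ) := by
    intro z
    rw [Complex.ofReal_exp]
    congr 1
    push_cast
    ring
  simp only [e0] at h1
  rw [integral_complex_ofReal, integral_exp_gk hv] at h1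
  have e1 : ∀ z : Space d, (ENNReal.ofReal (gk v z)).toReal • Complex.exp (⟪z, t⟫ * Complex.I) =
      (((√(2 * Real.pi * v))⁻¹ ^ d : ℝ) : ℂ) *
        Complex.exp (-((1 / (2 * v) : ℝ) : ℂ) * ‖z‖ ^ 2 + Complex.I * ⟪t, z⟫) := by
    intro z
    rw [ENNReal.toReal_ofReal (gk_nonneg v z), Complex.exp_add, e0, gk, Complex.real_smul,
      real_inner_comm]
    push_cast
    rw [mul_comm Complex.I]
    ring
  simp only [e1]
  rw [integral_const_mul, h1, ← mul_assoc, ← Complex.ofReal_mul, ← mul_pow, inv_mul_cancel₀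
    (Real.sqrt_pos.2 (by positivity)).ne', one_pow, Complex.ofReal_one, one_mul]
  congr 1
  have : (v : ℂ) ≠ 0 := by exact_mod_cast hv.ne'
  push_cast
  rw [Complex.I_sq]
  field_simp
  norm_num

lemma gk_four {v : ℝ} (hv : 0 ≤ v) (z : Space d) :
    gk (4 * v) z = (2⁻¹) ^ d * ((√(2 * Real.pi * v))⁻¹ ^ d * Real.exp (-(‖z‖ ^ 2 / (8 * v)))) := by
  rw [gk, show 2 * Real.pi * (4 * v) = 2 ^ 2 * (2 * Real.pi * v) by ring,
    Real.sqrt_mul (by positivity), Real.sqrt_sq (by norm_num), mul_inv, mul_pow,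
    show 2 * (4 * v) = 8 * v by ring]
  ring

/-- The kernel `gk (4 * v)` has a quarter of the exponent of `gk v` and a prefactor smaller by `2 ^
d`. Hence any estimate that leaves a quarter of the Gaussian decay unspent becomes a bound by a
wider Gaussian kernel. -/
lemma gk_le_of_exp {v A : ℝ} (hv : 0 ≤ v) {z : Space d} {y : ℝ}
    (h : y ≤ A * Real.exp (-(‖z‖ ^ 2 / (8 * v)))) :
    (√(2 * Real.pi * v))⁻¹ ^ d * y ≤ 2 ^ d * A * gk (4 * v) z := by
  rw [gk_four hv]
  have e : (2:ℝ) ^ d * (2⁻¹) ^ d = 1 := by rw [← mul_pow]; norm_num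
  calc _ ≤ (√(2 * Real.pi * v))⁻¹ ^ d * (A * Real.exp (-(‖z‖ ^ 2 / (8 * v)))) := by gcongr
    _ = (2 ^ d * 2⁻¹ ^ d) * ((√(2 * Real.pi * v))⁻¹ ^ d * (A * Real.exp (-(‖z‖ ^ 2 / (8 * v))))) := by
        rw [e, one_mul]
    _ = _ := by ring

lemma norm_sq_le_shift (z h : Space d) : ‖z‖ ^ 2 ≤ 2 * ‖z - h‖ ^ 2 + 2 * ‖h‖ ^ 2 := by
  have : ‖z‖ ≤ ‖z - h‖ + ‖h‖ := by simpa using norm_add_le (z - h) h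
  nlinarith [norm_nonneg z, norm_nonneg (z - h), norm_nonneg h, sq_nonneg (‖z - h‖ - ‖h‖)]

/-- A shifted Gaussian density is dominated by a wider one. -/
lemma gk_shift_le {v : ℝ} (hv : 0 < v) (z h : Space d) :
    gk v (z - h) ≤ 2 ^ d * Real.exp (‖h‖ ^ 2 / (4 * v)) * gk (4 * v) z := by
  rw [gk]
  refine gk_le_of_exp hv.le ?_
  rw [← Real.exp_add, Real.exp_le_exp]
  have := norm_sq_le_shift z h
  have e1 : ‖z‖ ^ 2 / (8 * v) ≤ (2 * ‖z - h‖ ^ 2 + 2 * ‖h‖ ^ 2) / (8 * v) := by gcongr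
  have e2 : (2 * ‖z - h‖ ^ 2 + 2 * ‖h‖ ^ 2) / (8 * v) =
    ‖z - h‖ ^ 2 / (2 * v) / 2 + ‖h‖ ^ 2 / (4 * v) := by field_simp; ring
  have e3 : 0 ≤ ‖z - h‖ ^ 2 / (2 * v) := by positivity
  linarith

lemma gk_le_four {v : ℝ} (hv : 0 < v) (z : Space d) : gk v z ≤ 2 ^ d * gk (4 * v) z := by
  simpa using gk_shift_le hv z 0

lemma abs_exp_neg_sub_le (a b : ℝ) :
    |Real.exp (-a) - Real.exp (-b)| ≤ |a - b| * (Real.exp (-a) + Real.exp (-b)) := by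
  have key : ∀ x y : ℝ, Real.exp (-x) - Real.exp (-y) ≤ (y - x) * Real.exp (-x) := by
    intro x y
    have := Real.add_one_le_exp (-(y - x))
    have e : Real.exp (-y) = Real.exp (-(y - x)) * Real.exp (-x) := by
      rw [← Real.exp_add]; congr 1; ring
    rw [e]
    nlinarith [Real.exp_pos (-x)]
  have pa := Real.exp_pos (-a)
  have pb := Real.exp_pos (-b)
  rw [abs_le]
  constructor
  · have := key b a
    nlinarith [le_abs_self (a - b), abs_nonneg (a - b)]
  · have := key a b
    nlinarith [neg_abs_le (a - b), abs_nonneg (a - b)]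

lemma mul_exp_le (y : ℝ) : y * Real.exp (-(y ^ 2 / 8)) ≤ 2 := by
  have h := Real.add_one_le_exp (y ^ 2 / 8)
  have h1 : y ≤ 2 * Real.exp (y ^ 2 / 8) := by nlinarith [sq_nonneg (y - 2)]
  rw [Real.exp_neg, ← div_eq_mul_inv, div_le_iff₀ (Real.exp_pos _)]
  exact h1

/-- Regularity of the Gaussian density under small shifts. -/
lemma abs_gk_sub_le {v L : ℝ} (hv : 0 < v) (hL : 0 ≤ L) (z h : Space d) (hh : ‖h‖ ≤ L * √v) :
    |gk v (z - h) - gk v z| ≤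
      2 ^ d * (‖h‖ / √v * (2 * (2 + L) * Real.exp (L ^ 2 / 2))) * gk (4 * v) z := by
  have hs : 0 < √v := Real.sqrt_pos.2 hv
  have hsq : √v ^ 2 = v := Real.sq_sqrt hv.le
  unfold gk
  rw [← mul_sub, abs_mul, abs_of_nonneg (by positivity : (0:ℝ) ≤ (√(2 * Real.pi * v))⁻¹ ^ d)]
  refine gk_le_of_exp hv.le ?_
  -- In units of `√v` only exponentials of squares remain; `y`, `η`, `x` are the scaled lengths of
  -- `z`, `h`, `z - h`.
  set y := ‖z‖ / √v with hy
  set η := ‖h‖ / √v with hη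
  have hy0 : 0 ≤ y := by positivity
  have hη0 : 0 ≤ η := by positivity
  have hηL : η ≤ L := by rw [hη, div_le_iff₀ hs]; exact hh
  set x := ‖z - h‖ / √v with hx
  have ez : ‖z‖ = y * √v := by rw [hy]; field_simp
  have eh : ‖h‖ = η * √v := by rw [hη]; field_simp
  have ex : ‖z - h‖ = x * √v := by rw [hx]; field_simp
  have e1 : ‖z - h‖ ^ 2 / (2 * v) = x ^ 2 / 2 := by rw [ex, mul_pow, hsq]; field_simp
  have e2 : ‖z‖ ^ 2 / (2 * v) = y ^ 2 / 2 := by rw [ez, mul_pow, hsq]; field_simp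
  have e3 : ‖z‖ ^ 2 / (8 * v) = y ^ 2 / 8 := by rw [ez, mul_pow, hsq]; field_simp
  have hx0 : 0 ≤ x := by positivity
  have hxy : x ≤ y + η := by
    have := norm_sub_le z h
    rw [ex, ez, eh, ← add_mul] at this
    exact le_of_mul_le_mul_right this hs
  have hyx : y ≤ x + η := by
    have : ‖z‖ ≤ ‖z - h‖ + ‖h‖ := by simpa using norm_add_le (z - h) h
    rw [ex, ez, eh, ← add_mul] at this
    exact le_of_mul_le_mul_right this hs
  rw [e1, e2, e3]
  refine (abs_exp_neg_sub_le _ _).trans ?_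
  have hab : |x ^ 2 / 2 - y ^ 2 / 2| ≤ η * (y + L) := by
    rw [abs_le]; constructor <;> nlinarith
  have hE1 : Real.exp (-(x ^ 2 / 2)) ≤ Real.exp (L ^ 2 / 2) * Real.exp (-(y ^ 2 / 4)) := by
    rw [← Real.exp_add, Real.exp_le_exp]
    nlinarith [sq_nonneg (x - η)]
  have hE2 : Real.exp (-(y ^ 2 / 2)) ≤ Real.exp (L ^ 2 / 2) * Real.exp (-(y ^ 2 / 4)) := by
    rw [← Real.exp_add, Real.exp_le_exp]
    nlinarith
  -- One half of this decay absorbs the polynomial factor, the other half survives in the wider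
  -- kernel.
  have hE3 : Real.exp (-(y ^ 2 / 4)) = Real.exp (-(y ^ 2 / 8)) * Real.exp (-(y ^ 2 / 8)) := by
    rw [← Real.exp_add]; congr 1; ring
  have hE4 : (y + L) * Real.exp (-(y ^ 2 / 8)) ≤ 2 + L := by
    rw [add_mul]
    refine add_le_add (mul_exp_le y) (mul_le_of_le_one_right hL ?_)
    rw [Real.exp_le_one_iff]; nlinarith
  calc _ ≤ η * (y + L) * (2 * (Real.exp (L ^ 2 / 2) * Real.exp (-(y ^ 2 / 4)))) := by
        apply mul_le_mul hab (by linarith) (by positivity) (by positivity)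
    _ = η * ((y + L) * Real.exp (-(y ^ 2 / 8))) * (2 * Real.exp (L ^ 2 / 2)) *
          Real.exp (-(y ^ 2 / 8)) := by rw [hE3]; ring
    _ ≤ η * (2 + L) * (2 * Real.exp (L ^ 2 / 2)) * Real.exp (-(y ^ 2 / 8)) := by gcongr
    _ = _ := by ring

lemma abs_apply_le_norm (z : Space d) (i : Fin d) : |z i| ≤ ‖z‖ := by
  simpa using PiLp.norm_apply_le z i

/-- The factor `z i / v` costs `1/√v` once part of the Gaussian decay is spent on `‖z‖/√v`. This is
the inverse square root singularity of the gradient of the heat semigroup. -/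
lemma abs_dk_le {v : ℝ} (hv : 0 < v) (i : Fin d) (z : Space d) :
    |dk i v z| ≤ 2 ^ d * (2 / √v) * gk (4 * v) z := by
  have hs : 0 < √v := Real.sqrt_pos.2 hv
  have hsq : √v ^ 2 = v := Real.sq_sqrt hv.le
  rw [dk, gk, mul_left_comm, abs_mul, abs_of_nonneg (by positivity : (0:ℝ) ≤ (√(2 * Real.pi * v))⁻¹ ^ d)]
  refine gk_le_of_exp hv.le ?_
  set y := ‖z‖ / √v with hy
  have ez : ‖z‖ = y * √v := by rw [hy]; field_simp
  have e2 : ‖z‖ ^ 2 / (2 * v) = y ^ 2 / 2 := by rw [ez, mul_pow, hsq]; field_simp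
  have e3 : ‖z‖ ^ 2 / (8 * v) = y ^ 2 / 8 := by rw [ez, mul_pow, hsq]; field_simp
  rw [e2, e3, abs_mul, abs_of_pos (Real.exp_pos _), abs_div, abs_of_pos hv]
  have h1 : |z i| / v ≤ y / √v := by
    rw [hy, div_div, ← sq, hsq]
    gcongr
    exact abs_apply_le_norm z i
  have h2 : Real.exp (-(y ^ 2 / 2)) ≤ Real.exp (-(y ^ 2 / 8)) * Real.exp (-(y ^ 2 / 8)) := by
    rw [← Real.exp_add, Real.exp_le_exp]; nlinarith
  have hy0 : 0 ≤ y := by positivity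
  calc _ ≤ y / √v * (Real.exp (-(y ^ 2 / 8)) * Real.exp (-(y ^ 2 / 8))) := by gcongr
    _ = (y * Real.exp (-(y ^ 2 / 8))) / √v * Real.exp (-(y ^ 2 / 8)) := by ring
    _ ≤ 2 / √v * Real.exp (-(y ^ 2 / 8)) := by gcongr; exact mul_exp_le y

lemma integrable_dk {v : ℝ} (hv : 0 < v) (i : Fin d) : Integrable (dk i v : Space d → ℝ) :=
  ((integrable_gk (by positivity : 0 < 4 * v)).const_mul (2 ^ d * (2 / √v))).mono'
    (continuous_dk i v).aestronglyMeasurable (Eventually.of_forall (abs_dk_le hv i))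

lemma integral_abs_dk_le {v : ℝ} (hv : 0 < v) (i : Fin d) :
    ∫ z : Space d, |dk i v z| ≤ 2 ^ d * 2 * (1 / √v) := by
  calc _ ≤ ∫ z : Space d, 2 ^ d * (2 / √v) * gk (4 * v) z :=
        integral_mono (integrable_dk hv i).abs ((integrable_gk (by positivity)).const_mul _)
          (abs_dk_le hv i)
    _ = _ := by rw [integral_const_mul, integral_gk (by positivity)]; ring

/-- The identity behind the Cauchy-Schwarz comparison of opposite drifts. -/
lemma gk_sq {v : ℝ} (hv : 0 < v) (z h : Space d) :
    gk v z ^ 2 = gk v (z - h) * gk v (z + h) * Real.exp (‖h‖ ^ 2 / v) := by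
  unfold gk
  have hp := parallelogram_law_with_norm ℝ z h
  rw [mul_pow, sq (Real.exp _), ← Real.exp_add]
  have : Real.exp (-(‖z‖ ^ 2 / (2 * v)) + -(‖z‖ ^ 2 / (2 * v))) =
      Real.exp (-(‖z - h‖ ^ 2 / (2 * v))) * Real.exp (-(‖z + h‖ ^ 2 / (2 * v))) *
        Real.exp (‖h‖ ^ 2 / v) := by
    rw [← Real.exp_add, ← Real.exp_add]
    congr 1
    have : ‖z - h‖ ^ 2 = 2 * (‖z‖ ^ 2 + ‖h‖ ^ 2) - ‖z + h‖ ^ 2 := by nlinarith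
    rw [this]
    field_simp
    ring
  rw [this]
  ring

lemma exp_gauss_le {v v₀ : ℝ} (hv : 0 < v) (h1 : v ≤ 2 * v₀) (z : Space d) :
    Real.exp (-(‖z‖ ^ 2 / (2 * v))) ≤ Real.exp (-(‖z‖ ^ 2 / (2 * (2 * v₀)))) := by
  rw [Real.exp_le_exp, neg_le_neg_iff]
  gcongr

/-- A single integrable majorant for all variances near `v₀`, needed for dominated convergence. -/
lemma gk_le_near {v v₀ : ℝ} (hv₀ : 0 < v₀) (h : v ∈ Ioo (v₀ / 2) (2 * v₀)) (z : Space d) :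
    gk v z ≤ 2 ^ d * gk (2 * v₀) z := by
  have hv : 0 < v := lt_trans (by positivity) h.1
  have e : √(2 * Real.pi * (2 * v₀)) = 2 * √(2 * Real.pi * (v₀ / 2)) := by
    rw [show 2 * Real.pi * (2 * v₀) = 2 ^ 2 * (2 * Real.pi * (v₀ / 2)) by ring,
      Real.sqrt_mul (by positivity), Real.sqrt_sq (by norm_num)]
  have e2 : (2:ℝ) ^ d * (√(2 * Real.pi * (2 * v₀)))⁻¹ ^ d = (√(2 * Real.pi * (v₀ / 2)))⁻¹ ^ d := by
    rw [← mul_pow, e, mul_inv, mul_inv_cancel_left₀ (by norm_num)]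
  unfold gk
  rw [← mul_assoc, e2]
  have h0 : 0 < √(2 * Real.pi * (v₀ / 2)) := Real.sqrt_pos.2 (by positivity)
  have h1 := h.1
  have h3 := exp_gauss_le hv h.2.le z
  gcongr

lemma continuousOn_gk_time (z : Space d) : ContinuousOn (fun v => gk v z) (Ioi 0) := by
  unfold gk
  refine ContinuousOn.mul (ContinuousOn.pow (ContinuousOn.inv₀ (by fun_prop) ?_) _)
    (Real.continuous_exp.comp_continuousOn (ContinuousOn.neg (ContinuousOn.div (by fun_prop)
      (by fun_prop) ?_)))
  · intro v hv
    have : 0 < v := hv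
    exact (Real.sqrt_pos.2 (by positivity)).ne'
  · intro v hv
    have : 0 < v := hv
    positivity

/-- Convolution operators are bounded by the `L¹` norm of their kernel, so continuity in `L¹` is
what yields norm continuity of the heat semigroup at positive times. -/
lemma tendsto_integral_abs_gk_sub {v₀ : ℝ} (hv₀ : 0 < v₀) :
    Tendsto (fun v => ∫ z : Space d, |gk v z - gk v₀ z|) (𝓝 v₀) (𝓝 0) := by
  have hev : ∀ᶠ v in 𝓝 v₀, v ∈ Ioo (v₀ / 2) (2 * v₀) := Ioo_mem_nhds (by linarith) (by linarith)
  have := tendsto_integral_filter_of_dominated_convergence (μ := (volume : Measure (Space d)))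
    (l := 𝓝 v₀) (F := fun v z => |gk v z - gk v₀ z|) (f := fun _ => (0:ℝ))
    (fun z => 2 ^ d * gk (2 * v₀) z + gk v₀ z) ?_ ?_ ?_ ?_
  · simpa using this
  · exact Eventually.of_forall fun v =>
      ((continuous_gk v).sub (continuous_gk v₀)).abs.aestronglyMeasurable
  · filter_upwards [hev] with v hv
    refine Eventually.of_forall fun z => ?_
    rw [Real.norm_eq_abs, abs_abs]
    refine (abs_sub _ _).trans ?_
    rw [abs_of_nonneg (gk_nonneg _ _), abs_of_nonneg (gk_nonneg _ _)]
    exact add_le_add_left (gk_le_near hv₀ hv z) _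
  · exact ((integrable_gk (by positivity)).const_mul _).add (integrable_gk hv₀)
  · refine Eventually.of_forall fun z => ?_
    have := ((continuousOn_gk_time z).continuousAt (Ioi_mem_nhds hv₀)).sub
      (continuousAt_const (y := gk v₀ z))
    simpa [ContinuousAt] using this.abs

lemma tendsto_integral_abs_dk_sub (i : Fin d) {v₀ : ℝ} (hv₀ : 0 < v₀) :
    Tendsto (fun v => ∫ z : Space d, |dk i v z - dk i v₀ z|) (𝓝 v₀) (𝓝 0) := by
  have hev : ∀ᶠ v in 𝓝 v₀, v ∈ Ioo (v₀ / 2) (2 * v₀) := Ioo_mem_nhds (by linarith) (by linarith)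
  have := tendsto_integral_filter_of_dominated_convergence (μ := (volume : Measure (Space d)))
    (l := 𝓝 v₀) (F := fun v z => |dk i v z - dk i v₀ z|) (f := fun _ => (0:ℝ))
    (fun z => 2 ^ d * 4 * |dk i (2 * v₀) z| + |dk i v₀ z|) ?_ ?_ ?_ ?_
  · simpa using this
  · exact Eventually.of_forall fun v =>
      ((continuous_dk i v).sub (continuous_dk i v₀)).abs.aestronglyMeasurable
  · filter_upwards [hev] with v hv
    have hv0 : 0 < v := lt_trans (by positivity) hv.1
    refine Eventually.of_forall fun z => ?_
    rw [Real.norm_eq_abs, abs_abs]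
    refine (abs_sub _ _).trans (add_le_add_left ?_ _)
    unfold dk
    rw [abs_mul, abs_mul, abs_of_nonneg (gk_nonneg _ _), abs_of_nonneg (gk_nonneg _ _), abs_div,
      abs_div, abs_of_pos hv0, abs_of_pos (by positivity : 0 < 2 * v₀)]
    have h1 : |z i| / v ≤ 4 * (|z i| / (2 * v₀)) := by
      rw [mul_div_assoc', div_le_div_iff₀ hv0 (by positivity)]
      nlinarith [abs_nonneg (z i), hv.1]
    calc _ ≤ (4 * (|z i| / (2 * v₀))) * (2 ^ d * gk (2 * v₀) z) := by
          apply mul_le_mul h1 (gk_le_near hv₀ hv z) (gk_nonneg _ _) (by positivity)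
      _ = _ := by ring
  · exact ((integrable_dk (by positivity) i).abs.const_mul _).add (integrable_dk hv₀ i).abs
  · refine Eventually.of_forall fun z => ?_
    have h2 : ContinuousAt (fun v => dk i v z) v₀ := by
      unfold dk
      exact (continuousAt_const.div continuousAt_id hv₀.ne').mul
        ((continuousOn_gk_time z).continuousAt (Ioi_mem_nhds hv₀))
    have := h2.sub (continuousAt_const (y := dk i v₀ z))
    simpa [ContinuousAt] using this.abs

end GaussKernel

end FKTorus

end

/-! ### Calculus on the torus and completeness of trigonometric monomials. -/

noncomputable section

namespace FKTorus

open Set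
open scoped RealInnerProductSpace

section TorusCalculus

variable {d : ℕ}

lemma toTorus_add (x y : Space d) : toTorus (x + y) = toTorus x + toTorus y := by
  ext i; simp [toTorus]

lemma toTorus_zero : toTorus (0 : Space d) = 0 := by
  ext i; simp [toTorus]

lemma toTorus_neg (x : Space d) : toTorus (-x) = -toTorus x := by
  ext i; simp [toTorus]

lemma continuous_toTorus : Continuous (toTorus : Space d → Torus d) := by
  unfold toTorus
  refine continuous_pi fun i => (AddCircle.continuous_mk' 1).comp (by fun_prop)

/-- Through this, continuity on the torus is equivalent to continuity of periodic lifts. -/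
lemma isOpenQuotientMap_toTorus : IsOpenQuotientMap (toTorus : Space d → Torus d) := by
  have h1 : IsOpenQuotientMap (fun (x : Fin d → ℝ) (i : Fin d) => ((x i : ℝ) : UnitAddCircle)) :=
    IsOpenQuotientMap.piMap (f := fun (_ : Fin d) (x : ℝ) => (x : UnitAddCircle))
      fun _ => QuotientAddGroup.isOpenQuotientMap_mk
  exact h1.comp (PiLp.homeomorph 2 (fun _ : Fin d => ℝ)).isOpenQuotientMap

lemma surjective_toTorus : Function.Surjective (toTorus : Space d → Torus d) :=
  isOpenQuotientMap_toTorus.surjective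

lemma single_eq_toTorus (i : Fin d) (s : ℝ) :
    (Pi.single i (s : UnitAddCircle) : Torus d) = toTorus (s • EuclideanSpace.single i 1) := by
  ext j
  by_cases h : j = i
  · subst h; simp [toTorus]
  · simp [toTorus, h]

lemma SmoothTest.continuous {ψ : Torus d → ℝ} (h : SmoothTest ψ) : Continuous ψ :=
  isOpenQuotientMap_toTorus.isQuotientMap.continuous_iff.2 (ContDiff.continuous h)

lemma hasDerivAt_line {ψ : Torus d → ℝ} (h : SmoothTest ψ) (i : Fin d) (x : Space d) :
    HasDerivAt (fun s : ℝ => ψ (toTorus x + Pi.single i (s : UnitAddCircle)))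
      (fderiv ℝ (fun y => ψ (toTorus y)) x (EuclideanSpace.single i 1)) 0 := by
  have h1 : HasFDerivAt (fun y => ψ (toTorus y)) (fderiv ℝ (fun y => ψ (toTorus y)) x)
      (x + (0:ℝ) • EuclideanSpace.single i 1) := by
    rw [zero_smul, add_zero]
    exact ((ContDiff.differentiable h (by simp)) x).hasFDerivAt
  have h2 : HasDerivAt (fun s : ℝ => x + s • (EuclideanSpace.single i (1:ℝ) : Space d))
      (EuclideanSpace.single i 1) 0 := by
    simpa using ((hasDerivAt_id (0:ℝ)).smul_const (EuclideanSpace.single i (1:ℝ) : Space d)).const_add x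
  have h3 := h1.comp_hasDerivAt (0:ℝ) h2
  refine h3.congr_of_eventuallyEq (Eventually.of_forall fun s => ?_)
  simp only [Function.comp, toTorus_add, single_eq_toTorus]

lemma partialDeriv_toTorus {ψ : Torus d → ℝ} (h : SmoothTest ψ) (i : Fin d) (x : Space d) :
    partialDeriv i ψ (toTorus x) =
      fderiv ℝ (fun y => ψ (toTorus y)) x (EuclideanSpace.single i 1) :=
  (hasDerivAt_line h i x).deriv

lemma hasDerivAt_partialDeriv {ψ : Torus d → ℝ} (h : SmoothTest ψ) (i : Fin d) (x : Torus d) :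
    HasDerivAt (fun s : ℝ => ψ (x + Pi.single i (s : UnitAddCircle))) (partialDeriv i ψ x) 0 := by
  obtain ⟨x, rfl⟩ := surjective_toTorus x
  rw [partialDeriv_toTorus h]
  exact hasDerivAt_line h i x

lemma SmoothTest.partialDeriv {ψ : Torus d → ℝ} (h : SmoothTest ψ) (i : Fin d) :
    SmoothTest (partialDeriv i ψ) := by
  unfold SmoothTest
  simp only [partialDeriv_toTorus h]
  exact (ContDiff.fderiv_right h (by simp)).clm_apply contDiff_const

lemma SmoothTest.mul {ψ χ : Torus d → ℝ} (h : SmoothTest ψ) (h' : SmoothTest χ) :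
    SmoothTest (fun x => ψ x * χ x) :=
  ContDiff.mul h h'

lemma partialDeriv_mul {ψ χ : Torus d → ℝ} (h : SmoothTest ψ) (h' : SmoothTest χ) (i : Fin d)
    (x : Torus d) : FKTorus.partialDeriv i (fun x => ψ x * χ x) x =
      FKTorus.partialDeriv i ψ x * χ x + ψ x * FKTorus.partialDeriv i χ x := by
  have := ((hasDerivAt_partialDeriv h i x).mul (hasDerivAt_partialDeriv h' i x)).deriv
  rw [FKTorus.partialDeriv]
  refine Eq.trans ?_ (this.trans ?_)
  · rfl
  · simp

lemma exists_bound_of_continuous {ψ : Torus d → ℝ} (h : Continuous ψ) :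
    ∃ C, 0 ≤ C ∧ ∀ x, |ψ x| ≤ C := by
  obtain ⟨C, hC⟩ := isCompact_univ.exists_bound_of_continuousOn (f := ψ) h.continuousOn
  exact ⟨C, (norm_nonneg _).trans (hC 0 (mem_univ _)), fun x => hC x (mem_univ _)⟩

/-- The trigonometric monomial `cos (2π n·x + θ)`. -/
def trig (n : Fin d → ℤ) (θ : ℝ) (x : Torus d) : ℝ :=
  (Complex.exp (θ * Complex.I) * UnitAddTorus.mFourier n x).re

/-- The frequency vector `2π n`. -/
def freq (n : Fin d → ℤ) : Space d := WithLp.toLp 2 fun i => 2 * Real.pi * n i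

/-- The linear form `2π n·x`. -/
def phase (n : Fin d → ℤ) : Space d →L[ℝ] ℝ := innerSL ℝ (freq n)

lemma phase_single (n : Fin d → ℤ) (i : Fin d) :
    phase n (EuclideanSpace.single i 1) = 2 * Real.pi * n i := by
  simp [phase, freq, EuclideanSpace.inner_single_right]

lemma trig_toTorus (n : Fin d → ℤ) (θ : ℝ) (x : Space d) :
    trig n θ (toTorus x) = Real.cos (phase n x + θ) := by
  have : UnitAddTorus.mFourier n (toTorus x) = Complex.exp ((phase n x : ℝ) * Complex.I) := by
    simp only [UnitAddTorus.mFourier, ContinuousMap.coe_mk, toTorus, fourier_coe_apply]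
    rw [← Complex.exp_sum]
    congr 1
    simp only [phase, freq, innerSL_apply_apply, PiLp.inner_apply]
    push_cast
    rw [Finset.sum_mul]
    refine Finset.sum_congr rfl fun i _ => ?_
    simp
    ring
  rw [trig, this, ← Complex.exp_add, ← add_mul, ← Complex.ofReal_add, Complex.exp_ofReal_mul_I_re,
    add_comm]

lemma smoothTest_trig (n : Fin d → ℤ) (θ : ℝ) : SmoothTest (trig n θ) := by
  unfold SmoothTest
  simp only [trig_toTorus]
  exact Real.contDiff_cos.comp ((phase n).contDiff.add contDiff_const)

/-- Differentiation shifts the phase by `π/2`, so real monomials with arbitrary phase are closed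
under derivatives up to scalars. -/
lemma partialDeriv_trig (n : Fin d → ℤ) (θ : ℝ) (i : Fin d) (x : Torus d) :
    partialDeriv i (trig n θ) x = 2 * Real.pi * n i * trig n (θ + Real.pi / 2) x := by
  obtain ⟨x, rfl⟩ := surjective_toTorus x
  rw [partialDeriv_toTorus (smoothTest_trig n θ)]
  simp only [trig_toTorus]
  have h1 : HasFDerivAt (fun y => phase n y + θ) (phase n) x := (phase n).hasFDerivAt.add_const θ
  rw [h1.cos.fderiv, ← add_assoc, Real.cos_add_pi_div_two]
  simp [phase_single]
  ring

lemma continuous_trig (n : Fin d → ℤ) (θ : ℝ) : Continuous (trig n θ) :=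
  (smoothTest_trig n θ).continuous

/-- The class in `L²` of a continuous function. -/
def contLp (ψ : Torus d → ℝ) (h : Continuous ψ) : L2Torus d :=
  ContinuousMap.toLp 2 (torusMeasure d) ℝ ⟨ψ, h⟩

lemma coeFn_contLp (ψ : Torus d → ℝ) (h : Continuous ψ) : contLp ψ h =ᵐ[torusMeasure d] ψ :=
  ContinuousMap.coeFn_toLp (𝕜 := ℝ) (torusMeasure d) ⟨ψ, h⟩

lemma integrable_mul_coe (φ : L2Torus d) {ψ : Torus d → ℝ} (h : Continuous ψ) :
    Integrable (fun x => φ x * ψ x) (torusMeasure d) := by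
  obtain ⟨C, _, hC⟩ := exists_bound_of_continuous h
  exact ((Lp.memLp φ).integrable (by norm_num)).mul_bdd h.aestronglyMeasurable
    (Eventually.of_forall hC)

lemma inner_contLp (φ : L2Torus d) (ψ : Torus d → ℝ) (h : Continuous ψ) :
    ⟪φ, contLp ψ h⟫ = ∫ x, φ x * ψ x ∂torusMeasure d := by
  rw [L2.inner_def]
  refine integral_congr_ae ?_
  filter_upwards [coeFn_contLp ψ h] with x hx
  simp [hx, mul_comm]

/-- A function in `L²` that is orthogonal to all trigonometric monomials vanishes. -/
lemma eq_zero_of_inner_trig {φ : L2Torus d}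
    (h : ∀ n θ, ⟪φ, contLp (trig n θ) (continuous_trig n θ)⟫ = 0) : φ = 0 := by
  have hint : ∀ f : C(Torus d, ℂ), Integrable (fun x => (φ x : ℂ) * f x) (torusMeasure d) := by
    intro f
    refine (Integrable.ofReal ((Lp.memLp φ).integrable (by norm_num))).mul_bdd (c := ‖f‖)
      f.continuous.aestronglyMeasurable (Eventually.of_forall fun x => f.norm_coe_le_norm x)
  let ℓ : C(Torus d, ℂ) →ₗ[ℂ] ℂ :=
    { toFun := fun f => ∫ x, (φ x : ℂ) * f x ∂torusMeasure d
      map_add' := fun f g => by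
        rw [← integral_add (hint f) (hint g)]
        refine integral_congr_ae (Eventually.of_forall fun x => ?_)
        simp [mul_add]
      map_smul' := fun a f => by
        rw [RingHom.id_apply, smul_eq_mul, ← integral_const_mul]
        refine integral_congr_ae (Eventually.of_forall fun x => ?_)
        simp; ring }
  have hℓ : ∀ f, ‖ℓ f‖ ≤ (∫ x, ‖φ x‖ ∂torusMeasure d) * ‖f‖ := by
    intro f
    refine (norm_integral_le_integral_norm _).trans ?_
    rw [← integral_mul_const]
    refine integral_mono (hint f).norm
      (((Lp.memLp φ).integrable (by norm_num)).norm.mul_const _) fun x => ?_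
    simp only [norm_mul, Complex.norm_real]
    exact mul_le_mul_of_nonneg_left (f.norm_coe_le_norm x) (norm_nonneg _)
  let ℓc : C(Torus d, ℂ) →L[ℂ] ℂ := ℓ.mkContinuous _ hℓ
  have hmono : ∀ n, ℓ (UnitAddTorus.mFourier n) = 0 := by
    intro n
    have key : ∀ θ : ℝ, (Complex.exp (θ * Complex.I) * ℓ (UnitAddTorus.mFourier n)).re = 0 := by
      intro θ
      change (Complex.exp (θ * Complex.I) * ∫ x, (φ x : ℂ) * UnitAddTorus.mFourier n x ∂torusMeasure d).re = 0
      rw [← integral_const_mul, ← RCLike.re_eq_complex_re,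
        ← integral_re ((hint (UnitAddTorus.mFourier n)).const_mul _), ← h n θ, inner_contLp]
      refine integral_congr_ae (Eventually.of_forall fun x => ?_)
      simp only [RCLike.re_eq_complex_re, trig]
      rw [mul_left_comm, Complex.re_ofReal_mul]
    -- The phases `0` and `π/2` give the real part and, up to sign, the imaginary part.
    have h0 := key 0
    have h1 := key (Real.pi / 2)
    have e : Complex.exp ((Real.pi / 2 : ℝ) * Complex.I) = Complex.I := by
      push_cast; exact Complex.exp_pi_div_two_mul_I
    rw [e] at h1
    simp at h0 h1
    exact Complex.ext h0 h1
  -- A bounded functional that kills the characters kills their closed span, which is the whole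
  -- space.
  have hall : ∀ f : C(Torus d, ℂ), ℓc f = 0 := by
    have hker : (⊤ : Submodule ℂ C(Torus d, ℂ)) ≤ LinearMap.ker ℓc.toLinearMap := by
      rw [← UnitAddTorus.span_mFourier_closure_eq_top]
      refine Submodule.topologicalClosure_minimal _ (Submodule.span_le.2 ?_) ℓc.isClosed_ker
      rintro _ ⟨n, rfl⟩
      exact hmono n
    exact fun f => hker (Submodule.mem_top : f ∈ ⊤)
  have hcont : ∀ ψ : C(Torus d, ℝ), ⟪φ, ContinuousMap.toLp 2 (torusMeasure d) ℝ ψ⟫ = 0 := by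
    intro ψ
    have h1 := hall ⟨fun x => (ψ x : ℂ), by fun_prop⟩
    have h2 : ((∫ x, φ x * ψ x ∂torusMeasure d : ℝ) : ℂ) = 0 := by
      rw [← integral_complex_ofReal, ← h1]
      refine integral_congr_ae (Eventually.of_forall fun x => ?_)
      simp
    have h3 := inner_contLp φ ψ ψ.continuous
    rw [Complex.ofReal_eq_zero.1 h2] at h3
    exact h3
  have hd := ContinuousMap.toLp_denseRange ℝ (torusMeasure d) ℝ (p := 2) (by norm_num)
  have : ∀ χ : L2Torus d, ⟪φ, χ⟫ = 0 := by
    intro χ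
    refine hd.induction_on (p := fun χ : L2Torus d => ⟪φ, χ⟫ = 0) χ ?_ ?_
    · exact isClosed_eq (by fun_prop) continuous_const
    · exact hcont
  exact inner_self_eq_zero.1 (this φ)

lemma ext_inner_trig {φ χ : L2Torus d}
    (h : ∀ n θ, ⟪φ, contLp (trig n θ) (continuous_trig n θ)⟫ =
      ⟪χ, contLp (trig n θ) (continuous_trig n θ)⟫) : φ = χ := by
  rw [← sub_eq_zero]
  refine eq_zero_of_inner_trig fun n θ => ?_
  rw [inner_sub_left, h, sub_self]

end TorusCalculus

end FKTorus

end

/-! ### Translations, convolution operators and the heat semigroup on `L²`. -/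

noncomputable section

namespace FKTorus

open Set
open scoped RealInnerProductSpace

section Convolution

variable {d : ℕ}

/-- Translation by `y` on `L²`. -/
def trans (y : Torus d) : L2Torus d →L[ℝ] L2Torus d :=
  (Lp.compMeasurePreservingₗᵢ ℝ (fun x => x + y)
    (measurePreserving_add_right (torusMeasure d) y)).toContinuousLinearMap

lemma coeFn_trans (y : Torus d) (φ : L2Torus d) :
    trans y φ =ᵐ[torusMeasure d] fun x => φ (x + y) :=
  Lp.coeFn_compMeasurePreserving φ (measurePreserving_add_right (torusMeasure d) y)

lemma norm_trans (y : Torus d) (φ : L2Torus d) : ‖trans y φ‖ = ‖φ‖ :=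
  (Lp.compMeasurePreservingₗᵢ ℝ (fun x => x + y)
    (measurePreserving_add_right (torusMeasure d) y)).norm_map φ

lemma continuous_trans_apply (φ : L2Torus d) : Continuous fun y => trans y φ := by
  have h : Continuous fun y : Torus d => (⟨fun x => x + y, by fun_prop⟩ : C(Torus d, Torus d)) :=
    ContinuousMap.continuous_of_continuous_uncurry _ (by simpa using (by fun_prop))
  exact Continuous.compMeasurePreservingLp (continuous_const (y := φ)) h
    (fun y => measurePreserving_add_right (torusMeasure d) y) (by norm_num)

lemma trans_zero (φ : L2Torus d) : trans 0 φ = φ := by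
  refine Lp.ext ?_
  filter_upwards [coeFn_trans 0 φ] with x hx
  simpa using hx

lemma inner_trans (y : Torus d) (φ ψ : L2Torus d) : ⟪trans y φ, ψ⟫ = ⟪φ, trans (-y) ψ⟫ := by
  rw [L2.inner_def, L2.inner_def]
  rw [← integral_add_right_eq_self (μ := torusMeasure d) (fun x => ⟪φ x, trans (-y) ψ x⟫) y]
  refine integral_congr_ae ?_
  have h := (measurePreserving_add_right (torusMeasure d) y).quasiMeasurePreserving.ae
    (coeFn_trans (-y) ψ)
  filter_upwards [h, coeFn_trans y φ] with x hx hx'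
  rw [hx, hx']
  simp

lemma integrable_smul_trans {ρ : Space d → ℝ} (hρ : Integrable ρ) (φ : L2Torus d) :
    Integrable fun z => ρ z • trans (toTorus z) φ := by
  refine (hρ.norm.mul_const ‖φ‖).mono' ?_ (Eventually.of_forall fun z => ?_)
  · exact hρ.aestronglyMeasurable.smul
      ((continuous_trans_apply φ).comp continuous_toTorus).aestronglyMeasurable
  · rw [norm_smul, norm_trans]

open Classical in
/-- The operator `φ ↦ ∫ ρ(z) φ(· + z) dz`. -/
def convOp (ρ : Space d → ℝ) : L2Torus d →L[ℝ] L2Torus d :=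
  if hρ : Integrable ρ then
    LinearMap.mkContinuous
      { toFun := fun φ => ∫ z, ρ z • trans (toTorus z) φ
        map_add' := fun φ ψ => by
          rw [← integral_add (integrable_smul_trans hρ φ) (integrable_smul_trans hρ ψ)]
          simp only [map_add, smul_add]
        map_smul' := fun a φ => by
          rw [RingHom.id_apply, ← integral_smul]
          simp only [map_smul, smul_comm a] } (∫ z, |ρ z|) (fun φ => by
      refine (norm_integral_le_integral_norm _).trans (le_of_eq ?_)
      rw [← integral_mul_const]
      simp only [norm_smul, norm_trans, Real.norm_eq_abs])
  else 0

lemma convOp_apply {ρ : Space d → ℝ} (hρ : Integrable ρ) (φ : L2Torus d) :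
    convOp ρ φ = ∫ z, ρ z • trans (toTorus z) φ := by
  rw [convOp, dif_pos hρ]; rfl

lemma norm_convOp_le (ρ : Space d → ℝ) : ‖convOp ρ‖ ≤ ∫ z, |ρ z| := by
  by_cases hρ : Integrable ρ
  · rw [convOp, dif_pos hρ]
    exact LinearMap.mkContinuous_norm_le _ (by positivity) _
  · rw [convOp, dif_neg hρ, norm_zero]
    positivity

lemma convOp_sub {ρ σ : Space d → ℝ} (hρ : Integrable ρ) (hσ : Integrable σ) :
    convOp ρ - convOp σ = convOp (fun z => ρ z - σ z) := by
  ext1 φ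
  rw [sub_apply, convOp_apply hρ, convOp_apply hσ,
    convOp_apply (ρ := fun z => ρ z - σ z) (hρ.sub hσ), ← integral_sub (integrable_smul_trans hρ φ) (integrable_smul_trans hσ φ)]
  simp only [sub_smul]

lemma inner_convOp {ρ : Space d → ℝ} (hρ : Integrable ρ) (φ ψ : L2Torus d) :
    ⟪convOp ρ φ, ψ⟫ = ⟪φ, convOp (fun z => ρ (-z)) ψ⟫ := by
  rw [convOp_apply hρ, convOp_apply hρ.comp_neg, ← integral_inner (integrable_smul_trans hρ.comp_neg ψ),
    real_inner_comm, ← integral_inner (integrable_smul_trans hρ φ),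
    ← integral_neg_eq_self (fun z => ⟪φ, ρ (-z) • trans (toTorus z) ψ⟫)]
  refine integral_congr_ae (Eventually.of_forall fun z => ?_)
  simp only [neg_neg, inner_smul_right, toTorus_neg]
  rw [real_inner_comm, inner_trans]

lemma integrable_shift {f : Torus d → ℝ} (hf : Integrable f (torusMeasure d)) (y : Torus d) :
    Integrable (fun x => f (x + y)) (torusMeasure d) :=
  (measurePreserving_add_right (torusMeasure d) y).integrable_comp_of_integrable hf

lemma integrable_prod_shift {ρ : Space d → ℝ} (hρ : Integrable ρ) {f : Torus d → ℝ}
    (hf : Integrable f (torusMeasure d)) (hfm : StronglyMeasurable f) :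
    Integrable (fun p : Torus d × Space d => ρ p.2 * f (p.1 + toTorus p.2))
      ((torusMeasure d).prod volume) := by
  have hm : Measurable fun p : Torus d × Space d => p.1 + toTorus p.2 :=
    (continuous_fst.add (continuous_toTorus.comp continuous_snd)).measurable
  rw [integrable_prod_iff']
  · constructor
    · exact Eventually.of_forall fun z => (integrable_shift hf (toTorus z)).const_mul (ρ z)
    · refine (hρ.norm.mul_const (∫ x, ‖f x‖ ∂torusMeasure d)).congr
        (Eventually.of_forall fun z => ?_)
      simp only [norm_mul]
      rw [integral_const_mul, integral_add_right_eq_self (μ := torusMeasure d) (fun x => ‖f x‖)]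
  · exact hρ.aestronglyMeasurable.comp_snd.mul (hfm.comp_measurable hm).aestronglyMeasurable

/-- The operator is a Bochner integral with values in `L²`. Testing against indicators of measurable
sets and exchanging integrals identifies it pointwise. -/
lemma coeFn_convOp {ρ : Space d → ℝ} (hρ : Integrable ρ) (φ : L2Torus d) :
    convOp ρ φ =ᵐ[torusMeasure d] fun x => ∫ z, ρ z * φ (x + toTorus z) := by
  have hφ : Integrable φ (torusMeasure d) := (Lp.memLp φ).integrable (by norm_num)
  have hp := integrable_prod_shift hρ hφ (Lp.stronglyMeasurable φ)
  refine Integrable.ae_eq_of_forall_setIntegral_eq _ _ ((Lp.memLp _).integrable (by norm_num))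
    hp.integral_prod_left fun s hs hs' => ?_
  rw [← L2.inner_indicatorConstLp_one (𝕜 := ℝ) hs hs'.ne, convOp_apply hρ,
    ← integral_inner (integrable_smul_trans hρ φ)]
  have hp' : Integrable (fun p : Torus d × Space d => ρ p.2 * φ (p.1 + toTorus p.2))
      (((torusMeasure d).restrict s).prod volume) := by
    rw [← Measure.restrict_univ (μ := (volume : Measure (Space d))), Measure.prod_restrict]
    exact hp.integrableOn
  rw [integral_integral_swap hp']
  refine integral_congr_ae (Eventually.of_forall fun z => ?_)
  simp only
  rw [inner_smul_right, L2.inner_indicatorConstLp_one, integral_const_mul]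
  congr 1
  refine integral_congr_ae (ae_restrict_of_ae ?_)
  filter_upwards [coeFn_trans (toTorus z) φ] with x hx using hx

/-- Lebesgue null sets of the torus lift to null sets. -/
lemma quasiMeasurePreserving_shift (x : Torus d) :
    Measure.QuasiMeasurePreserving (fun z : Space d => x + toTorus z) volume (torusMeasure d) := by
  have hm : ∀ x : Torus d, Measurable fun z : Space d => x + toTorus z :=
    fun x => (continuous_const.add continuous_toTorus).measurable
  refine ⟨hm x, Measure.AbsolutelyContinuous.mk fun N hN h0 => ?_⟩
  rw [Measure.map_apply (hm x) hN]
  have hm2 : Measurable fun p : Torus d × Space d => p.1 + toTorus p.2 :=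
    (continuous_fst.add (continuous_toTorus.comp continuous_snd)).measurable
  have hS : MeasurableSet ((fun p : Torus d × Space d => p.1 + toTorus p.2) ⁻¹' N) := hm2 hN
  have h1 : ((torusMeasure d).prod (volume : Measure (Space d)))
      ((fun p : Torus d × Space d => p.1 + toTorus p.2) ⁻¹' N) = 0 := by
    rw [← Measure.measurePreserving_swap.measure_preimage (hS.nullMeasurableSet),
      Measure.measure_prod_null (measurable_swap hS)]
    refine Eventually.of_forall fun z => ?_
    change torusMeasure d ((fun x : Torus d => x + toTorus z) ⁻¹' N) = 0
    rw [(measurePreserving_add_right (torusMeasure d) (toTorus z)).measure_preimage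
      hN.nullMeasurableSet, h0]
  -- By Fubini the preimage is null for almost every base point; translation by a lift of `x - x₀`
  -- passes from one such point to every point.
  obtain ⟨x₀, hx₀⟩ := (Measure.measure_ae_null_of_prod_null h1).exists
  obtain ⟨w, hw⟩ := surjective_toTorus (x - x₀)
  have h2 : volume ((fun z : Space d => z + w) ⁻¹' ((fun z : Space d => x₀ + toTorus z) ⁻¹' N)) = 0 := by
    rw [(measurePreserving_add_right volume w).measure_preimage (hm x₀ hN).nullMeasurableSet]
    exact hx₀
  convert h2 using 2
  ext z
  simp only [mem_preimage, toTorus_add, hw]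
  rw [show x₀ + (toTorus z + (x - x₀)) = x + toTorus z by abel]

end Convolution

section Heat

variable {d : ℕ}

/-- The heat semigroup, parametrised by the variance of its Gaussian kernel. -/
def heat (v : ℝ) : L2Torus d →L[ℝ] L2Torus d :=
  if v ≤ 0 then ContinuousLinearMap.id ℝ _ else convOp (gk v)

/-- The derivative `∂ᵢ` of the heat semigroup. -/
def heatD (i : Fin d) (v : ℝ) : L2Torus d →L[ℝ] L2Torus d := convOp (dk i v)

lemma heat_of_nonpos {v : ℝ} (hv : v ≤ 0) : (heat v : L2Torus d →L[ℝ] L2Torus d) =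
    ContinuousLinearMap.id ℝ _ := if_pos hv

lemma heat_of_pos {v : ℝ} (hv : 0 < v) : (heat v : L2Torus d →L[ℝ] L2Torus d) = convOp (gk v) :=
  if_neg hv.not_ge

lemma norm_heat_le (v : ℝ) : ‖(heat v : L2Torus d →L[ℝ] L2Torus d)‖ ≤ 1 := by
  rcases le_or_gt v 0 with hv | hv
  · rw [heat_of_nonpos hv]; exact ContinuousLinearMap.norm_id_le
  · rw [heat_of_pos hv]
    refine (norm_convOp_le _).trans (le_of_eq ?_)
    simp only [abs_of_nonneg (gk_nonneg _ _), integral_gk hv]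

lemma norm_heat_apply_le (v : ℝ) (φ : L2Torus d) : ‖heat v φ‖ ≤ ‖φ‖ := by
  simpa using (heat v).le_of_opNorm_le (norm_heat_le v) φ

lemma norm_heatD_le (i : Fin d) {v : ℝ} (hv : 0 < v) : ‖heatD i v‖ ≤ 2 ^ d * 2 * (1 / √v) :=
  (norm_convOp_le _).trans (integral_abs_dk_le hv i)

/-- The Gaussian is even. Its derivative is odd, whence the sign in `inner_heatD`. -/
lemma inner_heat (v : ℝ) (φ ψ : L2Torus d) : ⟪heat v φ, ψ⟫ = ⟪φ, heat v ψ⟫ := by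
  rcases le_or_gt v 0 with hv | hv
  · rw [heat_of_nonpos hv]; rfl
  · rw [heat_of_pos hv, inner_convOp (integrable_gk hv)]
    simp only [gk_neg]

lemma inner_heatD (i : Fin d) {v : ℝ} (hv : 0 < v) (φ ψ : L2Torus d) :
    ⟪heatD i v φ, ψ⟫ = -⟪φ, heatD i v ψ⟫ := by
  rw [heatD, inner_convOp (integrable_dk hv i)]
  simp only [dk_neg]
  rw [convOp_apply (ρ := fun z => -dk i v z) (integrable_dk hv i).neg,
    convOp_apply (integrable_dk hv i)]
  simp only [neg_smul]
  rw [integral_neg, inner_neg_right]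

lemma continuousOn_convOp {ρ : ℝ → Space d → ℝ} (hρ : ∀ v, 0 < v → Integrable (ρ v))
    (h : ∀ v₀, 0 < v₀ → Tendsto (fun v => ∫ z, |ρ v z - ρ v₀ z|) (𝓝 v₀) (𝓝 0)) :
    ContinuousOn (fun v => convOp (ρ v)) (Ioi 0) := by
  intro v₀ hv₀
  refine ContinuousAt.continuousWithinAt ?_
  rw [ContinuousAt, tendsto_iff_norm_sub_tendsto_zero]
  refine squeeze_zero' (Eventually.of_forall fun _ => norm_nonneg _) ?_ (h v₀ hv₀)
  filter_upwards [lt_mem_nhds hv₀] with v hv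
  rw [convOp_sub (hρ v hv) (hρ v₀ hv₀)]
  exact norm_convOp_le _

lemma continuousOn_heat : ContinuousOn (fun v => (heat v : L2Torus d →L[ℝ] L2Torus d)) (Ioi 0) :=
  (continuousOn_convOp (fun _ hv => integrable_gk hv) fun _ hv =>
    tendsto_integral_abs_gk_sub hv).congr fun _ hv => heat_of_pos hv

lemma continuousOn_heatD (i : Fin d) : ContinuousOn (fun v => heatD i v) (Ioi 0) :=
  continuousOn_convOp (fun _ hv => integrable_dk hv i) fun _ hv => tendsto_integral_abs_dk_sub i hv

lemma integral_gauss {v : ℝ} (hv : 0 < v) {E : Type*} [NormedAddCommGroup E] [NormedSpace ℝ E]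
    (f : Space d → E) : ∫ z, f z ∂gauss d v = ∫ z, gk v z • f z := by
  rw [gauss_eq_withDensity hv, integral_withDensity_eq_integral_toReal_smul
    (continuous_gk v).measurable.ennreal_ofReal (Eventually.of_forall fun _ => ENNReal.ofReal_lt_top)]
  simp only [ENNReal.toReal_ofReal (gk_nonneg v _)]

/-- Integrating against a fixed standard Gaussian keeps the formula valid down to `v = 0`, where
strong continuity becomes a matter of dominated convergence. -/
lemma heat_eq_integral {v : ℝ} (hv : 0 ≤ v) (φ : L2Torus d) :
    heat v φ = ∫ ζ, trans (toTorus (√v • ζ)) φ ∂stdGaussian (Space d) := by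
  have hm : AEMeasurable (fun ζ : Space d => √v • ζ) (stdGaussian (Space d)) := by fun_prop
  have hc : Continuous fun z : Space d => trans (toTorus z) φ :=
    (continuous_trans_apply φ).comp continuous_toTorus
  rcases hv.eq_or_lt with rfl | hv
  · simp [heat_of_nonpos, toTorus_zero, trans_zero]
  · rw [heat_of_pos hv, convOp_apply (integrable_gk hv), ← integral_gauss hv, gauss,
      integral_map hm hc.aestronglyMeasurable]

lemma tendsto_heat (φ : L2Torus d) : Tendsto (fun v => heat v φ) (𝓝[≥] 0) (𝓝 φ) := by
  have hc : Continuous fun z : Space d => trans (toTorus z) φ :=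
    (continuous_trans_apply φ).comp continuous_toTorus
  have h : Tendsto (fun v : ℝ => ∫ ζ, trans (toTorus (√v • ζ)) φ ∂stdGaussian (Space d)) (𝓝[≥] 0)
      (𝓝 (∫ ζ, φ ∂stdGaussian (Space d))) := by
    refine tendsto_integral_filter_of_dominated_convergence (fun _ => ‖φ‖) ?_ ?_
      (integrable_const _) ?_
    · exact Eventually.of_forall fun v => (hc.comp (by fun_prop)).aestronglyMeasurable
    · exact Eventually.of_forall fun v => Eventually.of_forall fun ζ => (norm_trans _ _).le
    · refine Eventually.of_forall fun ζ => tendsto_nhdsWithin_of_tendsto_nhds ?_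
      have h1 : Continuous fun v : ℝ => trans (toTorus (√v • ζ)) φ :=
        hc.comp ((Real.continuous_sqrt).smul continuous_const)
      have h2 := h1.tendsto 0
      simpa [toTorus_zero, trans_zero] using h2
  simp only [integral_const, probReal_univ, one_smul] at h
  refine h.congr' ?_
  filter_upwards [self_mem_nhdsWithin] with v hv
  rw [heat_eq_integral hv]

end Heat

end FKTorus

end

/-! ### Weak derivatives expressed through the heat semigroup. -/

noncomputable section

namespace FKTorus

open Set
open scoped RealInnerProductSpace

section WeakDerivative

variable {d : ℕ}

lemma coeFn_convOp_of_ae {ρ : Space d → ℝ} (hρ : Integrable ρ) {φ : L2Torus d} {f : Torus d → ℝ}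
    (hf : φ =ᵐ[torusMeasure d] f) :
    convOp ρ φ =ᵐ[torusMeasure d] fun x => ∫ z, ρ z * f (x + toTorus z) := by
  filter_upwards [coeFn_convOp hρ φ] with x hx
  rw [hx]
  refine integral_congr_ae ?_
  filter_upwards [(quasiMeasurePreserving_shift x).ae hf] with z hz
  rw [hz]

/-- The Fourier multiplier of the heat semigroup. -/
def lam (n : Fin d → ℤ) (v : ℝ) : ℝ := Real.exp (-(v * ‖freq n‖ ^ 2) / 2)

/-- The integral is the characteristic function of the Gaussian at the frequency `2πn`; monomials
are eigenfunctions of the heat semigroup. -/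
lemma integral_gk_trig {v : ℝ} (hv : 0 < v) (n : Fin d → ℤ) (θ : ℝ) (x : Torus d) :
    ∫ z, gk v z * trig n θ (x + toTorus z) = lam n v * trig n θ x := by
  obtain ⟨x, rfl⟩ := surjective_toTorus x
  have h1 : ∫ z, Complex.exp (⟪z, freq n⟫ * Complex.I) ∂gauss d v = (lam n v : ℝ) := by
    have := charFun_gauss hv.le (freq n)
    rw [charFun_apply] at this
    rw [this, lam]
    push_cast
    rfl
  have hi : Integrable (fun z : Space d => Complex.exp ((phase n x + θ : ℝ) * Complex.I) *
      Complex.exp (⟪z, freq n⟫ * Complex.I)) (gauss d v) := by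
    refine Integrable.const_mul ?_ _
    refine (integrable_const (1:ℝ)).mono' (by fun_prop) (Eventually.of_forall fun z => ?_)
    rw [Complex.norm_exp_ofReal_mul_I]
  have h2 : ∫ z, trig n θ (toTorus x + toTorus z) ∂gauss d v =
      (Complex.exp ((phase n x + θ : ℝ) * Complex.I) * (lam n v : ℝ)).re := by
    rw [← h1, ← integral_const_mul, ← RCLike.re_eq_complex_re, ← integral_re hi]
    refine integral_congr_ae (Eventually.of_forall fun z => ?_)
    simp only [RCLike.re_eq_complex_re]
    rw [← Complex.exp_add, ← add_mul, ← Complex.ofReal_add, Complex.exp_ofReal_mul_I_re,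
      ← toTorus_add, trig_toTorus, map_add, real_inner_comm]
    congr 1
    simp only [phase, innerSL_apply_apply]
    ring
  have h3 := integral_gauss hv fun z => trig n θ (toTorus x + toTorus z)
  simp only [smul_eq_mul] at h3
  rw [← h3, h2, mul_comm, Complex.re_ofReal_mul, Complex.exp_ofReal_mul_I_re, trig_toTorus]

/-- The class of a trigonometric monomial in `L²`. -/
def trigLp (n : Fin d → ℤ) (θ : ℝ) : L2Torus d := contLp (trig n θ) (continuous_trig n θ)

lemma heat_trigLp {v : ℝ} (hv : 0 ≤ v) (n : Fin d → ℤ) (θ : ℝ) :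
    heat v (trigLp n θ) = lam n v • trigLp n θ := by
  rcases hv.eq_or_lt with rfl | hv
  · simp [heat_of_nonpos, lam]
  rw [heat_of_pos hv]
  refine Lp.ext ?_
  filter_upwards [coeFn_convOp_of_ae (integrable_gk hv) (coeFn_contLp _ (continuous_trig n θ)),
    coeFn_contLp _ (continuous_trig n θ), Lp.coeFn_smul (lam n v) (trigLp n θ)] with x h1 h2 h3
  rw [h3, Pi.smul_apply, trigLp, h1, h2, integral_gk_trig hv, smul_eq_mul]

lemma hasFDerivAt_gk {v : ℝ} (hv : 0 < v) (z : Space d) :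
    HasFDerivAt (gk v) (-(gk v z / v) • innerSL ℝ z) z := by
  have h := ((((hasStrictFDerivAt_norm_sq z).hasFDerivAt.const_mul (2 * v)⁻¹).neg.exp).const_mul
    ((√(2 * Real.pi * v))⁻¹ ^ d))
  have e : gk v = fun y : Space d =>
      (√(2 * Real.pi * v))⁻¹ ^ d * Real.exp (-((2 * v)⁻¹ * ‖y‖ ^ 2)) := by
    ext y
    rw [gk, div_eq_inv_mul]
  rw [e]
  refine h.congr_fderiv ?_
  ext w
  simp
  field_simp

/-- Integration by parts against a Gaussian. -/
lemma integral_gk_partialDeriv {v : ℝ} (hv : 0 < v) {ψ : Torus d → ℝ} (h : SmoothTest ψ)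
    (i : Fin d) (x : Torus d) :
    ∫ z, gk v z * partialDeriv i ψ (x + toTorus z) = ∫ z, dk i v z * ψ (x + toTorus z) := by
  have hbd : ∀ {ρ : Space d → ℝ} {χ : Torus d → ℝ}, Integrable ρ → Continuous χ →
      Integrable fun z => ρ z * χ (x + toTorus z) := by
    intro ρ χ hρ hχ
    obtain ⟨C, _, hC⟩ := exists_bound_of_continuous hχ
    exact hρ.mul_bdd (hχ.comp (continuous_const.add continuous_toTorus)).aestronglyMeasurable
      (Eventually.of_forall fun z => hC _)
  obtain ⟨x, rfl⟩ := surjective_toTorus x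
  have hd : ∀ z, HasLineDerivAt ℝ (fun z : Space d => ψ (toTorus x + toTorus z))
      (partialDeriv i ψ (toTorus x + toTorus z)) z (EuclideanSpace.single i 1) := by
    intro z
    have := hasDerivAt_partialDeriv h i (toTorus x + toTorus z)
    rw [HasLineDerivAt]
    refine this.congr_of_eventuallyEq (Eventually.of_forall fun t => ?_)
    simp only [toTorus_add, single_eq_toTorus, add_assoc]
  have hg : ∀ z : Space d, HasLineDerivAt ℝ (gk v) (-dk i v z) z (EuclideanSpace.single i 1) := by
    intro z
    refine ((hasFDerivAt_gk hv z).hasLineDerivAt _).congr_deriv ?_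
    simp [dk, EuclideanSpace.inner_single_right]
    ring
  have := integral_bilinear_hasLineDerivAt_right_eq_neg_left_of_integrable
    (μ := (volume : Measure (Space d))) (B := ContinuousLinearMap.mul ℝ ℝ)
    (f := gk v) (f' := fun z => -dk i v z) (g := fun z => ψ (toTorus x + toTorus z))
    (g' := fun z => partialDeriv i ψ (toTorus x + toTorus z)) (v := EuclideanSpace.single i 1)
    (by simpa using (hbd (integrable_dk hv i) h.continuous).neg)
    (by simpa using hbd (integrable_gk hv) (h.partialDeriv i).continuous)
    (by simpa using hbd (integrable_gk hv) h.continuous) (fun z _ => hg z) (fun z _ => hd z)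
  simp only [ContinuousLinearMap.mul_apply'] at this
  rw [this, ← integral_neg]
  simp only [neg_mul, neg_neg]

lemma heat_partialDeriv {v : ℝ} (hv : 0 < v) {ψ : Torus d → ℝ} (h : SmoothTest ψ) (i : Fin d) :
    heat v (contLp (partialDeriv i ψ) (h.partialDeriv i).continuous) =
      heatD i v (contLp ψ h.continuous) := by
  rw [heat_of_pos hv, heatD]
  refine Lp.ext ?_
  filter_upwards [coeFn_convOp_of_ae (integrable_gk hv) (coeFn_contLp _ (h.partialDeriv i).continuous),
    coeFn_convOp_of_ae (integrable_dk hv i) (coeFn_contLp _ h.continuous)] with x h1 h2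
  rw [h1, h2, integral_gk_partialDeriv hv h]

lemma contLp_partialDeriv_trig (n : Fin d → ℤ) (θ : ℝ) (i : Fin d) :
    contLp (partialDeriv i (trig n θ)) ((smoothTest_trig n θ).partialDeriv i).continuous =
      (2 * Real.pi * n i) • trigLp n (θ + Real.pi / 2) := by
  rw [trigLp, contLp, contLp, ← map_smul]
  congr 1
  ext x
  simp [partialDeriv_trig]

lemma trigLp_add_pi (n : Fin d → ℤ) (θ : ℝ) :
    trigLp n (θ + Real.pi / 2 + Real.pi / 2) = -trigLp n θ := by
  rw [trigLp, contLp, trigLp, contLp, ← map_neg]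
  congr 1
  ext x
  obtain ⟨x, rfl⟩ := surjective_toTorus x
  simp only [ContinuousMap.coe_mk, ContinuousMap.neg_apply, trig_toTorus]
  rw [add_assoc, add_halves, ← add_assoc, Real.cos_add_pi]

lemma heatD_trigLp {v : ℝ} (hv : 0 < v) (n : Fin d → ℤ) (θ : ℝ) (i : Fin d) :
    heatD i v (trigLp n θ) = (lam n v * (2 * Real.pi * n i)) • trigLp n (θ + Real.pi / 2) := by
  rw [trigLp, ← heat_partialDeriv hv (smoothTest_trig n θ), contLp_partialDeriv_trig, map_smul,
    heat_trigLp hv.le, smul_smul, mul_comm]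

/-- The adjoints agree when tested on monomials, and these determine elements of `L²`. Identities
between heat operators thus reduce to identities between Fourier multipliers. -/
lemma clm_ext_trig {A B : L2Torus d →L[ℝ] L2Torus d} (h : ∀ n θ, A (trigLp n θ) = B (trigLp n θ)) :
    A = B := by
  have : ContinuousLinearMap.adjoint A = ContinuousLinearMap.adjoint B := by
    ext1 φ
    refine ext_inner_trig fun n θ => ?_
    have := h n θ
    rw [trigLp] at this
    rw [ContinuousLinearMap.adjoint_inner_left, ContinuousLinearMap.adjoint_inner_left, this]
  simpa using congrArg ContinuousLinearMap.adjoint this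

lemma lam_add (n : Fin d → ℤ) (s t : ℝ) : lam n (s + t) = lam n s * lam n t := by
  rw [lam, lam, lam, ← Real.exp_add]
  congr 1; ring

lemma heat_add {s t : ℝ} (hs : 0 ≤ s) (ht : 0 ≤ t) :
    (heat (s + t) : L2Torus d →L[ℝ] L2Torus d) = heat s ∘L heat t :=
  clm_ext_trig fun n θ => by
    rw [ContinuousLinearMap.comp_apply, heat_trigLp (add_nonneg hs ht), heat_trigLp ht, map_smul,
      heat_trigLp hs, smul_smul, lam_add, mul_comm]

lemma heatD_add (i : Fin d) {s t : ℝ} (hs : 0 < s) (ht : 0 ≤ t) :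
    heatD i (s + t) = heatD i s ∘L heat t :=
  clm_ext_trig fun n θ => by
    rw [ContinuousLinearMap.comp_apply, heatD_trigLp (by positivity), heat_trigLp ht, map_smul,
      heatD_trigLp hs, smul_smul, lam_add]
    congr 1; ring

lemma heat_comp_heatD (i : Fin d) {s t : ℝ} (hs : 0 ≤ s) (ht : 0 < t) :
    heat s ∘L heatD i t = heatD i (t + s) :=
  clm_ext_trig fun n θ => by
    rw [ContinuousLinearMap.comp_apply, heatD_trigLp ht, heatD_trigLp (by positivity), map_smul,
      heat_trigLp hs, smul_smul, lam_add]
    congr 1; ring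

/-- The weak derivative in terms of the heat semigroup. -/
lemma hasWeakPartial_iff (i : Fin d) (u g : L2Torus d) :
    HasWeakPartial i u g ↔ ∀ v, 0 < v → heat v g = heatD i v u := by
  have hdef : HasWeakPartial i u g ↔ ∀ (ψ : Torus d → ℝ) (h : SmoothTest ψ),
      ⟪u, contLp (partialDeriv i ψ) (h.partialDeriv i).continuous⟫ =
        -⟪g, contLp ψ h.continuous⟫ := by
    refine forall₂_congr fun ψ h => ?_
    rw [inner_contLp, inner_contLp]
  rw [hdef]
  constructor
  · intro H v hv
    -- On monomials both operators act by the same multiplier `lam n v` after one differentiation,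
    -- so the weak derivative need only be tested there.
    refine ext_inner_trig fun n θ => ?_
    have h1 := H _ (smoothTest_trig n θ)
    change ⟪heat v g, trigLp n θ⟫ = ⟪heatD i v u, trigLp n θ⟫
    rw [contLp_partialDeriv_trig] at h1
    rw [inner_heat, heat_trigLp hv.le, inner_heatD i hv, heatD_trigLp hv, mul_smul,
      inner_smul_right, inner_smul_right, h1]
    simp [trigLp]
  · intro H ψ h
    -- Conversely, the assumption gives the defining identity for smoothed test functions, and `v →
    -- 0` removes the smoothing.
    have key : ∀ v, 0 < v → ⟪u, heat v (contLp (partialDeriv i ψ) (h.partialDeriv i).continuous)⟫ =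
        -⟪g, heat v (contLp ψ h.continuous)⟫ := by
      intro v hv
      rw [heat_partialDeriv hv h, ← inner_heat, H v hv, inner_heatD i hv, neg_neg]
    have h1 := (tendsto_const_nhds (x := u)).inner (𝕜 := ℝ) ((tendsto_heat
      (contLp (partialDeriv i ψ) (h.partialDeriv i).continuous)).mono_left
        (nhdsWithin_mono 0 Ioi_subset_Ici_self))
    have h2 := ((tendsto_const_nhds (x := g)).inner (𝕜 := ℝ) ((tendsto_heat
      (contLp ψ h.continuous)).mono_left (nhdsWithin_mono 0 Ioi_subset_Ici_self))).neg
    refine tendsto_nhds_unique (h1.congr' ?_) h2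
    filter_upwards [self_mem_nhdsWithin] with v hv using key v hv

/-- Multiplication by a continuous function. -/
def mulOp : C(Torus d, ℝ) →L[ℝ] L2Torus d →L[ℝ] L2Torus d :=
  ((ContinuousLinearMap.mul ℝ ℝ).holderL (torusMeasure d) ⊤ 2 2).comp
    (ContinuousMap.toLp ⊤ (torusMeasure d) ℝ)

lemma coeFn_mulOp (a : C(Torus d, ℝ)) (φ : L2Torus d) :
    mulOp a φ =ᵐ[torusMeasure d] fun x => a x * φ x := by
  have h1 := ContinuousLinearMap.coeFn_holder (ContinuousLinearMap.mul ℝ ℝ)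
    (r := 2) (ContinuousMap.toLp ⊤ (torusMeasure d) ℝ a) φ
  filter_upwards [h1, ContinuousMap.coeFn_toLp (p := ⊤) (𝕜 := ℝ) (torusMeasure d) a] with x h1 h2
  rw [← h2]
  exact h1

lemma norm_mulOp_le (a : C(Torus d, ℝ)) {C : ℝ} (hC : 0 ≤ C) (h : ∀ x, |a x| ≤ C) :
    ‖mulOp a‖ ≤ C := by
  refine ContinuousLinearMap.opNorm_le_bound _ hC fun φ => ?_
  refine Lp.norm_le_mul_norm_of_ae_le_mul ?_
  filter_upwards [coeFn_mulOp a φ] with x hx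
  rw [hx, norm_mul]
  exact mul_le_mul_of_nonneg_right (h x) (norm_nonneg _)

lemma inner_mulOp_contLp (a : C(Torus d, ℝ)) (φ : L2Torus d) {ψ : Torus d → ℝ} (h : Continuous ψ) :
    ⟪mulOp a φ, contLp ψ h⟫ = ∫ x, φ x * (a x * ψ x) ∂torusMeasure d := by
  rw [inner_contLp]
  refine integral_congr_ae ?_
  filter_upwards [coeFn_mulOp a φ] with x hx
  rw [hx]; ring

lemma hasWeakPartial_def (i : Fin d) (u g : L2Torus d) :
    HasWeakPartial i u g ↔ ∀ (ψ : Torus d → ℝ) (h : SmoothTest ψ),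
      ⟪u, contLp (partialDeriv i ψ) (h.partialDeriv i).continuous⟫ =
        -⟪g, contLp ψ h.continuous⟫ := by
  refine forall₂_congr fun ψ h => ?_
  rw [inner_contLp, inner_contLp]

/-- The product rule. -/
lemma HasWeakPartial.mulOp {i : Fin d} {u g : L2Torus d} (H : HasWeakPartial i u g)
    {a a' : C(Torus d, ℝ)} (ha : SmoothTest a) (ha' : ∀ x, a' x = partialDeriv i a x) :
    HasWeakPartial i (mulOp a u) (mulOp a g + mulOp a' u) := by
  rw [hasWeakPartial_def]
  intro ψ h
  have h1 := H _ (ha.mul h)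
  have hψ := (h.partialDeriv i).continuous
  rw [inner_mulOp_contLp, inner_add_left, inner_mulOp_contLp, inner_mulOp_contLp]
  have e : ∫ x, u x * partialDeriv i (fun x => a x * ψ x) x ∂torusMeasure d =
      ∫ x, u x * (a' x * ψ x) ∂torusMeasure d +
        ∫ x, u x * (a x * partialDeriv i ψ x) ∂torusMeasure d := by
    rw [← integral_add (integrable_mul_coe u (by have := h.continuous; fun_prop))
      (integrable_mul_coe u (by fun_prop))]
    refine integral_congr_ae (Eventually.of_forall fun x => ?_)
    simp only
    rw [partialDeriv_mul ha h, ha' x]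
    ring
  rw [e] at h1
  linarith

lemma HasWeakPartial.unique {i : Fin d} {u g g' : L2Torus d} (H : HasWeakPartial i u g)
    (H' : HasWeakPartial i u g') : g = g' := by
  rw [hasWeakPartial_iff] at H H'
  have hm := nhdsWithin_mono (0:ℝ) (Ioi_subset_Ici_self (a := (0:ℝ)))
  refine tendsto_nhds_unique ((tendsto_heat g).mono_left hm) (((tendsto_heat g').mono_left hm).congr' ?_)
  filter_upwards [self_mem_nhdsWithin] with v hv
  rw [H v hv, H' v hv]

/-- The weak second derivative is nonpositive. -/
lemma HasWeakPartial.inner_second {i : Fin d} {u g h : L2Torus d} (H : HasWeakPartial i u g)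
    (H' : HasWeakPartial i g h) : ⟪h, u⟫ = -‖g‖ ^ 2 := by
  rw [hasWeakPartial_iff] at H H'
  have hm := nhdsWithin_mono (0:ℝ) (Ioi_subset_Ici_self (a := (0:ℝ)))
  have h1 := ((tendsto_heat h).mono_left hm).inner (𝕜 := ℝ) (tendsto_const_nhds (x := u))
  have h2 := ((tendsto_const_nhds (x := g)).inner (𝕜 := ℝ) ((tendsto_heat g).mono_left hm)).neg
  rw [real_inner_self_eq_norm_sq] at h2
  -- At positive `v` the identity reads `⟪heatD i v g, u⟫ = -⟪g, heatD i v u⟫ = -⟪g, heat v g⟫`.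
  refine tendsto_nhds_unique h1 (h2.congr' ?_)
  filter_upwards [self_mem_nhdsWithin] with v hv
  rw [H' v hv, inner_heatD i hv, H v hv]

lemma intervalIntegrable_of_singular {E : Type*} [NormedAddCommGroup E] {F : ℝ → E} {v C : ℝ}
    (hv : 0 ≤ v) (hF : ContinuousOn F (Ioi 0)) (h : ∀ r, 0 < r → ‖F r‖ ≤ C * (1 / √r)) :
    IntervalIntegrable F volume 0 v := by
  refine ((intervalIntegrable_one_div_sqrt 0 v).const_mul C).mono_fun' ?_ ?_
  · rw [uIoc_of_le hv]
    exact (hF.mono fun x hx => hx.1).aestronglyMeasurable measurableSet_Ioc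
  · rw [uIoc_of_le hv]
    filter_upwards [ae_restrict_mem measurableSet_Ioc] with r hr using h r hr.1

lemma intervalIntegrable_heatD (i : Fin d) (g : L2Torus d) {v : ℝ} (hv : 0 ≤ v) :
    IntervalIntegrable (fun r => heatD i r g) volume 0 v := by
  refine intervalIntegrable_of_singular (C := 2 ^ d * 2 * ‖g‖) hv
    ((continuousOn_heatD i).clm_apply continuousOn_const) fun r hr => ?_
  refine ((heatD i r).le_of_opNorm_le (norm_heatD_le i hr) g).trans (le_of_eq ?_)
  ring

lemma integral_lam (n : Fin d → ℤ) (v : ℝ) :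
    ∫ r in (0:ℝ)..v, -(‖freq n‖ ^ 2 / 2) * lam n r = lam n v - 1 := by
  have h : ∀ r, HasDerivAt (lam n) (-(‖freq n‖ ^ 2 / 2) * lam n r) r := by
    intro r
    have h1 : HasDerivAt (fun v : ℝ => -(v * ‖freq n‖ ^ 2) / 2) (-(‖freq n‖ ^ 2) / 2) r := by
      simpa using (((hasDerivAt_id r).mul_const (‖freq n‖ ^ 2)).neg.div_const 2)
    refine h1.exp.congr_deriv ?_
    rw [lam]; ring
  rw [intervalIntegral.integral_eq_sub_of_hasDerivAt (fun r _ => h r)]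
  · simp [lam]
  · refine Continuous.intervalIntegrable ?_ _ _
    unfold lam
    fun_prop

/-- The heat flow of a function with a weak gradient. -/
lemma heat_sub_self_eq {u : L2Torus d} {g : Fin d → L2Torus d} (hg : ∀ i, HasWeakPartial i u (g i))
    {v : ℝ} (hv : 0 ≤ v) :
    heat v u - u = (1 / 2 : ℝ) • ∫ r in (0:ℝ)..v, ∑ i, heatD i r (g i) := by
  have hint : IntervalIntegrable (fun r => ∑ i, heatD i r (g i)) volume 0 v := by
    have := IntervalIntegrable.sum Finset.univ fun i (_ : i ∈ Finset.univ) => intervalIntegrable_heatD i (g i) hv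
    exact this.congr fun x _ => by simp
  -- Tested on a monomial the claim is the fundamental theorem of calculus for `lam n`, since `‖freq
  -- n‖²` is the sum of the squares `(2πnᵢ)²`.
  refine ext_inner_trig fun n θ => ?_
  change ⟪heat v u - u, trigLp n θ⟫ = ⟪_, trigLp n θ⟫
  have e2 := ((innerSL ℝ) (trigLp n θ)).intervalIntegral_comp_comm hint
  simp only [innerSL_apply_apply] at e2
  rw [real_inner_comm _ ((1 / 2 : ℝ) • _), inner_smul_right, ← e2, inner_sub_left, inner_heat,
    heat_trigLp hv, inner_smul_right,
    show lam n v * ⟪u, trigLp n θ⟫ - ⟪u, trigLp n θ⟫ = (lam n v - 1) * ⟪u, trigLp n θ⟫ by ring,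
    ← integral_lam, ← intervalIntegral.integral_mul_const, ← intervalIntegral.integral_const_mul]
  refine intervalIntegral.integral_congr_ae (Eventually.of_forall fun r hr => ?_)
  rw [uIoc_of_le hv] at hr
  have hi : ∀ i, ⟪trigLp n θ, heatD i r (g i)⟫ =
      -((2 * Real.pi * n i) ^ 2 * (lam n r * ⟪u, trigLp n θ⟫)) := by
    intro i
    have h1 := (hasWeakPartial_def i _ _).1 (hg i) _ (smoothTest_trig n (θ + Real.pi / 2))
    rw [contLp_partialDeriv_trig, trigLp_add_pi, inner_smul_right, inner_neg_right] at h1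
    change _ = -⟪g i, trigLp n (θ + Real.pi / 2)⟫ at h1
    rw [real_inner_comm, inner_heatD i hr.1, heatD_trigLp hr.1, inner_smul_right]
    linear_combination -(lam n r * (2 * Real.pi * n i)) * h1
  have hn : ‖freq n‖ ^ 2 = ∑ i, (2 * Real.pi * n i) ^ 2 := by
    rw [EuclideanSpace.norm_sq_eq]
    simp [freq, mul_pow]
  rw [inner_sum, Finset.sum_congr rfl fun i _ => hi i, Finset.sum_neg_distrib, ← Finset.sum_mul,
    ← hn]
  ring

/-- One weak derivative gives the rate `√v`, because the integrand in `heat_sub_self_eq` is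
`O(1/√r)`. -/
lemma norm_heat_sub_self_le {u : L2Torus d} {g : Fin d → L2Torus d}
    (hg : ∀ i, HasWeakPartial i u (g i)) {v : ℝ} (hv : 0 ≤ v) :
    ‖heat v u - u‖ ≤ 2 ^ d * 2 * √v * ∑ i, ‖g i‖ := by
  rw [heat_sub_self_eq hg hv, norm_smul]
  have h := intervalIntegral.norm_integral_le_of_norm_le (μ := volume) (a := 0) (b := v)
    (f := fun r => ∑ i, heatD i r (g i)) (g := fun r => (2 ^ d * 2 * ∑ i, ‖g i‖) * (1 / √r)) hv
    (by
      refine Eventually.of_forall fun r hr => (norm_sum_le _ _).trans ?_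
      rw [mul_right_comm, Finset.mul_sum]
      exact Finset.sum_le_sum fun i _ => (heatD i r).le_of_opNorm_le (norm_heatD_le i hr.1) _)
    ((intervalIntegrable_one_div_sqrt 0 v).const_mul _)
  have h2 := FirstOrderSystem.integral_inv_sqrt_sub hv
  simp only [sub_zero] at h2
  rw [intervalIntegral.integral_const_mul, h2] at h
  rw [Real.norm_of_nonneg (by norm_num)]
  linarith

/-- The heat flow of a function in `H²`. -/
lemma heat_sub_self_eq_laplacian {u : L2Torus d} {g h : Fin d → L2Torus d}
    (hg : ∀ i, HasWeakPartial i u (g i)) (hh : ∀ i, HasWeakPartial i (g i) (h i))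
    {v : ℝ} (hv : 0 ≤ v) :
    heat v u - u = (1 / 2 : ℝ) • ∫ r in (0:ℝ)..v, heat r (∑ i, h i) := by
  rw [heat_sub_self_eq hg hv]
  congr 1
  refine intervalIntegral.integral_congr_ae (Eventually.of_forall fun r hr => ?_)
  rw [uIoc_of_le hv] at hr
  rw [map_sum]
  exact Finset.sum_congr rfl fun i _ => ((hasWeakPartial_iff i _ _).1 (hh i) r hr.1).symm

end WeakDerivative

end FKTorus

end

/-! ### Multiplication by the coefficients; the evolution system on functions and on jets. -/

noncomputable section

namespace FKTorus

open Set
open scoped RealInnerProductSpace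

section Coefficients

variable {d : ℕ}

open Classical in
/-- Multiplication by a function, which should be continuous. -/
def mulFun (a : Torus d → ℝ) : L2Torus d →L[ℝ] L2Torus d :=
  if h : Continuous a then mulOp ⟨a, h⟩ else 0

lemma mulFun_eq {a : Torus d → ℝ} (h : Continuous a) : mulFun a = mulOp ⟨a, h⟩ := dif_pos h

lemma coeFn_mulFun {a : Torus d → ℝ} (h : Continuous a) (φ : L2Torus d) :
    mulFun a φ =ᵐ[torusMeasure d] fun x => a x * φ x := by
  rw [mulFun_eq h]; exact coeFn_mulOp _ φ

lemma norm_mulFun_le {a : Torus d → ℝ} {C : ℝ} (hC : 0 ≤ C) (h : ∀ x, |a x| ≤ C) :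
    ‖mulFun a‖ ≤ C := by
  by_cases ha : Continuous a
  · rw [mulFun_eq ha]; exact norm_mulOp_le _ hC h
  · rw [mulFun, dif_neg ha, norm_zero]; exact hC

lemma HasWeakPartial.mulFun {i : Fin d} {u g : L2Torus d} (H : HasWeakPartial i u g)
    {a : Torus d → ℝ} (ha : SmoothTest a) :
    HasWeakPartial i (mulFun a u) (mulFun a g + mulFun (partialDeriv i a) u) := by
  rw [mulFun_eq ha.continuous, mulFun_eq (ha.partialDeriv i).continuous]
  exact H.mulOp ha fun x => rfl

lemma SmoothCoefficient.smoothTest {f : ℝ → Torus d → ℝ} (hf : SmoothCoefficient f) (t : ℝ) :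
    SmoothTest (f t) :=
  ContDiff.comp (g := fun p : ℝ × Space d => f p.1 (toTorus p.2)) hf
    (contDiff_const.prodMk contDiff_id)

lemma SmoothCoefficient.apply {b : ℝ → Torus d → Space d} (hb : SmoothCoefficient b) (i : Fin d) :
    SmoothCoefficient fun t x => b t x i :=
  (contDiff_euclidean.1 hb) i

lemma SmoothCoefficient.partialDeriv {f : ℝ → Torus d → ℝ} (hf : SmoothCoefficient f) (i : Fin d) :
    SmoothCoefficient fun t => partialDeriv i (f t) := by
  have e : ∀ p : ℝ × Space d, FKTorus.partialDeriv i (f p.1) (toTorus p.2) =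
      fderiv ℝ (fun p : ℝ × Space d => f p.1 (toTorus p.2)) p (0, EuclideanSpace.single i 1) := by
    intro p
    rw [partialDeriv_toTorus (hf.smoothTest p.1)]
    have h1 : HasFDerivAt (fun p : ℝ × Space d => f p.1 (toTorus p.2))
        (fderiv ℝ (fun p : ℝ × Space d => f p.1 (toTorus p.2)) p) (p.1, p.2) :=
      ((ContDiff.differentiable hf (by simp)) p).hasFDerivAt
    have h2 : HasFDerivAt (fun y : Space d => (p.1, y)) (ContinuousLinearMap.inr ℝ ℝ (Space d)) p.2 :=
      hasFDerivAt_prodMk_right p.1 p.2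
    exact congrArg (· (EuclideanSpace.single i 1)) (h1.comp p.2 h2).fderiv
  unfold SmoothCoefficient
  simp only [e]
  exact (ContDiff.fderiv_right hf (by simp)).clm_apply contDiff_const

lemma SmoothCoefficient.continuous {F : Type*} [NormedAddCommGroup F] [NormedSpace ℝ F]
    {f : ℝ → Torus d → F} (hf : SmoothCoefficient f) :
    Continuous fun p : ℝ × Torus d => f p.1 p.2 := by
  have h : IsOpenQuotientMap (Prod.map (id : ℝ → ℝ) (toTorus : Space d → Torus d)) :=
    IsOpenQuotientMap.id.prodMap isOpenQuotientMap_toTorus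
  exact h.isQuotientMap.continuous_iff.2 (ContDiff.continuous hf)

lemma SmoothCoefficient.continuous_mulFun {f : ℝ → Torus d → ℝ} (hf : SmoothCoefficient f) :
    Continuous fun t => mulFun (f t) := by
  have h : Continuous fun t : ℝ => (⟨f t, (hf.smoothTest t).continuous⟩ : C(Torus d, ℝ)) :=
    ContinuousMap.continuous_of_continuous_uncurry _ hf.continuous
  refine ((mulOp (d := d)).continuous.comp h).congr fun t => ?_
  rw [mulFun_eq (hf.smoothTest t).continuous]
  rfl

/-- Periodicity reduces the supremum to the compact set `[0, T] × Torus d`. -/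
lemma SmoothCoefficient.exists_bound {F : Type*} [NormedAddCommGroup F] [NormedSpace ℝ F]
    {f : ℝ → Torus d → F} (hf : SmoothCoefficient f) {T : ℝ} (hT : 0 < T)
    (hfT : ∀ t x, f (t + T) x = f t x) : ∃ C, 0 ≤ C ∧ ∀ t x, ‖f t x‖ ≤ C := by
  obtain ⟨C, hC⟩ := (isCompact_Icc (a := (0:ℝ)) (b := T)).prod (isCompact_univ (X := Torus d))
    |>.exists_bound_of_continuousOn hf.continuous.continuousOn
  have hC' : ∀ t ∈ Icc 0 T, ∀ x, ‖f t x‖ ≤ C := fun t ht x => hC (t, x) ⟨ht, mem_univ x⟩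
  refine ⟨C, (norm_nonneg _).trans (hC' 0 ⟨le_rfl, hT.le⟩ 0), fun t x => ?_⟩
  have hp : Function.Periodic (fun t => f t x) T := fun t => hfT t x
  obtain ⟨s, hs, hst⟩ := hp.exists_mem_Ico₀ hT t
  rw [show f t x = f s x from hst]
  exact hC' s ⟨hs.1, hs.2.le⟩ x

lemma SmoothCoefficient.exists_bound_mulFun {f : ℝ → Torus d → ℝ} (hf : SmoothCoefficient f)
    {T : ℝ} (hT : 0 < T) (hfT : ∀ t x, f (t + T) x = f t x) :
    ∃ C, 0 ≤ C ∧ ∀ t, ‖mulFun (f t)‖ ≤ C := by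
  obtain ⟨C, hC, h⟩ := hf.exists_bound hT hfT
  exact ⟨C, hC, fun t => norm_mulFun_le hC (h t)⟩

lemma partialDeriv_periodic {f : ℝ → Torus d → ℝ} {T : ℝ} (hfT : ∀ t x, f (t + T) x = f t x)
    (i : Fin d) (t : ℝ) (x : Torus d) :
    partialDeriv i (f (t + T)) x = partialDeriv i (f t) x := by
  rw [show f (t + T) = f t from funext (hfT t)]

end Coefficients

namespace FirstOrderSystem

variable {ι Y : Type*} [Fintype ι] [NormedAddCommGroup Y] [NormedSpace ℝ Y] [CompleteSpace Y]
  (A : FirstOrderSystem ι Y)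

/-- `grad` is the gradient of `sol`, in the sense of the semigroup. -/
lemma S_comp_grad (i : ι) {s t τ : ℝ} (hst : s < t) (hτ : 0 < τ) :
    A.S τ ∘L A.grad i t s = A.D i τ ∘L A.sol t s := by
  have h1 := ContinuousLinearMap.intervalIntegral_comp_comm (ContinuousLinearMap.compL ℝ Y Y Y (A.S τ))
      (((A.singKernel_D i).opKernel (W := Y)).intervalIntegrable (A.singFun_source s) hst)
  have h2 := ContinuousLinearMap.intervalIntegral_comp_comm
      (ContinuousLinearMap.compL ℝ Y Y Y (A.D i τ))
      ((A.singKernel_S.opKernel (W := Y)).intervalIntegrable (A.singFun_source s) hst)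
  have h0 : 0 < t - s := sub_pos.2 hst
  simp only [grad, sol, ContinuousLinearMap.comp_add]
  rw [A.S_comp_D i _ _ hτ.le h0, ← A.D_add i _ _ hτ h0.le, add_comm (t - s)]
  congr 1
  refine h1.symm.trans (Eq.trans ?_ h2)
  refine intervalIntegral.integral_congr_ae ?_
  have hne : ∀ᵐ r : ℝ, r ≠ t := by simp [ae_iff, measure_singleton]
  filter_upwards [hne] with r hrt hr
  rw [uIoc_of_le hst.le] at hr
  have h3 : 0 < t - r := sub_pos.2 (lt_of_le_of_ne hr.2 hrt)
  simp only [opKernel_apply, ContinuousLinearMap.compL_apply]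
  rw [← ContinuousLinearMap.comp_assoc, A.S_comp_D i _ _ hτ.le h3, ← ContinuousLinearMap.comp_assoc,
    ← A.D_add i _ _ hτ h3.le, add_comm τ]

section Diagonal

variable {Y : Type*} [NormedAddCommGroup Y] [NormedSpace ℝ Y] (O : Type*) [Fintype O]

/-- The diagonal action on families. -/
def diag (B : Y →L[ℝ] Y) : (O → Y) →L[ℝ] (O → Y) :=
  ContinuousLinearMap.pi fun o => B ∘L ContinuousLinearMap.proj o

lemma diag_apply (B : Y →L[ℝ] Y) (z : O → Y) (o : O) : diag O B z o = B (z o) := rfl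

lemma norm_diag_le (B : Y →L[ℝ] Y) : ‖diag O B‖ ≤ ‖B‖ := by
  refine ContinuousLinearMap.opNorm_le_bound _ (norm_nonneg _) fun z => ?_
  rw [pi_norm_le_iff_of_nonneg (by positivity)]
  intro o
  exact (B.le_opNorm _).trans (mul_le_mul_of_nonneg_left (norm_le_pi_norm z o) (norm_nonneg _))

lemma continuous_diag : Continuous (diag O : (Y →L[ℝ] Y) → (O → Y) →L[ℝ] (O → Y)) := by
  let ℓ : (Y →L[ℝ] Y) →ₗ[ℝ] ((O → Y) →L[ℝ] (O → Y)) :=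
    { toFun := diag O
      map_add' := fun _ _ => rfl
      map_smul' := fun _ _ => rfl }
  exact (ℓ.mkContinuous 1 fun B => by rw [one_mul]; exact norm_diag_le O B).continuous

end Diagonal

end FirstOrderSystem

section Systems

open FirstOrderSystem

variable {d : ℕ}

/-- The data of the equation: a diffusivity and smooth periodic coefficients. -/
structure Coefficients (d : ℕ) where
  κ : ℝ
  T : ℝ
  b : ℝ → Torus d → Space d
  c : ℝ → Torus d → ℝ
  κ_pos : 0 < κ
  T_pos : 0 < T
  b_smooth : SmoothCoefficient b
  c_smooth : SmoothCoefficient c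
  b_periodic : ∀ t x, b (t + T) x = b t x
  c_periodic : ∀ t x, c (t + T) x = c t x

namespace Coefficients

variable (P : Coefficients d)

lemma b_apply_periodic (i : Fin d) (t : ℝ) (x : Torus d) : P.b (t + P.T) x i = P.b t x i := by
  rw [P.b_periodic]

lemma heat_time_cont {E : Type*} [TopologicalSpace E] {F : ℝ → E} (hF : ContinuousOn F (Ioi 0)) :
    ContinuousOn (fun t => F (2 * P.κ * t)) (Ioi 0) := by
  have := P.κ_pos
  exact hF.comp (by fun_prop) fun t ht => by
    have h : 0 < t := ht
    show 0 < 2 * P.κ * t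
    positivity

lemma exists_bound_heatD : ∃ C, 0 ≤ C ∧ ∀ (i : Fin d) t, 0 < t →
    ‖heatD i (2 * P.κ * t)‖ ≤ C * (1 / √t) := by
  have := P.κ_pos
  refine ⟨2 ^ d * 2 * (1 / √(2 * P.κ)), by positivity, fun i t ht => ?_⟩
  refine (norm_heatD_le i (by positivity)).trans (le_of_eq ?_)
  rw [Real.sqrt_mul (by positivity)]
  have : 0 < √t := Real.sqrt_pos.2 ht
  have : 0 < √(2 * P.κ) := Real.sqrt_pos.2 (by positivity)
  field_simp

lemma exists_bound_b_mulFun : ∃ C, 0 ≤ C ∧ ∀ (i : Fin d) t, ‖mulFun fun x => P.b t x i‖ ≤ C := by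
  obtain ⟨C, hC, h⟩ := P.b_smooth.exists_bound P.T_pos P.b_periodic
  exact ⟨C, hC, fun i t => norm_mulFun_le hC fun x => (abs_apply_le_norm _ _).trans (h t x)⟩

/-- Duhamel's formula on `L²`. -/
def system : FirstOrderSystem (Fin d) (L2Torus d) where
  S t := heat (2 * P.κ * t)
  D i t := heatD i (2 * P.κ * t)
  β i t := mulFun fun x => P.b t x i
  χ t := mulFun (P.c t)
  S_zero := heat_of_nonpos (by simp)
  S_add s t hs ht := by
    have := P.κ_pos
    rw [mul_add]
    exact heat_add (by positivity) (by positivity)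
  S_cont := P.heat_time_cont continuousOn_heat
  S_bound := ⟨1, zero_le_one, fun t _ => norm_heat_le _⟩
  D_add i s t hs ht := by
    have := P.κ_pos
    rw [mul_add]
    exact heatD_add i (by positivity) (by positivity)
  S_comp_D i s t hs ht := by
    have := P.κ_pos
    rw [mul_add]
    exact heat_comp_heatD i (by positivity) (by positivity)
  D_cont i := P.heat_time_cont (continuousOn_heatD i)
  D_bound := P.exists_bound_heatD
  β_cont i := (P.b_smooth.apply i).continuous_mulFun
  χ_cont := P.c_smooth.continuous_mulFun
  β_bound := P.exists_bound_b_mulFun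
  χ_bound := P.c_smooth.exists_bound_mulFun P.T_pos P.c_periodic

/-- The map `(u, g) ↦ (a u, a g + u ∇a)` on functions with their gradients. -/
def jetMul (a : Torus d → ℝ) : (Option (Fin d) → L2Torus d) →L[ℝ] (Option (Fin d) → L2Torus d) :=
  diag _ (mulFun a) + ∑ j, ContinuousLinearMap.single ℝ (fun _ : Option (Fin d) => L2Torus d) (some j)
    ∘L mulFun (partialDeriv j a) ∘L ContinuousLinearMap.proj none

lemma jetMul_none (a : Torus d → ℝ) (z : Option (Fin d) → L2Torus d) :
    jetMul a z none = mulFun a (z none) := by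
  simp [jetMul, diag_apply]

lemma jetMul_some (a : Torus d → ℝ) (z : Option (Fin d) → L2Torus d) (j : Fin d) :
    jetMul a z (some j) = mulFun a (z (some j)) + mulFun (partialDeriv j a) (z none) := by
  simp [jetMul, diag_apply, Pi.single_apply]

lemma continuous_jetMul {f : ℝ → Torus d → ℝ} (hf : SmoothCoefficient f) :
    Continuous fun t => jetMul (f t) := by
  unfold jetMul
  refine ((continuous_diag _).comp hf.continuous_mulFun).add (continuous_finsetSum _ fun j _ => ?_)
  exact continuous_const.clm_comp ((hf.partialDeriv j).continuous_mulFun.clm_comp continuous_const)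

lemma exists_bound_jetMul {f : ℝ → Torus d → ℝ} (hf : SmoothCoefficient f)
    {T : ℝ} (hT : 0 < T) (hfT : ∀ t x, f (t + T) x = f t x) :
    ∃ C, 0 ≤ C ∧ ∀ t, ‖jetMul (f t)‖ ≤ C := by
  have hp : Function.Periodic (fun t => jetMul (f t)) T := fun t => by
    simp only [show f (t + T) = f t from funext (hfT t)]
  obtain ⟨C, hC⟩ := (isCompact_Icc (a := (0:ℝ)) (b := T)).exists_bound_of_continuousOn
    (continuous_jetMul hf).continuousOn
  refine ⟨C, (norm_nonneg _).trans (hC 0 ⟨le_rfl, hT.le⟩), fun t => ?_⟩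
  obtain ⟨s, hs, hst⟩ := hp.exists_mem_Ico₀ hT t
  rw [show jetMul (f t) = jetMul (f s) from hst]
  exact hC s ⟨hs.1, hs.2.le⟩

/-- Duhamel's formula for the function together with its gradient. -/
def jetSystem : FirstOrderSystem (Fin d) (Option (Fin d) → L2Torus d) where
  S t := diag _ (P.system.S t)
  D i t := diag _ (P.system.D i t)
  β i t := jetMul fun x => P.b t x i
  χ t := jetMul (P.c t)
  S_zero := by rw [P.system.S_zero]; rfl
  S_add s t hs ht := by rw [P.system.S_add s t hs ht]; rfl
  S_cont := (continuous_diag _).comp_continuousOn P.system.S_cont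
  S_bound := by
    obtain ⟨C, hC, h⟩ := P.system.S_bound
    exact ⟨C, hC, fun t ht => (norm_diag_le _ _).trans (h t ht)⟩
  D_add i s t hs ht := by rw [P.system.D_add i s t hs ht]; rfl
  S_comp_D i s t hs ht := by rw [← P.system.S_comp_D i s t hs ht]; rfl
  D_cont i := (continuous_diag _).comp_continuousOn (P.system.D_cont i)
  D_bound := by
    obtain ⟨C, hC, h⟩ := P.system.D_bound
    exact ⟨C, hC, fun i t ht => (norm_diag_le _ _).trans (h i t ht)⟩
  β_cont i := continuous_jetMul (P.b_smooth.apply i)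
  χ_cont := continuous_jetMul P.c_smooth
  β_bound := by
    choose C hC h using fun i => exists_bound_jetMul (P.b_smooth.apply i) P.T_pos
      (P.b_apply_periodic i)
    exact ⟨∑ i, C i, Finset.sum_nonneg fun i _ => hC i, fun i t => (h i t).trans
      (Finset.single_le_sum (fun i _ => hC i) (Finset.mem_univ i))⟩
  χ_bound := exists_bound_jetMul P.c_smooth P.T_pos P.c_periodic

end Coefficients

end Systems

end FKTorus

end

/-! ### Second derivatives of the solution. -/

noncomputable section

namespace FKTorus

open Set
open scoped RealInnerProductSpace Interval

namespace Coefficients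

open FirstOrderSystem

variable {d : ℕ} (P : Coefficients d)

lemma hasWeakPartial_of_S (i : Fin d) {u g : L2Torus d}
    (h : ∀ τ, 0 < τ → P.system.S τ g = P.system.D i τ u) : HasWeakPartial i u g := by
  rw [hasWeakPartial_iff]
  intro v hv
  have hκ := P.κ_pos
  have := h (v / (2 * P.κ)) (by positivity)
  change heat (2 * P.κ * (v / (2 * P.κ))) g = heatD i (2 * P.κ * (v / (2 * P.κ))) u at this
  rwa [mul_div_cancel₀ v (by positivity : 2 * P.κ ≠ 0)] at this

lemma hasWeakPartial_grad (i : Fin d) {s t : ℝ} (hst : s < t) (w : L2Torus d) :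
    HasWeakPartial i (P.system.sol t s w) (P.system.grad i t s w) :=
  P.hasWeakPartial_of_S i fun _ hτ => congrArg (fun B => B w) (P.system.S_comp_grad i hst hτ)

lemma hasWeakPartial_jetGrad (i : Fin d) {s t : ℝ} (hst : s < t) (z : Option (Fin d) → L2Torus d)
    (o : Option (Fin d)) :
    HasWeakPartial i (P.jetSystem.sol t s z o) (P.jetSystem.grad i t s z o) :=
  P.hasWeakPartial_of_S i fun _ hτ => congrArg (fun B => B z o) (P.jetSystem.S_comp_grad i hst hτ)

/-- Functions together with their weak gradients. -/
def jetSpace (d : ℕ) : Submodule ℝ (Option (Fin d) → L2Torus d) where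
  carrier := {z | ∀ (i : Fin d) (v : ℝ), 0 < v → heat v (z (some i)) = heatD i v (z none)}
  add_mem' := fun ha hb i v hv => by simp only [Pi.add_apply, map_add, ha i v hv, hb i v hv]
  zero_mem' := fun i v _ => by simp
  smul_mem' := fun c z hz i v hv => by simp only [Pi.smul_apply, map_smul, hz i v hv]

lemma mem_jetSpace {z : Option (Fin d) → L2Torus d} :
    z ∈ jetSpace d ↔ ∀ i, HasWeakPartial i (z none) (z (some i)) := by
  simp only [hasWeakPartial_iff]
  rfl

lemma isClosed_jetSpace : IsClosed (jetSpace d : Set (Option (Fin d) → L2Torus d)) := by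
  have : (jetSpace d : Set (Option (Fin d) → L2Torus d)) = ⋂ (i : Fin d) (v : ℝ) (_ : 0 < v),
      {z | heat v (z (some i)) = heatD i v (z none)} := by
    ext z; simp [jetSpace]
  rw [this]
  refine isClosed_iInter fun i => isClosed_iInter fun v => isClosed_iInter fun _ =>
    isClosed_eq ?_ ?_
  · exact (heat v).continuous.comp (continuous_apply _)
  · exact (heatD i v).continuous.comp (continuous_apply _)

lemma S_mem_jetSpace {t : ℝ} (ht : 0 < t) {z : Option (Fin d) → L2Torus d} (hz : z ∈ jetSpace d) :
    P.jetSystem.S t z ∈ jetSpace d := by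
  intro i v hv
  have hκ := P.κ_pos
  have ht' : 0 < 2 * P.κ * t := by positivity
  change heat v (heat (2 * P.κ * t) (z (some i))) = heatD i v (heat (2 * P.κ * t) (z none))
  rw [hz i _ ht']
  have h1 := congrArg (fun B => B (z none)) (heat_comp_heatD i hv.le ht')
  have h2 := congrArg (fun B => B (z none)) (heatD_add i hv ht'.le)
  simp only [ContinuousLinearMap.comp_apply] at h1 h2
  rw [h1, ← h2, add_comm]

lemma D_mem_jetSpace (j : Fin d) {t : ℝ} (ht : 0 < t) {z : Option (Fin d) → L2Torus d}
    (hz : z ∈ jetSpace d) : P.jetSystem.D j t z ∈ jetSpace d := by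
  intro i v hv
  have hκ := P.κ_pos
  have ht' : 0 < 2 * P.κ * t := by positivity
  change heat v (heatD j (2 * P.κ * t) (z (some i))) = heatD i v (heatD j (2 * P.κ * t) (z none))
  have h1 := congrArg (fun B => B (z (some i))) (heat_comp_heatD j hv.le ht')
  have h2 := congrArg (fun B => B (z (some i))) (heatD_add j ht' hv.le)
  simp only [ContinuousLinearMap.comp_apply] at h1 h2
  rw [h1, h2, hz i v hv]
  -- Derivatives of heat flows commute because their multipliers do.
  have h3 : heatD j (2 * P.κ * t) ∘L heatD i v = heatD i v ∘L heatD j (2 * P.κ * t) :=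
    clm_ext_trig fun n θ => by
      simp only [ContinuousLinearMap.comp_apply, heatD_trigLp hv, heatD_trigLp ht', map_smul,
        smul_smul]
      congr 1; ring
  exact congrArg (fun B => B (z none)) h3

lemma jetMul_mem_jetSpace {a : Torus d → ℝ} (ha : SmoothTest a) {z : Option (Fin d) → L2Torus d}
    (hz : z ∈ jetSpace d) : jetMul a z ∈ jetSpace d := by
  rw [mem_jetSpace] at hz ⊢
  intro i
  rw [jetMul_none, jetMul_some]
  exact (hz i).mulFun ha

/-- Functions paired with their weak gradients form a closed subspace. The heat operators preserve
it because they commute with derivatives, and `jetMul` preserves it by the product rule, so the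
abstract invariance applies. -/
lemma sol_mem_jetSpace {s t : ℝ} (hst : s < t) {z : Option (Fin d) → L2Torus d}
    (hz : z ∈ jetSpace d) : P.jetSystem.sol t s z ∈ jetSpace d :=
  (P.jetSystem.invariant (M := jetSpace d) isClosed_jetSpace (fun _ ht _ hw => P.S_mem_jetSpace ht hw)
    (fun i _ ht _ hw => P.D_mem_jetSpace i ht hw)
    (fun i t _ hw => jetMul_mem_jetSpace ((P.b_smooth.apply i).smoothTest t) hw)
    (fun t _ hw => jetMul_mem_jetSpace (P.c_smooth.smoothTest t) hw) hst).1 z hz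

/-- Projection to the component `none` commutes with the semigroup, its derivatives and the
coefficients, so `intertwine` applies. -/
lemma jetSystem_none {s t : ℝ} (hst : s < t) (z : Option (Fin d) → L2Torus d) :
    P.jetSystem.sol t s z none = P.system.sol t s (z none) := by
  have := (P.jetSystem.intertwine P.system
    (ContinuousLinearMap.proj (R := ℝ) (φ := fun _ : Option (Fin d) => L2Torus d) none)
    (fun _ _ => rfl) (fun _ _ _ => rfl)
    (fun i t => by ext1 z; exact jetMul_none _ z) (fun t => by ext1 z; exact jetMul_none _ z) hst).1
  exact congrArg (fun B => B z) this

/-- The solution together with its gradient. -/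
def jet (t s : ℝ) : L2Torus d →L[ℝ] (Option (Fin d) → L2Torus d) :=
  ContinuousLinearMap.pi fun o => o.elim (P.system.sol t s) fun j => P.system.grad j t s

lemma jet_mem {s t : ℝ} (hst : s < t) (w : L2Torus d) : P.jet t s w ∈ jetSpace d :=
  mem_jetSpace.2 fun i => P.hasWeakPartial_grad i hst w

/-- After a restart at `m` the gradient is itself a component of a solution of a system with the
same smoothing; this yields second derivatives without differentiating the singular Duhamel integral
twice. The components `some i` agree because both are weak derivatives of the same function. -/
lemma jetSystem_jet {s m t : ℝ} (hsm : s < m) (hmt : m < t) (w : L2Torus d) :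
    P.jetSystem.sol t m (P.jet m s w) = P.jet t s w := by
  have h0 : P.jetSystem.sol t m (P.jet m s w) none = P.jet t s w none := by
    rw [P.jetSystem_none hmt]
    change _ = P.system.sol t s w
    rw [P.system.sol_restart hsm hmt]
    rfl
  have h1 := mem_jetSpace.1 (P.sol_mem_jetSpace hmt (P.jet_mem hsm w))
  have h2 := mem_jetSpace.1 (P.jet_mem (hsm.trans hmt) w)
  ext1 o
  rcases o with _ | i
  · exact h0
  · have h3 := h1 i
    rw [h0] at h3
    exact h3.unique (h2 i)

/-- The second derivative `∂ᵢ∂ⱼ` of the solution, computed by restarting at time `m`. -/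
def hess (i j : Fin d) (t m s : ℝ) : L2Torus d →L[ℝ] L2Torus d :=
  ContinuousLinearMap.proj (some j) ∘L P.jetSystem.grad i t m ∘L P.jet m s

lemma hasWeakPartial_hess (i j : Fin d) {s m t : ℝ} (hsm : s < m) (hmt : m < t) (w : L2Torus d) :
    HasWeakPartial i (P.system.grad j t s w) (P.hess i j t m s w) := by
  have h := P.hasWeakPartial_jetGrad i hmt (P.jet m s w) (some j)
  rw [P.jetSystem_jet hsm hmt] at h
  exact h

lemma continuousOn_hess (i j : Fin d) (m s : ℝ) :
    ContinuousOn (fun t => P.hess i j t m s) (Ioi m) :=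
  continuousOn_const.clm_comp ((P.jetSystem.singFun_grad i m).cont.clm_comp continuousOn_const)

lemma continuousOn_S_comp_hess (i j : Fin d) (m s : ℝ) :
    ContinuousOn (fun p : ℝ × ℝ => P.system.S p.1 ∘L P.hess i j p.2 m s) (Ici 0 ×ˢ Ioi m) := by
  have h := P.jetSystem.continuousOn_S_comp_grad i m
  exact continuousOn_const (c := ContinuousLinearMap.proj (R := ℝ)
    (φ := fun _ : Option (Fin d) => L2Torus d) (some j)) |>.clm_comp
      (h.clm_comp (continuousOn_const (c := P.jet m s)))

/-- The Laplacian of the solution. -/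
def lap (t m s : ℝ) : L2Torus d →L[ℝ] L2Torus d := ∑ i, P.hess i i t m s

/-- The time derivative of the solution. -/
def rate (t m s : ℝ) : L2Torus d →L[ℝ] L2Torus d := P.κ • P.lap t m s + P.system.source s t

lemma continuousOn_lap (m s : ℝ) : ContinuousOn (fun t => P.lap t m s) (Ioi m) :=
  continuousOn_finsetSum _ fun i _ => P.continuousOn_hess i i m s

lemma continuousOn_S_comp_lap (m s : ℝ) :
    ContinuousOn (fun p : ℝ × ℝ => P.system.S p.1 ∘L P.lap p.2 m s) (Ici 0 ×ˢ Ioi m) := by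
  have := continuousOn_finsetSum Finset.univ fun i (_ : i ∈ Finset.univ) =>
    P.continuousOn_S_comp_hess i i m s
  refine this.congr fun p _ => ?_
  simp only [lap, ContinuousLinearMap.comp_finsetSum]

lemma continuousOn_rate {s m : ℝ} (hsm : s ≤ m) : ContinuousOn (fun t => P.rate t m s) (Ioi m) :=
  ((P.continuousOn_lap m s).const_smul P.κ).add
    ((P.system.singFun_source s).cont.mono (Ioi_subset_Ioi hsm))

/-- The heat flow of the solution at a fixed time. -/
lemma S_sub_one_comp_sol {s m t h : ℝ} (hsm : s < m) (hmt : m < t) (hh : 0 ≤ h) :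
    P.system.S h ∘L P.system.sol t s - P.system.sol t s =
      P.κ • ∫ r in (0:ℝ)..h, P.system.S r ∘L P.lap t m s := by
  have hκ := P.κ_pos
  have hint : IntervalIntegrable (fun r => P.system.S r ∘L P.lap t m s) volume 0 h := by
    refine ContinuousOn.intervalIntegrable ?_
    rw [uIcc_of_le hh]
    exact (P.continuousOn_S_comp_lap m s).comp (f := fun r => (r, t)) (by fun_prop)
      fun r hr => ⟨hr.1, hmt⟩
  ext1 w
  have h1 := heat_sub_self_eq_laplacian (fun i => P.hasWeakPartial_grad i (hsm.trans hmt) w)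
    (fun i => P.hasWeakPartial_hess i i hsm hmt w) (v := 2 * P.κ * h) (by positivity)
  have h2 := ContinuousLinearMap.intervalIntegral_apply hint w
  rw [sub_apply, smul_apply, h2]
  refine h1.trans ?_
  have h3 := intervalIntegral.smul_integral_comp_mul_left (a := 0) (b := h)
    (fun r => heat r (∑ i, P.hess i i t m s w)) (2 * P.κ)
  rw [mul_zero] at h3
  rw [← h3, smul_smul, show (1 / 2 : ℝ) * (2 * P.κ) = P.κ by ring]
  congr 1
  refine intervalIntegral.integral_congr fun r _ => ?_
  simp only [lap, ContinuousLinearMap.comp_apply, _root_.sum_apply]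
  rfl

end Coefficients

end FKTorus

end

/-! ### Differentiability of the solution in time. -/

noncomputable section

namespace FKTorus

open Set
open scoped RealInnerProductSpace Interval

section WeakLinear

variable {d : ℕ} {i : Fin d}

lemma HasWeakPartial.add {u u' g g' : L2Torus d} (h : HasWeakPartial i u g)
    (h' : HasWeakPartial i u' g') : HasWeakPartial i (u + u') (g + g') := by
  rw [hasWeakPartial_iff] at *
  intro v hv
  rw [map_add, map_add, h v hv, h' v hv]

lemma HasWeakPartial.sub {u u' g g' : L2Torus d} (h : HasWeakPartial i u g)
    (h' : HasWeakPartial i u' g') : HasWeakPartial i (u - u') (g - g') := by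
  rw [hasWeakPartial_iff] at *
  intro v hv
  rw [map_sub, map_sub, h v hv, h' v hv]

lemma HasWeakPartial.sum {ι : Type*} (s : Finset ι) {u g : ι → L2Torus d}
    (h : ∀ j, HasWeakPartial i (u j) (g j)) : HasWeakPartial i (∑ j ∈ s, u j) (∑ j ∈ s, g j) := by
  simp only [hasWeakPartial_iff] at *
  intro v hv
  rw [map_sum, map_sum]
  exact Finset.sum_congr rfl fun j _ => h j v hv

end WeakLinear

namespace Coefficients

open FirstOrderSystem

variable {d : ℕ} (P : Coefficients d)

/-- The semigroup is close to the identity on families with bounded gradients. -/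
lemma norm_S_comp_sub_le {B : L2Torus d →L[ℝ] L2Torus d} {B' : Fin d → L2Torus d →L[ℝ] L2Torus d}
    (hB : ∀ i w, HasWeakPartial i (B w) (B' i w)) {h : ℝ} (hh : 0 ≤ h) :
    ‖P.system.S h ∘L B - B‖ ≤ 2 ^ d * 2 * √(2 * P.κ * h) * ∑ i, ‖B' i‖ := by
  have hκ := P.κ_pos
  refine ContinuousLinearMap.opNorm_le_bound _ (by positivity) fun w => ?_
  refine (norm_heat_sub_self_le (fun i => hB i w) (by positivity : 0 ≤ 2 * P.κ * h)).trans ?_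
  rw [mul_assoc _ (∑ i, ‖B' i‖), Finset.sum_mul]
  exact mul_le_mul_of_nonneg_left (Finset.sum_le_sum fun i _ => (B' i).le_opNorm w) (by positivity)

/-- The gradient of the source term. -/
def gradSource (i : Fin d) (t m s : ℝ) : L2Torus d →L[ℝ] L2Torus d :=
  ∑ j, ((mulFun fun x => P.b t x j) ∘L P.hess i j t m s +
      mulFun (partialDeriv i fun x => P.b t x j) ∘L P.system.grad j t s) +
    (mulFun (P.c t) ∘L P.system.grad i t s + mulFun (partialDeriv i (P.c t)) ∘L P.system.sol t s)

lemma source_apply {s t : ℝ} (hst : s < t) (w : L2Torus d) : P.system.source s t w =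
    ∑ j, (mulFun fun x => P.b t x j) (P.system.grad j t s w) +
      mulFun (P.c t) (P.system.sol t s w) := by
  rw [P.system.source_eq_grad hst, add_apply, _root_.sum_apply]
  rfl

lemma hasWeakPartial_source (i : Fin d) {s m t : ℝ} (hsm : s < m) (hmt : m < t) (w : L2Torus d) :
    HasWeakPartial i (P.system.source s t w) (P.gradSource i t m s w) := by
  rw [P.source_apply (hsm.trans hmt), gradSource, add_apply, _root_.sum_apply]
  refine HasWeakPartial.add (HasWeakPartial.sum _ fun j => ?_) ?_
  · exact (P.hasWeakPartial_hess i j hsm hmt w).mulFun ((P.b_smooth.apply j).smoothTest t)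
  · exact (P.hasWeakPartial_grad i (hsm.trans hmt) w).mulFun (P.c_smooth.smoothTest t)

/-- First order expansion of the heat flow of the solution, uniformly on compact time intervals. -/
lemma norm_S_comp_sol_sub_le {s m a b ε : ℝ} (hsm : s < m) (hma : m < a) (hε : 0 < ε) :
    ∃ h₀, 0 < h₀ ∧ ∀ t ∈ Icc a b, ∀ h, 0 ≤ h → h ≤ h₀ →
      ‖P.system.S h ∘L P.system.sol t s - P.system.sol t s - (h * P.κ) • P.lap t m s‖ ≤ ε * h := by
  have hκ := P.κ_pos
  -- Uniform continuity on a compact set gives one `h₀` for all `t` in `[a, b]`. The set contains `r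
  -- = 0`, where the semigroup is the identity.
  have hc : ContinuousOn (fun p : ℝ × ℝ => P.system.S p.1 ∘L P.lap p.2 m s)
      (Icc 0 1 ×ˢ Icc a b) :=
    (P.continuousOn_S_comp_lap m s).mono
      (prod_mono (fun x hx => hx.1) fun x hx => hma.trans_le hx.1)
  have hu := (isCompact_Icc.prod isCompact_Icc).uniformContinuousOn_of_continuous hc
  rw [Metric.uniformContinuousOn_iff_le] at hu
  obtain ⟨δ, hδ, hu⟩ := hu (ε / P.κ) (by positivity)
  refine ⟨min δ 1, by positivity, fun t ht h h0 h1 => ?_⟩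
  have hmt : m < t := hma.trans_le ht.1
  have hint : IntervalIntegrable (fun r => P.system.S r ∘L P.lap t m s) volume 0 h := by
    refine ContinuousOn.intervalIntegrable ?_
    rw [uIcc_of_le h0]
    exact (P.continuousOn_S_comp_lap m s).comp (f := fun r => (r, t)) (by fun_prop)
      fun r hr => ⟨hr.1, hmt⟩
  have e : (h * P.κ) • P.lap t m s = P.κ • ∫ r in (0:ℝ)..h, P.lap t m s := by
    rw [intervalIntegral.integral_const, smul_smul, sub_zero, mul_comm]
  rw [P.S_sub_one_comp_sol hsm hmt h0, e, ← smul_sub,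
    ← intervalIntegral.integral_sub hint intervalIntegrable_const, norm_smul,
    Real.norm_of_nonneg hκ.le]
  have h2 : ‖∫ r in (0:ℝ)..h, (P.system.S r ∘L P.lap t m s - P.lap t m s)‖ ≤ ε / P.κ * |h - 0| := by
    refine intervalIntegral.norm_integral_le_of_norm_le_const fun r hr => ?_
    rw [uIoc_of_le h0] at hr
    have hr1 : r ≤ δ := hr.2.trans (h1.trans (min_le_left _ _))
    have hr2 : r ≤ 1 := hr.2.trans (h1.trans (min_le_right _ _))
    have := hu (r, t) ⟨⟨hr.1.le, hr2⟩, ht⟩ (0, t) ⟨⟨le_rfl, zero_le_one⟩, ht⟩ (by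
      rw [Prod.dist_eq, dist_self, Real.dist_eq, sub_zero, abs_of_pos hr.1]
      exact max_le hr1 hδ.le)
    rw [dist_eq_norm] at this
    simpa [P.system.S_zero] using this
  rw [sub_zero, abs_of_nonneg h0] at h2
  calc P.κ * _ ≤ P.κ * (ε / P.κ * h) := mul_le_mul_of_nonneg_left h2 hκ.le
    _ = ε * h := by field_simp

lemma norm_S_le (h : ℝ) : ‖P.system.S h‖ ≤ 1 := norm_heat_le _

/-- Duhamel's formula restarted at `t` splits the increment into the heat flow of the solution, with
first order term `κ • lap`, and the integral of the source over a short interval. The source is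
continuous in time and has a weak gradient, so the semigroup moves it by `O(√h)` only and the
integral is `h • source + o(h)`. -/
lemma hasDerivWithinAt_sol {s m t : ℝ} (hsm : s < m) (hmt : m < t) :
    HasDerivWithinAt (fun r => P.system.sol r s) (P.rate t m s) (Ioi t) t := by
  have hκ := P.κ_pos
  have hst := hsm.trans hmt
  rw [hasDerivWithinAt_iff_isLittleO, Asymptotics.isLittleO_iff]
  intro ε hε
  obtain ⟨h₀, hh₀, h1⟩ := P.norm_S_comp_sol_sub_le (b := t) hsm hmt (half_pos hε)
  have hF : ContinuousAt (P.system.source s) t :=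
    (P.system.singFun_source s).cont.continuousAt (Ioi_mem_nhds hst)
  obtain ⟨δ, hδ, h2⟩ := Metric.continuousAt_iff.1 hF (ε / 4) (by positivity)
  have hsq : Tendsto (fun h : ℝ => 2 ^ d * 2 * √(2 * P.κ * h) * ∑ i, ‖P.gradSource i t m s‖) (𝓝 0)
      (𝓝 0) := by
    have : Continuous fun h : ℝ => 2 ^ d * 2 * √(2 * P.κ * h) * ∑ i, ‖P.gradSource i t m s‖ := by
      fun_prop
    simpa using this.tendsto 0
  obtain ⟨δ', hδ', h3⟩ := Metric.eventually_nhds_iff.1 (hsq.eventually (gt_mem_nhds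
    (by positivity : 0 < ε / 4)))
  have hnh : ∀ᶠ x in 𝓝[>] t, x ∈ Ioo t (t + min h₀ (min δ δ')) :=
    Ioo_mem_nhdsGT (by have : 0 < min h₀ (min δ δ') := by positivity
                       linarith)
  filter_upwards [hnh] with x hx
  have hx0 : 0 < x - t := sub_pos.2 hx.1
  have hxh : x - t ≤ h₀ := by linarith [hx.2, min_le_left h₀ (min δ δ')]
  have hxδ : x - t < δ := by linarith [hx.2, min_le_right h₀ (min δ δ'), min_le_left δ δ']
  have hxδ' : x - t < δ' := by linarith [hx.2, min_le_right h₀ (min δ δ'), min_le_right δ δ']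
  have e1 := h1 t ⟨le_rfl, le_rfl⟩ (x - t) hx0.le hxh
  have hint := (P.system.singKernel_S.opKernel (W := L2Torus d)).intervalIntegrable
    ((P.system.singFun_source s).restrict hst.le) hx.1
  have e2 : ‖singConv (opKernel (L2Torus d) fun _ => P.system.S) (P.system.source s) t x -
      (x - t) • P.system.source s t‖ ≤ ε / 2 * |x - t| := by
    have e : (x - t) • P.system.source s t = ∫ r in t..x, P.system.source s t := by
      rw [intervalIntegral.integral_const]
    rw [singConv, e, ← intervalIntegral.integral_sub hint
      intervalIntegrable_const]
    refine intervalIntegral.norm_integral_le_of_norm_le_const fun r hr => ?_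
    rw [uIoc_of_le hx.1.le] at hr
    rw [opKernel_apply]
    have e3 : ‖P.system.S (x - r) ∘L (P.system.source s r - P.system.source s t)‖ ≤ ε / 4 := by
      refine (ContinuousLinearMap.opNorm_comp_le _ _).trans ?_
      have h4 := h2 (x := r) (by rw [Real.dist_eq, abs_of_pos (sub_pos.2 hr.1)]; linarith [hr.2])
      rw [dist_eq_norm] at h4
      calc _ ≤ 1 * (ε / 4) := mul_le_mul (P.norm_S_le _) h4.le (norm_nonneg _) zero_le_one
        _ = ε / 4 := one_mul _
    have e4 : ‖P.system.S (x - r) ∘L P.system.source s t - P.system.source s t‖ ≤ ε / 4 := by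
      refine (P.norm_S_comp_sub_le (fun i w => P.hasWeakPartial_source i hsm hmt w)
        (sub_nonneg.2 hr.2)).trans (h3 ?_).le
      rw [dist_zero_right, Real.norm_of_nonneg (sub_nonneg.2 hr.2)]
      linarith [hr.1]
    have e5 : P.system.S (x - r) ∘L P.system.source s r - P.system.source s t =
        P.system.S (x - r) ∘L (P.system.source s r - P.system.source s t) +
          (P.system.S (x - r) ∘L P.system.source s t - P.system.source s t) := by
      rw [ContinuousLinearMap.comp_sub]; abel
    rw [e5]
    linarith [norm_add_le (P.system.S (x - r) ∘L (P.system.source s r - P.system.source s t))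
      (P.system.S (x - r) ∘L P.system.source s t - P.system.source s t)]
  have e6 : P.system.sol x s - P.system.sol t s - (x - t) • P.rate t m s =
      (P.system.S (x - t) ∘L P.system.sol t s - P.system.sol t s - ((x - t) * P.κ) • P.lap t m s) +
      (singConv (opKernel (L2Torus d) fun _ => P.system.S) (P.system.source s) t x -
      (x - t) • P.system.source s t) := by
    rw [P.system.sol_eq_add_integral hst hx.1, rate, smul_add, smul_smul]
    abel
  rw [e6, Real.norm_eq_abs]
  rw [abs_of_pos hx0] at e2 ⊢
  linarith [norm_add_le (P.system.S (x - t) ∘L P.system.sol t s - P.system.sol t s -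
    ((x - t) * P.κ) • P.lap t m s) (singConv (opKernel (L2Torus d) fun _ => P.system.S)
      (P.system.source s) t x - (x - t) • P.system.source s t)]

/-- A continuous function with a continuous right derivative is recovered by integrating it. -/
lemma sol_sub_eq_integral {s m a b : ℝ} (hsm : s < m) (hma : m < a) (hab : a ≤ b) :
    P.system.sol b s - P.system.sol a s = ∫ t in a..b, P.rate t m s := by
  refine (intervalIntegral.integral_eq_sub_of_hasDeriv_right_of_le hab ?_
    (fun t ht => P.hasDerivWithinAt_sol hsm (hma.trans ht.1)) ?_).symm
  · exact (P.system.singFun_sol s).cont.mono fun t ht => (hsm.trans hma).trans_le ht.1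
  · refine ContinuousOn.intervalIntegrable ((P.continuousOn_rate hsm.le).mono ?_)
    rw [uIcc_of_le hab]
    exact fun t ht => hma.trans_le ht.1

/-- Restarting Duhamel's formula works forward in time and yields a right derivative; the integral
form upgrades it to a two-sided one. -/
lemma hasDerivAt_sol {s m t : ℝ} (hsm : s < m) (hmt : m < t) :
    HasDerivAt (fun r => P.system.sol r s) (P.rate t m s) t := by
  set a := (m + t) / 2 with ha
  have hma : m < a := by linarith
  have hat : a < t := by linarith
  have hR := P.continuousOn_rate hsm.le
  have hint : IntervalIntegrable (fun t => P.rate t m s) volume a t := by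
    refine ContinuousOn.intervalIntegrable (hR.mono ?_)
    rw [uIcc_of_le hat.le]
    exact fun t ht => hma.trans_le ht.1
  have h := intervalIntegral.integral_hasDerivAt_right hint
    (hR.stronglyMeasurableAtFilter isOpen_Ioi t hmt) (hR.continuousAt (Ioi_mem_nhds hmt))
  refine (h.add_const (P.system.sol a s)).congr_of_eventuallyEq ?_
  filter_upwards [Ioi_mem_nhds hat] with x hx
  rw [← P.sol_sub_eq_integral hsm hma (le_of_lt hx), sub_add_cancel]

/-- First order expansion of the solution, uniformly on compact time intervals. -/
lemma norm_sol_sub_sub_le {s m a b ε : ℝ} (hsm : s < m) (hma : m < a) (hε : 0 < ε) :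
    ∃ h₀, 0 < h₀ ∧ ∀ t ∈ Icc a b, ∀ h, 0 ≤ h → h ≤ h₀ →
      ‖P.system.sol (t + h) s - P.system.sol t s - h • P.rate t m s‖ ≤ ε * h := by
  have hc : ContinuousOn (fun t => P.rate t m s) (Icc a (b + 1)) :=
    (P.continuousOn_rate hsm.le).mono fun t ht => hma.trans_le ht.1
  have hu := isCompact_Icc.uniformContinuousOn_of_continuous hc
  rw [Metric.uniformContinuousOn_iff_le] at hu
  obtain ⟨δ, hδ, hu⟩ := hu ε hε
  refine ⟨min δ 1, by positivity, fun t ht h h0 h1 => ?_⟩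
  have hth : t ≤ t + h := by linarith
  have hint : IntervalIntegrable (fun t => P.rate t m s) volume t (t + h) := by
    refine ContinuousOn.intervalIntegrable ((P.continuousOn_rate hsm.le).mono ?_)
    rw [uIcc_of_le hth]
    exact fun r hr => hma.trans_le (ht.1.trans hr.1)
  have e : h • P.rate t m s = ∫ r in t..(t + h), P.rate t m s := by
    rw [intervalIntegral.integral_const, add_sub_cancel_left]
  rw [P.sol_sub_eq_integral hsm (hma.trans_le ht.1) hth, e,
    ← intervalIntegral.integral_sub hint intervalIntegrable_const]
  have := intervalIntegral.norm_integral_le_of_norm_le_const (a := t) (b := t + h) (C := ε)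
    (f := fun r => P.rate r m s - P.rate t m s) fun r hr => by
      rw [uIoc_of_le hth] at hr
      rw [← dist_eq_norm]
      refine hu r ⟨ht.1.trans hr.1.le, ?_⟩ t ⟨ht.1, by linarith [ht.2]⟩ ?_
      · linarith [hr.2, ht.2, min_le_right δ 1]
      · rw [Real.dist_eq, abs_of_pos (sub_pos.2 hr.1)]
        linarith [hr.2, min_le_left δ 1]
  rwa [add_sub_cancel_left, abs_of_nonneg h0] at this

end Coefficients

end FKTorus

end

/-! ### Existence and uniqueness of the solution operator. -/

noncomputable section

namespace FKTorus

open Set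
open scoped RealInnerProductSpace Interval

lemma GeneratorEq.sub {d : ℕ} {κ : ℝ} {b : ℝ → Torus d → Space d} {c : ℝ → Torus d → ℝ} {t : ℝ}
    {u f u' f' : L2Torus d} (h : GeneratorEq κ b c t u f) (h' : GeneratorEq κ b c t u' f') :
    GeneratorEq κ b c t (u - u') (f - f') := by
  obtain ⟨g, k, h1, h2, h3⟩ := h
  obtain ⟨g', k', h1', h2', h3'⟩ := h'
  refine ⟨fun i => g i - g' i, fun i j => k i j - k' i j, fun i => (h1 i).sub (h1' i),
    fun i j => (h2 i j).sub (h2' i j), ?_⟩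
  have e1 : ∀ᵐ x ∂torusMeasure d, ∀ i, (g i - g' i : L2Torus d) x = g i x - g' i x :=
    ae_all_iff.2 fun i => Lp.coeFn_sub _ _
  have e2 : ∀ᵐ x ∂torusMeasure d, ∀ i, (k i i - k' i i : L2Torus d) x = k i i x - k' i i x :=
    ae_all_iff.2 fun i => Lp.coeFn_sub _ _
  filter_upwards [h3, h3', e1, e2, Lp.coeFn_sub f f', Lp.coeFn_sub u u'] with x a1 a2 a3 a4 a5 a6
  simp only [a3, a4, a5, a6, Pi.sub_apply, a1, a2, mul_sub, Finset.sum_sub_distrib]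
  ring

namespace Coefficients

open FirstOrderSystem

variable {d : ℕ} (P : Coefficients d)

/-- The almost everywhere equation is turned into an identity in `L²`, of which inner products can
be taken. -/
lemma generatorEq_iff {t : ℝ} {u f : L2Torus d} : GeneratorEq P.κ P.b P.c t u f ↔
    ∃ (g : Fin d → L2Torus d) (h : Fin d → Fin d → L2Torus d),
      (∀ i, HasWeakPartial i u (g i)) ∧ (∀ i j, HasWeakPartial j (g i) (h i j)) ∧
      f = P.κ • ∑ i, h i i + ∑ i, (mulFun fun x => P.b t x i) (g i) + mulFun (P.c t) u := by
  refine exists₂_congr fun g h => and_congr_right fun _ => and_congr_right fun _ => ?_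
  have e1 : ∀ᵐ x ∂torusMeasure d, ∀ i, (mulFun fun x => P.b t x i) (g i) x = P.b t x i * g i x :=
    ae_all_iff.2 fun i => coeFn_mulFun ((P.b_smooth.apply i).smoothTest t).continuous _
  have e2 := coeFn_mulFun (P.c_smooth.smoothTest t).continuous u
  have e3 : (P.κ • ∑ i, h i i + ∑ i, (mulFun fun x => P.b t x i) (g i) + mulFun (P.c t) u :
      L2Torus d) =ᵐ[torusMeasure d]
      fun x => P.κ * ∑ i, h i i x + ∑ i, P.b t x i * g i x + P.c t x * u x := by
    filter_upwards [Lp.coeFn_add (P.κ • ∑ i, h i i + ∑ i, (mulFun fun x => P.b t x i) (g i))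
      (mulFun (P.c t) u), Lp.coeFn_add (P.κ • ∑ i, h i i) (∑ i, (mulFun fun x => P.b t x i) (g i)),
      Lp.coeFn_smul P.κ (∑ i, h i i), Lp.coeFn_finsetSum Finset.univ fun i => h i i,
      Lp.coeFn_finsetSum Finset.univ fun i => (mulFun fun x => P.b t x i) (g i), e1, e2]
      with x a1 a2 a3 a4 a5 a6 a7
    simp only [a1, a2, a3, a4, a5, a6, a7, Pi.add_apply, Pi.smul_apply, Finset.sum_apply, smul_eq_mul]
  constructor
  · intro H
    exact Lp.ext (EventuallyEq.trans H e3.symm)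
  · rintro rfl
    exact e3

lemma generatorEq_sol {s m t : ℝ} (hsm : s < m) (hmt : m < t) (w : L2Torus d) :
    GeneratorEq P.κ P.b P.c t (P.system.sol t s w) (P.rate t m s w) := by
  rw [generatorEq_iff]
  -- `hess j i` stands for `∂ⱼ∂ᵢ`; the indices are exchanged to match the order of differentiation
  -- in `GeneratorEq`.
  refine ⟨fun i => P.system.grad i t s w, fun i j => P.hess j i t m s w,
    fun i => P.hasWeakPartial_grad i (hsm.trans hmt) w,
    fun i j => P.hasWeakPartial_hess j i hsm hmt w, ?_⟩
  rw [rate, add_apply, smul_apply, P.source_apply (hsm.trans hmt), lap, _root_.sum_apply, add_assoc]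

/-- The solution operator. -/
def evol (t s : ℝ) : L2Torus d →L[ℝ] L2Torus d :=
  if t ≤ s then ContinuousLinearMap.id ℝ _ else P.system.sol t s

lemma evol_of_le {t s : ℝ} (h : t ≤ s) : P.evol t s = ContinuousLinearMap.id ℝ _ := if_pos h

lemma evol_of_lt {t s : ℝ} (h : s < t) : P.evol t s = P.system.sol t s := if_neg h.not_ge

/-- The solution differs from the strongly continuous semigroup by `O(√(t - s))`. -/
lemma tendsto_sol (s : ℝ) (w : L2Torus d) :
    Tendsto (fun t => P.system.sol t s w) (𝓝[>] s) (𝓝 w) := by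
  have hκ := P.κ_pos
  obtain ⟨C, hC, h⟩ := P.system.norm_sol_sub_le s 1
  have h1 : Tendsto (fun t => P.system.S (t - s) w) (𝓝[>] s) (𝓝 w) := by
    refine (tendsto_heat w).comp (tendsto_nhdsWithin_iff.2 ⟨?_, ?_⟩)
    · refine tendsto_nhdsWithin_of_tendsto_nhds ?_
      have : Continuous fun t => 2 * P.κ * (t - s) := by fun_prop
      simpa using this.tendsto s
    · filter_upwards [self_mem_nhdsWithin] with t ht
      have : 0 < t - s := sub_pos.2 ht
      show 0 ≤ 2 * P.κ * (t - s)
      positivity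
  have h2 : Tendsto (fun t => P.system.sol t s w - P.system.S (t - s) w) (𝓝[>] s) (𝓝 0) := by
    have h3 : Tendsto (fun t => C * √(t - s) * ‖w‖) (𝓝[>] s) (𝓝 0) := by
      refine tendsto_nhdsWithin_of_tendsto_nhds ?_
      have : Continuous fun t => C * √(t - s) * ‖w‖ := by fun_prop
      simpa using this.tendsto s
    refine squeeze_zero_norm' ?_ h3
    filter_upwards [Ioc_mem_nhdsGT (show s < s + 1 by linarith)] with t ht
    rw [← sub_apply]
    exact ContinuousLinearMap.le_of_opNorm_le _ (h t ht.1 ht.2) w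
  simpa using h2.add h1

theorem isSolutionOperator_evol : IsSolutionOperator P.κ P.b P.c P.evol where
  self_eq s _ := P.evol_of_le le_rfl
  comp_eq s r t _ hsr hrt := by
    rcases hsr.eq_or_lt with rfl | hsr
    · rw [P.evol_of_le (le_refl s)]; rfl
    rcases hrt.eq_or_lt with rfl | hrt
    · rw [P.evol_of_le (le_refl r)]; rfl
    rw [P.evol_of_lt hsr, P.evol_of_lt hrt, P.evol_of_lt (hsr.trans hrt),
      P.system.sol_restart hsr hrt]
  initial s _ w := by
    refine (P.tendsto_sol s w).congr' ?_
    filter_upwards [self_mem_nhdsWithin] with t ht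
    rw [P.evol_of_lt ht]
  evolution s t _ hst w := by
    -- Any restart time strictly between `s` and `t` would do.
    have h1 : s < (s + t) / 2 := by linarith
    have h2 : (s + t) / 2 < t := by linarith
    refine ⟨P.rate t ((s + t) / 2) s w, ?_, ?_⟩
    · rw [P.evol_of_lt hst]
      exact P.generatorEq_sol h1 h2 w
    · refine ((P.hasDerivAt_sol h1 h2).clm_apply (hasDerivAt_const t w)).congr_deriv ?_
        |>.congr_of_eventuallyEq ?_
      · simp
      · filter_upwards [Ioi_mem_nhds hst] with r hr
        rw [P.evol_of_lt hr]

/-- The energy estimate. -/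
lemma exists_energy_bound : ∃ C, 0 ≤ C ∧ ∀ (t : ℝ) (u f : L2Torus d),
    GeneratorEq P.κ P.b P.c t u f → ⟪f, u⟫ ≤ C * ‖u‖ ^ 2 := by
  have hκ := P.κ_pos
  obtain ⟨B, hB, hb⟩ := P.exists_bound_b_mulFun
  obtain ⟨C, hC, hc⟩ := P.c_smooth.exists_bound_mulFun P.T_pos P.c_periodic
  refine ⟨∑ _i : Fin d, B ^ 2 / (4 * P.κ) + C, by positivity, fun t u f h => ?_⟩
  obtain ⟨g, k, h1, h2, rfl⟩ := P.generatorEq_iff.1 h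
  rw [inner_add_left, inner_add_left, inner_smul_left, sum_inner, sum_inner]
  have e1 : ∀ i, ⟪k i i, u⟫ = -‖g i‖ ^ 2 := fun i => (h1 i).inner_second (h2 i i)
  -- Young's inequality, weighted so that the drift term is absorbed by the dissipation `-κ‖g i‖²`
  -- from `inner_second`.
  have e2 : ∀ i, ⟪(mulFun fun x => P.b t x i) (g i), u⟫ ≤
      B ^ 2 / (4 * P.κ) * ‖u‖ ^ 2 + P.κ * ‖g i‖ ^ 2 := by
    intro i
    have e3 : ⟪(mulFun fun x => P.b t x i) (g i), u⟫ ≤ B * ‖g i‖ * ‖u‖ :=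
      (real_inner_le_norm _ _).trans (mul_le_mul_of_nonneg_right
        (ContinuousLinearMap.le_of_opNorm_le _ (hb i t) _) (norm_nonneg _))
    have e4 : B ^ 2 / (4 * P.κ) * ‖u‖ ^ 2 + P.κ * ‖g i‖ ^ 2 - B * ‖g i‖ * ‖u‖ =
        (B * ‖u‖ - 2 * P.κ * ‖g i‖) ^ 2 / (4 * P.κ) := by
      field_simp
      ring
    have : 0 ≤ (B * ‖u‖ - 2 * P.κ * ‖g i‖) ^ 2 / (4 * P.κ) := by positivity
    linarith
  have e5 : ⟪mulFun (P.c t) u, u⟫ ≤ C * ‖u‖ ^ 2 := by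
    refine (real_inner_le_norm _ _).trans ?_
    rw [sq, ← mul_assoc]
    exact mul_le_mul_of_nonneg_right (ContinuousLinearMap.le_of_opNorm_le _ (hc t) _) (norm_nonneg _)
  have e6 := Finset.sum_le_sum fun i (_ : i ∈ Finset.univ) => e2 i
  rw [Finset.sum_add_distrib, ← Finset.sum_mul, ← Finset.mul_sum] at e6
  simp only [e1, Finset.sum_neg_distrib, conj_trivial]
  linarith

/-- Solution operators are unique. -/
theorem solutionOperator_unique {U U' : ℝ → ℝ → L2Torus d →L[ℝ] L2Torus d}
    (hU : IsSolutionOperator P.κ P.b P.c U) (hU' : IsSolutionOperator P.κ P.b P.c U')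
    {t : ℝ} (ht : 0 < t) : U t 0 = U' t 0 := by
  obtain ⟨C, hC, hE⟩ := P.exists_energy_bound
  ext1 w
  set D : ℝ → L2Torus d := fun r => U r 0 w - U' r 0 w with hD
  have hder : ∀ r, 0 < r → ∃ f, HasDerivAt D f r ∧ ⟪f, D r⟫ ≤ C * ‖D r‖ ^ 2 := by
    intro r hr
    obtain ⟨f, h1, h2⟩ := hU.evolution 0 r le_rfl hr w
    obtain ⟨f', h1', h2'⟩ := hU'.evolution 0 r le_rfl hr w
    exact ⟨f - f', h2.sub h2', hE r _ _ (h1.sub h1')⟩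
  choose! f hf1 hf2 using hder
  -- The energy bound makes this weighted square norm nonincreasing for `r > 0`. It tends to `0` at
  -- the initial time, so it vanishes.
  have hN : ∀ r, 0 < r → HasDerivAt (fun r => Real.exp (-(2 * C) * r) * ‖D r‖ ^ 2)
      (Real.exp (-(2 * C) * r) * (2 * (⟪f r, D r⟫ - C * ‖D r‖ ^ 2))) r := by
    intro r hr
    have h1 : HasDerivAt (fun r => Real.exp (-(2 * C) * r)) (Real.exp (-(2 * C) * r) * (-(2 * C))) r := by
      simpa using ((hasDerivAt_id r).const_mul (-(2 * C))).exp
    have h2 := (hf1 r hr).norm_sq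
    refine (h1.mul h2).congr_deriv ?_
    rw [real_inner_comm]
    ring
  have hanti : AntitoneOn (fun r => Real.exp (-(2 * C) * r) * ‖D r‖ ^ 2) (Ioi 0) := by
    refine antitoneOn_of_deriv_nonpos (convex_Ioi 0)
      (fun r hr => (hN r hr).continuousAt.continuousWithinAt) ?_ ?_
    · rw [interior_Ioi]
      exact fun r hr => (hN r hr).differentiableAt.differentiableWithinAt
    · rw [interior_Ioi]
      intro r hr
      rw [(hN r hr).deriv]
      exact mul_nonpos_of_nonneg_of_nonpos (Real.exp_pos _).le (by linarith [hf2 r hr])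
  have hlim : Tendsto (fun r => Real.exp (-(2 * C) * r) * ‖D r‖ ^ 2) (𝓝[>] 0) (𝓝 0) := by
    have h1 : Tendsto D (𝓝[>] 0) (𝓝 0) := by
      simpa using (hU.initial 0 le_rfl w).sub (hU'.initial 0 le_rfl w)
    have h2 : Tendsto (fun r => Real.exp (-(2 * C) * r)) (𝓝[>] (0:ℝ)) (𝓝 1) := by
      refine tendsto_nhdsWithin_of_tendsto_nhds ?_
      have : Continuous fun r : ℝ => Real.exp (-(2 * C) * r) := by fun_prop
      simpa using this.tendsto 0
    simpa using h2.mul (h1.norm.pow 2)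
  have hle : Real.exp (-(2 * C) * t) * ‖D t‖ ^ 2 ≤ 0 := by
    refine ge_of_tendsto hlim ?_
    filter_upwards [Ioc_mem_nhdsGT ht] with r hr
    exact hanti hr.1 ht hr.2
  have h0 : ‖D t‖ ^ 2 = 0 := by
    refine le_antisymm ?_ (sq_nonneg _)
    by_contra hne
    exact absurd hle (not_le.2 (mul_pos (Real.exp_pos _) (not_le.1 hne)))
  exact sub_eq_zero.1 (norm_eq_zero.1 (pow_eq_zero_iff two_ne_zero |>.1 h0))

end Coefficients

end FKTorus

end

/-! ### Gaussian upper bounds for products of steps with drift. -/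

noncomputable section

namespace FKTorus

open Set
open scoped ENNReal

section HeatE

variable {d : ℕ}

/-- The heat semigroup on nonnegative functions. -/
def hE (v : ℝ) (f : Torus d → ℝ≥0∞) (x : Torus d) : ℝ≥0∞ := ∫⁻ z, f (x + toTorus z) ∂gauss d v

lemma measurable_shift : Measurable fun p : Torus d × Space d => p.1 + toTorus p.2 :=
  (continuous_fst.add (continuous_toTorus.comp continuous_snd)).measurable

lemma measurable_shift_right (x : Torus d) : Measurable fun z : Space d => x + toTorus z :=
  (continuous_const.add continuous_toTorus).measurable

lemma measurable_comp_shift {f : Torus d → ℝ≥0∞} (hf : Measurable f) (x : Torus d) :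
    Measurable fun z : Space d => f (x + toTorus z) :=
  hf.comp (measurable_shift_right x)

lemma measurable_gk_mul (v : ℝ) {f : Torus d → ℝ≥0∞} (hf : Measurable f) (x : Torus d) :
    Measurable fun z : Space d => ENNReal.ofReal (gk v z) * f (x + toTorus z) :=
  (continuous_gk v).measurable.ennreal_ofReal.mul (measurable_comp_shift hf x)

lemma measurable_hE (v : ℝ) {f : Torus d → ℝ≥0∞} (hf : Measurable f) : Measurable (hE v f) :=
  (hf.comp measurable_shift).lintegral_prod_right'

lemma hE_mono (v : ℝ) {f g : Torus d → ℝ≥0∞} (h : ∀ x, f x ≤ g x) (x : Torus d) :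
    hE v f x ≤ hE v g x := lintegral_mono fun _ => h _

lemma hE_add (v : ℝ) {f g : Torus d → ℝ≥0∞} (hf : Measurable f) (x : Torus d) :
    hE v (fun y => f y + g y) x = hE v f x + hE v g x :=
  lintegral_add_left (hf.comp (measurable_shift_right x)) _

lemma hE_const_mul (v : ℝ) (c : ℝ≥0∞) {f : Torus d → ℝ≥0∞} (hf : Measurable f) (x : Torus d) :
    hE v (fun y => c * f y) x = c * hE v f x :=
  lintegral_const_mul _ (hf.comp (measurable_shift_right x))

lemma hE_zero (f : Torus d → ℝ≥0∞) : hE 0 f = f := by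
  ext x
  rw [hE, gauss_zero, lintegral_dirac, toTorus_zero, add_zero]

lemma hE_hE {s t : ℝ} (hs : 0 ≤ s) (ht : 0 ≤ t) {f : Torus d → ℝ≥0∞} (hf : Measurable f)
    (x : Torus d) : hE s (hE t f) x = hE (s + t) f x := by
  rw [hE, hE, ← gauss_conv hs ht, Measure.lintegral_conv (measurable_comp_shift hf x)]
  refine lintegral_congr fun z => ?_
  rw [hE]
  simp only [toTorus_add, add_assoc]

lemma hE_eq {v : ℝ} (hv : 0 < v) (f : Torus d → ℝ≥0∞) (hf : Measurable f) (x : Torus d) :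
    hE v f x = ∫⁻ z, ENNReal.ofReal (gk v z) * f (x + toTorus z) := by
  rw [hE, gauss_eq_withDensity hv, lintegral_withDensity_eq_lintegral_mul _
    (continuous_gk v).measurable.ennreal_ofReal (measurable_comp_shift hf x)]
  rfl

lemma hE_shift_eq {v : ℝ} (hv : 0 < v) (f : Torus d → ℝ≥0∞) (hf : Measurable f) (x : Torus d)
    (h : Space d) :
    hE v f (x + toTorus h) = ∫⁻ z, ENNReal.ofReal (gk v (z - h)) * f (x + toTorus z) := by
  rw [hE_eq hv f hf, ← lintegral_add_right_eq_self
    (fun z => ENNReal.ofReal (gk v (z - h)) * f (x + toTorus z)) h]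
  refine lintegral_congr fun z => ?_
  rw [add_sub_cancel_right, toTorus_add, add_assoc, add_comm (toTorus h)]

lemma lintegral_mul_gk_le {w A : ℝ} (hA : 0 ≤ A) {k : Space d → ℝ} (hw : 0 < w)
    (hk : ∀ z, k z ≤ A * gk w z) {f : Torus d → ℝ≥0∞} (hf : Measurable f) (x : Torus d) :
    ∫⁻ z, ENNReal.ofReal (k z) * f (x + toTorus z) ≤ ENNReal.ofReal A * hE w f x := by
  rw [hE_eq hw f hf, ← lintegral_const_mul _ (measurable_gk_mul w hf x)]
  refine lintegral_mono fun z => ?_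
  rw [← mul_assoc, ← ENNReal.ofReal_mul hA]
  gcongr
  exact hk z

/-- Shifting costs a constant and a larger variance. -/
lemma hE_shift_le {v : ℝ} (hv : 0 < v) {f : Torus d → ℝ≥0∞} (hf : Measurable f) (x : Torus d)
    (h : Space d) :
    hE v f (x + toTorus h) ≤
      ENNReal.ofReal (2 ^ d * Real.exp (‖h‖ ^ 2 / (4 * v))) * hE (4 * v) f x := by
  rw [hE_shift_eq hv f hf]
  exact lintegral_mul_gk_le (by positivity) (by positivity) (fun z => gk_shift_le hv z h) hf x

lemma hE_le_four {v : ℝ} (hv : 0 < v) {f : Torus d → ℝ≥0∞} (hf : Measurable f) (x : Torus d) :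
    hE v f x ≤ ENNReal.ofReal (2 ^ d) * hE (4 * v) f x := by
  rw [hE_eq hv f hf]
  exact lintegral_mul_gk_le (by positivity) (by positivity) (fun z => gk_le_four hv z) hf x

/-- The constant in the estimate for small shifts. -/
def shiftConst (d : ℕ) (L : ℝ) : ℝ := 2 ^ d * (2 * (2 + L) * Real.exp (L ^ 2 / 2))

lemma shiftConst_nonneg {L : ℝ} (hL : 0 ≤ L) : 0 ≤ shiftConst d L := by
  unfold shiftConst; positivity

lemma abs_gk_sub_le' {v L : ℝ} (hv : 0 < v) (hL : 0 ≤ L) (z h : Space d) (hh : ‖h‖ ≤ L * √v) :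
    |gk v (z - h) - gk v z| ≤ shiftConst d L * (‖h‖ / √v) * gk (4 * v) z := by
  refine (abs_gk_sub_le hv hL z h hh).trans (le_of_eq ?_)
  rw [shiftConst]; ring

/-- For shifts of size `O(√v)` the cost is additive and proportional to `‖h‖/√v`. Along many small
steps these costs can be summed, whereas the constant factor of `hE_shift_le` would be multiplied at
each step. -/
lemma hE_shift_le_add {v L : ℝ} (hv : 0 < v) (hL : 0 ≤ L) {f : Torus d → ℝ≥0∞} (hf : Measurable f)
    (x : Torus d) {h : Space d} (hh : ‖h‖ ≤ L * √v) :
    hE v f (x + toTorus h) ≤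
      hE v f x + ENNReal.ofReal (shiftConst d L * (‖h‖ / √v)) * hE (4 * v) f x := by
  have hC := shiftConst_nonneg (d := d) hL
  rw [hE_shift_eq hv f hf, hE_eq hv f hf, hE_eq (by positivity : 0 < 4 * v) f hf,
    ← lintegral_const_mul _ (measurable_gk_mul _ hf x), ← lintegral_add_left (measurable_gk_mul v hf x)]
  refine lintegral_mono fun z => ?_
  rw [← mul_assoc, ← ENNReal.ofReal_mul (by positivity), ← add_mul,
    ← ENNReal.ofReal_add (gk_nonneg _ _) (mul_nonneg (by positivity) (gk_nonneg _ _))]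
  gcongr
  have := (abs_le.1 (abs_gk_sub_le' hv hL z h hh)).2
  linarith

lemma lintegral_hE (v : ℝ) {f : Torus d → ℝ≥0∞} (hf : Measurable f) :
    ∫⁻ x, hE v f x ∂torusMeasure d = ∫⁻ x, f x ∂torusMeasure d := by
  unfold hE
  have hm : Measurable (Function.uncurry fun (x : Torus d) (z : Space d) => f (x + toTorus z)) :=
    hf.comp measurable_shift
  rw [lintegral_lintegral_swap hm.aemeasurable]
  have : ∀ z : Space d, ∫⁻ x, f (x + toTorus z) ∂torusMeasure d = ∫⁻ x, f x ∂torusMeasure d :=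
    fun z => lintegral_add_right_eq_self f (toTorus z)
  simp only [this, lintegral_const, measure_univ, mul_one]

lemma exists_toTorus_norm_le (x : Torus d) : ∃ w : Space d, toTorus w = x ∧ ‖w‖ ≤ √d := by
  obtain ⟨y, hy⟩ := surjective_toTorus x
  refine ⟨WithLp.toLp 2 fun i => Int.fract (y i), ?_, ?_⟩
  · rw [← hy]
    ext i
    simp only [toTorus]
    exact QuotientAddGroup.eq.2 ⟨⌊y i⌋, by
      change ⌊y i⌋ • (1:ℝ) = -Int.fract (y i) + y i
      rw [zsmul_one, Int.fract]; ring⟩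
  · rw [EuclideanSpace.norm_eq]
    refine Real.sqrt_le_sqrt ?_
    calc _ ≤ ∑ i : Fin d, (1:ℝ) := Finset.sum_le_sum fun i _ => by
          simp only [Real.norm_eq_abs, sq_abs]
          nlinarith [Int.fract_nonneg (y i), Int.fract_lt_one (y i)]
      _ = d := by simp

/-- Two points of the torus differ by a vector of length at most `√d`, so the shift estimate
compares all values, at the price of a larger variance. -/
lemma hE_le_hE (v : ℝ) (hv : 0 < v) {f : Torus d → ℝ≥0∞} (hf : Measurable f) (x x' : Torus d) :
    hE v f x ≤ ENNReal.ofReal (2 ^ d * Real.exp ((d : ℝ) / (4 * v))) * hE (4 * v) f x' := by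
  obtain ⟨w, hw, hn⟩ := exists_toTorus_norm_le (x - x')
  have h := hE_shift_le hv hf x' w
  rw [hw, add_sub_cancel] at h
  refine h.trans ?_
  gcongr
  calc ‖w‖ ^ 2 ≤ √(d : ℝ) ^ 2 := by gcongr
    _ = (d : ℝ) := Real.sq_sqrt (Nat.cast_nonneg d)

/-- Average `hE_le_hE` over the second point; the heat flow preserves the integral. -/
lemma hE_le_lintegral {v : ℝ} (hv : 0 < v) {f : Torus d → ℝ≥0∞} (hf : Measurable f) (x : Torus d) :
    hE v f x ≤ ENNReal.ofReal (2 ^ d * Real.exp (d / (4 * v))) * ∫⁻ y, f y ∂torusMeasure d := by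
  have h := lintegral_mono (μ := torusMeasure d) fun x' => hE_le_hE v hv hf x x'
  rwa [lintegral_const, measure_univ, mul_one, lintegral_const_mul _ (measurable_hE _ hf),
    lintegral_hE _ hf] at h

lemma lintegral_le_hE {v : ℝ} (hv : 0 < v) {f : Torus d → ℝ≥0∞} (hf : Measurable f) (x : Torus d) :
    ∫⁻ y, f y ∂torusMeasure d ≤ ENNReal.ofReal (2 ^ d * Real.exp (d / v)) * hE v f x := by
  have h := lintegral_mono (μ := torusMeasure d) fun x' =>
    hE_le_hE (v / 4) (by positivity) hf x' x
  rwa [lintegral_const, measure_univ, mul_one, lintegral_hE _ hf,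
    mul_div_cancel₀ v (by norm_num : (4:ℝ) ≠ 0)] at h

end HeatE

section Products

variable {d : ℕ}

/-- One step with drift `h` of a random walk with Gaussian increments of variance `v`. -/
def stepE (v : ℝ) (h : Torus d → Space d) (f : Torus d → ℝ≥0∞) (x : Torus d) : ℝ≥0∞ :=
  hE v f (x + toTorus (h x))

/-- Products of the operators `stepE`. -/
def prodE (v : ℝ) (h : ℕ → Torus d → Space d) : ℕ → (Torus d → ℝ≥0∞) → Torus d → ℝ≥0∞
  | 0, f => f
  | n + 1, f => stepE v (h n) (prodE v h n f)

lemma measurable_add_toTorus {h : Torus d → Space d} (hh : Measurable h) :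
    Measurable fun x => x + toTorus (h x) :=
  measurable_shift.comp (measurable_id.prodMk hh)

lemma measurable_stepE (v : ℝ) {h : Torus d → Space d} (hh : Measurable h) {f : Torus d → ℝ≥0∞}
    (hf : Measurable f) : Measurable (stepE v h f) :=
  (measurable_hE v hf).comp (measurable_add_toTorus hh)

variable {v : ℝ} {h : ℕ → Torus d → Space d}

lemma measurable_prodE (hh : ∀ j, Measurable (h j)) (n : ℕ) {f : Torus d → ℝ≥0∞}
    (hf : Measurable f) : Measurable (prodE v h n f) := by
  induction n with
  | zero => exact hf
  | succ n ih => exact measurable_stepE v (hh n) ih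

lemma prodE_mono (n : ℕ) {f g : Torus d → ℝ≥0∞} (hfg : ∀ x, f x ≤ g x) (x : Torus d) :
    prodE v h n f x ≤ prodE v h n g x := by
  induction n generalizing x with
  | zero => exact hfg x
  | succ n ih => exact hE_mono v ih _

lemma prodE_add (hh : ∀ j, Measurable (h j)) (n : ℕ) {f g : Torus d → ℝ≥0∞} (hf : Measurable f) :
    prodE v h n (fun y => f y + g y) = fun x => prodE v h n f x + prodE v h n g x := by
  induction n with
  | zero => rfl
  | succ n ih =>
    ext x
    simp only [prodE, stepE]
    rw [ih, hE_add v (measurable_prodE hh n hf)]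

lemma prodE_const_mul (hh : ∀ j, Measurable (h j)) (n : ℕ) (c : ℝ≥0∞) {f : Torus d → ℝ≥0∞}
    (hf : Measurable f) :
    prodE v h n (fun y => c * f y) = fun x => c * prodE v h n f x := by
  induction n with
  | zero => rfl
  | succ n ih =>
    ext x
    simp only [prodE, stepE]
    rw [ih, hE_const_mul v c (measurable_prodE hh n hf)]

/-- The recursion adds the outermost step, while telescoping has to expose the innermost one. -/
lemma prodE_succ' (n : ℕ) (f : Torus d → ℝ≥0∞) :
    prodE v h (n + 1) f = prodE v (fun j => h (j + 1)) n (stepE v (h 0) f) := by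
  induction n with
  | zero => rfl
  | succ n ih =>
    rw [prodE, ih]
    rfl

/-- Telescoping of a product of steps against the heat semigroup. -/
lemma prodE_le_telescope (hv : 0 < v) {L B : ℝ} (hL : 0 ≤ L) (hB : ∀ j x, ‖h j x‖ ≤ B)
    (hBL : B ≤ L * √v) (hh : ∀ j, Measurable (h j)) (n : ℕ) {f : Torus d → ℝ≥0∞}
    (hf : Measurable f) (i : ℕ) (hi : i ≤ n) (x : Torus d) :
    prodE v h n f x ≤ prodE v (fun j => h (j + i)) (n - i) (hE (i * v) f) x +
      ∑ l ∈ Finset.range i, ENNReal.ofReal (shiftConst d L * (B / √((l + 1 : ℕ) * v))) *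
        prodE v (fun j => h (j + (l + 1))) (n - (l + 1)) (hE (4 * ((l + 1 : ℕ) * v)) f) x := by
  induction i with
  | zero => simp [hE_zero]
  | succ i ih =>
    refine (ih (by omega)).trans ?_
    rw [Finset.sum_range_succ, add_comm (∑ l ∈ Finset.range i, _), ← add_assoc]
    gcongr
    obtain ⟨k, hk⟩ : ∃ k, n - i = k + 1 := ⟨n - i - 1, by omega⟩
    have hk' : n - (i + 1) = k := by omega
    rw [hk, hk', prodE_succ']
    have hvi : 0 < ((i + 1 : ℕ) : ℝ) * v := by positivity
    have hm : ∀ j, Measurable ((fun j => h (j + (i + 1))) j) := fun j => hh _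
    -- The step acts on an already smoothed function, so its drift is measured against the
    -- accumulated variance `(i + 1)v` and not against `v`.
    have e : ∀ y, stepE v (h (0 + i)) (hE (i * v) f) y ≤ hE ((i + 1 : ℕ) * v) f y +
        ENNReal.ofReal (shiftConst d L * (B / √((i + 1 : ℕ) * v))) *
          hE (4 * ((i + 1 : ℕ) * v)) f y := by
      intro y
      have hB0 : 0 ≤ B := (norm_nonneg _).trans (hB 0 y)
      rw [stepE, hE_hE hv.le (by positivity) hf,
        show v + i * v = ((i + 1 : ℕ) : ℝ) * v by push_cast; ring]
      refine (hE_shift_le_add hvi hL hf y (h := h (0 + i) y) ?_).trans ?_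
      · refine (hB _ y).trans (hBL.trans ?_)
        gcongr
        push_cast
        nlinarith [mul_nonneg (Nat.cast_nonneg (α := ℝ) i) hv.le]
      · have := shiftConst_nonneg (d := d) hL
        gcongr
        exact hB _ y
    refine (prodE_mono k e x).trans (le_of_eq ?_)
    have e2 : (fun j => (fun j => h (j + i)) (j + 1)) = fun j => h (j + (i + 1)) := by
      ext1 j
      simp only [add_assoc, add_comm 1 i]
    rw [e2, prodE_add hm k (measurable_hE _ hf), prodE_const_mul hm k _ (measurable_hE _ hf)]

/-- A Gaussian upper bound for products of steps. -/
lemma prodE_le (hv : 0 < v) (N : ℕ) {L B : ℝ} (hL : 0 ≤ L) (hBL : B ≤ L * √v) {A : ℕ → ℝ} (hA0 : 1 ≤ A 0)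
    (hA : ∀ n, 0 ≤ A n)
    (hAn : ∀ n, n ≤ N → 2 ^ d + ∑ l ∈ Finset.range n, shiftConst d L * (B / √((l + 1 : ℕ) * v)) *
      A (n - (l + 1)) ≤ A n) (n : ℕ) (hnN : n ≤ N) {f : Torus d → ℝ≥0∞} (hf : Measurable f)
    (hB : ∀ j x, ‖h j x‖ ≤ B) (hh : ∀ j, Measurable (h j)) (x : Torus d) :
    prodE v h n f x ≤ ENNReal.ofReal (A n) * hE (4 * (n * v)) f x := by
  have hB0 : 0 ≤ B := (norm_nonneg _).trans (hB 0 x)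
  have hC := shiftConst_nonneg (d := d) hL
  induction n using Nat.strong_induction_on generalizing h f x with
  | _ n ih =>
    rcases Nat.eq_zero_or_pos n with rfl | hn
    · simp only [prodE, Nat.cast_zero, zero_mul, mul_zero, hE_zero]
      calc f x = ENNReal.ofReal 1 * f x := by simp
        _ ≤ _ := by gcongr
    have h1 := prodE_le_telescope hv hL hB hBL hh n hf n le_rfl x
    rw [Nat.sub_self] at h1
    refine h1.trans ?_
    have hnv : 0 < (n : ℝ) * v := by positivity
    have h2 : prodE v (fun j => h (j + n)) 0 (hE (n * v) f) x ≤
        ENNReal.ofReal (2 ^ d) * hE (4 * (n * v)) f x := hE_le_four hnv hf x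
    have h3 : ∀ l ∈ Finset.range n, ENNReal.ofReal (shiftConst d L * (B / √((l + 1 : ℕ) * v))) *
        prodE v (fun j => h (j + (l + 1))) (n - (l + 1)) (hE (4 * ((l + 1 : ℕ) * v)) f) x ≤
        ENNReal.ofReal (shiftConst d L * (B / √((l + 1 : ℕ) * v)) * A (n - (l + 1))) *
          hE (4 * (n * v)) f x := by
      intro l hl
      rw [Finset.mem_range] at hl
      -- The inductive bound and the telescoping error both carry the factor four, so the variances
      -- add up to exactly `4 * (n * v)` and no loss accumulates.
      have h4 := ih (n - (l + 1)) (by omega) (by omega) (measurable_hE (4 * ((l + 1 : ℕ) * v)) hf)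
        (h := fun j => h (j + (l + 1))) (fun j => hB _) (fun j => hh _) x
      rw [hE_hE (by positivity) (by positivity) hf, ← mul_add, ← add_mul, ← Nat.cast_add,
        Nat.sub_add_cancel (by omega)] at h4
      rw [ENNReal.ofReal_mul (by positivity : 0 ≤ shiftConst d L * (B / √((l + 1 : ℕ) * v))), mul_assoc]
      gcongr
    refine (add_le_add h2 (Finset.sum_le_sum h3)).trans ?_
    rw [← Finset.sum_mul, ← add_mul, ← ENNReal.ofReal_sum_of_nonneg
      (fun l _ => mul_nonneg (by positivity) (hA _)), ← ENNReal.ofReal_add (by positivity)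
      (Finset.sum_nonneg fun l _ => mul_nonneg (by positivity) (hA _))]
    gcongr
    exact hAn n hnN

end Products

end FKTorus

end

/-! ### Discrete Gronwall inequality with a square root singularity. -/

noncomputable section

namespace FKTorus

open Set
open scoped ENNReal

section Gronwall

lemma sum_inv_sqrt_le (n : ℕ) : ∑ l ∈ Finset.range n, 1 / √((l + 1 : ℕ) : ℝ) ≤ 2 * √n := by
  induction n with
  | zero => simp
  | succ n ih =>
    rw [Finset.sum_range_succ]
    have h1 : 0 < √((n + 1 : ℕ) : ℝ) := Real.sqrt_pos.2 (by positivity)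
    have h2 : 0 ≤ √(n : ℝ) := Real.sqrt_nonneg _
    have h3 : √((n + 1 : ℕ) : ℝ) ^ 2 = n + 1 := by rw [Real.sq_sqrt (by positivity)]; push_cast; ring
    have h4 : √(n : ℝ) ^ 2 = n := Real.sq_sqrt (by positivity)
    have h5 : 1 / √((n + 1 : ℕ) : ℝ) ≤ 2 * (√((n + 1 : ℕ) : ℝ) - √(n : ℝ)) := by
      rw [div_le_iff₀ h1]
      nlinarith [sq_nonneg (√((n + 1 : ℕ) : ℝ) - √(n : ℝ))]
    linarith

lemma sum_step_div_sqrt_le {Δ : ℝ} (hΔ : 0 < Δ) (n : ℕ) :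
    ∑ l ∈ Finset.range n, Δ / √((l + 1 : ℕ) * Δ) ≤ 2 * √(n * Δ) := by
  have hs : 0 < √Δ := Real.sqrt_pos.2 hΔ
  have e : ∀ l : ℕ, Δ / √((l + 1 : ℕ) * Δ) = √Δ * (1 / √((l + 1 : ℕ) : ℝ)) := by
    intro l
    have h1 : 0 < √((l + 1 : ℕ) : ℝ) := Real.sqrt_pos.2 (by positivity)
    rw [Real.sqrt_mul (by positivity)]
    have h2 : √Δ ^ 2 = Δ := Real.sq_sqrt hΔ.le
    field_simp
    rw [h2]
  simp only [e]
  rw [← Finset.mul_sum, Real.sqrt_mul (by positivity)]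
  calc √Δ * _ ≤ √Δ * (2 * √n) := mul_le_mul_of_nonneg_left (sum_inv_sqrt_le n) hs.le
    _ = _ := by ring

/-- Weights for the discrete Gronwall lemma with a square root singularity. -/
lemma exists_discrete_weight (C T : ℝ) (hC : 0 ≤ C) :
    ∃ θ : ℝ, 0 ≤ θ ∧ ∀ (Δ : ℝ), 0 < Δ → ∀ n : ℕ, n * Δ ≤ T →
      ∑ l ∈ Finset.range n, C * (Δ / √((l + 1 : ℕ) * Δ)) * Real.exp (-(θ * ((l + 1 : ℕ) * Δ))) ≤
        1 / 2 := by
  -- Terms with `(l + 1)Δ ≤ δ` contribute little because `Δ/√((l + 1)Δ)` sums to at most `2√δ` over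
  -- them; the exponential weight handles the remaining terms.
  obtain ⟨δ, hδ, hδC⟩ : ∃ δ : ℝ, 0 < δ ∧ C * (2 * √δ) ≤ 1 / 4 := by
    refine ⟨(1 / (8 * (C + 1))) ^ 2, by positivity, ?_⟩
    rw [Real.sqrt_sq (by positivity)]
    rw [show C * (2 * (1 / (8 * (C + 1)))) = (1 / 4) * (C / (C + 1)) by field_simp; ring]
    have : C / (C + 1) ≤ 1 := by rw [div_le_one (by positivity)]; linarith
    linarith
  -- With this `θ` the exponent `θ * δ` is `8C√T`, and `exp x ≥ x + 1` suffices.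
  obtain ⟨θ, hθ, hθT⟩ : ∃ θ : ℝ, 0 ≤ θ ∧ C * (2 * √T) * Real.exp (-(θ * δ)) ≤ 1 / 4 := by
    refine ⟨8 * (C * √T) / δ, by positivity, ?_⟩
    rw [div_mul_cancel₀ _ hδ.ne', Real.exp_neg, ← div_eq_mul_inv, div_le_iff₀ (Real.exp_pos _)]
    have := Real.add_one_le_exp (8 * (C * √T))
    linarith
  refine ⟨θ, hθ, fun Δ hΔ n hn => ?_⟩
  rw [← Finset.sum_filter_add_sum_filter_not (Finset.range n) fun l => ((l + 1 : ℕ) : ℝ) * Δ ≤ δ]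
  have h1 : ∑ l ∈ Finset.range n with ((l + 1 : ℕ) : ℝ) * Δ ≤ δ,
      C * (Δ / √((l + 1 : ℕ) * Δ)) * Real.exp (-(θ * ((l + 1 : ℕ) * Δ))) ≤ 1 / 4 := by
    set k := ⌊δ / Δ⌋₊ with hk
    have hsub : (Finset.range n).filter (fun l => ((l + 1 : ℕ) : ℝ) * Δ ≤ δ) ⊆ Finset.range k := by
      intro l hl
      rw [Finset.mem_filter] at hl
      rw [Finset.mem_range, hk]
      exact Nat.lt_of_succ_le ((Nat.le_floor_iff (by positivity)).2 (by
        rw [le_div_iff₀ hΔ]; exact hl.2))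
    calc _ ≤ ∑ l ∈ Finset.range n with ((l + 1 : ℕ) : ℝ) * Δ ≤ δ, C * (Δ / √((l + 1 : ℕ) * Δ)) := by
          refine Finset.sum_le_sum fun l _ => mul_le_of_le_one_right (by positivity) ?_
          rw [Real.exp_le_one_iff, neg_nonpos]
          positivity
      _ ≤ ∑ l ∈ Finset.range k, C * (Δ / √((l + 1 : ℕ) * Δ)) :=
          Finset.sum_le_sum_of_subset_of_nonneg hsub fun l _ _ => by positivity
      _ ≤ C * (2 * √(k * Δ)) := by
          rw [← Finset.mul_sum]
          exact mul_le_mul_of_nonneg_left (sum_step_div_sqrt_le hΔ k) hC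
      _ ≤ C * (2 * √δ) := by
          gcongr
          rw [← le_div_iff₀ hΔ]
          exact Nat.floor_le (by positivity)
      _ ≤ 1 / 4 := hδC
  have h2 : ∑ l ∈ Finset.range n with ¬((l + 1 : ℕ) : ℝ) * Δ ≤ δ,
      C * (Δ / √((l + 1 : ℕ) * Δ)) * Real.exp (-(θ * ((l + 1 : ℕ) * Δ))) ≤ 1 / 4 := by
    calc _ ≤ ∑ l ∈ Finset.range n with ¬((l + 1 : ℕ) : ℝ) * Δ ≤ δ,
          C * (Δ / √((l + 1 : ℕ) * Δ)) * Real.exp (-(θ * δ)) := by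
          refine Finset.sum_le_sum fun l hl => ?_
          rw [Finset.mem_filter, not_le] at hl
          have := hl.2.le
          gcongr
      _ ≤ ∑ l ∈ Finset.range n, C * (Δ / √((l + 1 : ℕ) * Δ)) * Real.exp (-(θ * δ)) :=
          Finset.sum_le_sum_of_subset_of_nonneg (Finset.filter_subset _ _) fun l _ _ => by positivity
      _ ≤ C * (2 * √T) * Real.exp (-(θ * δ)) := by
          rw [← Finset.sum_mul, ← Finset.mul_sum]
          gcongr
          refine (sum_step_div_sqrt_le hΔ n).trans ?_
          gcongr
      _ ≤ 1 / 4 := hθT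
  linarith

/-- The discrete Gronwall recursion. -/
lemma exists_gronwall (C T a : ℝ) (hC : 0 ≤ C) (hT : 0 ≤ T) (ha : 1 ≤ a) :
    ∃ A : ℝ, 1 ≤ A ∧ ∀ (Δ : ℝ), 0 < Δ → ∃ F : ℕ → ℝ, 1 ≤ F 0 ∧ (∀ n, 0 ≤ F n) ∧
      (∀ n : ℕ, n * Δ ≤ T → F n ≤ A) ∧ ∀ n : ℕ, n * Δ ≤ T →
        a + ∑ l ∈ Finset.range n, C * (Δ / √((l + 1 : ℕ) * Δ)) * F (n - (l + 1)) ≤ F n := by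
  obtain ⟨θ, hθ, h⟩ := exists_discrete_weight C T hC
  -- Of `F n = 2a exp(θnΔ)` one half pays for `a` and the other half for the convolution sum.
  refine ⟨2 * a * Real.exp (θ * T), ?_, fun Δ hΔ => ⟨fun n => 2 * a * Real.exp (θ * (n * Δ)), ?_, ?_,
    ?_, fun n hn => ?_⟩⟩
  · have : 1 ≤ Real.exp (θ * T) := Real.one_le_exp (by positivity)
    nlinarith
  · simp; linarith
  · intro n; positivity
  · intro n hn
    change 2 * a * Real.exp (θ * (n * Δ)) ≤ _
    gcongr
  have h1 := h Δ hΔ n hn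
  have e : ∀ l ∈ Finset.range n, C * (Δ / √((l + 1 : ℕ) * Δ)) *
      (2 * a * Real.exp (θ * ((n - (l + 1) : ℕ) * Δ))) = (2 * a * Real.exp (θ * (n * Δ))) *
        (C * (Δ / √((l + 1 : ℕ) * Δ)) * Real.exp (-(θ * ((l + 1 : ℕ) * Δ)))) := by
    intro l hl
    rw [Finset.mem_range] at hl
    rw [Nat.cast_sub (by omega), show θ * (((n : ℝ) - ((l + 1 : ℕ) : ℝ)) * Δ) =
      θ * (n * Δ) + -(θ * ((l + 1 : ℕ) * Δ)) by ring, Real.exp_add]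
    ring
  rw [Finset.sum_congr rfl e, ← Finset.mul_sum]
  have h2 : 1 ≤ Real.exp (θ * (n * Δ)) := Real.one_le_exp (by positivity)
  nlinarith [mul_le_mul_of_nonneg_left h1 (by positivity : 0 ≤ 2 * a * Real.exp (θ * (n * Δ)))]

end Gronwall

/-! ### Uniform Gaussian upper bound and the Cauchy–Schwarz comparison of opposite drifts. -/

section Bounds

variable {d : ℕ}

/-- The Gaussian upper bound with a constant that is uniform in the step size. -/
lemma exists_prodE_le (d : ℕ) (κ B T : ℝ) (hκ : 0 < κ) (hB : 0 ≤ B) (hT : 0 < T) :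
    ∃ A : ℝ, 1 ≤ A ∧ ∀ (Δ : ℝ), 0 < Δ → ∀ n : ℕ, n * Δ ≤ T →
      ∀ (h : ℕ → Torus d → Space d), (∀ j x, ‖h j x‖ ≤ B * Δ) → (∀ j, Measurable (h j)) →
      ∀ (f : Torus d → ℝ≥0∞), Measurable f → ∀ x,
        prodE (2 * κ * Δ) h n f x ≤ ENNReal.ofReal A * hE (4 * (n * (2 * κ * Δ))) f x := by
  -- Chosen so that `BΔ ≤ L√(2κΔ)` for all `Δ ≤ T`: drifts are of order `Δ`, diffusive increments of
  -- order `√Δ`.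
  set L := B * √T / √(2 * κ) with hL
  have hκ2 : 0 < √(2 * κ) := Real.sqrt_pos.2 (by positivity)
  have hL0 : 0 ≤ L := by positivity
  have hS := shiftConst_nonneg (d := d) hL0
  obtain ⟨A, hA, hG⟩ := exists_gronwall (shiftConst d L * (B / √(2 * κ))) T (2 ^ d) (by positivity)
    hT.le (one_le_pow₀ (by norm_num))
  refine ⟨A, hA, fun Δ hΔ n hn h hb hm f hf x => ?_⟩
  rcases Nat.eq_zero_or_pos n with rfl | hn0
  · simp only [prodE, Nat.cast_zero, zero_mul, mul_zero, hE_zero]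
    calc f x = ENNReal.ofReal 1 * f x := by simp
      _ ≤ _ := by gcongr
  obtain ⟨F, hF0, hFn, hFA, hF⟩ := hG Δ hΔ
  have hΔT : Δ ≤ T := by
    have : (1:ℝ) ≤ n := by exact_mod_cast hn0
    nlinarith
  have hv : 0 < 2 * κ * Δ := by positivity
  have hsq : √(2 * κ * Δ) = √(2 * κ) * √Δ := Real.sqrt_mul (by positivity) _
  have hBL : B * Δ ≤ L * √(2 * κ * Δ) := by
    rw [hsq, hL]
    calc B * Δ = B * (√Δ * √Δ) := by rw [Real.mul_self_sqrt hΔ.le]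
      _ ≤ B * (√T * √Δ) := by gcongr
      _ = _ := by field_simp
  have key := prodE_le (h := h) hv n hL0 hBL hF0 hFn (fun m hm => ?_) n le_rfl hf hb hm x
  · refine key.trans ?_
    gcongr
    exact hFA n hn
  · have hmT : m * Δ ≤ T := le_trans (by gcongr) hn
    refine le_trans (le_of_eq ?_) (hF m hmT)
    congr 1
    refine Finset.sum_congr rfl fun l _ => ?_
    have h1 : 0 < √((l + 1 : ℕ) * Δ) := Real.sqrt_pos.2 (by positivity)
    rw [show ((l + 1 : ℕ) : ℝ) * (2 * κ * Δ) = 2 * κ * ((l + 1 : ℕ) * Δ) by ring,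
      Real.sqrt_mul (by positivity)]
    field_simp

/-- By `gk_sq` the centred Gaussian is the geometric mean of its shifts by `h x` and `-h x`, up to a
factor `exp (‖h x‖²/(2v))`. Cauchy–Schwarz in `z` then separates the two drifts. -/
lemma stepE_cauchySchwarz {v B : ℝ} (hv : 0 < v) {h : Torus d → Space d} {F G G' : Torus d → ℝ≥0∞}
    (hF : Measurable F) (hG : Measurable G) (hG' : Measurable G') (x : Torus d) (hB : ‖h x‖ ≤ B)
    (hFG : ∀ y, F y ≤ G y ^ (1 / 2 : ℝ) * G' y ^ (1 / 2 : ℝ)) :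
    hE v F x ≤ ENNReal.ofReal (Real.exp (B ^ 2 / v / 2)) *
      (stepE v h G x ^ (1 / 2 : ℝ) * stepE v (fun x => -h x) G' x ^ (1 / 2 : ℝ)) := by
  have hm : ∀ (w : Space d) {G : Torus d → ℝ≥0∞}, Measurable G → Measurable fun z : Space d =>
      ENNReal.ofReal (gk v (z - w)) * G (x + toTorus z) := fun w G hG =>
    ((continuous_gk v).comp (continuous_sub_right w)).measurable.ennreal_ofReal.mul
      (measurable_comp_shift hG x)
  rw [stepE, stepE, hE_shift_eq hv G hG, hE_shift_eq hv G' hG', hE_eq hv F hF]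
  have hpt : ∀ z : Space d, ENNReal.ofReal (gk v z) * F (x + toTorus z) ≤
      ENNReal.ofReal (Real.exp (B ^ 2 / v / 2)) *
        ((ENNReal.ofReal (gk v (z - h x)) * G (x + toTorus z)) ^ (1 / 2 : ℝ) *
          (ENNReal.ofReal (gk v (z - -h x)) * G' (x + toTorus z)) ^ (1 / 2 : ℝ)) := by
    intro z
    have h1 := gk_nonneg v (z - h x)
    have h2 := gk_nonneg v (z - -h x)
    have e1 : gk v z ≤ Real.exp (B ^ 2 / v / 2) *
        (gk v (z - h x) ^ (1 / 2 : ℝ) * gk v (z - -h x) ^ (1 / 2 : ℝ)) := by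
      refine (sq_le_sq₀ (gk_nonneg v z) (by positivity)).1 ?_
      rw [gk_sq hv z (h x), ← Real.sqrt_eq_rpow, ← Real.sqrt_eq_rpow, mul_pow, mul_pow,
        Real.sq_sqrt h1, Real.sq_sqrt h2, ← Real.exp_nat_mul, sub_neg_eq_add, mul_comm]
      rw [sub_neg_eq_add] at h2
      refine mul_le_mul_of_nonneg_right (Real.exp_le_exp.2 ?_) (mul_nonneg h1 h2)
      rw [Nat.cast_ofNat, mul_div_cancel₀ _ (two_ne_zero' ℝ)]
      gcongr
    calc _ ≤ ENNReal.ofReal (Real.exp (B ^ 2 / v / 2) *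
        (gk v (z - h x) ^ (1 / 2 : ℝ) * gk v (z - -h x) ^ (1 / 2 : ℝ))) *
          (G (x + toTorus z) ^ (1 / 2 : ℝ) * G' (x + toTorus z) ^ (1 / 2 : ℝ)) := by
          gcongr
          exact hFG _
      _ = _ := by
          rw [ENNReal.ofReal_mul (by positivity), ENNReal.ofReal_mul (by positivity),
            ENNReal.mul_rpow_of_nonneg _ _ (by norm_num), ENNReal.mul_rpow_of_nonneg _ _ (by norm_num),
            ENNReal.ofReal_rpow_of_nonneg h1 (by norm_num),
            ENNReal.ofReal_rpow_of_nonneg h2 (by norm_num)]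
          ring
  refine (lintegral_mono hpt).trans ?_
  rw [lintegral_const_mul' _ _ ENNReal.ofReal_ne_top]
  gcongr
  have := ENNReal.lintegral_mul_le_Lp_mul_Lq (volume : Measure (Space d)) Real.HolderConjugate.two_two
    ((hm (h x) hG).pow_const (1 / 2 : ℝ)).aemeasurable
    ((hm (-h x) hG').pow_const (1 / 2 : ℝ)).aemeasurable
  simp only [← ENNReal.rpow_mul] at this
  norm_num at this ⊢
  exact this

/-- Iterating the comparison accumulates `exp (nB²/(2v))`, which stays bounded when `B` is of order
`v` and `nv` is bounded. An upper bound for the drift `-h` thereby becomes a lower bound for the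
drift `h`. -/
lemma hE_le_sqrt_prodE {v B : ℝ} (hv : 0 < v) {h : ℕ → Torus d → Space d}
    (hB : ∀ j x, ‖h j x‖ ≤ B) (hh : ∀ j, Measurable (h j)) {f : Torus d → ℝ≥0∞} (hf : Measurable f)
    (n : ℕ) (x : Torus d) :
    hE (n * v) f x ≤ ENNReal.ofReal (Real.exp (n * (B ^ 2 / v / 2))) *
      (prodE v h n f x ^ (1 / 2 : ℝ) * prodE v (fun j x => -h j x) n f x ^ (1 / 2 : ℝ)) := by
  induction n generalizing x with
  | zero =>
    simp only [Nat.cast_zero, zero_mul, hE_zero, Real.exp_zero, ENNReal.ofReal_one, one_mul, prodE]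
    rw [← ENNReal.rpow_add_of_nonneg _ _ (by norm_num) (by norm_num)]
    norm_num
  | succ n ih =>
    have hh' : ∀ j, Measurable fun x => -h j x := fun j => (hh j).neg
    have e : ((n + 1 : ℕ) : ℝ) * v = v + n * v := by push_cast; ring
    rw [e, ← hE_hE hv.le (by positivity) hf]
    have h1 : ∀ y, hE (n * v) f y ≤
        (ENNReal.ofReal (Real.exp (n * (B ^ 2 / v / 2))) * prodE v h n f y) ^ (1 / 2 : ℝ) *
        (ENNReal.ofReal (Real.exp (n * (B ^ 2 / v / 2))) *
          prodE v (fun j x => -h j x) n f y) ^ (1 / 2 : ℝ) := by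
      intro y
      refine (ih y).trans (le_of_eq ?_)
      rw [ENNReal.mul_rpow_of_nonneg _ _ (by norm_num), ENNReal.mul_rpow_of_nonneg _ _ (by norm_num),
        mul_mul_mul_comm, ← ENNReal.rpow_add_of_nonneg _ _ (by norm_num) (by norm_num)]
      norm_num
    have h2 := stepE_cauchySchwarz (B := B) (h := h n) hv (measurable_hE _ hf)
      ((measurable_prodE hh n hf).const_mul _) ((measurable_prodE hh' n hf).const_mul _) x (hB n x) h1
    refine h2.trans (le_of_eq ?_)
    rw [stepE, stepE, hE_const_mul _ _ (measurable_prodE hh n hf),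
      hE_const_mul _ _ (measurable_prodE hh' n hf), ENNReal.mul_rpow_of_nonneg _ _ (by norm_num),
      ENNReal.mul_rpow_of_nonneg _ _ (by norm_num), mul_mul_mul_comm (_ ^ (1 / 2 : ℝ)),
      ← ENNReal.rpow_add_of_nonneg _ _ (by norm_num) (by norm_num), ← mul_assoc,
      show (1 / 2 + 1 / 2 : ℝ) = 1 by norm_num, ENNReal.rpow_one,
      ← ENNReal.ofReal_mul (Real.exp_pos _).le, ← Real.exp_add,
      show B ^ 2 / v / 2 + n * (B ^ 2 / v / 2) = ((n + 1 : ℕ) : ℝ) * (B ^ 2 / v / 2) by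
        push_cast; ring]
    rfl

end Bounds

end FKTorus

end

/-! ### Uniform minorization and boundedness of the discretized operators. -/

noncomputable section

namespace FKTorus

open Set
open scoped ENNReal

section Steps

variable {d : ℕ} {κ Δ : ℝ} {b : ℝ → Torus d → Space d} {c : ℝ → Torus d → ℝ}

lemma measurableEmbedding_sqrt_smul {v : ℝ} (hv : 0 < v) :
    MeasurableEmbedding fun ζ : Space d => √v • ζ :=
  (Homeomorph.smulOfNeZero (√v) (Real.sqrt_pos.2 hv).ne').measurableEmbedding

lemma stepOp_eq (hκ : 0 < κ) (hΔ : 0 < Δ) (t : ℝ) (φ : Torus d → ℝ) (x : Torus d) :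
    stepOp κ b c Δ t φ x = ∫ z, Real.exp (Δ * c t (x + toTorus (Δ • b t x) + toTorus z)) *
      φ (x + toTorus (Δ • b t x) + toTorus z) ∂gauss d (2 * κ * Δ) := by
  rw [gauss, (measurableEmbedding_sqrt_smul (by positivity)).integral_map, stepOp, transitionOp]
  simp only [eulerStep, toTorus_add, add_assoc]

lemma ae_gauss_shift {v : ℝ} (hv : 0 < v) (x : Torus d) {p : Torus d → Prop}
    (h : ∀ᵐ y ∂torusMeasure d, p y) : ∀ᵐ z ∂gauss d v, p (x + toTorus z) := by
  have h1 := (quasiMeasurePreserving_shift x).ae h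
  rw [gauss_eq_withDensity hv]
  exact (withDensity_absolutelyContinuous _ _).ae_le h1

lemma stepOp_congr_ae (hκ : 0 < κ) (hΔ : 0 < Δ) (t : ℝ) {φ ψ : Torus d → ℝ}
    (h : φ =ᵐ[torusMeasure d] ψ) : stepOp κ b c Δ t φ = stepOp κ b c Δ t ψ := by
  ext x
  rw [stepOp_eq hκ hΔ, stepOp_eq hκ hΔ]
  refine integral_congr_ae ?_
  filter_upwards [ae_gauss_shift (by positivity : 0 < 2 * κ * Δ) (x + toTorus (Δ • b t x)) h]
    with z hz
  rw [hz]

/-- A Gaussian step has a density and does not see null sets; at least one step is needed, hence `n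
+ 1`. -/
lemma stepProd_congr_ae (hκ : 0 < κ) (hΔ : 0 < Δ) {φ ψ : Torus d → ℝ}
    (h : φ =ᵐ[torusMeasure d] ψ) (n : ℕ) :
    stepProd κ b c Δ (n + 1) φ = stepProd κ b c Δ (n + 1) ψ := by
  induction n with
  | zero => exact stepOp_congr_ae hκ hΔ _ h
  | succ n ih => rw [stepProd, ih]; rfl

/-- Comparison of the discretized operators with products of steps without potential. -/
lemma stepProd_bounds (hκ : 0 < κ) (hΔ : 0 < Δ) (hb : ∀ t, Continuous (b t))
    (hc : ∀ t, Continuous (c t)) {C : ℝ} (hC : ∀ t x, |c t x| ≤ C) {φ : Torus d → ℝ}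
    (hφ : Measurable φ) (hφ0 : ∀ x, 0 ≤ φ x)
    (hfin : ∀ n x, prodE (2 * κ * Δ) (fun j x => Δ • b (j * Δ) x) (n + 1)
      (fun y => ENNReal.ofReal (φ y)) x ≠ ⊤) (n : ℕ) :
    Measurable (stepProd κ b c Δ n φ) ∧ (∀ x, 0 ≤ stepProd κ b c Δ n φ x) ∧ ∀ x,
      ENNReal.ofReal (Real.exp (-(n * (Δ * C)))) * prodE (2 * κ * Δ) (fun j x => Δ • b (j * Δ) x) n
        (fun y => ENNReal.ofReal (φ y)) x ≤ ENNReal.ofReal (stepProd κ b c Δ n φ x) ∧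
      ENNReal.ofReal (stepProd κ b c Δ n φ x) ≤ ENNReal.ofReal (Real.exp (n * (Δ * C))) *
        prodE (2 * κ * Δ) (fun j x => Δ • b (j * Δ) x) n (fun y => ENNReal.ofReal (φ y)) x := by
  induction n with
  | zero => exact ⟨hφ, hφ0, fun x => by simp [stepProd, prodE]⟩
  | succ n ih =>
    obtain ⟨h1, h2, h3⟩ := ih
    set f : Torus d → ℝ≥0∞ := fun y => ENNReal.ofReal (φ y) with hf
    set ψ := stepProd κ b c Δ n φ with hψ
    set pE := prodE (2 * κ * Δ) (fun j x => Δ • b (j * Δ) x) n f with hpE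
    have hbm : Measurable fun x => Δ • b (n * Δ) x := ((hb _).const_smul Δ).measurable
    have hF : Measurable fun y => Real.exp (Δ * c (n * Δ) y) * ψ y :=
      (Real.continuous_exp.comp ((hc _).const_mul Δ |>.congr fun _ => rfl)).measurable.mul h1
    have hF0 : ∀ y, 0 ≤ Real.exp (Δ * c (n * Δ) y) * ψ y :=
      fun y => mul_nonneg (Real.exp_pos _).le (h2 y)
    have hE1 : ∀ x, Real.exp (-(Δ * C)) ≤ Real.exp (Δ * c (n * Δ) x) := fun x => by
      rw [Real.exp_le_exp, ← mul_neg]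
      exact mul_le_mul_of_nonneg_left (abs_le.1 (hC _ x)).1 hΔ.le
    have hE2 : ∀ x, Real.exp (Δ * c (n * Δ) x) ≤ Real.exp (Δ * C) := fun x => by
      rw [Real.exp_le_exp]
      exact mul_le_mul_of_nonneg_left (abs_le.1 (hC _ x)).2 hΔ.le
    set G : Torus d → ℝ≥0∞ := fun y => ENNReal.ofReal (Real.exp (Δ * c (n * Δ) y) * ψ y) with hG
    have hlow : ∀ y, ENNReal.ofReal (Real.exp (-((n + 1 : ℕ) * (Δ * C)))) * pE y ≤ G y := by
      intro y
      rw [show -(((n + 1 : ℕ) : ℝ) * (Δ * C)) = -(Δ * C) + -(n * (Δ * C)) by push_cast; ring,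
        Real.exp_add, ENNReal.ofReal_mul (Real.exp_pos _).le, mul_assoc]
      simp only [hG]
      rw [ENNReal.ofReal_mul (Real.exp_pos _).le]
      exact mul_le_mul' (ENNReal.ofReal_le_ofReal (hE1 y)) (h3 y).1
    have hup : ∀ y, G y ≤ ENNReal.ofReal (Real.exp ((n + 1 : ℕ) * (Δ * C))) * pE y := by
      intro y
      rw [show ((n + 1 : ℕ) : ℝ) * (Δ * C) = Δ * C + n * (Δ * C) by push_cast; ring,
        Real.exp_add, ENNReal.ofReal_mul (Real.exp_pos _).le, mul_assoc]
      simp only [hG]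
      rw [ENNReal.ofReal_mul (Real.exp_pos _).le]
      exact mul_le_mul' (ENNReal.ofReal_le_ofReal (hE2 y)) (h3 y).2
    have hstep : ∀ c' : ℝ≥0∞, c' ≠ ⊤ → ∀ x,
        stepE (2 * κ * Δ) (fun x => Δ • b (n * Δ) x) (fun y => c' * pE y) x =
        c' * prodE (2 * κ * Δ) (fun j x => Δ • b (j * Δ) x) (n + 1) f x := by
      intro c' hc' x
      exact lintegral_const_mul' _ _ hc'
    have hGle : ∀ x, stepE (2 * κ * Δ) (fun x => Δ • b (n * Δ) x) G x ≤
        ENNReal.ofReal (Real.exp ((n + 1 : ℕ) * (Δ * C))) *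
          prodE (2 * κ * Δ) (fun j x => Δ • b (j * Δ) x) (n + 1) f x := fun x => by
      rw [← hstep _ ENNReal.ofReal_ne_top]
      exact hE_mono _ hup _
    have hGge : ∀ x, ENNReal.ofReal (Real.exp (-((n + 1 : ℕ) * (Δ * C)))) *
          prodE (2 * κ * Δ) (fun j x => Δ • b (j * Δ) x) (n + 1) f x ≤
        stepE (2 * κ * Δ) (fun x => Δ • b (n * Δ) x) G x := fun x => by
      rw [← hstep _ ENNReal.ofReal_ne_top]
      exact hE_mono _ hlow _
    have hval : ∀ x, stepProd κ b c Δ (n + 1) φ x =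
        (stepE (2 * κ * Δ) (fun x => Δ • b (n * Δ) x) G x).toReal := by
      intro x
      rw [stepProd, stepOp_eq hκ hΔ, integral_eq_lintegral_of_nonneg_ae
        (Eventually.of_forall fun z => hF0 _)
        (hF.comp (measurable_shift_right _)).aestronglyMeasurable]
      rfl
    -- Finiteness excludes the default value `0` at infinite integrals, for which the lower bound
    -- could fail.
    have hne : ∀ x, stepE (2 * κ * Δ) (fun x => Δ • b (n * Δ) x) G x ≠ ⊤ := fun x =>
      ne_top_of_le_ne_top (ENNReal.mul_ne_top ENNReal.ofReal_ne_top (hfin n x)) (hGle x)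
    refine ⟨?_, fun x => ?_, fun x => ?_⟩
    · rw [funext hval]
      exact (measurable_stepE _ hbm hF.ennreal_ofReal).ennreal_toReal
    · rw [hval]; exact ENNReal.toReal_nonneg
    · rw [hval, ENNReal.ofReal_toReal (hne x)]
      exact ⟨hGge x, hGle x⟩

end Steps

namespace Coefficients

variable {d : ℕ} (P : Coefficients d)

/-- Uniform lower and upper bounds for the products of steps without potential. -/
lemma exists_prodE_bounds : ∃ K : ℝ, 1 ≤ K ∧ ∀ M : ℕ, 0 < M → ∀ f : Torus d → ℝ≥0∞, Measurable f →
    ∫⁻ y, f y ∂torusMeasure d ≠ ⊤ → ∀ x,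
      prodE (2 * P.κ * (P.T / M)) (fun j x => (P.T / M) • P.b (j * (P.T / M)) x) M f x ≤
        ENNReal.ofReal K * ∫⁻ y, f y ∂torusMeasure d ∧
      ∫⁻ y, f y ∂torusMeasure d ≤ ENNReal.ofReal K *
        prodE (2 * P.κ * (P.T / M)) (fun j x => (P.T / M) • P.b (j * (P.T / M)) x) M f x := by
  have hκ := P.κ_pos
  have hT := P.T_pos
  obtain ⟨B, hB, hb⟩ := P.b_smooth.exists_bound hT P.b_periodic
  have hbc : ∀ t, Continuous (P.b t) := fun t =>
    P.b_smooth.continuous.comp (continuous_const.prodMk continuous_id)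
  obtain ⟨A, hA, h⟩ := exists_prodE_le d P.κ B P.T hκ hB hT
  -- `C2` bounds products from above, `C3` compares the integral with the heat flow at variance
  -- `2κT`, and `E1` is the accumulated Cauchy–Schwarz factor.
  set C2 : ℝ := A * (2 ^ d * Real.exp (d / (4 * (4 * (2 * P.κ * P.T))))) with hC2
  set C3 : ℝ := 2 ^ d * Real.exp (d / (2 * P.κ * P.T)) with hC3
  set E1 : ℝ := Real.exp (B ^ 2 * P.T / (4 * P.κ)) with hE1
  have hC2p : 0 < C2 := by positivity
  refine ⟨max 1 (max C2 ((C3 * E1) ^ 2 * C2)), le_max_left _ _, fun M hM f hf hfin x => ?_⟩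
  set Δ := P.T / M with hΔdef
  have hM' : (0:ℝ) < M := by exact_mod_cast hM
  have hΔ : 0 < Δ := by positivity
  have hMΔ : M * Δ = P.T := by rw [hΔdef]; field_simp
  have hMv : M * (2 * P.κ * Δ) = 2 * P.κ * P.T := by rw [← hMΔ]; ring
  set I := ∫⁻ y, f y ∂torusMeasure d with hI
  have hup : ∀ hh : ℕ → Torus d → Space d, (∀ j x, ‖hh j x‖ ≤ B * Δ) → (∀ j, Measurable (hh j)) →
      prodE (2 * P.κ * Δ) hh M f x ≤ ENNReal.ofReal C2 * I := by
    intro hh h1 h2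
    refine (h Δ hΔ M hMΔ.le hh h1 h2 f hf x).trans ?_
    rw [hMv, hC2, ENNReal.ofReal_mul (by positivity), mul_assoc (ENNReal.ofReal A)]
    exact mul_le_mul_right (hE_le_lintegral (by positivity) hf x) _
  have hn1 : ∀ (j : ℕ) (x : Torus d), ‖Δ • P.b (j * Δ) x‖ ≤ B * Δ := fun j x => by
    rw [norm_smul, Real.norm_of_nonneg hΔ.le, mul_comm]
    exact mul_le_mul_of_nonneg_right (hb _ _) hΔ.le
  have hm1 : ∀ j : ℕ, Measurable fun x => Δ • P.b (j * Δ) x :=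
    fun j => ((hbc _).const_smul Δ).measurable
  have hu1 := hup (fun j x => Δ • P.b (j * Δ) x) hn1 hm1
  have hu2 := hup (fun j x => -(Δ • P.b (j * Δ) x)) (fun j x => by rw [norm_neg]; exact hn1 j x)
    (fun j => (hm1 j).neg)
  refine ⟨hu1.trans ?_, ?_⟩
  · gcongr
    exact (le_max_left _ _).trans (le_max_right _ _)
  have hlow := hE_le_sqrt_prodE (by positivity : 0 < 2 * P.κ * Δ) hn1 hm1 hf M x
  have e1 : (M : ℝ) * ((B * Δ) ^ 2 / (2 * P.κ * Δ) / 2) = B ^ 2 * P.T / (4 * P.κ) := by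
    rw [← hMΔ]; field_simp; ring
  rw [hMv, e1] at hlow
  have h0 := lintegral_le_hE (by positivity : 0 < 2 * P.κ * P.T) hf x
  set p := prodE (2 * P.κ * Δ) (fun j x => Δ • P.b (j * Δ) x) M f x with hp
  have hpfin : p ≠ ⊤ := ne_top_of_le_ne_top (ENNReal.mul_ne_top ENNReal.ofReal_ne_top hfin) hu1
  -- The upper bound holds for `-b` too. Inserted into the Cauchy–Schwarz comparison it leaves `I ≤
  -- const * √p * √I`, which is then squared and divided by `I`.
  have hlow2 : I ≤ ENNReal.ofReal C3 * (ENNReal.ofReal E1 *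
      (p ^ (1 / 2 : ℝ) * (ENNReal.ofReal C2 * I) ^ (1 / 2 : ℝ))) := by
    refine h0.trans ?_
    gcongr
    refine hlow.trans ?_
    gcongr
  set i := I.toReal with hi
  set q := p.toReal with hq
  have hi0 : 0 ≤ i := ENNReal.toReal_nonneg
  have hq0 : 0 ≤ q := ENNReal.toReal_nonneg
  have hreal : i ≤ C3 * (E1 * (√q * √(C2 * i))) := by
    rw [← ENNReal.ofReal_toReal hfin, ← ENNReal.ofReal_toReal hpfin, ← hi, ← hq,
      ← ENNReal.ofReal_mul hC2p.le, ENNReal.ofReal_rpow_of_nonneg hq0 (by norm_num),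
      ENNReal.ofReal_rpow_of_nonneg (by positivity) (by norm_num), ← ENNReal.ofReal_mul (by positivity),
      ← ENNReal.ofReal_mul (by positivity), ← ENNReal.ofReal_mul (by positivity),
      ENNReal.ofReal_le_ofReal_iff (by positivity), ← Real.sqrt_eq_rpow, ← Real.sqrt_eq_rpow] at hlow2
    exact hlow2
  have hfinal : i ≤ (C3 * E1) ^ 2 * C2 * q := by
    rcases hi0.eq_or_lt with h0 | hpos
    · rw [← h0]; positivity
    have h2 : i ^ 2 ≤ (C3 * (E1 * (√q * √(C2 * i)))) ^ 2 := pow_le_pow_left₀ hi0 hreal 2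
    have h3 : (C3 * (E1 * (√q * √(C2 * i)))) ^ 2 = (C3 * E1) ^ 2 * C2 * q * i := by
      have e2 : (C3 * (E1 * (√q * √(C2 * i)))) ^ 2 = (C3 * E1) ^ 2 * (√q ^ 2 * √(C2 * i) ^ 2) := by
        ring
      rw [e2, Real.sq_sqrt hq0, Real.sq_sqrt (by positivity)]
      ring
    rw [h3, sq] at h2
    exact le_of_mul_le_mul_right h2 hpos
  rw [← ENNReal.ofReal_toReal hfin, ← ENNReal.ofReal_toReal hpfin, ← hi, ← hq,
    ← ENNReal.ofReal_mul (by positivity)]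
  refine ENNReal.ofReal_le_ofReal (hfinal.trans ?_)
  gcongr
  exact (le_max_right _ _).trans (le_max_right _ _)

/-- Uniform minorization and boundedness of the discretized operators. -/
theorem exists_periodOp_bounds : ∃ ε γ : ℝ, 0 < ε ∧ ε < γ ∧ ∀ M : ℕ, 0 < M → ∀ φ : Torus d → ℝ,
    MemLp φ 2 (torusMeasure d) → 0 ≤ᵐ[torusMeasure d] φ → ∀ x,
      ε * ∫ y, φ y ∂torusMeasure d ≤ periodOp P.κ P.b P.c P.T M φ x ∧
      periodOp P.κ P.b P.c P.T M φ x ≤ γ * ∫ y, φ y ∂torusMeasure d := by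
  have hκ := P.κ_pos
  have hT := P.T_pos
  obtain ⟨C, hC, hc⟩ := P.c_smooth.exists_bound hT P.c_periodic
  obtain ⟨B, hB, hb⟩ := P.b_smooth.exists_bound hT P.b_periodic
  have hbc : ∀ t, Continuous (P.b t) := fun t =>
    P.b_smooth.continuous.comp (continuous_const.prodMk continuous_id)
  obtain ⟨K, hK, h⟩ := P.exists_prodE_bounds
  refine ⟨Real.exp (-(P.T * C)) / K, Real.exp (P.T * C) * K + 1, by positivity, ?_,
    fun M hM φ hφ hφ0 x => ?_⟩
  · have h1 : Real.exp (-(P.T * C)) ≤ 1 := Real.exp_le_one_iff.2 (by rw [neg_nonpos]; positivity)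
    have h2 : Real.exp (-(P.T * C)) / K ≤ 1 := by
      rw [div_le_one (by positivity)]; exact h1.trans hK
    have h3 : 0 < Real.exp (P.T * C) * K := by positivity
    linarith
  -- A measurable representative that is nonnegative everywhere; products with at least one step do
  -- not distinguish it from `φ`.
  set ψ : Torus d → ℝ := fun y => max (hφ.1.mk φ y) 0 with hψ
  have hψm : Measurable ψ := hφ.1.stronglyMeasurable_mk.measurable.max measurable_const
  have hψ0 : ∀ y, 0 ≤ ψ y := fun y => le_max_right _ _
  have hφψ : φ =ᵐ[torusMeasure d] ψ := by
    filter_upwards [hφ.1.ae_eq_mk, hφ0] with y h1 h2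
    rw [hψ]
    simp only [← h1]
    exact (max_eq_left h2).symm
  have hint : Integrable ψ (torusMeasure d) := (hφ.integrable (by norm_num)).congr hφψ
  have hI : ∫⁻ y, ENNReal.ofReal (ψ y) ∂torusMeasure d =
      ENNReal.ofReal (∫ y, φ y ∂torusMeasure d) := by
    rw [integral_congr_ae hφψ, ofReal_integral_eq_lintegral_ofReal hint (Eventually.of_forall hψ0)]
  set i := ∫ y, φ y ∂torusMeasure d with hi
  have hi0 : 0 ≤ i := integral_nonneg_of_ae hφ0
  set Δ := P.T / M with hΔdef
  have hM' : (0:ℝ) < M := by exact_mod_cast hM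
  have hΔ : 0 < Δ := by positivity
  have hMΔ : M * Δ = P.T := by rw [hΔdef]; field_simp
  have hfin : ∀ n x, prodE (2 * P.κ * Δ) (fun j x => Δ • P.b (j * Δ) x) (n + 1)
      (fun y => ENNReal.ofReal (ψ y)) x ≠ ⊤ := by
    intro n x
    -- Finiteness is required for every number of steps, so the time horizon is taken to be `(n +
    -- 1)Δ`.
    obtain ⟨A, _, hA⟩ := exists_prodE_le d P.κ B ((n + 1 : ℕ) * Δ) hκ hB (by positivity)
    refine ne_top_of_le_ne_top ?_ (hA Δ hΔ (n + 1) le_rfl (fun j x => Δ • P.b (j * Δ) x)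
      (fun j x => by
        rw [norm_smul, Real.norm_of_nonneg hΔ.le, mul_comm]
        exact mul_le_mul_of_nonneg_right (hb _ _) hΔ.le)
      (fun j => ((hbc _).const_smul Δ).measurable) _ hψm.ennreal_ofReal x)
    refine ENNReal.mul_ne_top ENNReal.ofReal_ne_top (ne_top_of_le_ne_top ?_
      (hE_le_lintegral (by positivity) hψm.ennreal_ofReal x))
    rw [hI]
    exact ENNReal.mul_ne_top ENNReal.ofReal_ne_top ENNReal.ofReal_ne_top
  obtain ⟨k, rfl⟩ : ∃ k, M = k + 1 := ⟨M - 1, by omega⟩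
  have hper : periodOp P.κ P.b P.c P.T (k + 1) φ x = stepProd P.κ P.b P.c Δ (k + 1) ψ x := by
    rw [periodOp, stepProd_congr_ae hκ hΔ hφψ]
  obtain ⟨-, hs0, hs⟩ := stepProd_bounds hκ hΔ hbc (fun t => (P.c_smooth.smoothTest t).continuous)
    hc hψm hψ0 hfin (k + 1)
  obtain ⟨hs1, hs2⟩ := hs x
  obtain ⟨hp1, hp2⟩ := h (k + 1) hM (fun y => ENNReal.ofReal (ψ y)) hψm.ennreal_ofReal
    (by rw [hI]; exact ENNReal.ofReal_ne_top) x
  rw [← hper, ← mul_assoc, hMΔ] at hs1 hs2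
  rw [hI] at hp1 hp2
  have hq0 : 0 ≤ periodOp P.κ P.b P.c P.T (k + 1) φ x := by rw [hper]; exact hs0 x
  constructor
  · have h1 : ENNReal.ofReal (Real.exp (-(P.T * C)) * i) ≤
        ENNReal.ofReal (K * periodOp P.κ P.b P.c P.T (k + 1) φ x) := by
      rw [ENNReal.ofReal_mul (Real.exp_pos _).le, ENNReal.ofReal_mul (by positivity)]
      refine (mul_le_mul_right hp2 _).trans ?_
      rw [mul_left_comm]
      gcongr
    rw [ENNReal.ofReal_le_ofReal_iff (by positivity)] at h1
    rw [div_mul_eq_mul_div, div_le_iff₀ (by positivity)]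
    linarith
  · have h1 : ENNReal.ofReal (periodOp P.κ P.b P.c P.T (k + 1) φ x) ≤
        ENNReal.ofReal (Real.exp (P.T * C) * (K * i)) := by
      rw [ENNReal.ofReal_mul (Real.exp_pos _).le, ENNReal.ofReal_mul (by positivity)]
      refine hs2.trans ?_
      gcongr
    rw [ENNReal.ofReal_le_ofReal_iff (by positivity)] at h1
    nlinarith

end Coefficients

end FKTorus

end

/-! ### Second order expansion of shifted Gaussians and kernel operators on `L²`. -/

noncomputable section

namespace FKTorus

open Set

section KernelExpansion

variable {d : ℕ}

lemma abs_exp_sub_one_sub_id_le_mul (u : ℝ) :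
    |Real.exp u - 1 - u| ≤ u ^ 2 * Real.exp |u| := by
  have h := Complex.norm_exp_sub_sum_le_norm_mul_exp (u : ℂ) 2
  simp only [Finset.sum_range_succ, Finset.sum_range_zero, pow_zero, pow_one, Nat.factorial,
    zero_add, Nat.cast_one, div_one, mul_one, Complex.norm_real, Real.norm_eq_abs, sq_abs] at h
  rw [← Complex.ofReal_exp, ← Complex.ofReal_one, ← Complex.ofReal_add, ← Complex.ofReal_sub,
    Complex.norm_real, Real.norm_eq_abs] at h
  rwa [sub_sub]

lemma sum_mul_dk (v : ℝ) (z h : Space d) :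
    ∑ i, h i * dk i v z = inner ℝ h z / v * gk v z := by
  rw [PiLp.inner_apply, Finset.sum_div, Finset.sum_mul]
  refine Finset.sum_congr rfl fun i _ => ?_
  simp only [dk, RCLike.inner_apply, conj_trivial]
  ring

/-- The constant in the second order expansion of a shifted Gaussian kernel. -/
def shiftConst₂ (d : ℕ) (L : ℝ) : ℝ :=
  2 ^ d * ((16 + L ^ 2) * Real.exp (2 * L ^ 2 + L ^ 2 / 2) + 1)

lemma shiftConst₂_nonneg (d : ℕ) (L : ℝ) : 0 ≤ shiftConst₂ d L := by
  unfold shiftConst₂; positivity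

/-- The scalar core of the expansion: `s` is the linear term, `u` the exact exponent, and `y`, `η`
the scaled lengths of `z`, `h`. Powers of `y` and `exp |u|` are traded for `exp (3y²/8)`, which the
decay `exp (-y²/2)` can afford. -/
lemma abs_le_of_sq_le {y L s u η : ℝ} (hu : u = s - η ^ 2 / 2)
    (hu2 : u ^ 2 ≤ η ^ 2 * (2 * y ^ 2 + L ^ 2))
    (hua2 : |u| ≤ y ^ 2 / 8 + (2 * L ^ 2 + L ^ 2 / 2)) :
    |Real.exp u - 1 - s| ≤
      η ^ 2 * ((16 + L ^ 2) * Real.exp (2 * L ^ 2 + L ^ 2 / 2) + 1) * Real.exp (3 * (y ^ 2 / 8)) := by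
  have hy2 : y ^ 2 ≤ 8 * Real.exp (y ^ 2 / 8) := by
    have := Real.add_one_le_exp (y ^ 2 / 8); linarith
  have hE1 : 1 ≤ Real.exp (y ^ 2 / 8) := Real.one_le_exp (by positivity)
  have hua : Real.exp |u| ≤ Real.exp (y ^ 2 / 8) * Real.exp (2 * L ^ 2 + L ^ 2 / 2) := by
    rw [← Real.exp_add]; exact Real.exp_le_exp.2 hua2
  rw [show Real.exp (3 * (y ^ 2 / 8)) = Real.exp (y ^ 2 / 8) ^ 3 by
    rw [← Real.exp_nat_mul]; norm_num]
  have hm : 0 ≤ Real.exp (2 * L ^ 2 + L ^ 2 / 2) := (Real.exp_pos _).le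
  generalize Real.exp (y ^ 2 / 8) = a at *
  generalize Real.exp (2 * L ^ 2 + L ^ 2 / 2) = m at *
  have hη : 0 ≤ η ^ 2 := sq_nonneg η
  have e : Real.exp u - 1 - s = (Real.exp u - 1 - u) + -(η ^ 2 / 2) := by rw [hu]; ring
  have h1 : |Real.exp u - 1 - s| ≤ u ^ 2 * Real.exp |u| + η ^ 2 := by
    rw [e]
    refine (abs_add_le _ _).trans (add_le_add (abs_exp_sub_one_sub_id_le_mul u) ?_)
    rw [abs_neg, abs_of_nonneg (by positivity)]; linarith
  have h8 : 2 * y ^ 2 + L ^ 2 ≤ (16 + L ^ 2) * a := by nlinarith [sq_nonneg L]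
  have h9 : (1:ℝ) ≤ a ^ 3 := one_le_pow₀ hE1
  have h10 : a ^ 2 ≤ a ^ 3 := pow_le_pow_right₀ hE1 (by norm_num)
  calc |Real.exp u - 1 - s| ≤ u ^ 2 * Real.exp |u| + η ^ 2 := h1
    _ ≤ η ^ 2 * (2 * y ^ 2 + L ^ 2) * (a * m) + η ^ 2 * 1 := by
        rw [mul_one]
        exact add_le_add_left (mul_le_mul hu2 hua (Real.exp_pos _).le (by positivity)) _
    _ ≤ η ^ 2 * ((16 + L ^ 2) * a) * (a * m) + η ^ 2 * 1 := by gcongr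
    _ = η ^ 2 * ((16 + L ^ 2) * m) * a ^ 2 + η ^ 2 * 1 := by ring
    _ ≤ η ^ 2 * ((16 + L ^ 2) * m) * a ^ 3 + η ^ 2 * a ^ 3 := by gcongr
    _ = _ := by ring

/-- The shifted Gaussian is the centred one times `exp (s - η²/2)` with `s = ⟨h, z⟩/v`. Its linear
part is the sum over `dk`, and the remainder is quadratic in `‖h‖/√v`. -/
lemma abs_gk_sub_sub_le {v L : ℝ} (hv : 0 < v) (z h : Space d) (hh : ‖h‖ ≤ L * √v) :
    |gk v (z - h) - gk v z - ∑ i, h i * dk i v z| ≤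
      shiftConst₂ d L * (‖h‖ ^ 2 / v) * gk (4 * v) z := by
  have hs : 0 < √v := Real.sqrt_pos.2 hv
  have hsq : √v ^ 2 = v := Real.sq_sqrt hv.le
  set y := ‖z‖ / √v with hy
  set η := ‖h‖ / √v with hη
  have hy0 : 0 ≤ y := by positivity
  have hη0 : 0 ≤ η := by positivity
  have hηL : η ≤ L := by rw [hη, div_le_iff₀ hs]; exact hh
  have ez : ‖z‖ = y * √v := by rw [hy]; field_simp
  have eh : ‖h‖ = η * √v := by rw [hη]; field_simp
  set s := inner ℝ h z / v with hsdef
  have hsle : |s| ≤ y * η := by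
    rw [hsdef, abs_div, abs_of_pos hv, div_le_iff₀ hv]
    refine (abs_real_inner_le_norm h z).trans (le_of_eq ?_)
    have e : ‖h‖ * ‖z‖ = y * η * √v ^ 2 := by rw [ez, eh]; ring
    rw [e, hsq]
  have hexp : Real.exp (-(‖z - h‖ ^ 2 / (2 * v))) =
      Real.exp (-(‖z‖ ^ 2 / (2 * v))) * Real.exp (s - η ^ 2 / 2) := by
    rw [← Real.exp_add]
    congr 1
    rw [norm_sub_sq_real, real_inner_comm, hsdef, hη, div_pow, hsq]
    field_simp
    ring
  have e2 : ‖z‖ ^ 2 / (2 * v) = y ^ 2 / 2 := by rw [ez, mul_pow, hsq]; field_simp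
  have e3 : ‖z‖ ^ 2 / (8 * v) = y ^ 2 / 8 := by rw [ez, mul_pow, hsq]; field_simp
  have e4 : ‖h‖ ^ 2 / v = η ^ 2 := by rw [hη, div_pow, hsq]
  have hid : gk v (z - h) - gk v z - ∑ i, h i * dk i v z =
      (√(2 * Real.pi * v))⁻¹ ^ d * (Real.exp (-(y ^ 2 / 2)) *
        (Real.exp (s - η ^ 2 / 2) - 1 - s)) := by
    rw [sum_mul_dk, ← hsdef]
    unfold gk
    rw [hexp, e2]
    ring
  rw [hid, abs_mul, abs_of_nonneg (by positivity : (0:ℝ) ≤ (√(2 * Real.pi * v))⁻¹ ^ d), shiftConst₂,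
    mul_assoc (2 ^ d : ℝ) _ (‖h‖ ^ 2 / v)]
  refine gk_le_of_exp hv.le ?_
  rw [e3, e4, abs_mul, abs_of_pos (Real.exp_pos _)]
  set u := s - η ^ 2 / 2 with hu
  have hL0 : 0 ≤ L := hη0.trans hηL
  have hua : |u| ≤ y * η + η ^ 2 / 2 := by
    rw [hu]
    refine (abs_sub _ _).trans ?_
    rw [abs_of_nonneg (by positivity : 0 ≤ η ^ 2 / 2)]
    linarith
  have hη2 : η ^ 2 ≤ L ^ 2 := pow_le_pow_left₀ hη0 hηL 2
  have hu2 : u ^ 2 ≤ η ^ 2 * (2 * y ^ 2 + L ^ 2) := by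
    rw [← sq_abs]
    calc |u| ^ 2 ≤ (y * η + η ^ 2 / 2) ^ 2 := pow_le_pow_left₀ (abs_nonneg _) hua 2
      _ ≤ 2 * (y * η) ^ 2 + 2 * (η ^ 2 / 2) ^ 2 := by nlinarith [sq_nonneg (y * η - η ^ 2 / 2)]
      _ = η ^ 2 * (2 * y ^ 2 + η ^ 2 / 2) := by ring
      _ ≤ _ := by gcongr; linarith [sq_nonneg L]
  have hua2 : |u| ≤ y ^ 2 / 8 + (2 * L ^ 2 + L ^ 2 / 2) := by
    have : y * η ≤ y * L := by gcongr
    nlinarith [sq_nonneg (y - 4 * L)]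
  refine (mul_le_mul_of_nonneg_left (abs_le_of_sq_le hu hu2 hua2) (Real.exp_pos _).le).trans
    (le_of_eq ?_)
  have e7 : Real.exp (-(y ^ 2 / 8)) = Real.exp (-(y ^ 2 / 2)) * Real.exp (3 * (y ^ 2 / 8)) := by
    rw [← Real.exp_add]; congr 1; ring
  rw [e7]
  ring

end KernelExpansion

section KernelOperators

variable {d : ℕ}

open Classical in
/-- The integral operator `φ ↦ ∫ k(x, z) φ(x + z) dz` on `L²`. -/
def kerOp (k : Torus d → Space d → ℝ) : L2Torus d →L[ℝ] L2Torus d :=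
  if h : ∃ B : L2Torus d →L[ℝ] L2Torus d, ∀ φ : L2Torus d, B φ =ᵐ[torusMeasure d]
    fun x => ∫ z, k x z * φ (x + toTorus z) then h.choose else 0

/-- The kernel `k` is measurable and dominated by a multiple of a Gaussian kernel. -/
structure GaussDom (k : Torus d → Space d → ℝ) (A w : ℝ) : Prop where
  meas : Measurable (Function.uncurry k)
  pos : 0 < w
  le : ∀ x z, |k x z| ≤ A * gk w z

variable {k k' : Torus d → Space d → ℝ} {A A' w w' : ℝ}

lemma GaussDom.nonneg (h : GaussDom k A w) : 0 ≤ A :=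
  nonneg_of_mul_nonneg_left ((abs_nonneg _).trans (h.le 0 0)) (gk_pos h.pos 0)

lemma GaussDom.ae_integrable (h : GaussDom k A w) (φ : L2Torus d) : ∀ᵐ x ∂torusMeasure d,
    Integrable fun z => k x z * φ (x + toTorus z) := by
  have hφ : Integrable φ (torusMeasure d) := (Lp.memLp φ).integrable (by norm_num)
  filter_upwards [(integrable_prod_shift (integrable_gk h.pos) hφ
    (Lp.stronglyMeasurable φ)).prod_right_ae] with x hx
  refine (hx.norm.const_mul A).mono' ?_ (Eventually.of_forall fun z => ?_)
  · exact (h.meas.of_uncurry_left.mul ((Lp.stronglyMeasurable φ).measurable.comp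
      (measurable_shift_right x))).aestronglyMeasurable
  · rw [norm_mul, norm_mul, ← mul_assoc, Real.norm_eq_abs, Real.norm_of_nonneg (gk_nonneg _ _)]
    exact mul_le_mul_of_nonneg_right (h.le x z) (norm_nonneg _)

lemma gaussDom_gk (hw : 0 < w) : GaussDom (fun _ : Torus d => gk w) 1 w where
  meas := (continuous_gk w).measurable.comp measurable_snd
  pos := hw
  le _ z := by rw [abs_of_nonneg (gk_nonneg _ _), one_mul]

/-- Domination by a Gaussian reduces `L²` bounds for the integral operator to contractivity of the
heat semigroup on `|φ|`. -/
lemma GaussDom.abs_integral_le (h : GaussDom k A w) (φ : L2Torus d) : ∀ᵐ x ∂torusMeasure d,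
    ‖∫ z, k x z * φ (x + toTorus z)‖ ≤ A * ‖heat w |φ| x‖ := by
  filter_upwards [coeFn_convOp_of_ae (integrable_gk h.pos) (Lp.coeFn_abs φ),
    (gaussDom_gk h.pos).ae_integrable φ] with x hx hi
  rw [heat_of_pos h.pos, hx]
  have e : ∀ z, gk w z * |φ (x + toTorus z)| = ‖gk w z * φ (x + toTorus z)‖ := fun z => by
    rw [norm_mul, Real.norm_of_nonneg (gk_nonneg _ _), Real.norm_eq_abs]
  simp only [e]
  rw [Real.norm_of_nonneg (integral_nonneg fun z => norm_nonneg _), ← integral_const_mul]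
  refine norm_integral_le_of_norm_le (hi.norm.const_mul A) (Eventually.of_forall fun z => ?_)
  rw [norm_mul, ← e, ← mul_assoc]
  exact mul_le_mul_of_nonneg_right (h.le x z) (abs_nonneg _)

lemma norm_abs_L2 (φ : L2Torus d) : ‖|φ|‖ = ‖φ‖ := norm_abs_eq_norm φ

lemma GaussDom.memLp (h : GaussDom k A w) (φ : L2Torus d) :
    MemLp (fun x => ∫ z, k x z * φ (x + toTorus z)) 2 (torusMeasure d) := by
  refine MemLp.of_le_mul (Lp.memLp (heat w |φ|)) ?_ (h.abs_integral_le φ)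
  have hm : StronglyMeasurable fun p : Torus d × Space d => k p.1 p.2 * φ (p.1 + toTorus p.2) :=
    (h.meas.mul ((Lp.stronglyMeasurable φ).measurable.comp measurable_shift)).stronglyMeasurable
  exact hm.integral_prod_right'.aestronglyMeasurable

lemma GaussDom.exists_op (h : GaussDom k A w) :
    ∃ B : L2Torus d →L[ℝ] L2Torus d, ∀ φ : L2Torus d, B φ =ᵐ[torusMeasure d]
      fun x => ∫ z, k x z * φ (x + toTorus z) := by
  have hshift : ∀ {φ ψ : Torus d → ℝ}, φ =ᵐ[torusMeasure d] ψ → ∀ x,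
      ∫ z, k x z * φ (x + toTorus z) = ∫ z, k x z * ψ (x + toTorus z) := fun {φ ψ} hφ x => by
    refine integral_congr_ae ?_
    filter_upwards [(quasiMeasurePreserving_shift x).ae hφ] with z hz
    rw [hz]
  refine ⟨LinearMap.mkContinuous
    { toFun := fun φ => ((h.memLp φ).toLp _)
      map_add' := fun φ ψ => ?_
      map_smul' := fun a φ => ?_ } A fun φ => ?_, fun φ => (h.memLp φ).coeFn_toLp⟩
  · refine Lp.ext ?_
    filter_upwards [(h.memLp (φ + ψ)).coeFn_toLp, (h.memLp φ).coeFn_toLp, (h.memLp ψ).coeFn_toLp,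
      Lp.coeFn_add ((h.memLp φ).toLp _) ((h.memLp ψ).toLp _), h.ae_integrable φ, h.ae_integrable ψ]
      with x h1 h2 h3 h4 h5 h6
    rw [h1, h4, Pi.add_apply, h2, h3, hshift (Lp.coeFn_add φ ψ), ← integral_add h5 h6]
    simp only [Pi.add_apply, mul_add]
  · refine Lp.ext ?_
    filter_upwards [(h.memLp (a • φ)).coeFn_toLp, (h.memLp φ).coeFn_toLp,
      Lp.coeFn_smul a ((h.memLp φ).toLp _)] with x h1 h2 h4
    rw [h1, RingHom.id_apply, h4, Pi.smul_apply, h2, hshift (Lp.coeFn_smul a φ), smul_eq_mul,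
      ← integral_const_mul]
    simp only [Pi.smul_apply, smul_eq_mul, mul_left_comm]
  · refine (Lp.norm_le_mul_norm_of_ae_le_mul (g := heat w |φ|) (c := A) ?_).trans ?_
    · filter_upwards [(h.memLp φ).coeFn_toLp, h.abs_integral_le φ] with x h1 h2
      change ‖((h.memLp φ).toLp _) x‖ ≤ _
      rwa [h1]
    · rw [← norm_abs_L2 φ]
      exact mul_le_mul_of_nonneg_left (norm_heat_apply_le _ _) h.nonneg

lemma GaussDom.coeFn_kerOp (h : GaussDom k A w) (φ : L2Torus d) :
    kerOp k φ =ᵐ[torusMeasure d] fun x => ∫ z, k x z * φ (x + toTorus z) := by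
  rw [kerOp, dif_pos h.exists_op]
  exact h.exists_op.choose_spec φ

lemma GaussDom.norm_kerOp_le (h : GaussDom k A w) : ‖kerOp k‖ ≤ A := by
  refine ContinuousLinearMap.opNorm_le_bound _ h.nonneg fun φ => ?_
  refine (Lp.norm_le_mul_norm_of_ae_le_mul (g := heat w |φ|) (c := A) ?_).trans ?_
  · filter_upwards [h.coeFn_kerOp φ, h.abs_integral_le φ] with x h1 h2
    rwa [h1]
  · rw [← norm_abs_L2 φ]
    exact mul_le_mul_of_nonneg_left (norm_heat_apply_le _ _) h.nonneg

end KernelOperators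

end FKTorus

end

/-! ### Shifted heat operators and telescoping of operator products. -/

noncomputable section

namespace FKTorus

open Set

section ShiftHeat

variable {d : ℕ}

/-- The heat semigroup evaluated at shifted points, `φ ↦ (heat v φ)(x + h(x))`. -/
def shiftHeat (v : ℝ) (h : Torus d → Space d) : L2Torus d →L[ℝ] L2Torus d :=
  kerOp fun x z => gk v (z - h x)

variable {v B : ℝ} {h : Torus d → Space d}

lemma measurable_shift_kernel (v : ℝ) (hh : Measurable h) :
    Measurable (Function.uncurry fun x z => gk v (z - h x)) :=
  (continuous_gk v).measurable.comp (measurable_snd.sub (hh.comp measurable_fst))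

lemma gaussDom_shift (hv : 0 < v) (hh : Measurable h) (hB : ∀ x, ‖h x‖ ≤ B) :
    GaussDom (fun x z => gk v (z - h x)) (2 ^ d * Real.exp (B ^ 2 / (4 * v))) (4 * v) where
  meas := measurable_shift_kernel v hh
  pos := by positivity
  le x z := by
    rw [abs_of_nonneg (gk_nonneg _ _)]
    refine (gk_shift_le hv z (h x)).trans ?_
    have := gk_nonneg (4 * v) z
    gcongr
    exact hB x

lemma norm_shiftHeat_le (hv : 0 < v) (hh : Measurable h) (hB : ∀ x, ‖h x‖ ≤ B) :
    ‖shiftHeat v h‖ ≤ 2 ^ d * Real.exp (B ^ 2 / (4 * v)) :=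
  (gaussDom_shift hv hh hB).norm_kerOp_le

lemma heat_eq_kerOp (hv : 0 < v) : heat v = kerOp fun _ : Torus d => gk v := by
  ext1 φ
  refine Lp.ext ?_
  rw [heat_of_pos hv]
  exact (coeFn_convOp (integrable_gk hv) φ).trans ((gaussDom_gk hv).coeFn_kerOp φ).symm

/-- The difference receives a Gaussian bound of its own with a small constant `A''`, which turns
kernel estimates into operator norm estimates. -/
lemma kerOp_sub_of_le {k k' : Torus d → Space d → ℝ} {A A' A'' w w' w'' : ℝ} (h : GaussDom k A w)
    (h' : GaussDom k' A' w') (hw : 0 < w'') (hle : ∀ x z, |k x z - k' x z| ≤ A'' * gk w'' z) :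
    kerOp k - kerOp k' = kerOp (fun x z => k x z - k' x z) ∧
      GaussDom (fun x z => k x z - k' x z) A'' w'' := by
  have h'' : GaussDom (fun x z => k x z - k' x z) A'' w'' := ⟨h.meas.sub h'.meas, hw, hle⟩
  refine ⟨?_, h''⟩
  ext1 φ
  refine Lp.ext ?_
  filter_upwards [h.coeFn_kerOp φ, h'.coeFn_kerOp φ, h''.coeFn_kerOp φ, h.ae_integrable φ,
    h'.ae_integrable φ, Lp.coeFn_sub (kerOp k φ) (kerOp k' φ)] with x h1 h2 h3 h4 h5 h6
  rw [sub_apply, h6, Pi.sub_apply, h1, h2, h3, ← integral_sub h4 h5]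
  simp only [sub_mul]

lemma abs_shift_sub_le {L : ℝ} (hv : 0 < v) (hL : 0 ≤ L) (hB : ∀ x, ‖h x‖ ≤ B) (hBL : B ≤ L * √v)
    (x : Torus d) (z : Space d) :
    |gk v (z - h x) - gk v z| ≤ shiftConst d L * (B / √v) * gk (4 * v) z := by
  refine (abs_gk_sub_le' hv hL z (h x) ((hB x).trans hBL)).trans ?_
  have := gk_nonneg (4 * v) z
  have := shiftConst_nonneg (d := d) hL
  gcongr
  exact hB x

lemma norm_shiftHeat_sub_le {L : ℝ} (hv : 0 < v) (hL : 0 ≤ L) (hh : Measurable h)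
    (hB : ∀ x, ‖h x‖ ≤ B) (hBL : B ≤ L * √v) :
    ‖shiftHeat v h - heat v‖ ≤ shiftConst d L * (B / √v) := by
  obtain ⟨h1, h2⟩ := kerOp_sub_of_le (gaussDom_shift hv hh hB) (gaussDom_gk hv)
    (by positivity : 0 < 4 * v) (abs_shift_sub_le hv hL hB hBL)
  rw [shiftHeat, heat_eq_kerOp hv, h1]
  exact h2.norm_kerOp_le

lemma gaussDom_sum_dk (hv : 0 < v) (hh : Measurable h) (hB : ∀ x, ‖h x‖ ≤ B) :
    GaussDom (fun x z => ∑ i, h x i * dk i v z) (d * (B * (2 ^ d * (2 / √v)))) (4 * v) where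
  meas := by
    refine Finset.measurable_sum _ fun i _ => ?_
    have h1 : Measurable fun x => h x i := (PiLp.continuous_apply 2 _ i).measurable.comp hh
    exact (h1.comp measurable_fst).mul ((continuous_dk i v).measurable.comp measurable_snd)
  pos := by positivity
  le x z := by
    refine (Finset.abs_sum_le_sum_abs _ _).trans ?_
    have hle : ∀ i : Fin d, |h x i * dk i v z| ≤ B * (2 ^ d * (2 / √v) * gk (4 * v) z) := fun i => by
      rw [abs_mul]
      exact mul_le_mul ((abs_apply_le_norm _ i).trans (hB x)) (abs_dk_le hv i z) (abs_nonneg _)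
        ((norm_nonneg _).trans (hB x))
    refine (Finset.sum_le_sum fun i _ => hle i).trans (le_of_eq ?_)
    rw [Finset.sum_const, Finset.card_univ, Fintype.card_fin, nsmul_eq_mul]
    ring

lemma sum_mulFun_comp_heatD (hv : 0 < v) (hh : Continuous h) (hB : ∀ x, ‖h x‖ ≤ B) :
    ∑ i, (mulFun fun x => h x i) ∘L heatD i v = kerOp fun x z => ∑ i, h x i * dk i v z := by
  ext1 φ
  refine Lp.ext ?_
  have hdom : ∀ i : Fin d, GaussDom (fun _ : Torus d => dk i v) (2 ^ d * (2 / √v)) (4 * v) :=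
    fun i => ⟨(continuous_dk i v).measurable.comp measurable_snd, by positivity,
      fun _ z => abs_dk_le hv i z⟩
  have hhc : ∀ i, Continuous fun x => h x i := fun i => (PiLp.continuous_apply 2 _ i).comp hh
  have h1 : ∀ i : Fin d, (mulFun fun x => h x i) (heatD i v φ) =ᵐ[torusMeasure d]
      fun x => ∫ z, h x i * dk i v z * φ (x + toTorus z) := fun i => by
    filter_upwards [coeFn_mulFun (hhc i) (heatD i v φ), coeFn_convOp (integrable_dk hv i) φ]
      with x e1 e2
    rw [e1, heatD, e2, ← integral_const_mul]
    simp only [mul_assoc]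
  have h2 : ∀ᵐ x ∂torusMeasure d, ∀ i : Fin d, (mulFun fun x => h x i) (heatD i v φ) x =
      ∫ z, h x i * dk i v z * φ (x + toTorus z) := ae_all_iff.2 h1
  have h3 : ∀ᵐ x ∂torusMeasure d, ∀ i : Fin d, Integrable fun z => dk i v z * φ (x + toTorus z) :=
    ae_all_iff.2 fun i => (hdom i).ae_integrable φ
  rw [sum_apply]
  filter_upwards [Lp.coeFn_finsetSum Finset.univ
    (fun i => ((mulFun fun x => h x i) ∘L heatD i v) φ), h2, h3,
    (gaussDom_sum_dk hv hh.measurable hB).coeFn_kerOp φ] with x e1 e2 e3 e4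
  rw [e1, e4, Finset.sum_apply]
  simp only [ContinuousLinearMap.comp_apply, e2, Finset.sum_mul]
  rw [integral_finsetSum]
  intro i _
  simp only [mul_assoc]
  exact (e3 i).const_mul _

lemma norm_shiftHeat_sub_sub_le {L : ℝ} (hv : 0 < v) (hL : 0 ≤ L) (hh : Continuous h)
    (hB : ∀ x, ‖h x‖ ≤ B) (hBL : B ≤ L * √v) :
    ‖shiftHeat v h - heat v - ∑ i, (mulFun fun x => h x i) ∘L heatD i v‖ ≤
      shiftConst₂ d L * (B ^ 2 / v) := by
  obtain ⟨h1, h2⟩ := kerOp_sub_of_le (gaussDom_shift hv hh.measurable hB) (gaussDom_gk hv)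
    (by positivity : 0 < 4 * v) (abs_shift_sub_le hv hL hB hBL)
  obtain ⟨h3, h4⟩ := kerOp_sub_of_le h2 (gaussDom_sum_dk hv hh.measurable hB)
    (A'' := shiftConst₂ d L * (B ^ 2 / v)) (by positivity : 0 < 4 * v) fun x z => by
      refine (abs_gk_sub_sub_le hv z (h x) ((hB x).trans hBL)).trans ?_
      have := gk_nonneg (4 * v) z
      have := shiftConst₂_nonneg d L
      gcongr
      exact hB x
  rw [sum_mulFun_comp_heatD hv hh hB, shiftHeat, heat_eq_kerOp hv, h1, h3]
  exact h4.norm_kerOp_le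

lemma shift_kernel_integral (v : ℝ) (f : Torus d → ℝ) (x : Torus d) (y : Space d) :
    ∫ z, gk v (z - y) * f (x + toTorus z) = ∫ z, gk v z * f (x + toTorus y + toTorus z) := by
  rw [← integral_add_right_eq_self (fun z => gk v (z - y) * f (x + toTorus z)) y]
  simp only [add_sub_cancel_right, toTorus_add]
  refine integral_congr_ae (Eventually.of_forall fun z => ?_)
  simp only
  rw [add_comm (toTorus z), add_assoc]

lemma coeFn_shiftHeat (hv : 0 < v) (hh : Measurable h) (hB : ∀ x, ‖h x‖ ≤ B) {φ : L2Torus d}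
    {f : Torus d → ℝ} (hf : φ =ᵐ[torusMeasure d] f) :
    shiftHeat v h φ =ᵐ[torusMeasure d]
      fun x => ∫ z, gk v z * f (x + toTorus (h x) + toTorus z) := by
  filter_upwards [(gaussDom_shift hv hh hB).coeFn_kerOp φ] with x hx
  rw [shiftHeat, hx, ← shift_kernel_integral]
  refine integral_congr_ae ?_
  filter_upwards [(quasiMeasurePreserving_shift x).ae hf] with z hz
  rw [hz]

lemma shiftHeat_trigLp (hv : 0 < v) (hh : Measurable h) (hB : ∀ x, ‖h x‖ ≤ B) (n : Fin d → ℤ)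
    (θ : ℝ) : shiftHeat v h (trigLp n θ) =ᵐ[torusMeasure d]
      fun x => lam n v * trig n θ (x + toTorus (h x)) := by
  filter_upwards [coeFn_shiftHeat hv hh hB (coeFn_contLp _ (continuous_trig n θ))] with x hx
  rw [trigLp, hx, integral_gk_trig hv]

/-- The shift depends only on the output point, so a heat flow applied first merely adds its
variance. -/
lemma shiftHeat_comp_heat (hv : 0 < v) (hh : Measurable h) (hB : ∀ x, ‖h x‖ ≤ B) {w : ℝ}
    (hw : 0 ≤ w) : shiftHeat v h ∘L heat w = shiftHeat (v + w) h := by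
  refine clm_ext_trig fun n θ => ?_
  rw [ContinuousLinearMap.comp_apply, heat_trigLp hw, map_smul]
  refine Lp.ext ?_
  filter_upwards [shiftHeat_trigLp hv hh hB n θ,
    shiftHeat_trigLp (by positivity : 0 < v + w) hh hB n θ,
    Lp.coeFn_smul (lam n w) (shiftHeat v h (trigLp n θ))] with x h1 h2 h3
  rw [h2, h3, Pi.smul_apply, h1, lam_add, smul_eq_mul]
  ring

end ShiftHeat

section Products

variable {Y : Type*} [NormedAddCommGroup Y] [NormedSpace ℝ Y]

/-- The product `K (i + n - 1) ⋯ K (i + 1) K i`. -/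
def opProd (K : ℕ → Y →L[ℝ] Y) (i : ℕ) : ℕ → Y →L[ℝ] Y
  | 0 => ContinuousLinearMap.id ℝ Y
  | n + 1 => K (i + n) ∘L opProd K i n

lemma opProd_add (K : ℕ → Y →L[ℝ] Y) (i m n : ℕ) :
    opProd K i (m + n) = opProd K (i + m) n ∘L opProd K i m := by
  induction n with
  | zero => rfl
  | succ n ih =>
    rw [← add_assoc, opProd, ih, opProd, ContinuousLinearMap.comp_assoc, add_assoc]

/-- Telescoping of a product of operators against a sequence of approximate solutions. -/
lemma opProd_comp_sub (K W : ℕ → Y →L[ℝ] Y) (i n : ℕ) :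
    opProd K i n ∘L W 0 - W n = ∑ l ∈ Finset.range n,
      opProd K (i + (l + 1)) (n - (l + 1)) ∘L (K (i + l) ∘L W l - W (l + 1)) := by
  induction n with
  | zero => simp [opProd]
  | succ n ih =>
    have h1 : ∀ l ∈ Finset.range n, opProd K (i + (l + 1)) (n + 1 - (l + 1)) ∘L
        (K (i + l) ∘L W l - W (l + 1)) = K (i + n) ∘L (opProd K (i + (l + 1)) (n - (l + 1)) ∘L
          (K (i + l) ∘L W l - W (l + 1))) := fun l hl => by
      have hl' := Finset.mem_range.1 hl
      obtain ⟨k, rfl⟩ : ∃ k, n = l + 1 + k := ⟨n - (l + 1), by omega⟩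
      rw [show l + 1 + k + 1 - (l + 1) = k + 1 by omega, show l + 1 + k - (l + 1) = k by omega,
        opProd, ContinuousLinearMap.comp_assoc, show i + (l + 1) + k = i + (l + 1 + k) by ring]
    rw [Finset.sum_range_succ, Finset.sum_congr rfl h1, ← ContinuousLinearMap.comp_finsetSum, ← ih,
      Nat.sub_self, opProd, opProd, ContinuousLinearMap.comp_sub, ContinuousLinearMap.comp_assoc,
      ContinuousLinearMap.id_comp]
    abel

end Products

end FKTorus

end

/-! ### Expansion of one step and stability of the scheme. -/

noncomputable section

namespace FKTorus

open Set

section Multipliers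

variable {d : ℕ}

lemma mulFun_sub {a a' : Torus d → ℝ} (h : Continuous a) (h' : Continuous a') :
    mulFun a - mulFun a' = mulFun fun x => a x - a' x := by
  rw [mulFun_eq h, mulFun_eq h',
    mulFun_eq (a := fun x => a x - a' x) (h.sub h'), ← map_sub]
  rfl

lemma mulFun_const_mul (r : ℝ) {a : Torus d → ℝ} (h : Continuous a) :
    (mulFun fun x => r * a x) = r • mulFun a := by
  rw [mulFun_eq h, mulFun_eq (h.const_mul r : Continuous fun x => r * a x),
    ← map_smul]
  rfl

lemma mulFun_one : (mulFun fun _ : Torus d => (1 : ℝ)) = ContinuousLinearMap.id ℝ _ := by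
  ext1 φ
  refine Lp.ext ?_
  filter_upwards [coeFn_mulFun continuous_const φ] with x hx
  rw [hx, one_mul]; rfl

end Multipliers

namespace Coefficients

variable {d : ℕ} (P : Coefficients d)

/-- The drift part of a step of the scheme. -/
def driftOp (Δ t : ℝ) : L2Torus d →L[ℝ] L2Torus d :=
  shiftHeat (2 * P.κ * Δ) fun x => Δ • P.b t x

/-- The potential part of a step of the scheme. -/
def potOp (Δ t : ℝ) : L2Torus d →L[ℝ] L2Torus d := mulFun fun x => Real.exp (Δ * P.c t x)

/-- A step of the scheme on `L²`. -/
def kstep (Δ t : ℝ) : L2Torus d →L[ℝ] L2Torus d := P.driftOp Δ t ∘L P.potOp Δ t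

lemma continuous_b (t : ℝ) : Continuous (P.b t) :=
  P.b_smooth.continuous.comp (continuous_const.prodMk continuous_id)

lemma continuous_c (t : ℝ) : Continuous (P.c t) := (P.c_smooth.smoothTest t).continuous

lemma potOp_expansion : ∃ C, 0 ≤ C ∧ ∀ Δ t, 0 < Δ → Δ ≤ P.T →
    ‖P.potOp Δ t - ContinuousLinearMap.id ℝ _ - Δ • P.system.χ t‖ ≤ C * Δ ^ 2 ∧
      ‖P.potOp Δ t - ContinuousLinearMap.id ℝ _‖ ≤ C * Δ := by
  have hT := P.T_pos
  obtain ⟨C, hC, hc⟩ := P.c_smooth.exists_bound hT P.c_periodic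
  refine ⟨C ^ 2 * Real.exp (P.T * C) * (1 + P.T) + C, by positivity, fun Δ t hΔ hΔT => ?_⟩
  have hcc := P.continuous_c t
  have he : Continuous fun x => Real.exp (Δ * P.c t x) := by fun_prop
  have hΔc : Continuous fun x => Δ * P.c t x := by fun_prop
  have hΔC : ∀ x, |Δ * P.c t x| ≤ Δ * C := fun x => by
    rw [abs_mul, abs_of_pos hΔ]
    exact mul_le_mul_of_nonneg_left (hc t x) hΔ.le
  have h1 : ‖P.potOp Δ t - ContinuousLinearMap.id ℝ _ - Δ • P.system.χ t‖ ≤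
      C ^ 2 * Real.exp (P.T * C) * Δ ^ 2 := by
    change ‖_ - _ - Δ • mulFun (P.c t)‖ ≤ _
    rw [potOp, ← mulFun_one, ← mulFun_const_mul Δ hcc, mulFun_sub he continuous_const,
      mulFun_sub (a := fun x => Real.exp (Δ * P.c t x) - 1) (he.sub continuous_const) hΔc]
    refine norm_mulFun_le (by positivity) fun x => ?_
    refine (abs_exp_sub_one_sub_id_le_mul _).trans ?_
    have h2 : (Δ * P.c t x) ^ 2 ≤ (Δ * C) ^ 2 := by
      rw [← sq_abs]; exact pow_le_pow_left₀ (abs_nonneg _) (hΔC x) 2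
    have h3 : Real.exp |Δ * P.c t x| ≤ Real.exp (P.T * C) :=
      Real.exp_le_exp.2 ((hΔC x).trans (by gcongr))
    calc _ ≤ (Δ * C) ^ 2 * Real.exp (P.T * C) := by gcongr
      _ = _ := by ring
  have h2 : ‖Δ • P.system.χ t‖ ≤ Δ * C := by
    rw [norm_smul, Real.norm_of_nonneg hΔ.le]
    exact mul_le_mul_of_nonneg_left (norm_mulFun_le hC (hc t)) hΔ.le
  have hE : 0 ≤ C ^ 2 * Real.exp (P.T * C) := by positivity
  refine ⟨h1.trans ?_, ?_⟩
  · gcongr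
    nlinarith
  · calc _ = ‖(P.potOp Δ t - ContinuousLinearMap.id ℝ _ - Δ • P.system.χ t) + Δ • P.system.χ t‖ := by
          rw [sub_add_cancel]
      _ ≤ C ^ 2 * Real.exp (P.T * C) * Δ ^ 2 + Δ * C := (norm_add_le _ _).trans (add_le_add h1 h2)
      _ ≤ C ^ 2 * Real.exp (P.T * C) * (P.T * Δ) + Δ * C := by
          rw [sq Δ]; gcongr
      _ ≤ _ := by nlinarith [mul_nonneg hE hΔ.le]

/-- Composition with `P.system.S w` raises the variance to `2κ(w + Δ)` while the drift stays `O(Δ)`,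
which gives the ratios `Δ/√(w + Δ)` and `Δ²/(w + Δ)`. The first has bounded sums over the steps and
gives stability; the second gives consistency. -/
lemma driftOp_expansion : ∃ C, 0 ≤ C ∧ ∀ Δ t w, 0 < Δ → Δ ≤ P.T → 0 ≤ w →
    ‖P.driftOp Δ t‖ ≤ C ∧
    ‖P.driftOp Δ t ∘L P.system.S w - P.system.S (w + Δ)‖ ≤ C * (Δ / √(w + Δ)) ∧
    ‖(P.driftOp Δ t - P.system.S Δ - Δ • ∑ i, P.system.β i t ∘L P.system.D i Δ) ∘L P.system.S w‖ ≤
      C * (Δ ^ 2 / (w + Δ)) := by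
  have hT := P.T_pos
  have hκ := P.κ_pos
  obtain ⟨B, hB, hb⟩ := P.b_smooth.exists_bound hT P.b_periodic
  set L : ℝ := B * √P.T / √(2 * P.κ) with hL
  have hL0 : 0 ≤ L := by positivity
  have hs1 := shiftConst_nonneg (d := d) hL0
  have hs2 := shiftConst₂_nonneg d L
  refine ⟨2 ^ d * Real.exp ((B * P.T) * B / (8 * P.κ)) + shiftConst d L * (B / √(2 * P.κ)) +
    shiftConst₂ d L * (B ^ 2 / (2 * P.κ)), by positivity, fun Δ t w hΔ hΔT hw => ?_⟩
  have hbc : Continuous fun x => Δ • P.b t x := (P.continuous_b t).const_smul Δ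
  have hbB : ∀ x, ‖Δ • P.b t x‖ ≤ B * Δ := fun x => by
    rw [norm_smul, Real.norm_of_nonneg hΔ.le, mul_comm]
    exact mul_le_mul_of_nonneg_right (hb _ _) hΔ.le
  have hv : 0 < 2 * P.κ * Δ := by positivity
  have hvw : 0 < 2 * P.κ * Δ + 2 * P.κ * w := by positivity
  have hvw' : 2 * P.κ * Δ + 2 * P.κ * w = 2 * P.κ * (w + Δ) := by ring
  have hwΔ : 0 < w + Δ := by positivity
  have hBL : B * Δ ≤ L * √(2 * P.κ * Δ + 2 * P.κ * w) := by
    rw [hvw', Real.sqrt_mul (by positivity), hL]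
    calc B * Δ = B * (√Δ * √Δ) := by rw [Real.mul_self_sqrt hΔ.le]
      _ ≤ B * (√P.T * √(w + Δ)) := by gcongr; linarith
      _ = _ := by field_simp
  have hcomp : P.driftOp Δ t ∘L P.system.S w =
      shiftHeat (2 * P.κ * Δ + 2 * P.κ * w) fun x => Δ • P.b t x :=
    shiftHeat_comp_heat hv hbc.measurable hbB (by positivity)
  have hS : P.system.S (w + Δ) = heat (2 * P.κ * Δ + 2 * P.κ * w) := by rw [hvw']; rfl
  have hp1 : 0 ≤ 2 ^ d * Real.exp ((B * P.T) * B / (8 * P.κ)) := by positivity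
  have hp2 : 0 ≤ shiftConst d L * (B / √(2 * P.κ)) := by positivity
  have hp3 : 0 ≤ shiftConst₂ d L * (B ^ 2 / (2 * P.κ)) := by positivity
  refine ⟨?_, ?_, ?_⟩
  · refine (norm_shiftHeat_le hv hbc.measurable hbB).trans ?_
    have : (B * Δ) ^ 2 / (4 * (2 * P.κ * Δ)) ≤ (B * P.T) * B / (8 * P.κ) := by
      have e : (B * Δ) ^ 2 / (4 * (2 * P.κ * Δ)) = (B * Δ) * B / (8 * P.κ) := by field_simp; ring
      rw [e]; gcongr
    have h2 : 2 ^ d * Real.exp ((B * Δ) ^ 2 / (4 * (2 * P.κ * Δ))) ≤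
      2 ^ d * Real.exp ((B * P.T) * B / (8 * P.κ)) := by gcongr
    linarith
  · rw [hcomp, hS]
    refine (norm_shiftHeat_sub_le hvw hL0 hbc.measurable hbB hBL).trans ?_
    have e : shiftConst d L * (B * Δ / √(2 * P.κ * Δ + 2 * P.κ * w)) =
        shiftConst d L * (B / √(2 * P.κ)) * (Δ / √(w + Δ)) := by
      rw [hvw', Real.sqrt_mul (by positivity)]; field_simp
    rw [e]
    gcongr
    linarith
  · have hSS : P.system.S Δ ∘L P.system.S w = heat (2 * P.κ * Δ + 2 * P.κ * w) := by
      rw [← P.system.S_add Δ w hΔ.le hw, add_comm, hS]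
    have hβ : (Δ • ∑ i, P.system.β i t ∘L P.system.D i Δ) ∘L P.system.S w =
        ∑ i, (mulFun fun x => (Δ • P.b t x) i) ∘L heatD i (2 * P.κ * Δ + 2 * P.κ * w) := by
      rw [ContinuousLinearMap.smul_comp, ContinuousLinearMap.finsetSum_comp, Finset.smul_sum]
      refine Finset.sum_congr rfl fun i _ => ?_
      have hbi : Continuous fun x => P.b t x i := (PiLp.continuous_apply 2 _ i).comp (P.continuous_b t)
      rw [ContinuousLinearMap.comp_assoc, ← P.system.D_add i Δ w hΔ hw]
      have e1 : (mulFun fun x => (Δ • P.b t x) i) = Δ • mulFun fun x => P.b t x i :=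
        mulFun_const_mul Δ hbi
      have e2 : P.system.D i (Δ + w) = heatD i (2 * P.κ * Δ + 2 * P.κ * w) := by
        rw [hvw', add_comm]; rfl
      rw [e1, e2, ContinuousLinearMap.smul_comp]
      rfl
    rw [ContinuousLinearMap.sub_comp, ContinuousLinearMap.sub_comp, hcomp, hSS, hβ]
    refine (norm_shiftHeat_sub_sub_le hvw hL0 hbc hbB hBL).trans ?_
    have e : shiftConst₂ d L * ((B * Δ) ^ 2 / (2 * P.κ * Δ + 2 * P.κ * w)) =
        shiftConst₂ d L * (B ^ 2 / (2 * P.κ)) * (Δ ^ 2 / (w + Δ)) := by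
      rw [hvw']; field_simp
    rw [e]
    gcongr
    linarith

/-- Stability of the scheme and comparison with the heat semigroup. -/
lemma exists_stability : ∃ A, 1 ≤ A ∧ ∀ Δ, 0 < Δ → Δ ≤ P.T → ∀ i n : ℕ, n * Δ ≤ P.T →
    ‖opProd (fun j => P.kstep Δ (j * Δ)) i n‖ ≤ A ∧
      ‖opProd (fun j => P.kstep Δ (j * Δ)) i n - P.system.S (n * Δ)‖ ≤ A * √(n * Δ) := by
  have hT := P.T_pos
  obtain ⟨C1, hC1, h1⟩ := P.potOp_expansion
  obtain ⟨C2, hC2, h2⟩ := P.driftOp_expansion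
  set C : ℝ := C2 * C1 * √P.T + C2 with hC
  have hC0 : 0 ≤ C := by positivity
  have hstep : ∀ Δ, 0 < Δ → Δ ≤ P.T → ∀ t, ∀ l : ℕ, (l + 1 : ℕ) * Δ ≤ P.T →
      ‖P.kstep Δ t ∘L P.system.S (l * Δ) - P.system.S ((l + 1 : ℕ) * Δ)‖ ≤
        C * (Δ / √((l + 1 : ℕ) * Δ)) := by
    intro Δ hΔ hΔT t l hl
    have e0 : ((l + 1 : ℕ) : ℝ) * Δ = l * Δ + Δ := by push_cast; ring
    rw [e0] at hl ⊢
    have e : P.kstep Δ t ∘L P.system.S (l * Δ) - P.system.S (l * Δ + Δ) =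
        P.driftOp Δ t ∘L (P.potOp Δ t - ContinuousLinearMap.id ℝ _) ∘L P.system.S (l * Δ) +
        (P.driftOp Δ t ∘L P.system.S (l * Δ) - P.system.S (l * Δ + Δ)) := by
      ext1 φ; simp [kstep]
    obtain ⟨a1, a2, -⟩ := h2 Δ t (l * Δ) hΔ hΔT (by positivity)
    have hpos : 0 < l * Δ + Δ := by positivity
    have hq : Δ ≤ √P.T * (Δ / √(l * Δ + Δ)) := by
      rw [mul_div_assoc', le_div_iff₀ (Real.sqrt_pos.2 hpos), mul_comm]
      gcongr
    rw [e]
    refine (norm_add_le _ _).trans ?_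
    have h3 : ‖P.driftOp Δ t ∘L (P.potOp Δ t - ContinuousLinearMap.id ℝ _) ∘L P.system.S (l * Δ)‖ ≤
        C2 * (C1 * Δ * 1) := by
      refine (ContinuousLinearMap.opNorm_comp_le _ _).trans ?_
      refine mul_le_mul a1 ?_ (norm_nonneg _) hC2
      refine (ContinuousLinearMap.opNorm_comp_le _ _).trans ?_
      exact mul_le_mul (h1 Δ t hΔ hΔT).2 (P.norm_S_le _) (norm_nonneg _) (by positivity)
    have h4 : C2 * (C1 * Δ * 1) ≤ C2 * (C1 * (√P.T * (Δ / √(l * Δ + Δ))) * 1) := by gcongr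
    rw [hC]
    nlinarith
  obtain ⟨A, hA, hF⟩ := exists_gronwall C P.T 1 hC0 hT.le le_rfl
  have hA2 : A ≤ 2 * A * C + A := by nlinarith [mul_nonneg (zero_le_one.trans hA) hC0]
  refine ⟨2 * A * C + A, hA.trans hA2, fun Δ hΔ hΔT => ?_⟩
  obtain ⟨F, hF0, hFn, hFA, hFr⟩ := hF Δ hΔ
  set K : ℕ → L2Torus d →L[ℝ] L2Torus d := fun j => P.kstep Δ (j * Δ) with hK
  -- Each defect is `O(Δ/√((l + 1)Δ))`, so the norms of the products obey the discrete Gronwall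
  -- recursion.
  have htel : ∀ i n : ℕ, opProd K i n - P.system.S (n * Δ) = ∑ l ∈ Finset.range n,
      opProd K (i + (l + 1)) (n - (l + 1)) ∘L
        (K (i + l) ∘L P.system.S (l * Δ) - P.system.S ((l + 1 : ℕ) * Δ)) := fun i n => by
    rw [← opProd_comp_sub K (fun l : ℕ => P.system.S (l * Δ)) i n]
    simp only [Nat.cast_zero, zero_mul, P.system.S_zero, ContinuousLinearMap.comp_id]
  have hdiff : ∀ n : ℕ, n * Δ ≤ P.T → ∀ G : ℕ → ℝ,
      (∀ l < n, ∀ i, ‖opProd K i (n - (l + 1))‖ ≤ G (n - (l + 1))) → ∀ i,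
      ‖opProd K i n - P.system.S (n * Δ)‖ ≤
        ∑ l ∈ Finset.range n, C * (Δ / √((l + 1 : ℕ) * Δ)) * G (n - (l + 1)) := by
    intro n hn G hG i
    rw [htel]
    refine norm_sum_le_of_le _ fun l hl => ?_
    have hl' := Finset.mem_range.1 hl
    refine (ContinuousLinearMap.opNorm_comp_le _ _).trans ?_
    rw [mul_comm]
    refine mul_le_mul (hstep Δ hΔ hΔT _ l ?_) (hG l hl' _) (norm_nonneg _) (by positivity)
    refine le_trans ?_ hn
    gcongr
    exact_mod_cast hl'
  have hbound : ∀ n : ℕ, n * Δ ≤ P.T → ∀ i, ‖opProd K i n‖ ≤ F n := by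
    intro n
    induction n using Nat.strong_induction_on with
    | _ n ih =>
      intro hn i
      have h3 := hdiff n hn F (fun l hl i => ih _ (by omega) (le_trans (by gcongr; omega) hn) i) i
      have h4 := hFr n hn
      have h5 : ‖opProd K i n‖ ≤ ‖opProd K i n - P.system.S (n * Δ)‖ + ‖P.system.S (n * Δ)‖ := by
        simpa using norm_add_le (opProd K i n - P.system.S (n * Δ)) (P.system.S (n * Δ))
      linarith [P.norm_S_le (n * Δ)]
  intro i n hn
  refine ⟨((hbound n hn i).trans (hFA n hn)).trans hA2, ?_⟩
  -- The uniform bound, inserted once more into the telescoping sum, gives the short time estimate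
  -- `O(√(nΔ))`.
  have h3 := hdiff n hn (fun _ => A) (fun l hl i => by
    have : ((n - (l + 1) : ℕ) : ℝ) * Δ ≤ P.T := le_trans (by gcongr; omega) hn
    exact (hbound _ this i).trans (hFA _ this)) i
  refine h3.trans ?_
  rw [← Finset.sum_mul, ← Finset.mul_sum]
  have h4 := sum_step_div_sqrt_le hΔ n
  calc C * (∑ l ∈ Finset.range n, Δ / √((l + 1 : ℕ) * Δ)) * A ≤ C * (2 * √(n * Δ)) * A := by gcongr
    _ = 2 * A * C * √(n * Δ) := by ring
    _ ≤ _ := by gcongr; linarith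

end Coefficients

end FKTorus

end

/-! ### Consistency and convergence of the scheme. -/

noncomputable section

namespace FKTorus

open Set

namespace Coefficients

variable {d : ℕ} (P : Coefficients d)

lemma exists_bound_Icc {E : Type*} [SeminormedAddCommGroup E] {F : ℝ → E} {m a b : ℝ}
    (hF : ContinuousOn F (Ioi m)) (hma : m < a) : ∃ G, 0 ≤ G ∧ ∀ t ∈ Icc a b, ‖F t‖ ≤ G := by
  obtain ⟨G, hG⟩ := isCompact_Icc.exists_bound_of_continuousOn
    (hF.mono fun t (ht : t ∈ Icc a b) => hma.trans_le ht.1)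
  exact ⟨max G 0, le_max_right _ _, fun t ht => (hG t ht).trans (le_max_left _ _)⟩

lemma exists_uniform_bound {ι : Type*} [Fintype ι] {α : Type*} {s : Set α} {f : ι → α → ℝ}
    (h : ∀ i, ∃ G, 0 ≤ G ∧ ∀ t ∈ s, f i t ≤ G) : ∃ G, 0 ≤ G ∧ ∀ i, ∀ t ∈ s, f i t ≤ G := by
  choose G hG hf using h
  exact ⟨∑ i, G i, Finset.sum_nonneg fun i _ => hG i, fun i t ht => (hf i t ht).trans
    (Finset.single_le_sum (fun i _ => hG i) (Finset.mem_univ i))⟩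

/-- Bounds for the solution and its derivatives up to the second order, away from time zero. -/
lemma exists_regularity_bound {s m a : ℝ} (b : ℝ) (hsm : s < m) (hma : m < a) :
    ∃ G, 0 ≤ G ∧ ∀ t ∈ Icc a b, ‖P.system.sol t s‖ ≤ G ∧ (∀ i, ‖P.system.grad i t s‖ ≤ G) ∧
      ∀ i j, ‖P.hess i j t m s‖ ≤ G := by
  obtain ⟨G1, h1, h1'⟩ := exists_bound_Icc (b := b) (P.system.singFun_sol s).cont (hsm.trans hma)
  obtain ⟨G2, h2, h2'⟩ := exists_uniform_bound fun i =>
    exists_bound_Icc (b := b) (P.system.singFun_grad i s).cont (hsm.trans hma)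
  obtain ⟨G3, h3, h3'⟩ := exists_uniform_bound fun p : Fin d × Fin d =>
    exists_bound_Icc (b := b) (P.continuousOn_hess p.1 p.2 m s) hma
  refine ⟨G1 + G2 + G3, by positivity, fun t ht => ⟨?_, fun i => ?_, fun i j => ?_⟩⟩
  · linarith [h1' t ht]
  · linarith [h2' i t ht]
  · linarith [h3' (i, j) t ht]

lemma exists_bound_partial_c : ∃ C, 0 ≤ C ∧ ∀ (i : Fin d) (t : ℝ),
    ‖mulFun (partialDeriv i (P.c t))‖ ≤ C := by
  obtain ⟨C, hC, h⟩ := exists_uniform_bound (s := (univ : Set ℝ))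
    (f := fun (i : Fin d) t => ‖mulFun (partialDeriv i (P.c t))‖) fun i => by
      obtain ⟨C, hC, h⟩ := (P.c_smooth.partialDeriv i).exists_bound_mulFun P.T_pos
        (partialDeriv_periodic P.c_periodic i)
      exact ⟨C, hC, fun t _ => h t⟩
  exact ⟨C, hC, fun i t => h i t (mem_univ t)⟩

lemma exists_norm_S_comp_sub_le : ∃ H, 0 ≤ H ∧ ∀ (B : L2Torus d →L[ℝ] L2Torus d)
    (B' : Fin d → L2Torus d →L[ℝ] L2Torus d) (G : ℝ),
    (∀ i w, HasWeakPartial i (B w) (B' i w)) → (∀ i, ‖B' i‖ ≤ G) → ∀ h, 0 ≤ h →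
      ‖P.system.S h ∘L B - B‖ ≤ H * √h * G := by
  have hκ := P.κ_pos
  refine ⟨2 ^ d * 2 * √(2 * P.κ) * d, by positivity, fun B B' G hB hG h hh => ?_⟩
  refine (P.norm_S_comp_sub_le hB hh).trans ?_
  rw [Real.sqrt_mul (by positivity)]
  have h1 : ∑ i, ‖B' i‖ ≤ d * G := by
    refine (Finset.sum_le_sum fun i _ => hG i).trans (le_of_eq ?_)
    rw [Finset.sum_const, Finset.card_univ, Fintype.card_fin, nsmul_eq_mul]
  calc _ ≤ 2 ^ d * 2 * (√(2 * P.κ) * √h) * (d * G) := by gcongr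
    _ = _ := by ring

/-- The error consists of the potential remainder, its interaction with the drift, the motion of
`χV` under the heat flow, the drift remainder on `V` smoothed for a time `ρ`, the cost of that
smoothing, and the motion of the gradient. Without smoothing the drift remainder is bounded only by
`O(Δ)`. -/
lemma kstep_decomposition {s t : ℝ} (hst : s < t) {Δ : ℝ} (hΔ : 0 < Δ) (ρ : ℝ) :
    P.kstep Δ t ∘L P.system.sol t s - P.system.S Δ ∘L P.system.sol t s - Δ • P.system.source s t =
      P.driftOp Δ t ∘L (P.potOp Δ t - ContinuousLinearMap.id ℝ _ - Δ • P.system.χ t) ∘L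
        P.system.sol t s +
      Δ • ((P.driftOp Δ t - P.system.S Δ) ∘L P.system.χ t ∘L P.system.sol t s) +
      Δ • (P.system.S Δ ∘L (P.system.χ t ∘L P.system.sol t s) - P.system.χ t ∘L P.system.sol t s) +
      (P.driftOp Δ t - P.system.S Δ - Δ • ∑ i, P.system.β i t ∘L P.system.D i Δ) ∘L P.system.S ρ ∘L
        P.system.sol t s -
      (P.driftOp Δ t - P.system.S Δ - Δ • ∑ i, P.system.β i t ∘L P.system.D i Δ) ∘L
        (P.system.S ρ ∘L P.system.sol t s - P.system.sol t s) +
      Δ • ∑ i, P.system.β i t ∘L (P.system.S Δ ∘L P.system.grad i t s - P.system.grad i t s) := by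
  have h1 : ∀ i, P.system.S Δ ∘L P.system.grad i t s = P.system.D i Δ ∘L P.system.sol t s :=
    fun i => P.system.S_comp_grad i hst hΔ
  simp only [h1]
  rw [P.system.source_eq_grad hst]
  ext1 w
  simp only [kstep, sub_apply, add_apply, ContinuousLinearMap.comp_apply, smul_apply, _root_.sum_apply,
    map_sub, map_smul, smul_add, smul_sub, ContinuousLinearMap.id_apply, Finset.sum_sub_distrib]
  abel

/-- With `ρ = √Δ` the smoothed drift remainder is `O(Δ^{3/2})` and the cost of smoothing is `O(Δ√ρ)
= O(Δ^{5/4})`. The latter determines the rate; only `o(Δ)` matters later. -/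
lemma exists_kstep_sub_le {s m a : ℝ} (b : ℝ) (hsm : s < m) (hma : m < a) :
    ∃ K, 0 ≤ K ∧ ∀ t ∈ Icc a b, ∀ Δ, 0 < Δ → Δ ≤ 1 → Δ ≤ P.T →
      ‖P.kstep Δ t ∘L P.system.sol t s - P.system.S Δ ∘L P.system.sol t s -
        Δ • P.system.source s t‖ ≤ K * (Δ * √√Δ) := by
  obtain ⟨G, hG, hreg⟩ := P.exists_regularity_bound b hsm hma
  obtain ⟨R1, hR1, h1⟩ := P.potOp_expansion
  obtain ⟨R2, hR2, h2⟩ := P.driftOp_expansion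
  obtain ⟨X, hX, hχ⟩ := P.system.χ_bound
  obtain ⟨Y, hY, hβ⟩ := P.system.β_bound
  obtain ⟨Z, hZ, hpc⟩ := P.exists_bound_partial_c
  obtain ⟨H, hH, hS⟩ := P.exists_norm_S_comp_sub_le
  refine ⟨R2 * R1 * G + R2 * X * G + H * (X * G + Z * G) + R2 * G + R2 * H * G + d * Y * H * G,
    by positivity, fun t ht Δ hΔ hΔ1 hΔT => ?_⟩
  have hmt : m < t := hma.trans_le ht.1
  have hst : s < t := hsm.trans hmt
  obtain ⟨hg1, hg2, hg3⟩ := hreg t ht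
  have hρ : 0 < √Δ := Real.sqrt_pos.2 hΔ
  rw [P.kstep_decomposition hst hΔ (√Δ)]
  obtain ⟨hd1, hd2, hd3⟩ := h2 Δ t 0 hΔ hΔT le_rfl
  rw [P.system.S_zero, ContinuousLinearMap.comp_id, zero_add] at hd2 hd3
  obtain ⟨-, -, hd4⟩ := h2 Δ t (√Δ) hΔ hΔT hρ.le
  set E := P.driftOp Δ t - P.system.S Δ - Δ • ∑ i, P.system.β i t ∘L P.system.D i Δ with hE
  -- All powers are expressed through this fourth root of `Δ`, with `q ≤ 1`.
  set q := √√Δ with hq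
  have hq0 : 0 < q := Real.sqrt_pos.2 hρ
  have hq2 : √Δ = q ^ 2 := (Real.sq_sqrt hρ.le).symm
  have hq4 : Δ = q ^ 4 := by
    rw [show q ^ 4 = (q ^ 2) ^ 2 by ring, ← hq2, Real.sq_sqrt hΔ.le]
  have hq1 : q ≤ 1 := by
    have h3 : √Δ ≤ 1 := Real.sqrt_le_iff.2 ⟨zero_le_one, by simpa using hΔ1⟩
    exact Real.sqrt_le_iff.2 ⟨zero_le_one, by simpa using h3⟩
  have hnΔ : ∀ B : L2Torus d →L[ℝ] L2Torus d, ‖Δ • B‖ = Δ * ‖B‖ := fun B => by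
    rw [norm_smul, Real.norm_of_nonneg hΔ.le]
  have hΔq : 0 ≤ Δ * q := by positivity
  have hsq : √Δ ≤ q := by rw [hq2]; nlinarith
  have hcV : ‖P.system.χ t ∘L P.system.sol t s‖ ≤ X * G :=
    (ContinuousLinearMap.opNorm_comp_le _ _).trans (mul_le_mul (hχ t) hg1 (norm_nonneg _) hX)
  have t1 : ‖P.driftOp Δ t ∘L (P.potOp Δ t - ContinuousLinearMap.id ℝ _ - Δ • P.system.χ t) ∘L
        P.system.sol t s‖ ≤ R2 * R1 * G * (Δ * q) := by
    refine (ContinuousLinearMap.opNorm_comp_le _ _).trans ?_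
    refine (mul_le_mul hd1 ((ContinuousLinearMap.opNorm_comp_le _ _).trans
      (mul_le_mul (h1 Δ t hΔ hΔT).1 hg1 (norm_nonneg _) (by positivity))) (norm_nonneg _) hR2).trans ?_
    have : Δ ^ 2 ≤ Δ * q := by
      rw [sq]; gcongr
      exact ((Real.le_sqrt' hΔ).2 (by nlinarith)).trans hsq
    calc R2 * (R1 * Δ ^ 2 * G) ≤ R2 * (R1 * (Δ * q) * G) := by gcongr
      _ = _ := by ring
  have t2 : ‖Δ • ((P.driftOp Δ t - P.system.S Δ) ∘L P.system.χ t ∘L P.system.sol t s)‖ ≤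
      R2 * X * G * (Δ * q) := by
    rw [hnΔ]
    have : Δ / √Δ ≤ q := by rw [Real.div_sqrt]; exact hsq
    calc _ ≤ Δ * (R2 * (Δ / √Δ) * (X * G)) := by
          gcongr
          exact (ContinuousLinearMap.opNorm_comp_le _ _).trans
            (mul_le_mul hd2 hcV (norm_nonneg _) (by positivity))
      _ ≤ Δ * (R2 * q * (X * G)) := by gcongr
      _ = _ := by ring
  have t3 : ‖Δ • (P.system.S Δ ∘L (P.system.χ t ∘L P.system.sol t s) -
      P.system.χ t ∘L P.system.sol t s)‖ ≤ H * (X * G + Z * G) * (Δ * q) := by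
    rw [hnΔ]
    have h4 := hS (P.system.χ t ∘L P.system.sol t s)
      (fun i => P.system.χ t ∘L P.system.grad i t s + mulFun (partialDeriv i (P.c t)) ∘L
        P.system.sol t s) (X * G + Z * G)
      (fun i w => (P.hasWeakPartial_grad i hst w).mulFun (P.c_smooth.smoothTest t))
      (fun i => (norm_add_le _ _).trans (add_le_add
        ((ContinuousLinearMap.opNorm_comp_le _ _).trans
          (mul_le_mul (hχ t) (hg2 i) (norm_nonneg _) hX))
        ((ContinuousLinearMap.opNorm_comp_le _ _).trans
          (mul_le_mul (hpc i t) hg1 (norm_nonneg _) hZ)))) Δ hΔ.le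
    calc _ ≤ Δ * (H * √Δ * (X * G + Z * G)) := by gcongr
      _ ≤ Δ * (H * q * (X * G + Z * G)) := by gcongr
      _ = _ := by ring
  have t4 : ‖E ∘L P.system.S (√Δ) ∘L P.system.sol t s‖ ≤ R2 * G * (Δ * q) := by
    rw [← ContinuousLinearMap.comp_assoc]
    refine (ContinuousLinearMap.opNorm_comp_le _ _).trans
      ((mul_le_mul hd4 hg1 (norm_nonneg _) (by positivity)).trans ?_)
    have : Δ ^ 2 / (√Δ + Δ) ≤ Δ * q := by
      rw [div_le_iff₀ (by positivity)]
      have e : Δ ^ 2 = Δ * q ^ 2 * √Δ := by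
        rw [hq2]; nth_rewrite 1 [hq4]; rw [hq4]; ring
      calc Δ ^ 2 = Δ * (q * q) * √Δ := by rw [e]; ring
        _ ≤ Δ * (q * 1) * (√Δ + Δ) := by gcongr; linarith
        _ = _ := by ring
    calc R2 * (Δ ^ 2 / (√Δ + Δ)) * G ≤ R2 * (Δ * q) * G := by gcongr
      _ = _ := by ring
  have t5 : ‖E ∘L (P.system.S (√Δ) ∘L P.system.sol t s - P.system.sol t s)‖ ≤
      R2 * H * G * (Δ * q) := by
    have h4 := hS (P.system.sol t s) (fun i => P.system.grad i t s) G
      (fun i w => P.hasWeakPartial_grad i hst w) hg2 (√Δ) hρ.le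
    refine (ContinuousLinearMap.opNorm_comp_le _ _).trans
      ((mul_le_mul hd3 h4 (norm_nonneg _) (by positivity)).trans (le_of_eq ?_))
    rw [← hq]
    field_simp
  have t6 : ‖Δ • ∑ i, P.system.β i t ∘L (P.system.S Δ ∘L P.system.grad i t s -
      P.system.grad i t s)‖ ≤ d * Y * H * G * (Δ * q) := by
    rw [hnΔ]
    have h5 : ‖∑ i, P.system.β i t ∘L (P.system.S Δ ∘L P.system.grad i t s -
        P.system.grad i t s)‖ ≤ d * (Y * (H * q * G)) := by
      refine (norm_sum_le_of_le (f := fun i => P.system.β i t ∘L (P.system.S Δ ∘L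
        P.system.grad i t s - P.system.grad i t s)) _ (fun i _ => ?_)).trans
        (le_of_eq (by rw [Finset.sum_const, Finset.card_univ, Fintype.card_fin, nsmul_eq_mul]))
      have h4 := hS (P.system.grad i t s) (fun j => P.hess j i t m s) G
        (fun j w => P.hasWeakPartial_hess j i hsm hmt w) (fun j => hg3 j i) Δ hΔ.le
      refine (ContinuousLinearMap.opNorm_comp_le _ _).trans
        (mul_le_mul (hβ i t) (h4.trans ?_) (norm_nonneg _) hY)
      gcongr
    calc _ ≤ Δ * (d * (Y * (H * q * G))) := by gcongr
      _ = _ := by ring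
  refine (norm_add_le_of_le (norm_sub_le_of_le (norm_add_le_of_le (norm_add_le_of_le
    (norm_add_le_of_le t1 t2) t3) t4) t5) t6).trans (le_of_eq ?_)
  ring

/-- Uniform consistency of the scheme away from time zero. -/
lemma exists_consistency {s a ε : ℝ} (b : ℝ) (hsa : s < a) (hε : 0 < ε) :
    ∃ h₀, 0 < h₀ ∧ ∀ t ∈ Icc a b, ∀ Δ, 0 < Δ → Δ ≤ h₀ →
      ‖P.kstep Δ t ∘L P.system.sol t s - P.system.sol (t + Δ) s‖ ≤ ε * Δ := by
  obtain ⟨m, hsm, hma⟩ := exists_between hsa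
  obtain ⟨K, hK, h1⟩ := P.exists_kstep_sub_le b hsm hma
  obtain ⟨k1, hk1, h2⟩ := P.norm_S_comp_sol_sub_le (b := b) hsm hma (by positivity : 0 < ε / 3)
  obtain ⟨k2, hk2, h3⟩ := P.norm_sol_sub_sub_le (b := b) hsm hma (by positivity : 0 < ε / 3)
  have hlim : Tendsto (fun Δ : ℝ => K * √√Δ) (𝓝 0) (𝓝 0) := by
    have : Continuous fun Δ : ℝ => K * √√Δ := by fun_prop
    simpa using this.tendsto 0
  obtain ⟨k3, hk3, h4⟩ := Metric.eventually_nhds_iff.1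
    (hlim.eventually (Iio_mem_nhds (by positivity : 0 < ε / 3)))
  refine ⟨min (min k1 k2) (min (k3 / 2) (min 1 P.T)), by have := P.T_pos; positivity,
    fun t ht Δ hΔ hle => ?_⟩
  simp only [le_min_iff] at hle
  obtain ⟨⟨c1, c2⟩, c3, c4, c5⟩ := hle
  -- Scheme, heat flow and exact solution are expanded to first order; the terms `κ • lap` and
  -- `source` cancel.
  have e : P.kstep Δ t ∘L P.system.sol t s - P.system.sol (t + Δ) s =
      (P.kstep Δ t ∘L P.system.sol t s - P.system.S Δ ∘L P.system.sol t s -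
        Δ • P.system.source s t) +
      (P.system.S Δ ∘L P.system.sol t s - P.system.sol t s - (Δ * P.κ) • P.lap t m s) -
      (P.system.sol (t + Δ) s - P.system.sol t s - Δ • P.rate t m s) := by
    rw [rate, smul_add, smul_smul]; abel
  have h5 : K * √√Δ < ε / 3 := h4 (by
    rw [Real.dist_eq, sub_zero, abs_of_pos hΔ]; linarith)
  rw [e]
  refine (norm_sub_le_of_le (norm_add_le_of_le (h1 t ht Δ hΔ c4 c5) (h2 t ht Δ hΔ.le c1))
    (h3 t ht Δ hΔ.le c2)).trans ?_
  nlinarith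

/-- Convergence of the scheme to the solution in the operator norm. -/
theorem exists_convergence {ε : ℝ} (hε : 0 < ε) : ∃ M₀ : ℕ, 0 < M₀ ∧ ∀ M : ℕ, M₀ ≤ M →
    ‖opProd (fun j => P.kstep (P.T / M) (j * (P.T / M))) 0 M - P.system.sol P.T 0‖ ≤ ε := by
  have hT := P.T_pos
  obtain ⟨A, hA, hstab⟩ := P.exists_stability
  obtain ⟨C, hC, hsol⟩ := P.system.norm_sol_sub_le 0 P.T
  have hA0 : 0 < A := by linarith
  have hlim : Tendsto (fun δ : ℝ => A * ((A + C) * √(2 * δ))) (𝓝[>] 0) (𝓝 0) := by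
    have : Continuous fun δ : ℝ => A * ((A + C) * √(2 * δ)) := by fun_prop
    exact tendsto_nhdsWithin_of_tendsto_nhds (by simpa using this.tendsto 0)
  -- Consistency is uniform only away from time zero. On the initial layer, scheme and solution are
  -- both compared with the heat semigroup, at cost `O(√δ)`.
  obtain ⟨δ, hδ1, hδ0, hδ2⟩ := ((hlim.eventually (gt_mem_nhds (by positivity : 0 < ε / 2))).and
    (Ioo_mem_nhdsGT (by positivity : (0:ℝ) < P.T / 2))).exists
  obtain ⟨h₀, hh₀, hcons⟩ := P.exists_consistency (ε := ε / (2 * A * P.T)) P.T hδ0 (by positivity)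
  obtain ⟨M₀, hM₀⟩ := exists_nat_gt (P.T / min h₀ δ)
  have hmin : 0 < min h₀ δ := lt_min hh₀ hδ0
  have hM₀0 : (0:ℝ) < M₀ := lt_trans (by positivity) hM₀
  refine ⟨M₀, by exact_mod_cast hM₀0, fun M hM => ?_⟩
  have hM' : (M₀ : ℝ) ≤ M := by exact_mod_cast hM
  have hMpos : (0:ℝ) < M := hM₀0.trans_le hM'
  have hM1 : (1:ℝ) ≤ M := by exact_mod_cast (by exact_mod_cast hMpos : 0 < M)
  set Δ := P.T / M with hΔdef
  have hΔ : 0 < Δ := by positivity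
  have hMΔ : M * Δ = P.T := by rw [hΔdef]; field_simp
  have hΔT : Δ ≤ P.T := div_le_self hT.le hM1
  have hΔmin : Δ ≤ min h₀ δ := by
    rw [hΔdef, div_le_iff₀ hMpos]
    rw [div_lt_iff₀ hmin] at hM₀
    nlinarith
  obtain ⟨hΔh, hΔδ⟩ := le_min_iff.1 hΔmin
  -- The number of steps that leaves `[0, δ)`; rounding up keeps `n₀Δ ≤ 2δ` because `Δ ≤ δ`.
  set n₀ := ⌈δ / Δ⌉₊ with hn₀
  have hn1 : δ ≤ n₀ * Δ := by
    rw [← div_le_iff₀ hΔ]; exact Nat.le_ceil _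
  have hn2 : n₀ * Δ ≤ 2 * δ := by
    have h1 : (n₀ : ℝ) < δ / Δ + 1 := Nat.ceil_lt_add_one (by positivity)
    have h2 : (n₀ : ℝ) * Δ < (δ / Δ + 1) * Δ := by gcongr
    rw [add_mul, div_mul_cancel₀ _ hΔ.ne'] at h2
    linarith
  have hn3 : n₀ * Δ ≤ P.T := by linarith
  have hn4 : n₀ ≤ M := by
    have : (n₀ : ℝ) ≤ M := le_of_mul_le_mul_right (hn3.trans hMΔ.ge) hΔ
    exact_mod_cast this
  clear_value n₀ Δ
  obtain ⟨k, rfl⟩ := Nat.exists_eq_add_of_le hn4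
  set K : ℕ → L2Torus d →L[ℝ] L2Torus d := fun j => P.kstep Δ (j * Δ) with hK
  have htel := opProd_comp_sub K (fun l : ℕ => P.system.sol ((n₀ + l : ℕ) * Δ) 0) n₀ k
  have e : opProd K 0 (n₀ + k) - P.system.sol P.T 0 =
      opProd K n₀ k ∘L (opProd K 0 n₀ - P.system.sol (n₀ * Δ) 0) +
      ∑ l ∈ Finset.range k, opProd K (n₀ + (l + 1)) (k - (l + 1)) ∘L
        (K (n₀ + l) ∘L P.system.sol ((n₀ + l : ℕ) * Δ) 0 -
          P.system.sol ((n₀ + (l + 1) : ℕ) * Δ) 0) := by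
    rw [← htel, opProd_add, zero_add, hMΔ, ContinuousLinearMap.comp_sub, add_zero]
    abel
  have hle : ∀ n : ℕ, n ≤ n₀ + k → n * Δ ≤ P.T := fun n hn => by
    rw [← hMΔ]; gcongr
  have hn5 : 0 < n₀ * Δ := hδ0.trans_le hn1
  have h1 : ‖opProd K 0 n₀ - P.system.sol (n₀ * Δ) 0‖ ≤ (A + C) * √(2 * δ) := by
    have h2 := (hstab Δ hΔ hΔT 0 n₀ hn3).2
    have h3 := hsol (n₀ * Δ) hn5 (by simpa using hn3)
    rw [sub_zero] at h3
    have h4 : √(n₀ * Δ) ≤ √(2 * δ) := Real.sqrt_le_sqrt hn2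
    calc _ = ‖(opProd K 0 n₀ - P.system.S (n₀ * Δ)) -
          (P.system.sol (n₀ * Δ) 0 - P.system.S (n₀ * Δ))‖ := by rw [sub_sub_sub_cancel_right]
      _ ≤ A * √(n₀ * Δ) + C * √(n₀ * Δ) := norm_sub_le_of_le h2 h3
      _ = (A + C) * √(n₀ * Δ) := by ring
      _ ≤ _ := by gcongr
  have h2 : ‖opProd K n₀ k ∘L (opProd K 0 n₀ - P.system.sol (n₀ * Δ) 0)‖ ≤
      A * ((A + C) * √(2 * δ)) :=
    (ContinuousLinearMap.opNorm_comp_le _ _).trans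
      (mul_le_mul (hstab Δ hΔ hΔT n₀ k (hle k (by omega))).1 h1 (norm_nonneg _) hA0.le)
  have h3 : ∀ l ∈ Finset.range k, ‖opProd K (n₀ + (l + 1)) (k - (l + 1)) ∘L
        (K (n₀ + l) ∘L P.system.sol ((n₀ + l : ℕ) * Δ) 0 -
          P.system.sol ((n₀ + (l + 1) : ℕ) * Δ) 0)‖ ≤ A * (ε / (2 * A * P.T) * Δ) := fun l hl => by
    have hl' := Finset.mem_range.1 hl
    have h4 := hcons ((n₀ + l : ℕ) * Δ) ⟨hn1.trans (by gcongr; omega), hle _ (by omega)⟩ Δ hΔ hΔh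
    rw [show ((n₀ + l : ℕ) : ℝ) * Δ + Δ = (n₀ + (l + 1) : ℕ) * Δ by push_cast; ring] at h4
    exact (ContinuousLinearMap.opNorm_comp_le _ _).trans
      (mul_le_mul (hstab Δ hΔ hΔT _ _ (hle _ (by omega))).1 h4 (norm_nonneg _) hA0.le)
  have h5 : ∑ l ∈ Finset.range k, A * (ε / (2 * A * P.T) * Δ) ≤ ε / 2 := by
    rw [Finset.sum_const, Finset.card_range, nsmul_eq_mul]
    have h6 : k * Δ ≤ P.T := hle k (by omega)
    calc k * (A * (ε / (2 * A * P.T) * Δ)) = A * (ε / (2 * A * P.T)) * (k * Δ) := by ring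
      _ ≤ A * (ε / (2 * A * P.T)) * P.T := by gcongr
      _ = ε / 2 := by field_simp
  rw [e]
  refine (norm_add_le_of_le h2 ((norm_sum_le_of_le _ h3).trans h5)).trans ?_
  linarith

end Coefficients

end FKTorus

end

/-! ### The scheme on functions and on `L²` classes; bounds in the limit. -/

noncomputable section

namespace FKTorus

open Set

namespace Coefficients

variable {d : ℕ} (P : Coefficients d)

lemma coeFn_kstep {Δ : ℝ} (hΔ : 0 < Δ) (t : ℝ) {φ : L2Torus d} {f : Torus d → ℝ}
    (hf : φ =ᵐ[torusMeasure d] f) :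
    P.kstep Δ t φ =ᵐ[torusMeasure d] stepOp P.κ P.b P.c Δ t f := by
  have hκ := P.κ_pos
  obtain ⟨B, hB, hb⟩ := P.b_smooth.exists_bound P.T_pos P.b_periodic
  have he : Continuous fun x => Real.exp (Δ * P.c t x) :=
    Real.continuous_exp.comp ((P.continuous_c t).const_smul Δ)
  have hbB : ∀ x, ‖Δ • P.b t x‖ ≤ Δ * B := fun x => by
    rw [norm_smul, Real.norm_of_nonneg hΔ.le]
    exact mul_le_mul_of_nonneg_left (hb _ _) hΔ.le
  have h1 : P.potOp Δ t φ =ᵐ[torusMeasure d] fun x => Real.exp (Δ * P.c t x) * f x := by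
    filter_upwards [coeFn_mulFun he φ, hf] with x hx hx'
    rw [potOp, hx, hx']
  filter_upwards [coeFn_shiftHeat (by positivity : 0 < 2 * P.κ * Δ)
    ((P.continuous_b t).const_smul Δ).measurable hbB h1] with x hx
  rw [kstep, ContinuousLinearMap.comp_apply, driftOp]
  refine hx.trans ?_
  rw [stepOp_eq hκ hΔ, integral_gauss (by positivity)]
  rfl

lemma coeFn_opProd {Δ : ℝ} (hΔ : 0 < Δ) (φ : L2Torus d) (n : ℕ) :
    opProd (fun j => P.kstep Δ (j * Δ)) 0 n φ =ᵐ[torusMeasure d]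
      stepProd P.κ P.b P.c Δ n φ := by
  induction n with
  | zero => rfl
  | succ n ih =>
    rw [opProd, zero_add, ContinuousLinearMap.comp_apply]
    exact P.coeFn_kstep hΔ _ ih

/-- The discretized one-period operator on `L²`. -/
def periodL2 (M : ℕ) : L2Torus d →L[ℝ] L2Torus d :=
  opProd (fun j => P.kstep (P.T / M) (j * (P.T / M))) 0 M

lemma coeFn_periodL2 {M : ℕ} (hM : 0 < M) (φ : L2Torus d) :
    P.periodL2 M φ =ᵐ[torusMeasure d] periodOp P.κ P.b P.c P.T M φ :=
  P.coeFn_opProd (div_pos P.T_pos (by exact_mod_cast hM)) φ M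

/-- Convergence of the discretized operators, in terms of functions. -/
theorem exists_eLpNorm_sub_le {δ : ℝ} (hδ : 0 < δ) : ∃ M₀ : ℕ, ∀ M : ℕ, M₀ ≤ M → ∀ φ : L2Torus d,
    eLpNorm (fun x => periodOp P.κ P.b P.c P.T M φ x - P.system.sol P.T 0 φ x) 2
      (torusMeasure d) ≤ ENNReal.ofReal (δ * ‖φ‖) := by
  obtain ⟨M₀, hM₀, h⟩ := P.exists_convergence hδ
  refine ⟨M₀, fun M hM φ => ?_⟩
  have h1 : (fun x => periodOp P.κ P.b P.c P.T M φ x - P.system.sol P.T 0 φ x) =ᵐ[torusMeasure d]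
      ((P.periodL2 M - P.system.sol P.T 0) φ : L2Torus d) := by
    filter_upwards [P.coeFn_periodL2 (hM₀.trans_le hM) φ,
      Lp.coeFn_sub (P.periodL2 M φ) (P.system.sol P.T 0 φ)] with x h1 h2
    rw [sub_apply, h2, Pi.sub_apply, h1]
  rw [eLpNorm_congr_ae h1, ← ENNReal.ofReal_toReal (Lp.eLpNorm_ne_top _), ← Lp.norm_def]
  exact ENNReal.ofReal_le_ofReal (ContinuousLinearMap.le_of_opNorm_le _ (h M hM) φ)

lemma tendsto_periodL2 (φ : L2Torus d) :
    Tendsto (fun M => P.periodL2 M φ) atTop (𝓝 (P.system.sol P.T 0 φ)) := by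
  have h : Tendsto (fun M => P.periodL2 M) atTop (𝓝 (P.system.sol P.T 0)) := by
    rw [Metric.tendsto_atTop]
    intro ε hε
    obtain ⟨M₀, -, h⟩ := P.exists_convergence (half_pos hε)
    refine ⟨M₀, fun M hM => ?_⟩
    rw [dist_eq_norm]
    exact (h M hM).trans_lt (half_lt_self hε)
  exact ((ContinuousLinearMap.apply ℝ (L2Torus d) φ).continuous.tendsto _).comp h

/-- Bounds that hold for all discretized operators pass to the solution operator. -/
lemma ae_bounds_of_periodOp {ε γ : ℝ} (h : ∀ M : ℕ, 0 < M → ∀ φ : Torus d → ℝ,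
    MemLp φ 2 (torusMeasure d) → 0 ≤ᵐ[torusMeasure d] φ → ∀ x,
      ε * ∫ y, φ y ∂torusMeasure d ≤ periodOp P.κ P.b P.c P.T M φ x ∧
      periodOp P.κ P.b P.c P.T M φ x ≤ γ * ∫ y, φ y ∂torusMeasure d)
    {φ : L2Torus d} (hφ : 0 ≤ᵐ[torusMeasure d] φ) : ∀ᵐ x ∂torusMeasure d,
      ε * ∫ y, φ y ∂torusMeasure d ≤ P.system.sol P.T 0 φ x ∧
      P.system.sol P.T 0 φ x ≤ γ * ∫ y, φ y ∂torusMeasure d := by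
  set I := ∫ y, φ y ∂torusMeasure d
  have hev : ∀ᶠ M : ℕ in atTop, 0 < M := eventually_gt_atTop 0
  -- The order of `L²` is closed, so inequalities survive the limit at each single `φ`.
  have h1 : contLp (fun _ : Torus d => ε * I) continuous_const ≤ P.system.sol P.T 0 φ := by
    refine ge_of_tendsto (P.tendsto_periodL2 φ) (hev.mono fun M hM => ?_)
    rw [← Lp.coeFn_le]
    filter_upwards [coeFn_contLp (fun _ : Torus d => ε * I) continuous_const,
      P.coeFn_periodL2 hM φ] with x e1 e2
    rw [e1, e2]
    exact (h M hM φ (Lp.memLp φ) hφ x).1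
  have h2 : P.system.sol P.T 0 φ ≤ contLp (fun _ : Torus d => γ * I) continuous_const := by
    refine le_of_tendsto (P.tendsto_periodL2 φ) (hev.mono fun M hM => ?_)
    rw [← Lp.coeFn_le]
    filter_upwards [coeFn_contLp (fun _ : Torus d => γ * I) continuous_const,
      P.coeFn_periodL2 hM φ] with x e1 e2
    rw [e1, e2]
    exact (h M hM φ (Lp.memLp φ) hφ x).2
  rw [← Lp.coeFn_le] at h1 h2
  filter_upwards [h1, h2, coeFn_contLp (fun _ : Torus d => ε * I) continuous_const,
    coeFn_contLp (fun _ : Torus d => γ * I) continuous_const] with x e1 e2 e3 e4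
  rw [e3] at e1
  rw [e4] at e2
  exact ⟨e1, e2⟩

end Coefficients

end FKTorus

end

/-! ### The evolution on continuous functions and continuous representatives. -/

noncomputable section

namespace FKTorus

open Set
open scoped RealInnerProductSpace

section Uniform

variable {d : ℕ}

/-- The embedding of the continuous functions into `L²`. -/
def emb : C(Torus d, ℝ) →L[ℝ] L2Torus d := ContinuousMap.toLp 2 (torusMeasure d) ℝ

lemma coeFn_emb (f : C(Torus d, ℝ)) : emb f =ᵐ[torusMeasure d] f :=
  ContinuousMap.coeFn_toLp (𝕜 := ℝ) (torusMeasure d) f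

lemma injective_emb : Function.Injective (emb : C(Torus d, ℝ) → L2Torus d) :=
  ContinuousMap.toLp_injective (torusMeasure d)

lemma denseRange_emb : DenseRange (emb : C(Torus d, ℝ) → L2Torus d) :=
  ContinuousMap.toLp_denseRange ℝ (torusMeasure d) ℝ (by norm_num)

/-- Through the injective embedding the semigroup laws on continuous functions are inherited from
`L²`. -/
lemma ext_emb {A B : C(Torus d, ℝ) →L[ℝ] C(Torus d, ℝ)} (h : emb ∘L A = emb ∘L B) : A = B := by
  ext1 f
  exact injective_emb (congrArg (fun C => C f) h)

lemma integrable_mul_shift {ρ : Space d → ℝ} (hρ : Integrable ρ) (f : C(Torus d, ℝ)) (x : Torus d) :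
    Integrable fun z => ρ z * f (x + toTorus z) :=
  hρ.mul_bdd (c := ‖f‖)
    (f.continuous.comp (continuous_const.add continuous_toTorus)).aestronglyMeasurable
    (Eventually.of_forall fun _ => f.norm_coe_le_norm _)

lemma continuous_integral_shift {ρ : Space d → ℝ} (hρ : Integrable ρ) (f : C(Torus d, ℝ)) :
    Continuous fun x : Torus d => ∫ z, ρ z * f (x + toTorus z) := by
  refine continuous_of_dominated (bound := fun z => ‖ρ z‖ * ‖f‖)
    (fun x => (integrable_mul_shift hρ f x).aestronglyMeasurable) (fun x => Eventually.of_forall fun z => ?_)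
    (hρ.norm.mul_const _) (Eventually.of_forall fun z => ?_)
  · rw [norm_mul]
    exact mul_le_mul_of_nonneg_left (f.norm_coe_le_norm _) (norm_nonneg _)
  · exact continuous_const.mul (f.continuous.comp (continuous_id.add continuous_const))

open Classical in
/-- The operator `f ↦ ∫ ρ(z) f(· + z) dz` on continuous functions. -/
def convC (ρ : Space d → ℝ) : C(Torus d, ℝ) →L[ℝ] C(Torus d, ℝ) :=
  if hρ : Integrable ρ then
    LinearMap.mkContinuous
      { toFun := fun f => ⟨fun x => ∫ z, ρ z * f (x + toTorus z), continuous_integral_shift hρ f⟩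
        map_add' := fun f g => by
          ext x
          simp only [ContinuousMap.coe_mk, ContinuousMap.add_apply, mul_add]
          exact integral_add (integrable_mul_shift hρ f x) (integrable_mul_shift hρ g x)
        map_smul' := fun a f => by
          ext x
          simp only [ContinuousMap.coe_mk, ContinuousMap.smul_apply, smul_eq_mul, RingHom.id_apply,
            mul_left_comm _ a]
          exact integral_const_mul _ _ } (∫ z, |ρ z|) (fun f => by
      refine (ContinuousMap.norm_le _ (by positivity)).2 fun x => ?_
      refine (norm_integral_le_integral_norm _).trans ?_
      rw [← integral_mul_const]
      refine integral_mono (integrable_mul_shift hρ f x).norm (hρ.abs.mul_const _) fun z => ?_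
      simp only [norm_mul, Real.norm_eq_abs (ρ z)]
      exact mul_le_mul_of_nonneg_left (f.norm_coe_le_norm _) (abs_nonneg _))
  else 0

lemma convC_apply {ρ : Space d → ℝ} (hρ : Integrable ρ) (f : C(Torus d, ℝ)) (x : Torus d) :
    convC ρ f x = ∫ z, ρ z * f (x + toTorus z) := by
  rw [convC, dif_pos hρ]; rfl

lemma norm_convC_le (ρ : Space d → ℝ) : ‖convC ρ‖ ≤ ∫ z, |ρ z| := by
  by_cases hρ : Integrable ρ
  · rw [convC, dif_pos hρ]
    exact LinearMap.mkContinuous_norm_le _ (by positivity) _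
  · rw [convC, dif_neg hρ]
    exact (le_of_eq (norm_zero (E := C(Torus d, ℝ) →L[ℝ] C(Torus d, ℝ)))).trans (integral_nonneg fun z => abs_nonneg (ρ z))

lemma convC_sub {ρ σ : Space d → ℝ} (hρ : Integrable ρ) (hσ : Integrable σ) :
    convC ρ - convC σ = convC (fun z => ρ z - σ z) := by
  ext f x
  rw [sub_apply, ContinuousMap.sub_apply, convC_apply hρ, convC_apply hσ,
    convC_apply (ρ := fun z => ρ z - σ z) (hρ.sub hσ),
    ← integral_sub (integrable_mul_shift hρ f x) (integrable_mul_shift hσ f x)]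
  simp only [sub_mul]

lemma emb_comp_convC {ρ : Space d → ℝ} (hρ : Integrable ρ) :
    emb ∘L convC ρ = convOp ρ ∘L (emb : C(Torus d, ℝ) →L[ℝ] L2Torus d) := by
  ext1 f
  refine Lp.ext ?_
  filter_upwards [coeFn_emb (convC ρ f), coeFn_convOp_of_ae hρ (coeFn_emb f)] with x h1 h2
  rw [ContinuousLinearMap.comp_apply, ContinuousLinearMap.comp_apply, h1, h2, convC_apply hρ]

lemma continuousOn_convC {ρ : ℝ → Space d → ℝ} (hρ : ∀ v, 0 < v → Integrable (ρ v))
    (h : ∀ v₀, 0 < v₀ → Tendsto (fun v => ∫ z, |ρ v z - ρ v₀ z|) (𝓝 v₀) (𝓝 0)) :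
    ContinuousOn (fun v => convC (ρ v)) (Ioi 0) := by
  intro v₀ hv₀
  refine ContinuousAt.continuousWithinAt ?_
  refine (tendsto_iff_norm_sub_tendsto_zero (E := C(Torus d, ℝ) →L[ℝ] C(Torus d, ℝ))).2 ?_
  refine squeeze_zero' (Eventually.of_forall fun v => norm_nonneg (convC (ρ v) - convC (ρ v₀))) ?_
    (h v₀ hv₀)
  filter_upwards [lt_mem_nhds hv₀] with v hv
  rw [convC_sub (hρ v hv) (hρ v₀ hv₀)]
  exact norm_convC_le _

/-- The heat semigroup on continuous functions. -/
def heatC (v : ℝ) : C(Torus d, ℝ) →L[ℝ] C(Torus d, ℝ) :=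
  if v ≤ 0 then ContinuousLinearMap.id ℝ _ else convC (gk v)

lemma heatC_of_nonpos {v : ℝ} (hv : v ≤ 0) :
    (heatC v : C(Torus d, ℝ) →L[ℝ] C(Torus d, ℝ)) = ContinuousLinearMap.id ℝ _ := if_pos hv

lemma heatC_of_pos {v : ℝ} (hv : 0 < v) :
    (heatC v : C(Torus d, ℝ) →L[ℝ] C(Torus d, ℝ)) = convC (gk v) := if_neg hv.not_ge

lemma norm_heatC_le (v : ℝ) : ‖(heatC v : C(Torus d, ℝ) →L[ℝ] C(Torus d, ℝ))‖ ≤ 1 := by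
  rcases le_or_gt v 0 with hv | hv
  · rw [heatC_of_nonpos hv]; exact ContinuousLinearMap.norm_id_le
  · rw [heatC_of_pos hv]
    refine (norm_convC_le _).trans (le_of_eq ?_)
    simp only [abs_of_nonneg (gk_nonneg _ _), integral_gk hv]

lemma emb_comp_heatC (v : ℝ) :
    emb ∘L heatC v = heat v ∘L (emb : C(Torus d, ℝ) →L[ℝ] L2Torus d) := by
  rcases le_or_gt v 0 with hv | hv
  · rw [heatC_of_nonpos hv, heat_of_nonpos hv]; rfl
  · rw [heatC_of_pos hv, heat_of_pos hv, emb_comp_convC (integrable_gk hv)]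

lemma emb_comp_heatDC (i : Fin d) {v : ℝ} (hv : 0 < v) :
    emb ∘L convC (dk i v) = heatD i v ∘L (emb : C(Torus d, ℝ) →L[ℝ] L2Torus d) :=
  emb_comp_convC (integrable_dk hv i)

lemma emb_comp_mul (a : C(Torus d, ℝ)) :
    emb ∘L ContinuousLinearMap.mul ℝ C(Torus d, ℝ) a = mulOp a ∘L emb := by
  ext1 f
  refine Lp.ext ?_
  filter_upwards [coeFn_emb (a * f), coeFn_mulOp a (emb f), coeFn_emb f] with x h1 h2 h3
  rw [ContinuousLinearMap.comp_apply, ContinuousLinearMap.comp_apply, ContinuousLinearMap.mul_apply',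
    h1, h2, h3, ContinuousMap.mul_apply]

/-- The set of violation is open and null, hence empty. -/
lemma forall_le_of_ae_le {g : Torus d → ℝ} (hg : Continuous g) {C : ℝ}
    (h : ∀ᵐ x ∂torusMeasure d, g x ≤ C) (x : Torus d) : g x ≤ C := by
  have h1 : IsOpen {x | ¬ g x ≤ C} := by
    simp only [not_le]; exact isOpen_lt continuous_const hg
  have h2 := (h1.measure_eq_zero_iff (torusMeasure d)).1 (ae_iff.1 h)
  by_contra hx
  exact (h2 ▸ hx : x ∈ (∅ : Set (Torus d)))

lemma SmoothCoefficient.continuous_bundled {f : ℝ → Torus d → ℝ} (hf : SmoothCoefficient f) :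
    Continuous fun t : ℝ => (⟨f t, (hf.smoothTest t).continuous⟩ : C(Torus d, ℝ)) :=
  ContinuousMap.continuous_of_continuous_uncurry _ hf.continuous

end Uniform

namespace Coefficients

variable {d : ℕ} (P : Coefficients d)

/-- A component of the drift, as a continuous function. -/
def driftC (i : Fin d) (t : ℝ) : C(Torus d, ℝ) :=
  ⟨fun x => P.b t x i, ((P.b_smooth.apply i).smoothTest t).continuous⟩

/-- The potential, as a continuous function. -/
def potC (t : ℝ) : C(Torus d, ℝ) := ⟨P.c t, (P.c_smooth.smoothTest t).continuous⟩

/-- The evolution equation in the space of continuous functions. -/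
def systemC : FirstOrderSystem (Fin d) C(Torus d, ℝ) where
  S t := heatC (2 * P.κ * t)
  D i t := convC (dk i (2 * P.κ * t))
  β i t := ContinuousLinearMap.mul ℝ _ (P.driftC i t)
  χ t := ContinuousLinearMap.mul ℝ _ (P.potC t)
  S_zero := heatC_of_nonpos (by simp)
  S_add s t hs ht := ext_emb <| by
    have := P.κ_pos
    rw [emb_comp_heatC, ← ContinuousLinearMap.comp_assoc, emb_comp_heatC,
      ContinuousLinearMap.comp_assoc, emb_comp_heatC, ← ContinuousLinearMap.comp_assoc, mul_add,
      heat_add (by positivity) (by positivity)]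
  S_cont := P.heat_time_cont ((continuousOn_convC (fun _ hv => integrable_gk hv) fun _ hv =>
    tendsto_integral_abs_gk_sub hv).congr fun _ hv => heatC_of_pos hv)
  S_bound := ⟨1, zero_le_one, fun t _ => norm_heatC_le _⟩
  D_add i s t hs ht := ext_emb <| by
    have := P.κ_pos
    rw [emb_comp_heatDC i (by positivity), ← ContinuousLinearMap.comp_assoc,
      emb_comp_heatDC i (by positivity), ContinuousLinearMap.comp_assoc, emb_comp_heatC,
      ← ContinuousLinearMap.comp_assoc, mul_add, heatD_add i (by positivity) (by positivity)]
  S_comp_D i s t hs ht := ext_emb <| by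
    have := P.κ_pos
    rw [emb_comp_heatDC i (by positivity), ← ContinuousLinearMap.comp_assoc, emb_comp_heatC,
      ContinuousLinearMap.comp_assoc, emb_comp_heatDC i (by positivity),
      ← ContinuousLinearMap.comp_assoc, mul_add, heat_comp_heatD i (by positivity) (by positivity)]
  D_cont i := P.heat_time_cont (continuousOn_convC (fun _ hv => integrable_dk hv i) fun _ hv =>
    tendsto_integral_abs_dk_sub i hv)
  D_bound := by
    have hκ := P.κ_pos
    refine ⟨2 ^ d * 2 / √(2 * P.κ), by positivity, fun i t ht => ?_⟩
    refine ((norm_convC_le _).trans (integral_abs_dk_le (by positivity) i)).trans (le_of_eq ?_)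
    rw [Real.sqrt_mul (by positivity)]
    field_simp
  β_cont i := (ContinuousLinearMap.mul ℝ C(Torus d, ℝ)).continuous.comp
    (P.b_smooth.apply i).continuous_bundled
  χ_cont := (ContinuousLinearMap.mul ℝ C(Torus d, ℝ)).continuous.comp
    P.c_smooth.continuous_bundled
  β_bound := by
    obtain ⟨B, hB, hb⟩ := P.b_smooth.exists_bound P.T_pos P.b_periodic
    refine ⟨B, hB, fun i t => (ContinuousLinearMap.opNorm_mul_apply_le ℝ _ _).trans ?_⟩
    exact (ContinuousMap.norm_le _ hB).2 fun x => (abs_apply_le_norm _ i).trans (hb t x)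
  χ_bound := by
    obtain ⟨C, hC, hc⟩ := P.c_smooth.exists_bound P.T_pos P.c_periodic
    refine ⟨C, hC, fun t => (ContinuousLinearMap.opNorm_mul_apply_le ℝ _ _).trans ?_⟩
    exact (ContinuousMap.norm_le _ hC).2 fun x => hc t x

/-- Solving Duhamel's equation in `C(Torus d, ℝ)` makes solutions with continuous data continuous;
`intertwine` identifies them with the `L²` solutions. -/
lemma emb_comp_sol {s t : ℝ} (hst : s < t) :
    emb ∘L P.systemC.sol t s = P.system.sol t s ∘L emb := by
  have hκ := P.κ_pos
  refine (P.systemC.intertwine P.system emb (fun t _ => emb_comp_heatC _)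
    (fun i t ht => emb_comp_heatDC i (by positivity)) (fun i t => ?_) (fun t => ?_) hst).1
  · refine (emb_comp_mul _).trans ?_
    rw [driftC, ← mulFun_eq]; rfl
  · refine (emb_comp_mul _).trans ?_
    rw [potC, ← mulFun_eq]; rfl

/-- The solution operator maps nonnegative functions to functions with a continuous
representative satisfying the bounds of the discretized operators. -/
theorem exists_continuous_representative {ε γ : ℝ} (hε : 0 ≤ ε) (hγ : 0 ≤ γ)
    (h : ∀ φ : L2Torus d, 0 ≤ᵐ[torusMeasure d] φ → ∀ᵐ x ∂torusMeasure d,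
      ε * ∫ y, φ y ∂torusMeasure d ≤ P.system.sol P.T 0 φ x ∧
      P.system.sol P.T 0 φ x ≤ γ * ∫ y, φ y ∂torusMeasure d)
    {φ : L2Torus d} (hφ : 0 ≤ᵐ[torusMeasure d] φ) :
    ∃ g : Torus d → ℝ, Continuous g ∧ P.system.sol P.T 0 φ =ᵐ[torusMeasure d] g ∧
      ∀ x, ε * ∫ y, φ y ∂torusMeasure d ≤ g x ∧ g x ≤ γ * ∫ y, φ y ∂torusMeasure d := by
  set V := P.system.sol P.T 0 with hV
  set N := ‖contLp (fun _ : Torus d => (1:ℝ)) continuous_const‖ with hN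
  have hint : ∀ ψ : L2Torus d, ∫ y, ψ y ∂torusMeasure d ≤ ‖ψ‖ * N := fun ψ => by
    have h1 := inner_contLp ψ (fun _ : Torus d => (1:ℝ)) continuous_const
    simp only [mul_one] at h1
    rw [← h1]
    exact real_inner_le_norm _ _
  -- The lower bound makes `V` positive, so `|V ψ| ≤ V |ψ|`, and the upper bound then controls `V`
  -- from `L²` to `L^∞`.
  have hpos : ∀ ψ : L2Torus d, 0 ≤ ψ → 0 ≤ V ψ := fun ψ hψ => by
    rw [← Lp.coeFn_nonneg] at hψ ⊢
    filter_upwards [h ψ hψ] with x hx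
    exact (mul_nonneg hε (integral_nonneg_of_ae hψ)).trans hx.1
  have hbd : ∀ ψ : L2Torus d, ∀ᵐ x ∂torusMeasure d, |V ψ x| ≤ γ * (‖ψ‖ * N) := fun ψ => by
    have h1 : V ψ ≤ V |ψ| := by
      rw [← sub_nonneg, ← map_sub]; exact hpos _ (sub_nonneg.2 (le_abs_self ψ))
    have h2 : -V ψ ≤ V |ψ| := by
      rw [← sub_nonneg, ← map_neg, ← map_sub]; exact hpos _ (sub_nonneg.2 (neg_le_abs ψ))
    have h0 : 0 ≤ᵐ[torusMeasure d] (|ψ| : L2Torus d) := (Lp.coeFn_nonneg _).2 (abs_nonneg ψ)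
    filter_upwards [(Lp.coeFn_le _ _).2 h1, (Lp.coeFn_le _ _).2 h2, h _ h0, Lp.coeFn_neg (V ψ)]
      with x e1 e2 e3 e4
    rw [e4, Pi.neg_apply] at e2
    have e5 : γ * ∫ y, |ψ| y ∂torusMeasure d ≤ γ * (‖ψ‖ * N) := by
      rw [← norm_abs_L2 ψ]
      exact mul_le_mul_of_nonneg_left (hint _) hγ
    exact abs_le.2 ⟨by linarith [e3.2], by linarith [e3.2]⟩
  -- Continuous approximations of `φ` in `L²` have continuous images, which are uniformly Cauchy by
  -- the bound into `L^∞`; the uniform limit is the representative.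
  obtain ⟨u, hu, hlim⟩ := mem_closure_iff_seq_limit.1 (denseRange_emb φ)
  choose f hf using hu
  set W := P.systemC.sol P.T 0 with hW
  have hWV : ∀ k : C(Torus d, ℝ), emb (W k) = V (emb k) := fun k =>
    congrArg (fun A => A k) (P.emb_comp_sol P.T_pos)
  have hWn : ∀ k : C(Torus d, ℝ), ‖W k‖ ≤ γ * N * ‖emb k‖ := fun k => by
    refine (ContinuousMap.norm_le _ (by positivity)).2 fun x => ?_
    refine forall_le_of_ae_le (g := fun x => ‖W k x‖) (W k).continuous.norm ?_ x
    filter_upwards [hbd (emb k), coeFn_emb (W k)] with x h1 h2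
    rw [← h2, hWV, Real.norm_eq_abs]
    linarith
  have hcau : CauchySeq fun n => W (f n) := by
    have h1 : CauchySeq u := hlim.cauchySeq
    rw [Metric.cauchySeq_iff] at h1 ⊢
    intro η hη
    obtain ⟨n₀, hn₀⟩ := h1 (η / (γ * N + 1)) (by positivity)
    refine ⟨n₀, fun m hm n hn => ?_⟩
    have h2 := hn₀ m hm n hn
    rw [dist_eq_norm] at h2 ⊢
    rw [← map_sub]
    refine (hWn _).trans_lt ?_
    rw [map_sub, hf, hf]
    rw [lt_div_iff₀ (by positivity)] at h2
    nlinarith [norm_nonneg (u m - u n)]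
  obtain ⟨g, hg⟩ := cauchySeq_tendsto_of_complete hcau
  have hgV : emb g = V φ := by
    refine tendsto_nhds_unique ((emb.continuous.tendsto g).comp hg) ?_
    have h1 : (emb ∘ fun n => W (f n)) = fun n => V (u n) := by
      ext1 n
      rw [Function.comp_apply, hWV, hf]
    rw [h1]
    exact (V.continuous.tendsto φ).comp hlim
  have hae : V φ =ᵐ[torusMeasure d] g := by rw [← hgV]; exact coeFn_emb g
  refine ⟨g, g.continuous, hae, fun x => ⟨?_, ?_⟩⟩
  · have h1 := forall_le_of_ae_le (g := fun x => -g x) g.continuous.neg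
      (C := -(ε * ∫ y, φ y ∂torusMeasure d)) (by
        filter_upwards [h φ hφ, hae] with x h1 h2
        rw [← h2]; linarith [h1.1]) x
    linarith
  · refine forall_le_of_ae_le g.continuous ?_ x
    filter_upwards [h φ hφ, hae] with x h1 h2
    rw [← h2]; exact h1.2

end Coefficients

end FKTorus

end

theorem mainTheorem4 (d : ℕ) (κ T : ℝ) (hκ : 0 < κ) (hT : 0 < T)
    (b : ℝ → FKTorus.Torus d → FKTorus.Space d) (c : ℝ → FKTorus.Torus d → ℝ)
    (hb : FKTorus.SmoothCoefficient b) (hc : FKTorus.SmoothCoefficient c)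
    (hbT : ∀ t x, b (t + T) x = b t x) (hcT : ∀ t x, c (t + T) x = c t x) :
    (∃ U : ℝ → ℝ → FKTorus.L2Torus d →L[ℝ] FKTorus.L2Torus d,
      FKTorus.IsSolutionOperator κ b c U) ∧
    ∃ (η : Measure (FKTorus.Torus d)) (ε γ : ℝ),
      IsProbabilityMeasure η ∧ η ≪ FKTorus.torusMeasure d ∧
      (∀ φ : FKTorus.Torus d → ℝ, MemLp φ 2 (FKTorus.torusMeasure d) → Integrable φ η) ∧
      0 < ε ∧ ε < γ ∧
      -- uniform minorization and boundedness of the discretized operators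
      (∀ M : ℕ, 0 < M → ∀ φ : FKTorus.Torus d → ℝ, MemLp φ 2 (FKTorus.torusMeasure d) →
        0 ≤ᵐ[FKTorus.torusMeasure d] φ → ∀ x,
          ε * ∫ y, φ y ∂η ≤ FKTorus.periodOp κ b c T M φ x ∧
          FKTorus.periodOp κ b c T M φ x ≤ γ * ∫ y, φ y ∂η) ∧
      ∀ U : ℝ → ℝ → FKTorus.L2Torus d →L[ℝ] FKTorus.L2Torus d,
        FKTorus.IsSolutionOperator κ b c U →
        -- convergence to the exact solution operator in the operator norm of `L²`
        (∀ δ : ℝ, 0 < δ → ∃ M₀ : ℕ, ∀ M : ℕ, M₀ ≤ M → ∀ φ : FKTorus.L2Torus d,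
          eLpNorm (fun x => FKTorus.periodOp κ b c T M φ x - U T 0 φ x) 2
            (FKTorus.torusMeasure d) ≤ ENNReal.ofReal (δ * ‖φ‖)) ∧
        -- the same bounds for the exact solution operator
        (∀ φ : FKTorus.L2Torus d, 0 ≤ᵐ[FKTorus.torusMeasure d] φ →
          ∃ g : FKTorus.Torus d → ℝ, Continuous g ∧ U T 0 φ =ᵐ[FKTorus.torusMeasure d] g ∧
            ∀ x, ε * ∫ y, φ y ∂η ≤ g x ∧ g x ≤ γ * ∫ y, φ y ∂η) := by

  let P : FKTorus.Coefficients d := ⟨κ, T, b, c, hκ, hT, hb, hc, hbT, hcT⟩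
  obtain ⟨ε, γ, hε, hεγ, hbounds⟩ := P.exists_periodOp_bounds
  have hU : FKTorus.IsSolutionOperator κ b c P.evol := P.isSolutionOperator_evol
  -- The measure `η` is normalized Lebesgue measure, for which `L²` is contained in `L¹` since it is
  -- finite.
  refine ⟨⟨P.evol, hU⟩, FKTorus.torusMeasure d, ε, γ, inferInstance,
    Measure.AbsolutelyContinuous.rfl, fun φ hφ => hφ.integrable (by norm_num), hε, hεγ, hbounds,
    fun U hU' => ?_⟩
  -- Uniqueness transfers the results for the constructed evolution to every solution operator.
  have e : U T 0 = P.system.sol T 0 :=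
    (P.solutionOperator_unique hU' hU hT).trans (P.evol_of_lt hT)
  rw [e]
  exact ⟨fun δ hδ => P.exists_eLpNorm_sub_le hδ, fun φ hφ =>
    P.exists_continuous_representative hε.le (hε.le.trans hεγ.le)
      (fun φ hφ => P.ae_bounds_of_periodOp hbounds hφ) hφ⟩
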